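/- Let $k$ be an algebraically closed field of characteristic zero and let $\mathcal A$ be a premodular category over $k$, i.e. a braided spherical fusion category, with braiding $c_{X,Y}\colon X\otimes Y\to Y\otimes X$ and pivotal structure $\delta_X\colon X\to X^{**}$. Let $X_i$, $i\in\mathrm{Irr}(\mathcal A)$, represent the isomorphism classes of simple objects, let $d_i=\dim X_i$ and $\mathcal D=\sum_i d_i^2$, and fix square roots $\sqrt{d_i}$, $\sqrt{\mathcal D}$ with $\sqrt{d_1}=1$ and $\sqrt{d_i}=\sqrt{d_{i^*}}$. Write $\mathrm{ev}_X\colon X^*\otimes X\to\mathbf 1$, $\mathrm{coev}_X\colon \mathbf 1\to X\otimes X^*$ for the duality of $\mathcal A$, and $\widetilde{\mathrm{ev}}_X\colon X\otimes X^*\to\mathbf 1$, $\widetilde{\mathrm{coev}}_X\colon\mathbf 1\to X^*\otimes X$ for the maps obtained from it with $\delta$; ${}^*X$ is the dual with $\mathrm{ev}\colon X\otimes{}^*X\to\mathbf 1$ and $\mathrm{coev}\colon\mathbf 1\to{}^*X\otimes X$. Associativity and unit constraints of $\mathcal A$ are suppressed in formulas, as are identity factors (a morphism acts on the indicated tensor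 factors). The Drinfeld center $\mathcal Z(\mathcal A)$ has as objects the pairs $(X,\gamma)$ with $\gamma_B\colon B\otimes X\to X\otimes B$ a half-braiding, and as morphisms the $f$ in $\mathcal A$ that intertwine the half-braidings. For $B\in\mathcal A$ let $(\varphi_\alpha)$ be a basis of $\mathrm{Hom}(B\otimes X_i,X_j)$, $(\varphi^\alpha)$ the basis of $\mathrm{Hom}(X_j,B\otimes X_i)$ dual to it for the pairing $(f,g)\mapsto\mathrm{tr}(f\circ g)$, and $\widehat{\varphi^\alpha}\colon X_i^*\to X_j^*\otimes B$ the morphism obtained by rotating $\varphi^\alpha$ with $\widetilde{\mathrm{coev}}_{X_j}$ and $\widetilde{\mathrm{ev}}_{X_i}$. For $(X,\gamma),(Y,\mu)\in\mathcal Z(\mathcal A)$ let $Q_{\gamma,\mu}=\frac1{\mathcal D}\sum_i d_i\,L_i\colon X\otimes Y\to X\otimes Y$, where $L_i$ is the composite $$X Y\xrightarrow{\mathrm{coev}_{X_i}}X X_iX_i^*Y\xrightarrow{c_{X_i,X}^{-1},\ \mu_{X_i^*}}X_iXYX_i^*\xrightarrow{\gamma_{X_i},\ c_{Y,X_i^*}}XX_iX_i^*Y\xrightarrow{\widetilde{\mathrm{ev}}_{X_i}}XY,$$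 and let $(\gamma\,\overline\otimes\,\mu)_B=\frac1{\mathcal D}\sum_{i,j}d_id_j\sum_\alpha L_{ij\alpha}\colon B\otimes X\otimes Y\to X\otimes Y\otimes B$, where $L_{ij\alpha}$ is the composite $$BXY\xrightarrow{\mathrm{coev}_{X_i}}BXX_iX_i^*Y\xrightarrow{c_{X_i,X}^{-1},\ \mu_{X_i^*}}BX_iXYX_i^*\xrightarrow{\varphi_\alpha,\ \widehat{\varphi^\alpha}}X_jXYX_j^*B\xrightarrow{\gamma_{X_j},\ c_{Y,X_j^*}}XX_jX_j^*YB\xrightarrow{\widetilde{\mathrm{ev}}_{X_j}}XYB .$$ **Proposition.** $Q_{\gamma,\mu}$ is a projector that commutes with $\gamma\,\overline\otimes\,\mu$, and the restriction of $\gamma\,\overline\otimes\,\mu$ to $\mathrm{im}\,Q_{\gamma,\mu}$ is a half-braiding. The reduced tensor product $$(X,\gamma)\,\overline\otimes\,(Y,\mu)=(\mathrm{im}\,Q_{\gamma,\mu},\ \gamma\,\overline\otimes\,\mu),\qquad f\,\overline\otimes\,g=\text{the restriction of } f\otimes g \text{ (composed with } Q \text{ on both sides)},$$ makes $\mathcal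 Z(\mathcal A)$ a pivotal multifusion category over $k$. More precisely: 1. The associativity constraint of $\mathcal A$ restricts to isomorphisms $\big((X_1,\gamma_1)\overline\otimes(X_2,\gamma_2)\big)\overline\otimes(X_3,\gamma_3)\cong(X_1,\gamma_1)\overline\otimes\big((X_2,\gamma_2)\overline\otimes(X_3,\gamma_3)\big)$ of $\mathcal Z(\mathcal A)$, and these are the associativity constraint. 2. The unit object is $I(\mathbf 1)=\big(\bigoplus_iX_i\otimes X_i^*,\Gamma\big)$, where $\Gamma_B$ has the component $\sqrt{d_i}\sqrt{d_j}\sum_\alpha\varphi_\alpha\otimes\widehat{\varphi^\alpha}\colon B X_iX_i^*\to X_jX_j^*B$. The unit constraints are the restrictions to the images of $Q$ of the morphisms $I(\mathbf 1)\otimes X\to X$ and $X\otimes I(\mathbf 1)\to X$ whose $i$-th components are $\frac{\sqrt{d_i}}{\sqrt{\mathcal D}}$ times $$X_iX_i^*X\xrightarrow{c_{X,X_i^*}^{-1}}X_iXX_i^*\xrightarrow{\gamma_{X_i}}XX_iX_i^*\xrightarrow{\widetilde{\mathrm{ev}}_{X_i}}X,\qquad XX_iX_i^*\xrightarrow{c_{X_i,X}^{-1}}X_iXX_i^*\xrightarrow{\gamma_{X_i}}XX_iX_i^*\xrightarrow{\widetilde{\mathrm{ev}}_{X_i}}X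 .$$ 3. The duals are $(X,\gamma)^\vee=(X^*,\gamma^\vee)$ and ${}^\vee(X,\gamma)=({}^*X,{}^\vee\gamma)$, where $\gamma^\vee_B$ and ${}^\vee\gamma_B$ are the composites $$BX^*\xrightarrow{c_{B,X^*}}X^*B\xrightarrow{\mathrm{coev}_X}X^*BXX^*\xrightarrow{\gamma_B}X^*XBX^*\xrightarrow{\mathrm{ev}_X}BX^*\xrightarrow{c_{X^*,B}^{-1}}X^*B,$$ $$B\,{}^*X\xrightarrow{\mathrm{coev}}B\,{}^*X\,X\,{}^*X\xrightarrow{c_{B,{}^*X}}{}^*X\,B\,X\,{}^*X\xrightarrow{\gamma_B}{}^*X\,X\,B\,{}^*X\xrightarrow{c_{{}^*X,B}^{-1}}{}^*X\,X\,{}^*X\,B\xrightarrow{\mathrm{ev}}{}^*X\,B .$$ Let $(\gamma^*)_B=(\gamma_{{}^*B})^*$ and $({}^*\gamma)_B={}^*(\gamma_{B^*})$ be the standard dual half-braidings. For a half-braiding $n$ on $V$ put $$n'_B\colon BV\xrightarrow{c_{B,V}}VB\xrightarrow{\mathrm{coev}_B}BB^*VB\xrightarrow{n_{B^*}}BVB^*B\xrightarrow{\mathrm{ev}_B}BV\xrightarrow{c_{V,B}^{-1}}VB,$$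 $$n''_B\colon BV\xrightarrow{\mathrm{coev}}B\,{}^*B\,B\,V\xrightarrow{c_{V,B}^{-1}}B\,{}^*B\,V\,B\xrightarrow{n_{{}^*B}}B\,V\,{}^*B\,B\xrightarrow{c_{B,V}}V\,B\,{}^*B\,B\xrightarrow{\mathrm{ev}}VB .$$ Then $\gamma^\vee=(\gamma^*)'=(\gamma^*)''$ and ${}^\vee\gamma=({}^*\gamma)''=({}^*\gamma)'$. 4. The evaluation $(X,\gamma)^\vee\,\overline\otimes\,(X,\gamma)\to I(\mathbf 1)$ is the restriction to $\mathrm{im}\,Q_{\gamma^\vee,\gamma}$ of the morphism $X^*X\to I(\mathbf 1)$ whose $i$-th component is $\frac{\sqrt{d_i}}{\sqrt{\mathcal D}}$ times $$X^*X\xrightarrow{\mathrm{coev}_{X_i}}X_iX_i^*X^*X\xrightarrow{(\gamma^\vee\overline\otimes\gamma)_{X_i^*}}X_iX^*XX_i^*\xrightarrow{\mathrm{ev}_X}X_iX_i^*,$$ and it is equally the restriction of the morphism with $i$-th component $\frac{\sqrt{d_i}}{\sqrt{\mathcal D}}$ times $$X^*X\xrightarrow{\mathrm{coev}_{X_i}}X^*X_iX_i^*X\xrightarrow{c_{X_i,X^*}^{-1}}X_iX^*X_i^*X\xrightarrow{\gamma_{X_i^*}}X_iX^*XX_i^*\xrightarrow{\mathrm{ev}_X}X_iX_i^*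 .$$ The coevaluation $I(\mathbf 1)\to(X,\gamma)\,\overline\otimes\,(X,\gamma)^\vee$ is the projection to $\mathrm{im}\,Q_{\gamma,\gamma^\vee}$ of the morphism $I(\mathbf 1)\to XX^*$ whose $i$-th component is $\frac{\sqrt{d_i}}{\sqrt{\mathcal D}}$ times $$X_iX_i^*\xrightarrow{\mathrm{coev}_X}X_iXX^*X_i^*\xrightarrow{\gamma_{X_i}}XX_iX^*X_i^*\xrightarrow{c_{X^*,X_i^*}}XX_iX_i^*X^*\xrightarrow{\widetilde{\mathrm{ev}}_{X_i}}XX^* .$$ The same formulas with $(X,\gamma)$, $(X,\gamma)^\vee$ replaced by ${}^\vee(X,\gamma)$, $(X,\gamma)$ and with the duality of ${}^*X$ and $X$ give the evaluation $(X,\gamma)\,\overline\otimes\,{}^\vee(X,\gamma)\to I(\mathbf 1)$ and the coevaluation $I(\mathbf 1)\to{}^\vee(X,\gamma)\,\overline\otimes\,(X,\gamma)$. 5. The pivotal structure of $(\mathcal Z(\mathcal A),\overline\otimes)$ at $(X,\gamma)$ is $\delta_X$. -/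

import Mathlib

open CategoryTheory MonoidalCategory Limits HasLeftDual HasRightDual

universe v u w t

noncomputable section

namespace RedCenter

/-! ### Finite semisimple and multifusion categories -/

/-- A `k`-linear category is finite semisimple if it is abelian, has finite-dimensional morphism
spaces, every object is a finite direct sum of simple objects, and there are finitely many
isomorphism classes of simple objects. -/
class IsFiniteSemisimple (k : Type w) [Field k] (C : Type u) [Category.{v} C] [Preadditive C]
    [Linear k C] : Prop where
  abelian : ∃ a : Abelian C, a.toPreadditive = ‹Preadditive C›
  finite_hom : ∀ X Y : C, Module.Finite k (X ⟶ Y)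
  semisimple : ∀ X : C, ∃ (n : ℕ) (S : Fin n → C), (∀ i, Simple (S i)) ∧
    ∃ b : Bicone S, Nonempty b.IsBilimit ∧ Nonempty (b.pt ≅ X)
  finite_simple : ∃ (n : ℕ) (S : Fin n → C), ∀ X : C, Simple X → ∃ i, Nonempty (X ≅ S i)

attribute [instance] IsFiniteSemisimple.finite_hom

/-- A multifusion category: a finite semisimple `k`-linear rigid monoidal category whose tensor
product is bilinear on morphisms. -/
structure IsMultifusion (k : Type w) [Field k] (C : Type u) [Category.{v} C] [Preadditive C]
    [Linear k C] [MonoidalCategory C] [RigidCategory C] : Prop where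
  finite_semisimple : IsFiniteSemisimple k C
  tensor_additive : MonoidalPreadditive C
  tensor_linear : MonoidalLinear k C

/-! ### Pivotal structures

`Xᘁ` is the dual `X^*` with `ε : X^* ⊗ X ⟶ 𝟙` and `η : 𝟙 ⟶ X ⊗ X^*`, and `leftDual X` is the
dual `^*X` with `ε : X ⊗ ^*X ⟶ 𝟙` and `η : 𝟙 ⟶ ^*X ⊗ X`. -/

section Pivotal

variable (C : Type u) [Category.{v} C] [MonoidalCategory C] [RightRigidCategory C]

variable {C} in
/-- The canonical isomorphism `Y^* ⊗ X^* ≅ (X ⊗ Y)^*`. -/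
def dualTensorIso (X Y : C) : Yᘁ ⊗ Xᘁ ≅ (X ⊗ Y)ᘁ :=
  rightDualIso (X := X ⊗ Y) ExactPairing.tensor inferInstance

/-- A pivotal structure: a monoidal natural isomorphism `X ≅ X^{**}`. -/
structure PivotalStructure where
  iso : ∀ X : C, X ≅ rightDual (rightDual X)
  naturality : ∀ {X Y : C} (f : X ⟶ Y),
    f ≫ (iso Y).hom = (iso X).hom ≫ rightAdjointMate (rightAdjointMate f)
  monoidal : ∀ X Y : C,
    (iso (X ⊗ Y)).hom ≫ rightAdjointMate (dualTensorIso X Y).hom =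
      ((iso X).hom ⊗ₘ (iso Y).hom) ≫ (dualTensorIso (rightDual Y) (rightDual X)).hom

namespace PivotalStructure

variable {C} (P : PivotalStructure C)

/-- The evaluation `X ⊗ X^* ⟶ 𝟙` obtained from the pivotal structure. -/
def pev (X : C) : X ⊗ Xᘁ ⟶ 𝟙_ C :=
  (P.iso X).hom ▷ Xᘁ ≫ ε_ (rightDual X) (rightDual (rightDual X))

/-- The coevaluation `𝟙 ⟶ X^* ⊗ X` obtained from the pivotal structure. -/
def pcoev (X : C) : 𝟙_ C ⟶ Xᘁ ⊗ X :=
  η_ (rightDual X) (rightDual (rightDual X)) ≫ Xᘁ ◁ (P.iso X).inv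

/-- The trace of an endomorphism, as an endomorphism of the unit object. -/
def trace {X : C} (f : X ⟶ X) : 𝟙_ C ⟶ 𝟙_ C :=
  η_ X Xᘁ ≫ f ▷ Xᘁ ≫ P.pev X

/-- The trace of an endomorphism, closed up on the other side. -/
def traceOther {X : C} (f : X ⟶ X) : 𝟙_ C ⟶ 𝟙_ C :=
  P.pcoev X ≫ Xᘁ ◁ f ≫ ε_ X Xᘁ

/-- A pivotal structure is spherical if the two traces agree. -/
def IsSpherical : Prop :=
  ∀ {X : C} (f : X ⟶ X), P.trace f = P.traceOther f

end PivotalStructure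

end Pivotal

/-! ### The Drinfeld center as a linear category

Half-braidings are taken in the direction `γ_A : A ⊗ X ⟶ X ⊗ A`. The type below carries no
monoidal structure yet. -/

section Center

variable {A : Type u} [Category.{v} A] [MonoidalCategory A]

/-- `γ` is a half-braiding on `X`: a natural isomorphism `A ⊗ X ⟶ X ⊗ A`, compatible with tensor
products in `A`. -/
structure IsHalfBraiding (X : A) (γ : ∀ B : A, B ⊗ X ⟶ X ⊗ B) : Prop where
  isIso : ∀ B, IsIso (γ B)
  naturality : ∀ {B B' : A} (f : B ⟶ B'), f ▷ X ≫ γ B' = γ B ≫ X ◁ f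
  tensor : ∀ B B' : A, γ (B ⊗ B') =
    (α_ B B' X).hom ≫ B ◁ γ B' ≫ (α_ B X B').inv ≫ γ B ▷ B' ≫ (α_ X B B').hom

variable (A) in
/-- An object of the Drinfeld center: an object of `A` with a half-braiding. -/
structure DCenter where
  X : A
  br : ∀ B : A, B ⊗ X ⟶ X ⊗ B
  isHalfBraiding : IsHalfBraiding X br

namespace DCenter

/-- `f` intertwines the half-braidings. -/
def IsCentral (Z W : DCenter A) (f : Z.X ⟶ W.X) : Prop :=
  ∀ B : A, B ◁ f ≫ W.br B = Z.br B ≫ f ▷ B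

/-- A morphism of the Drinfeld center: a morphism that intertwines the half-braidings. -/
@[ext]
structure Hom (Z W : DCenter A) where
  f : Z.X ⟶ W.X
  central : IsCentral Z W f

instance : Category (DCenter A) where
  Hom := Hom
  id Z := ⟨𝟙 Z.X, fun B => by simp⟩
  comp f g := ⟨f.f ≫ g.f, fun B => by
    rw [MonoidalCategory.whiskerLeft_comp, Category.assoc, g.central, ← Category.assoc, f.central,
      Category.assoc, MonoidalCategory.comp_whiskerRight]⟩

@[ext]
theorem hom_ext {Z W : DCenter A} {f g : Z ⟶ W} (h : f.f = g.f) : f = g := Hom.ext h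

@[simp] theorem id_f (Z : DCenter A) : Hom.f (𝟙 Z) = 𝟙 Z.X := rfl

@[simp] theorem comp_f {Z W V : DCenter A} (f : Z ⟶ W) (g : W ⟶ V) :
    (f ≫ g).f = f.f ≫ g.f := rfl

/-- The morphism of the center with a given underlying morphism. -/
def homMk {Z W : DCenter A} (f : Z.X ⟶ W.X) (h : IsCentral Z W f) : Z ⟶ W := ⟨f, h⟩

/-- The isomorphism of the center with a given underlying morphism. -/
def isoMk {Z W : DCenter A} (f : Z.X ⟶ W.X) (h : IsCentral Z W f) (hf : IsIso f) : Z ≅ W where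
  hom := ⟨f, h⟩
  inv := ⟨inv f, fun B => by
    rw [← cancel_epi (B ◁ f), ← Category.assoc, ← MonoidalCategory.whiskerLeft_comp,
      IsIso.hom_inv_id, MonoidalCategory.whiskerLeft_id, Category.id_comp, ← Category.assoc, h,
      Category.assoc, ← MonoidalCategory.comp_whiskerRight, IsIso.hom_inv_id,
      MonoidalCategory.id_whiskerRight, Category.comp_id]⟩
  hom_inv_id := hom_ext (IsIso.hom_inv_id f)
  inv_hom_id := hom_ext (IsIso.inv_hom_id f)

section Linear

variable [Preadditive A] [MonoidalPreadditive A]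

instance (Z W : DCenter A) : Zero (Z ⟶ W) := ⟨⟨0, fun B => by simp⟩⟩

instance (Z W : DCenter A) : Add (Z ⟶ W) := ⟨fun f g => ⟨f.f + g.f, fun B => by
  simp [MonoidalPreadditive.whiskerLeft_add, MonoidalPreadditive.add_whiskerRight,
    Preadditive.add_comp, Preadditive.comp_add, f.central B, g.central B]⟩⟩

instance (Z W : DCenter A) : Neg (Z ⟶ W) := ⟨fun f => ⟨-f.f, fun B => by
  have h : f.f ∈ ({ carrier := {g | IsCentral Z W g}
                    zero_mem' := fun B => by simp
                    add_mem' := fun {a b} ha hb B => by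
                      have ha : B ◁ a ≫ W.br B = _ := ha B
                      have hb : B ◁ b ≫ W.br B = _ := hb B
                      simp [MonoidalPreadditive.whiskerLeft_add,
                        MonoidalPreadditive.add_whiskerRight, ha, hb]
                    neg_mem' := fun {a} ha B => by
                      have ha : B ◁ a ≫ W.br B = _ := ha B
                      have e : ∀ {P Q : A} (x y : P ⟶ Q), x + y = 0 → x = -y :=
                        fun x y h => eq_neg_of_add_eq_zero_left h
                      have h1 : B ◁ (-a) = -(B ◁ a) := e _ _ (by
                        rw [← MonoidalPreadditive.whiskerLeft_add]; simp)
                      have h2 : (-a) ▷ B = -(a ▷ B) := e _ _ (by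
                        rw [← MonoidalPreadditive.add_whiskerRight]; simp)
                      rw [h1, h2, Preadditive.neg_comp, Preadditive.comp_neg, ha] } :
      AddSubgroup (Z.X ⟶ W.X)) := f.central
  exact neg_mem h B⟩⟩

@[simp] theorem zero_f (Z W : DCenter A) : Hom.f (0 : Z ⟶ W) = 0 := rfl
@[simp] theorem add_f {Z W : DCenter A} (f g : Z ⟶ W) : (f + g).f = f.f + g.f := rfl
@[simp] theorem neg_f {Z W : DCenter A} (f : Z ⟶ W) : (-f).f = -f.f := rfl

instance (Z W : DCenter A) : AddCommGroup (Z ⟶ W) where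
  add_assoc f g h := hom_ext (add_assoc _ _ _)
  zero_add f := hom_ext (zero_add _)
  add_zero f := hom_ext (add_zero _)
  add_comm f g := hom_ext (add_comm _ _)
  neg_add_cancel f := hom_ext (neg_add_cancel _)
  nsmul := nsmulRec
  zsmul := zsmulRec

instance : Preadditive (DCenter A) where
  add_comp _ _ _ f g h := hom_ext (Preadditive.add_comp _ _ _ f.f g.f h.f)
  comp_add _ _ _ f g h := hom_ext (Preadditive.comp_add _ _ _ f.f g.f h.f)

variable {k : Type w} [Field k] [Linear k A] [MonoidalLinear k A]

instance (Z W : DCenter A) : SMul k (Z ⟶ W) := ⟨fun r f => ⟨r • f.f, fun B => by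
  simp [f.central B]⟩⟩

@[simp] theorem smul_f {Z W : DCenter A} (r : k) (f : Z ⟶ W) : (r • f).f = r • f.f := rfl

instance (Z W : DCenter A) : Module k (Z ⟶ W) where
  one_smul f := hom_ext (one_smul k f.f)
  mul_smul r s f := hom_ext (mul_smul r s f.f)
  smul_zero r := hom_ext (smul_zero r)
  smul_add r f g := hom_ext (smul_add r f.f g.f)
  add_smul r s f := hom_ext (add_smul r s f.f)
  zero_smul f := hom_ext (zero_smul k f.f)

instance : Linear k (DCenter A) where
  smul_comp _ _ _ r f g := hom_ext (Linear.smul_comp _ _ _ r f.f g.f)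
  comp_smul _ _ _ f r g := hom_ext (Linear.comp_smul _ _ _ f.f r g.f)

end Linear

end DCenter

end Center

/-! ### The reduced tensor product -/

section Reduced

variable {k : Type w} [Field k] {A : Type u} [Category.{v} A] [Abelian A] [Linear k A]
  [MonoidalCategory A] [BraidedCategory A] [RigidCategory A]

variable (k) in
/-- A choice of representatives `X_i` of the isomorphism classes of simple objects, of square roots
of their dimensions `d_i`, and of a square root of the dimension `D = ∑ d_i ^ 2`. -/
structure SimpleChoice (P : PivotalStructure A) (Irr : Type t) [Fintype Irr] where
  obj : Irr → A
  simple : ∀ i, Simple (obj i)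
  eq_of_iso : ∀ i j, Nonempty (obj i ≅ obj j) → i = j
  exists_iso : ∀ S : A, Simple S → ∃ i, Nonempty (S ≅ obj i)
  sqrtDim : Irr → k
  sqrtDim_sq : ∀ i, (sqrtDim i ^ 2) • 𝟙 (𝟙_ A) = P.trace (𝟙 (obj i))
  sqrtDim_unit : ∀ i, Nonempty (𝟙_ A ≅ obj i) → sqrtDim i = 1
  sqrtDim_dual : ∀ i j, Nonempty ((obj i)ᘁ ≅ obj j) → sqrtDim i = sqrtDim j
  sqrtGlobal : k
  sqrtGlobal_sq : sqrtGlobal ^ 2 = ∑ i, (sqrtDim i ^ 2) ^ 2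

variable {P : PivotalStructure A} {Irr : Type t} [Fintype Irr] (c : SimpleChoice k P Irr)

namespace SimpleChoice

/-- The dimension `d_i` of `X_i`. -/
def dim (i : Irr) : k := c.sqrtDim i ^ 2

/-- The dimension `D = ∑ d_i ^ 2` of `A`. -/
def globalDim : k := ∑ i, c.dim i ^ 2

/-- The coefficient `√d_i / √D`. -/
def coeff (i : Irr) : k := c.sqrtDim i / c.sqrtGlobal

/-- The object `X_i ⊗ X_i^*`. -/
abbrev summand (i : Irr) : A := c.obj i ⊗ (c.obj i)ᘁ

instance : HasBiproduct c.summand :=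
  haveI := Abelian.hasFiniteBiproducts (C := A)
  inferInstance

section Nodes

variable [IsFiniteSemisimple k A]

/-- The index set of a basis of `Hom(B ⊗ X_i, X_j)`. -/
abbrev NodeIndex (B : A) (i j : Irr) : Type :=
  Fin (Module.finrank k (B ⊗ c.obj i ⟶ c.obj j))

/-- A basis `φ_α` of `Hom(B ⊗ X_i, X_j)`. -/
def node (B : A) (i j : Irr) (α : c.NodeIndex B i j) : B ⊗ c.obj i ⟶ c.obj j :=
  Module.finBasis k (B ⊗ c.obj i ⟶ c.obj j) α

/-- The basis `φ^α` of `Hom(X_j, B ⊗ X_i)` dual to `φ_α` with respect to the pairing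
`(g, f) ↦ tr(f ∘ g)` (which is perfect, so that the element in question exists and is unique). -/
def conode (B : A) (i j : Irr) (α : c.NodeIndex B i j) : c.obj j ⟶ B ⊗ c.obj i :=
  haveI : Nonempty (c.obj j ⟶ B ⊗ c.obj i) := ⟨0⟩
  Classical.epsilon fun g => ∀ α', P.trace (g ≫ c.node B i j α') = if α' = α then 𝟙 (𝟙_ A) else 0

/-- The rotation `X_i^* ⟶ X_j^* ⊗ B` of a morphism `X_j ⟶ B ⊗ X_i`. -/
def rotate {B : A} {i j : Irr} (g : c.obj j ⟶ B ⊗ c.obj i) :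
    (c.obj i)ᘁ ⟶ (c.obj j)ᘁ ⊗ B :=
  𝟙 _ ⊗≫ P.pcoev (c.obj j) ▷ (c.obj i)ᘁ ⊗≫ (c.obj j)ᘁ ◁ g ▷ (c.obj i)ᘁ ⊗≫
    ((c.obj j)ᘁ ⊗ B) ◁ P.pev (c.obj i) ⊗≫ 𝟙 _

end Nodes

end SimpleChoice

variable (Z W : DCenter A)

/-- The loop coloured by `X_i` that links the strands of `Z` and `W`, from top to bottom: it is
created between the two strands; its left part goes behind `Z` to the left and returns through the
half-braiding of `Z`; its right part goes to the right through the half-braiding of `W` and returns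
in front of `W`. -/
def loop (i : Irr) : Z.X ⊗ W.X ⟶ Z.X ⊗ W.X :=
  𝟙 _ ⊗≫ Z.X ◁ η_ (c.obj i) (c.obj i)ᘁ ▷ W.X
    ⊗≫ (β_ (c.obj i) Z.X).inv ▷ ((c.obj i)ᘁ ⊗ W.X)
    ⊗≫ (c.obj i ⊗ Z.X) ◁ W.br (c.obj i)ᘁ
    ⊗≫ Z.br (c.obj i) ▷ (W.X ⊗ (c.obj i)ᘁ)
    ⊗≫ (Z.X ⊗ c.obj i) ◁ (β_ W.X (c.obj i)ᘁ).hom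
    ⊗≫ Z.X ◁ P.pev (c.obj i) ▷ W.X ⊗≫ 𝟙 _

/-- The projector `Q_{γ,μ}`: the regular-coloured loop, divided by `D`. -/
def Q : Z.X ⊗ W.X ⟶ Z.X ⊗ W.X :=
  (c.globalDim)⁻¹ • ∑ i, c.dim i • loop c Z W i

/-- The underlying object of the reduced tensor product: the image of `Q_{γ,μ}`. -/
def redX : A := image (Q c Z W)

/-- The inclusion of the image of `Q_{γ,μ}`. -/
def incl : redX c Z W ⟶ Z.X ⊗ W.X := image.ι (Q c Z W)

/-- The projection to the image of `Q_{γ,μ}`. -/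
def proj : Z.X ⊗ W.X ⟶ redX c Z W := factorThruImage (Q c Z W)

/-- The loop with a node `f` on its left side, where a strand `B` enters, and a node `h` on its
right side, where it leaves; the upper arc is coloured by `X_i` and the lower arc by `X_j`. -/
def nodeLoop (B : A) (i j : Irr) (f : B ⊗ c.obj i ⟶ c.obj j)
    (h : (c.obj i)ᘁ ⟶ (c.obj j)ᘁ ⊗ B) : B ⊗ (Z.X ⊗ W.X) ⟶ (Z.X ⊗ W.X) ⊗ B :=
  𝟙 _ ⊗≫ (B ⊗ Z.X) ◁ η_ (c.obj i) (c.obj i)ᘁ ▷ W.X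
    ⊗≫ B ◁ (β_ (c.obj i) Z.X).inv ▷ ((c.obj i)ᘁ ⊗ W.X)
    ⊗≫ (B ⊗ c.obj i ⊗ Z.X) ◁ W.br (c.obj i)ᘁ
    ⊗≫ f ▷ (Z.X ⊗ W.X ⊗ (c.obj i)ᘁ)
    ⊗≫ (c.obj j ⊗ Z.X ⊗ W.X) ◁ h
    ⊗≫ Z.br (c.obj j) ▷ (W.X ⊗ (c.obj j)ᘁ ⊗ B)
    ⊗≫ (Z.X ⊗ c.obj j) ◁ (β_ W.X (c.obj j)ᘁ).hom ▷ B
    ⊗≫ Z.X ◁ P.pev (c.obj j) ▷ (W.X ⊗ B) ⊗≫ 𝟙 _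

section Structure

variable [IsFiniteSemisimple k A]

/-- The natural transformation `γ ⊗̄ μ` on `X ⊗ Y`. -/
def redBr (B : A) : B ⊗ (Z.X ⊗ W.X) ⟶ (Z.X ⊗ W.X) ⊗ B :=
  (c.globalDim)⁻¹ • ∑ i, ∑ j, (c.dim i * c.dim j) •
    ∑ α, nodeLoop c Z W B i j (c.node B i j α) (c.rotate (c.conode B i j α))

/-- The half-braiding `γ ⊗̄ μ`, restricted to the image of `Q_{γ,μ}`. -/
def redBrRes (B : A) : B ⊗ redX c Z W ⟶ redX c Z W ⊗ B :=
  B ◁ incl c Z W ≫ redBr c Z W B ≫ proj c Z W ▷ B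

/-- The underlying object of `I(𝟙)`: the direct sum of the objects `X_i ⊗ X_i^*`. -/
def unitX : A := ⨁ c.summand

/-- The half-braiding `Γ` of `I(𝟙)`. -/
def unitBr (B : A) : B ⊗ unitX c ⟶ unitX c ⊗ B :=
  ∑ i, ∑ j, (c.sqrtDim i * c.sqrtDim j) • ∑ α,
    B ◁ biproduct.π c.summand i ≫
      (𝟙 _ ⊗≫ c.node B i j α ▷ (c.obj i)ᘁ ⊗≫ c.obj j ◁ c.rotate (c.conode B i j α) ⊗≫ 𝟙 _) ≫
      biproduct.ι c.summand j ▷ B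

end Structure

/-- The half-braiding `γ^∨` on `X^*`: the strand of `B` goes to the right behind `X^*`, goes to the
left through the (rotated) half-braiding of `X`, and goes to the right in front of `X^*`. -/
def dualBr (B : A) : B ⊗ Z.Xᘁ ⟶ Z.Xᘁ ⊗ B :=
  (β_ B Z.Xᘁ).hom ⊗≫ (Z.Xᘁ ⊗ B) ◁ η_ Z.X Z.Xᘁ ⊗≫ Z.Xᘁ ◁ Z.br B ▷ Z.Xᘁ
    ⊗≫ ε_ Z.X Z.Xᘁ ▷ (B ⊗ Z.Xᘁ) ⊗≫ (β_ Z.Xᘁ B).inv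

/-- The half-braiding `^∨γ` on `^*X`. -/
def leftDualBr (B : A) : B ⊗ leftDual Z.X ⟶ leftDual Z.X ⊗ B :=
  𝟙 _ ⊗≫ B ◁ η_ (leftDual Z.X) Z.X ▷ leftDual Z.X
    ⊗≫ (β_ B (leftDual Z.X)).hom ▷ (Z.X ⊗ leftDual Z.X)
    ⊗≫ leftDual Z.X ◁ Z.br B ▷ leftDual Z.X
    ⊗≫ (leftDual Z.X ⊗ Z.X) ◁ (β_ (leftDual Z.X) B).inv
    ⊗≫ leftDual Z.X ◁ ε_ (leftDual Z.X) Z.X ▷ B ⊗≫ 𝟙 _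

/-- The standard half-braiding `γ^*` on `X^*`, with `(γ^*)_B = (γ_{^*B})^*`. -/
def stdDualBr (B : A) : B ⊗ Z.Xᘁ ⟶ Z.Xᘁ ⊗ B :=
  𝟙 _ ⊗≫ (B ⊗ Z.Xᘁ) ◁ η_ (leftDual B) B
    ⊗≫ (B ⊗ Z.Xᘁ ⊗ leftDual B) ◁ η_ Z.X Z.Xᘁ ▷ B
    ⊗≫ (B ⊗ Z.Xᘁ) ◁ Z.br (leftDual B) ▷ (Z.Xᘁ ⊗ B)
    ⊗≫ B ◁ ε_ Z.X Z.Xᘁ ▷ (leftDual B ⊗ Z.Xᘁ ⊗ B)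
    ⊗≫ ε_ (leftDual B) B ▷ (Z.Xᘁ ⊗ B) ⊗≫ 𝟙 _

/-- The standard half-braiding `^*γ` on `^*X`, with `(^*γ)_B = ^*(γ_{B^*})`. -/
def stdLeftDualBr (B : A) : B ⊗ leftDual Z.X ⟶ leftDual Z.X ⊗ B :=
  𝟙 _ ⊗≫ η_ (leftDual Z.X) Z.X ▷ (B ⊗ leftDual Z.X)
    ⊗≫ leftDual Z.X ◁ η_ B Bᘁ ▷ (Z.X ⊗ B ⊗ leftDual Z.X)
    ⊗≫ (leftDual Z.X ⊗ B) ◁ Z.br Bᘁ ▷ (B ⊗ leftDual Z.X)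
    ⊗≫ (leftDual Z.X ⊗ B ⊗ Z.X) ◁ ε_ B Bᘁ ▷ leftDual Z.X
    ⊗≫ (leftDual Z.X ⊗ B) ◁ ε_ (leftDual Z.X) Z.X ⊗≫ 𝟙 _

/-- The strand of `B` goes to the right behind `Y` (above the node `n`), returns to the left through
`n`, and goes to the right in front of `Y` (below the node). -/
def twistOver {Y : A} (n : ∀ B : A, B ⊗ Y ⟶ Y ⊗ B) (B : A) : B ⊗ Y ⟶ Y ⊗ B :=
  (β_ B Y).hom ⊗≫ η_ B Bᘁ ▷ (Y ⊗ B) ⊗≫ B ◁ n Bᘁ ▷ B ⊗≫ (B ⊗ Y) ◁ ε_ B Bᘁ ⊗≫ (β_ Y B).inv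

/-- The strand of `B` goes to the right behind `Y` (below the node `n`), returns to the left through
`n`, and goes to the right in front of `Y` (above the node). -/
def twistUnder {Y : A} (n : ∀ B : A, B ⊗ Y ⟶ Y ⊗ B) (B : A) : B ⊗ Y ⟶ Y ⊗ B :=
  𝟙 _ ⊗≫ B ◁ η_ (leftDual B) B ▷ Y ⊗≫ (B ⊗ leftDual B) ◁ (β_ Y B).inv
    ⊗≫ B ◁ n (leftDual B) ▷ B ⊗≫ (β_ B Y).hom ▷ (leftDual B ⊗ B)
    ⊗≫ Y ◁ ε_ (leftDual B) B ▷ B ⊗≫ 𝟙 _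

section Structure

variable [IsFiniteSemisimple k A]

/-- The left unit constraint on `I(𝟙) ⊗ X`. -/
def leftUnit : unitX c ⊗ Z.X ⟶ Z.X :=
  ∑ i, c.coeff i • (biproduct.π c.summand i ▷ Z.X ≫
    (𝟙 _ ⊗≫ c.obj i ◁ (β_ Z.X (c.obj i)ᘁ).inv ⊗≫ Z.br (c.obj i) ▷ (c.obj i)ᘁ
      ⊗≫ Z.X ◁ P.pev (c.obj i) ⊗≫ 𝟙 _))

/-- The right unit constraint on `X ⊗ I(𝟙)`. -/
def rightUnit : Z.X ⊗ unitX c ⟶ Z.X :=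
  ∑ i, c.coeff i • (Z.X ◁ biproduct.π c.summand i ≫
    (𝟙 _ ⊗≫ (β_ (c.obj i) Z.X).inv ▷ (c.obj i)ᘁ ⊗≫ Z.br (c.obj i) ▷ (c.obj i)ᘁ
      ⊗≫ Z.X ◁ P.pev (c.obj i) ⊗≫ 𝟙 _))

section Duals

variable [ExactPairing Z.X W.X]

/-- The evaluation `W.X ⊗ Z.X ⟶ I(𝟙)` for objects `Z`, `W` of the center whose underlying objects
are dual, written with the half-braiding of the reduced tensor product of `W` and `Z`. -/
def evMap : W.X ⊗ Z.X ⟶ unitX c :=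
  ∑ i, c.coeff i • ((𝟙 _ ⊗≫ η_ (c.obj i) (c.obj i)ᘁ ▷ (W.X ⊗ Z.X)
      ⊗≫ c.obj i ◁ redBr c W Z (c.obj i)ᘁ
      ⊗≫ c.obj i ◁ ε_ Z.X W.X ▷ (c.obj i)ᘁ ⊗≫ 𝟙 _) ≫
    biproduct.ι c.summand i)

/-- The evaluation written with the half-braiding of `Z` only. -/
def evMapAlt : W.X ⊗ Z.X ⟶ unitX c :=
  ∑ i, c.coeff i • ((𝟙 _ ⊗≫ W.X ◁ η_ (c.obj i) (c.obj i)ᘁ ▷ Z.X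
      ⊗≫ (β_ (c.obj i) W.X).inv ▷ ((c.obj i)ᘁ ⊗ Z.X)
      ⊗≫ (c.obj i ⊗ W.X) ◁ Z.br (c.obj i)ᘁ
      ⊗≫ c.obj i ◁ ε_ Z.X W.X ▷ (c.obj i)ᘁ ⊗≫ 𝟙 _) ≫
    biproduct.ι c.summand i)

/-- The coevaluation `I(𝟙) ⟶ Z.X ⊗ W.X` for objects `Z`, `W` of the center whose underlying objects
are dual. -/
def coevMap : unitX c ⟶ Z.X ⊗ W.X :=
  ∑ i, c.coeff i • (biproduct.π c.summand i ≫
    (𝟙 _ ⊗≫ c.obj i ◁ η_ Z.X W.X ▷ (c.obj i)ᘁ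
      ⊗≫ Z.br (c.obj i) ▷ (W.X ⊗ (c.obj i)ᘁ)
      ⊗≫ (Z.X ⊗ c.obj i) ◁ (β_ W.X (c.obj i)ᘁ).hom
      ⊗≫ Z.X ◁ P.pev (c.obj i) ▷ W.X ⊗≫ 𝟙 _))

end Duals

/-- The objects are well defined: `Q_{γ,μ}` is a projector with which `γ ⊗̄ μ` commutes, and the
proposed half-braidings are half-braidings. -/
structure ObjectsDefined : Prop where
  idempotent : ∀ Z W : DCenter A, Q c Z W ≫ Q c Z W = Q c Z W
  commute : ∀ (Z W : DCenter A) (B : A),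
    B ◁ Q c Z W ≫ redBr c Z W B = redBr c Z W B ≫ Q c Z W ▷ B
  tensor : ∀ Z W : DCenter A, IsHalfBraiding (redX c Z W) (redBrRes c Z W)
  unit : IsHalfBraiding (unitX c) (unitBr c)
  dual : ∀ Z : DCenter A, IsHalfBraiding Z.Xᘁ (dualBr Z)
  leftDual : ∀ Z : DCenter A, IsHalfBraiding (HasLeftDual.leftDual Z.X) (leftDualBr Z)

variable {c}

/-- The reduced tensor product of two objects. -/
def redTensor (h : ObjectsDefined c) (Z W : DCenter A) : DCenter A :=
  ⟨redX c Z W, redBrRes c Z W, h.tensor Z W⟩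

/-- The object `I(𝟙)`. -/
def redUnit (h : ObjectsDefined c) : DCenter A := ⟨unitX c, unitBr c, h.unit⟩

/-- The dual `(X^*, γ^∨)`. -/
def redDual (h : ObjectsDefined c) (Z : DCenter A) : DCenter A := ⟨Z.Xᘁ, dualBr Z, h.dual Z⟩

/-- The dual `(^*X, ^∨γ)`. -/
def redLeftDual (h : ObjectsDefined c) (Z : DCenter A) : DCenter A :=
  ⟨HasLeftDual.leftDual Z.X, leftDualBr Z, h.leftDual Z⟩

instance (h : ObjectsDefined c) (Z : DCenter A) : ExactPairing Z.X (redDual h Z).X :=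
  inferInstanceAs (ExactPairing Z.X Z.Xᘁ)

instance (h : ObjectsDefined c) (Z : DCenter A) : ExactPairing (redLeftDual h Z).X Z.X :=
  inferInstanceAs (ExactPairing (HasLeftDual.leftDual Z.X) Z.X)

/-- The reduced tensor product of two morphisms: the restriction of `f ⊗ g`. -/
def redTensorHom {Z Z' W W' : DCenter A} (f : Z ⟶ Z') (g : W ⟶ W') :
    redX c Z W ⟶ redX c Z' W' :=
  incl c Z W ≫ (f.f ⊗ₘ g.f) ≫ proj c Z' W'

/-- The inclusion of `(Z₁ ⊗̄ Z₂) ⊗̄ Z₃` in `(X₁ ⊗ X₂) ⊗ X₃`. -/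
def inclLeft (h : ObjectsDefined c) (Z₁ Z₂ Z₃ : DCenter A) :
    (redTensor h (redTensor h Z₁ Z₂) Z₃).X ⟶ (Z₁.X ⊗ Z₂.X) ⊗ Z₃.X :=
  incl c (redTensor h Z₁ Z₂) Z₃ ≫ incl c Z₁ Z₂ ▷ Z₃.X

/-- The inclusion of `Z₁ ⊗̄ (Z₂ ⊗̄ Z₃)` in `X₁ ⊗ (X₂ ⊗ X₃)`. -/
def inclRight (h : ObjectsDefined c) (Z₁ Z₂ Z₃ : DCenter A) :
    (redTensor h Z₁ (redTensor h Z₂ Z₃)).X ⟶ Z₁.X ⊗ (Z₂.X ⊗ Z₃.X) :=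
  incl c Z₁ (redTensor h Z₂ Z₃) ≫ Z₁.X ◁ incl c Z₂ Z₃

/-- The restriction of the associativity constraint of `A`. -/
def redAssoc (h : ObjectsDefined c) (Z₁ Z₂ Z₃ : DCenter A) :
    (redTensor h (redTensor h Z₁ Z₂) Z₃).X ⟶ (redTensor h Z₁ (redTensor h Z₂ Z₃)).X :=
  inclLeft h Z₁ Z₂ Z₃ ≫ (α_ Z₁.X Z₂.X Z₃.X).hom ≫ Z₁.X ◁ proj c Z₂ Z₃ ≫
    proj c Z₁ (redTensor h Z₂ Z₃)

/-- The left unit constraint. -/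
def redLeftUnitor (h : ObjectsDefined c) (Z : DCenter A) :
    (redTensor h (redUnit h) Z).X ⟶ Z.X :=
  incl c (redUnit h) Z ≫ leftUnit c Z

/-- The right unit constraint. -/
def redRightUnitor (h : ObjectsDefined c) (Z : DCenter A) :
    (redTensor h Z (redUnit h)).X ⟶ Z.X :=
  incl c Z (redUnit h) ≫ rightUnit c Z

/-- The evaluation, restricted to the reduced tensor product. -/
def redEv (h : ObjectsDefined c) (Z W : DCenter A) [ExactPairing Z.X W.X] :
    (redTensor h W Z).X ⟶ (redUnit h).X :=
  incl c W Z ≫ evMap c Z W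

/-- The coevaluation, projected to the reduced tensor product. -/
def redCoev (h : ObjectsDefined c) (Z W : DCenter A) [ExactPairing Z.X W.X] :
    (redUnit h).X ⟶ (redTensor h Z W).X :=
  coevMap c Z W ≫ proj c Z W

/-- The proposed structure morphisms are morphisms of the center, the constraints are invertible,
the associativity constraint is the restriction of that of `A`, and the different expressions for
the dual half-braidings and for the evaluations agree. -/
structure MorphismsDefined (h : ObjectsDefined c) : Prop where
  tensorHom : ∀ {Z Z' W W' : DCenter A} (f : Z ⟶ Z') (g : W ⟶ W'),
    DCenter.IsCentral (redTensor h Z W) (redTensor h Z' W') (redTensorHom f g)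
  assoc : ∀ Z₁ Z₂ Z₃ : DCenter A, DCenter.IsCentral (redTensor h (redTensor h Z₁ Z₂) Z₃)
    (redTensor h Z₁ (redTensor h Z₂ Z₃)) (redAssoc h Z₁ Z₂ Z₃)
  assoc_isIso : ∀ Z₁ Z₂ Z₃ : DCenter A, IsIso (redAssoc h Z₁ Z₂ Z₃)
  assoc_restrict : ∀ Z₁ Z₂ Z₃ : DCenter A,
    redAssoc h Z₁ Z₂ Z₃ ≫ inclRight h Z₁ Z₂ Z₃ =
      inclLeft h Z₁ Z₂ Z₃ ≫ (α_ Z₁.X Z₂.X Z₃.X).hom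
  leftUnitor : ∀ Z : DCenter A,
    DCenter.IsCentral (redTensor h (redUnit h) Z) Z (redLeftUnitor h Z)
  leftUnitor_isIso : ∀ Z : DCenter A, IsIso (redLeftUnitor h Z)
  rightUnitor : ∀ Z : DCenter A,
    DCenter.IsCentral (redTensor h Z (redUnit h)) Z (redRightUnitor h Z)
  rightUnitor_isIso : ∀ Z : DCenter A, IsIso (redRightUnitor h Z)
  ev : ∀ Z : DCenter A,
    DCenter.IsCentral (redTensor h (redDual h Z) Z) (redUnit h) (redEv h Z (redDual h Z))
  coev : ∀ Z : DCenter A,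
    DCenter.IsCentral (redUnit h) (redTensor h Z (redDual h Z)) (redCoev h Z (redDual h Z))
  leftEv : ∀ Z : DCenter A,
    DCenter.IsCentral (redTensor h Z (redLeftDual h Z)) (redUnit h) (redEv h (redLeftDual h Z) Z)
  leftCoev : ∀ Z : DCenter A,
    DCenter.IsCentral (redUnit h) (redTensor h (redLeftDual h Z) Z)
      (redCoev h (redLeftDual h Z) Z)
  ev_eq : ∀ Z : DCenter A,
    redEv h Z (redDual h Z) = incl c (redDual h Z) Z ≫ evMapAlt c Z (redDual h Z)
  leftEv_eq : ∀ Z : DCenter A,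
    redEv h (redLeftDual h Z) Z = incl c Z (redLeftDual h Z) ≫ evMapAlt c (redLeftDual h Z) Z
  dualBr_eq : ∀ (Z : DCenter A) (B : A),
    dualBr Z B = twistOver (stdDualBr Z) B ∧ dualBr Z B = twistUnder (stdDualBr Z) B
  leftDualBr_eq : ∀ (Z : DCenter A) (B : A),
    leftDualBr Z B = twistUnder (stdLeftDualBr Z) B ∧
      leftDualBr Z B = twistOver (stdLeftDualBr Z) B

/-- The data of the reduced monoidal structure on the center. -/
@[reducible]
def redStruct {h : ObjectsDefined c} (hm : MorphismsDefined h) :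
    MonoidalCategoryStruct (DCenter A) where
  tensorObj := redTensor h
  whiskerLeft Z _ _ f := DCenter.homMk (redTensorHom (𝟙 Z) f) (hm.tensorHom (𝟙 Z) f)
  whiskerRight f W := DCenter.homMk (redTensorHom f (𝟙 W)) (hm.tensorHom f (𝟙 W))
  tensorHom f g := DCenter.homMk (redTensorHom f g) (hm.tensorHom f g)
  tensorUnit := redUnit h
  associator Z₁ Z₂ Z₃ :=
    DCenter.isoMk (redAssoc h Z₁ Z₂ Z₃) (hm.assoc Z₁ Z₂ Z₃) (hm.assoc_isIso Z₁ Z₂ Z₃)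
  leftUnitor Z := DCenter.isoMk (redLeftUnitor h Z) (hm.leftUnitor Z) (hm.leftUnitor_isIso Z)
  rightUnitor Z := DCenter.isoMk (redRightUnitor h Z) (hm.rightUnitor Z) (hm.rightUnitor_isIso Z)

/-- The data of the reduced monoidal structure satisfy the axioms of a monoidal category. -/
def IsMonoidal {h : ObjectsDefined c} (hm : MorphismsDefined h) : Prop :=
  ∃ M : MonoidalCategory (DCenter A), M.toMonoidalCategoryStruct = redStruct hm

/-- The reduced monoidal structure on the center. -/
@[reducible]
def redMonoidal {h : ObjectsDefined c} {hm : MorphismsDefined h} (hM : IsMonoidal hm) :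
    MonoidalCategory (DCenter A) :=
  { redStruct hm with
    tensorHom_def := by obtain ⟨M, hM⟩ := hM; rw [← hM]; exact M.tensorHom_def
    id_tensorHom_id := by obtain ⟨M, hM⟩ := hM; rw [← hM]; exact M.id_tensorHom_id
    tensorHom_comp_tensorHom := by
      obtain ⟨M, hM⟩ := hM; rw [← hM]; exact M.tensorHom_comp_tensorHom
    whiskerLeft_id := by obtain ⟨M, hM⟩ := hM; rw [← hM]; exact M.whiskerLeft_id
    id_whiskerRight := by obtain ⟨M, hM⟩ := hM; rw [← hM]; exact M.id_whiskerRight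
    associator_naturality := by obtain ⟨M, hM⟩ := hM; rw [← hM]; exact M.associator_naturality
    leftUnitor_naturality := by obtain ⟨M, hM⟩ := hM; rw [← hM]; exact M.leftUnitor_naturality
    rightUnitor_naturality := by obtain ⟨M, hM⟩ := hM; rw [← hM]; exact M.rightUnitor_naturality
    pentagon := by obtain ⟨M, hM⟩ := hM; rw [← hM]; exact M.pentagon
    triangle := by obtain ⟨M, hM⟩ := hM; rw [← hM]; exact M.triangle }

section Rigid

variable {h : ObjectsDefined c} {hm : MorphismsDefined h}

/-- `coev : 𝟙 ⟶ X ⊗ Y` and `ev : Y ⊗ X ⟶ 𝟙` satisfy the two zigzag identities. -/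
def IsDualPair {C : Type u} [Category.{v} C] [MonoidalCategory C] {X Y : C}
    (coev : 𝟙_ C ⟶ X ⊗ Y) (ev : Y ⊗ X ⟶ 𝟙_ C) : Prop :=
  Y ◁ coev ≫ (α_ Y X Y).inv ≫ ev ▷ Y = (ρ_ Y).hom ≫ (λ_ Y).inv ∧
    coev ▷ X ≫ (α_ X Y X).hom ≫ X ◁ ev = (λ_ X).hom ≫ (ρ_ X).inv

/-- The given evaluations and coevaluations make `(X^*, γ^∨)` and `(^*X, ^∨γ)` the two duals of
`(X, γ)` for the reduced tensor product. -/
structure IsRigid (hM : IsMonoidal hm) : Prop where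
  right : letI := redMonoidal hM
    ∀ Z : DCenter A, IsDualPair (C := DCenter A) (X := Z) (Y := redDual h Z)
      (DCenter.homMk (redCoev h Z (redDual h Z)) (hm.coev Z))
      (DCenter.homMk (redEv h Z (redDual h Z)) (hm.ev Z))
  left : letI := redMonoidal hM
    ∀ Z : DCenter A, IsDualPair (C := DCenter A) (X := redLeftDual h Z) (Y := Z)
      (DCenter.homMk (redCoev h (redLeftDual h Z) Z) (hm.leftCoev Z))
      (DCenter.homMk (redEv h (redLeftDual h Z) Z) (hm.leftEv Z))

/-- The reduced rigid structure on the center. -/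
@[reducible]
def redRigid {hM : IsMonoidal hm} (hr : IsRigid hM) :
    @RigidCategory (DCenter A) _ (redMonoidal hM) :=
  letI := redMonoidal hM
  { rightDual := fun Z =>
      { rightDual := redDual h Z
        exact :=
          { coevaluation' := DCenter.homMk (redCoev h Z (redDual h Z)) (hm.coev Z)
            evaluation' := DCenter.homMk (redEv h Z (redDual h Z)) (hm.ev Z)
            coevaluation_evaluation' := (hr.right Z).1
            evaluation_coevaluation' := (hr.right Z).2 } }
    leftDual := fun Z =>
      { leftDual := redLeftDual h Z
        exact :=
          { coevaluation' := DCenter.homMk (redCoev h (redLeftDual h Z) Z) (hm.leftCoev Z)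
            evaluation' := DCenter.homMk (redEv h (redLeftDual h Z) Z) (hm.leftEv Z)
            coevaluation_evaluation' := (hr.left Z).1
            evaluation_coevaluation' := (hr.left Z).2 } } }

end Rigid

end Structure

end Reduced

end RedCenter

end

open RedCenter

/-! Everything is reduced to statements about morphisms that intertwine half-braidings (`Cent`).
Besides the given half-braidings, every object of `A` carries two more, `plus` and `minus`, given by
the braiding and its inverse. For `(X, γ)` and `(Y, μ)` this yields two half-braidings on `X ⊗ Y`:
`sig`, which is the braiding on `X` and `μ` on `Y`, and `rho`, which is `γ` on `X` and the inverse
braiding on `Y`. Pulling the cup and the cap of the loop to the outside (`loop_eq_wrap`) turns it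
into a circle around the identity of `X ⊗ Y` that leaves through `sig` and returns through `rho`.
Hence `Q` is the average `avg` of the identity from `sig` to `rho`.

Averaging projects all morphisms onto the intertwiners. A strand `B` passes through the
regular-coloured loop (`avg_cent`): cutting on the left of the loop by the fusion formula for `B ⊗
X_i`, or on its right by the one for `X_j^* ⊗ B`, gives the same double sum of loops with two nodes.
Sphericity enters because the rotated bases must again be dual to each other. Conversely, an
intertwiner slides out of the loop, which leaves the factor `∑ d_i ^ 2 = D`, and `D ≠ 0` in
characteristic zero by a positivity argument for fusion matrices (`globalDim_ne_zero`). Averages are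
natural for intertwiners on both sides.

The morphism `Q` intertwines `sig` with `rho`, and also each of them with itself. So `Q ≫ Q` is the
average of `Q`, which is `Q`; on the image of `Q` the two half-braidings coincide, and their common
restriction is the reduced one (`redBr_eq`). A strand with `plus` on the left, or with `minus` on
the right, drops out of the loop. Therefore both ways of bracketing three objects are cut out by the
same idempotent, `Q` on the last two factors followed by `Q` on the first two, and the associator
restricts.

The object `I(𝟙)` is the target of a dinatural family `C ⊗ C^* ⟶ I(𝟙)`, and its half-braiding
generates this family from `𝟙 ⟶ I(𝟙)`. A central morphism out of `I(𝟙) ⊗ V`, with `minus` on `V`, is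
therefore determined on `V` (`hom_ext_unitX_left`). There the unit constraints become `1 / √D` times
the unitors of `A`. The evaluation is `√D` times the average of `ε` followed by `𝟙 ⟶ I(𝟙)`, so the
zigzag identities follow from those of `A`. The dual half-braiding is the inverse of the standard
one conjugated by crossings (`tw`). It makes `rho` and `sig` agree after the evaluation, which is
all that rigidity needs.

Dual morphisms for the reduced product are the dual morphisms of `A`, and the reduced comparison of
duals of products is a restriction of that of `A`; the pivotal axioms are inherited along the
projections. Finally, averaging a pseudo-inverse found in `A` gives a central one, so every morphism
of the center is von Neumann regular. Together with split idempotents and finite-dimensional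
morphism spaces this gives semisimplicity. Every simple object receives a nonzero morphism from one
of the objects `I(𝟙) ⊗ X_i`, so there are finitely many. -/

noncomputable section

namespace RedCenter

/-! ### Central morphisms and tensor products of half-braidings. -/

section Standard

variable {A : Type u} [Category.{v} A] [MonoidalCategory A]

/-- A family of morphisms of the shape of a half-braiding on `X`. -/
abbrev HB (X : A) := ∀ B : A, B ⊗ X ⟶ X ⊗ B

/-- `f` intertwines the families `γ` and `μ`. -/
def Cent {X Y : A} (γ : HB X) (μ : HB Y) (f : X ⟶ Y) : Prop :=
  ∀ B : A, B ◁ f ≫ μ B = γ B ≫ f ▷ B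

/-- The tensor product of half-braidings. -/
def tbr {X Y : A} (γ : HB X) (μ : HB Y) : HB (X ⊗ Y) := fun B =>
  (α_ B X Y).inv ≫ γ B ▷ Y ≫ (α_ X B Y).hom ≫ X ◁ μ B ≫ (α_ X Y B).inv

local infixr:70 "⊠" => tbr

/-- A natural family that is compatible with tensor products and monic at the unit object is
the canonical isomorphism at the unit object. -/
theorem br_unit_of_mono {X : A} (γ : HB X)
    (nat : ∀ {B B' : A} (f : B ⟶ B'), f ▷ X ≫ γ B' = γ B ≫ X ◁ f)
    (ten : ∀ B B' : A, γ (B ⊗ B') =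
      (α_ B B' X).hom ≫ B ◁ γ B' ≫ (α_ B X B').inv ≫ γ B ▷ B' ≫ (α_ X B B').hom)
    [Mono (γ (𝟙_ A))] : γ (𝟙_ A) = (λ_ X).hom ≫ (ρ_ X).inv := by
  -- Naturality along `𝟙 ⊗ 𝟙 ≅ 𝟙` together with the tensor axiom says that `γ (𝟙_ A)` is idempotent
  -- up to unitors; an idempotent that is monic is the identity.
  have h1 := nat (λ_ (𝟙_ A)).hom
  rw [ten] at h1
  have h3 : 𝟙_ A ◁ γ (𝟙_ A) ≫ (α_ (𝟙_ A) X (𝟙_ A)).inv ≫ (ρ_ (𝟙_ A ⊗ X)).hom ≫ γ (𝟙_ A) =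
      𝟙_ A ◁ γ (𝟙_ A) ≫ 𝟙_ A ◁ (ρ_ X).hom ≫ γ (𝟙_ A) := by
    simp
  have h4 : γ (𝟙_ A) ▷ (𝟙_ A) ≫ (α_ X (𝟙_ A) (𝟙_ A)).hom ≫ X ◁ (λ_ (𝟙_ A)).hom =
     (ρ_ _).hom ≫ γ (𝟙_ A) := by
    rw [← rightUnitor_naturality]; congr 1; monoidal
  have h5 : 𝟙_ A ◁ γ (𝟙_ A) ≫ 𝟙_ A ◁ (ρ_ X).hom ≫ γ (𝟙_ A) =
      𝟙_ A ◁ (λ_ X).hom ≫ γ (𝟙_ A) := by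
    rw [← h3, ← h4]
    simp only [Category.assoc] at h1
    rw [← cancel_epi (α_ (𝟙_ A) (𝟙_ A) X).hom, ← h1]
    rw [← Category.assoc]; congr 1; monoidal
  rw [← Category.assoc, cancel_mono, ← whiskerLeft_comp] at h5
  have h6 : γ (𝟙_ A) ≫ (ρ_ X).hom = (λ_ X).hom := by
    rw [← cancel_epi (λ_ _).hom, ← leftUnitor_naturality, h5, leftUnitor_naturality]
  rw [← h6]; simp

theorem IsHalfBraiding.unit {X : A} {γ : HB X} (h : IsHalfBraiding X γ) :
    γ (𝟙_ A) = (λ_ X).hom ≫ (ρ_ X).inv :=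
  have := h.isIso (𝟙_ A)
  br_unit_of_mono γ h.naturality h.tensor

theorem IsHalfBraiding.tbr {X Y : A} {γ : HB X} {μ : HB Y} (hγ : IsHalfBraiding X γ)
    (hμ : IsHalfBraiding Y μ) : IsHalfBraiding (X ⊗ Y) (γ ⊠ μ) where
  isIso B := by
    have := hγ.isIso B
    have := hμ.isIso B
    unfold RedCenter.tbr; infer_instance
  naturality {B B'} f := by
    have h1 := hγ.naturality f
    have h2 := hμ.naturality f
    unfold RedCenter.tbr
    calc _ = 𝟙 _ ⊗≫ (f ▷ X ≫ γ B') ▷ Y ⊗≫ X ◁ μ B' ⊗≫ 𝟙 _ := by monoidal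
      _ = 𝟙 _ ⊗≫ γ B ▷ Y ⊗≫ X ◁ (f ▷ Y ≫ μ B') ⊗≫ 𝟙 _ := by rw [h1]; monoidal
      _ = _ := by rw [h2]; monoidal
  tensor B B' := by
    unfold RedCenter.tbr
    rw [hγ.tensor, hμ.tensor]
    calc _ = 𝟙 _ ⊗≫ B ◁ γ B' ▷ Y ⊗≫ (γ B ▷ (B' ⊗ Y) ≫ (X ⊗ B) ◁ μ B') ⊗≫
          X ◁ μ B ▷ B' ⊗≫ 𝟙 _ := by monoidal
      _ = _ := by rw [← whisker_exchange]; monoidal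

namespace Cent

variable {X X' Y Y' V : A} {γ : HB X} {γ' : HB X'} {μ : HB Y} {μ' : HB Y'} {ν : HB V}

theorem id (γ : HB X) : Cent γ γ (𝟙 X) := fun B => by simp

theorem comp {f : X ⟶ Y} {g : Y ⟶ V} (hf : Cent γ μ f) (hg : Cent μ ν g) :
    Cent γ ν (f ≫ g) := fun B => by
  rw [whiskerLeft_comp, Category.assoc, hg, reassoc_of% hf B, comp_whiskerRight]

theorem inv {f : X ⟶ Y} {g : Y ⟶ X} (hf : Cent γ μ f) (h1 : f ≫ g = 𝟙 _) (h2 : g ≫ f = 𝟙 _) :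
    Cent μ γ g := fun B => by
  have : IsIso f := ⟨g, h1, h2⟩
  rw [← cancel_epi (B ◁ f), ← cancel_mono (f ▷ B)]
  simp only [Category.assoc, ← comp_whiskerRight, h2, ← whiskerLeft_comp_assoc, h1]
  simp [hf B]

theorem whiskerLeft (ν : HB V) {f : X ⟶ Y} (hf : Cent γ μ f) :
    Cent (ν ⊠ γ) (ν ⊠ μ) (V ◁ f) := fun B => by
  have h := hf B
  unfold tbr
  calc _ = 𝟙 _ ⊗≫ ((B ⊗ V) ◁ f ≫ ν B ▷ Y) ⊗≫ V ◁ μ B ⊗≫ 𝟙 _ := by monoidal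
    _ = 𝟙 _ ⊗≫ ν B ▷ X ⊗≫ V ◁ (B ◁ f ≫ μ B) ⊗≫ 𝟙 _ := by rw [whisker_exchange]; monoidal
    _ = _ := by rw [h]; monoidal

theorem whiskerRight {f : X ⟶ Y} (hf : Cent γ μ f) (ν : HB V) :
    Cent (γ ⊠ ν) (μ ⊠ ν) (f ▷ V) := fun B => by
  have h := hf B
  unfold tbr
  calc _ = 𝟙 _ ⊗≫ (B ◁ f ≫ μ B) ▷ V ⊗≫ Y ◁ ν B ⊗≫ 𝟙 _ := by monoidal
    _ = 𝟙 _ ⊗≫ γ B ▷ V ⊗≫ (f ▷ (B ⊗ V) ≫ Y ◁ ν B) ⊗≫ 𝟙 _ := by rw [h]; monoidal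
    _ = _ := by rw [← whisker_exchange]; monoidal

theorem tensorHom {f : X ⟶ X'} {g : Y ⟶ Y'} (hf : Cent γ γ' f) (hg : Cent μ μ' g) :
    Cent (γ ⊠ μ) (γ' ⊠ μ') (f ⊗ₘ g) := by
  rw [MonoidalCategory.tensorHom_def]
  exact (hf.whiskerRight μ).comp (hg.whiskerLeft γ')

theorem assoc (γ : HB X) (μ : HB Y) (ν : HB V) :
    Cent ((γ ⊠ μ) ⊠ ν) (γ ⊠ (μ ⊠ ν)) (α_ X Y V).hom := fun B => by
  unfold tbr; monoidal

theorem assoc_inv (γ : HB X) (μ : HB Y) (ν : HB V) :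
    Cent (γ ⊠ (μ ⊠ ν)) ((γ ⊠ μ) ⊠ ν) (α_ X Y V).inv :=
  (assoc γ μ ν).inv (Iso.hom_inv_id _) (Iso.inv_hom_id _)

/-- The half-braidings of objects of the center are morphisms of the center. -/
theorem br {B : A} (b : HB B) (hγ : IsHalfBraiding X γ) : Cent (b ⊠ γ) (γ ⊠ b) (γ B) := fun C => by
  -- The hexagon-like identity that is needed is the naturality of `γ` at the morphism `b C : C ⊗ B
  -- ⟶ B ⊗ C` itself, with both sides expanded by the tensor axiom.
  have h := hγ.naturality (b C)
  rw [hγ.tensor, hγ.tensor] at h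
  unfold tbr
  simp only [Category.assoc] at h ⊢
  rw [← cancel_mono (α_ X B C).hom]
  simp only [Category.assoc, h, Iso.inv_hom_id, Category.comp_id]
  simp

end Cent

end Standard

/-! ### The two half-braidings coming from the braiding. -/

section Braided

variable {A : Type u} [Category.{v} A] [MonoidalCategory A] [BraidedCategory A]

local infixr:70 "⊠" => tbr

/-- The half-braiding given by the braiding. -/
def plus (X : A) : HB X := fun B => (β_ B X).hom

/-- The half-braiding given by the inverse braiding. -/
def minus (X : A) : HB X := fun B => (β_ X B).inv

theorem isHalfBraiding_plus (X : A) : IsHalfBraiding X (plus X) where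
  isIso B := by unfold plus; infer_instance
  naturality f := BraidedCategory.braiding_naturality_left f X
  tensor B B' := BraidedCategory.braiding_tensor_left_hom B B' X

theorem isHalfBraiding_minus (X : A) : IsHalfBraiding X (minus X) where
  isIso B := by unfold minus; infer_instance
  naturality f := BraidedCategory.braiding_inv_naturality_left f X
  tensor B B' := BraidedCategory.braiding_tensor_right_inv X B B'

theorem tbr_plus (X Y : A) : plus X ⊠ plus Y = plus (X ⊗ Y) := by
  funext B
  simp only [plus, tbr, BraidedCategory.braiding_tensor_right_hom]

theorem tbr_minus (X Y : A) : minus X ⊠ minus Y = minus (X ⊗ Y) := by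
  funext B
  simp only [minus, tbr, BraidedCategory.braiding_tensor_left_inv]

theorem plus_unit : plus (𝟙_ A) = minus (𝟙_ A) := by
  funext B; simp [plus, minus]

namespace Cent

variable {X Y Y' : A} {γ : HB X}

theorem plus (f : X ⟶ Y) : Cent (plus X) (plus Y) f := fun B =>
  BraidedCategory.braiding_naturality_right B f

theorem minus (f : X ⟶ Y) : Cent (minus X) (minus Y) f := fun B =>
  BraidedCategory.braiding_inv_naturality_right B f

theorem leftUnitor (γ : HB X) : Cent (RedCenter.plus (𝟙_ A) ⊠ γ) γ (λ_ X).hom := fun B => by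
  simp only [tbr, RedCenter.plus, braiding_tensorUnit_right]
  monoidal

theorem leftUnitor_inv (γ : HB X) : Cent γ (RedCenter.plus (𝟙_ A) ⊠ γ) (λ_ X).inv :=
  (leftUnitor γ).inv (Iso.hom_inv_id _) (Iso.inv_hom_id _)

theorem rightUnitor (γ : HB X) : Cent (γ ⊠ RedCenter.plus (𝟙_ A)) γ (ρ_ X).hom := fun B => by
  simp only [tbr, RedCenter.plus, braiding_tensorUnit_right]
  monoidal

theorem rightUnitor_inv (γ : HB X) : Cent γ (γ ⊠ RedCenter.plus (𝟙_ A)) (ρ_ X).inv :=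
  (rightUnitor γ).inv (Iso.hom_inv_id _) (Iso.inv_hom_id _)

/-- Naturality of the braiding in its first argument along `γ C`. A strand with `plus` may thus be
crossed by `β_ X B` and its inverse; a strand with `minus` by `β_ B X` and its inverse, from
naturality in the second argument (`braiding_minus`). Which crossings occur in a diagram decides
which of the two half-braidings its auxiliary strands must carry. -/
theorem braiding_plus (γ : HB X) (B : A) :
    Cent (γ ⊠ RedCenter.plus B) (RedCenter.plus B ⊠ γ) (β_ X B).hom := fun C => by
  have h := BraidedCategory.braiding_naturality_left (γ C) B
  rw [BraidedCategory.braiding_tensor_left_hom, BraidedCategory.braiding_tensor_left_hom] at h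
  unfold tbr RedCenter.plus
  simp only [Category.assoc] at h ⊢
  rw [← cancel_mono (α_ B X C).hom, ← cancel_epi (α_ C X B).hom]
  simp only [Category.assoc, Iso.inv_hom_id, Category.comp_id, Iso.hom_inv_id_assoc] at h ⊢
  exact h.symm

theorem braiding_minus (γ : HB X) (B : A) :
    Cent (RedCenter.minus B ⊠ γ) (γ ⊠ RedCenter.minus B) (β_ B X).hom := fun C => by
  have h := BraidedCategory.braiding_naturality_right B (γ C)
  rw [BraidedCategory.braiding_tensor_right_hom, BraidedCategory.braiding_tensor_right_hom] at h
  unfold tbr RedCenter.minus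
  simp only [Category.assoc] at h ⊢
  rw [← cancel_epi (α_ C B X).hom, ← cancel_epi ((β_ B C).hom ▷ X),
    ← cancel_epi (α_ B C X).inv, ← cancel_mono (α_ X B C).hom, ← cancel_mono (X ◁ (β_ B C).hom),
    ← cancel_mono (α_ X C B).inv]
  simp only [Category.assoc, Iso.inv_hom_id, Category.comp_id, Iso.hom_inv_id_assoc,
    Iso.inv_hom_id_assoc, hom_inv_whiskerRight_assoc, ← MonoidalCategory.whiskerLeft_comp_assoc,
    Iso.hom_inv_id, MonoidalCategory.whiskerLeft_id, Category.id_comp] at h ⊢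
  exact h.symm

theorem braiding_plus_inv (γ : HB X) (B : A) :
    Cent (RedCenter.plus B ⊠ γ) (γ ⊠ RedCenter.plus B) (β_ X B).inv :=
  (braiding_plus γ B).inv (Iso.hom_inv_id _) (Iso.inv_hom_id _)

theorem braiding_minus_inv (γ : HB X) (B : A) :
    Cent (γ ⊠ RedCenter.minus B) (RedCenter.minus B ⊠ γ) (β_ B X).inv :=
  (braiding_minus γ B).inv (Iso.hom_inv_id _) (Iso.inv_hom_id _)

end Cent

end Braided

/-! ### Cups, caps and traces for a pivotal structure. -/

section PivotalCalculus

variable {A : Type u} [Category.{v} A] [MonoidalCategory A] [RightRigidCategory A]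

open ExactPairing

theorem dualTensorIso_hom_evaluation (X Y : A) :
    (dualTensorIso X Y).hom ▷ (X ⊗ Y) ≫ ε_ (X ⊗ Y) (X ⊗ Y)ᘁ =
      𝟙 _ ⊗≫ rightDual Y ◁ ε_ X Xᘁ ▷ Y ⊗≫ ε_ Y Yᘁ := by
  have := @rightAdjointMate_comp_evaluation A _ _ (X ⊗ Y) (X ⊗ Y) inferInstance
    ⟨rightDual Y ⊗ rightDual X⟩ (𝟙 _)
  rw [MonoidalCategory.whiskerLeft_id, Category.id_comp] at this
  exact this

namespace PivotalStructure

variable (P : PivotalStructure A)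

/-- The dual pairing given by the pivotal structure. -/
@[reducible]
def pairing (X : A) : ExactPairing Xᘁ X :=
  exactPairingCongrRight (P.iso X)

theorem pcoev_pev (X : A) : X ◁ P.pcoev X ⊗≫ P.pev X ▷ X = ⊗𝟙.hom :=
  @ExactPairing.coevaluation_evaluation'' A _ _ _ _ (P.pairing X)

theorem pev_pcoev (X : A) : P.pcoev X ▷ Xᘁ ⊗≫ Xᘁ ◁ P.pev X = ⊗𝟙.hom :=
  @ExactPairing.evaluation_coevaluation'' A _ _ _ _ (P.pairing X)

theorem pev_naturality {X Y : A} (f : X ⟶ Y) :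
    f ▷ Yᘁ ≫ P.pev Y = X ◁ fᘁ ≫ P.pev X := by
  unfold pev
  rw [← comp_whiskerRight_assoc, P.naturality, comp_whiskerRight_assoc,
    rightAdjointMate_comp_evaluation, whisker_exchange_assoc]

theorem pcoev_naturality {X Y : A} (f : X ⟶ Y) :
    P.pcoev X ≫ Xᘁ ◁ f = P.pcoev Y ≫ fᘁ ▷ Y := by
  have h : (P.iso X).inv ≫ f = fᘁᘁ ≫ (P.iso Y).inv := by
    rw [Iso.inv_comp_eq, ← Category.assoc, Iso.eq_comp_inv, P.naturality]
  unfold pcoev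
  rw [Category.assoc, Category.assoc, ← MonoidalCategory.whiskerLeft_comp, h,
    MonoidalCategory.whiskerLeft_comp, coevaluation_comp_rightAdjointMate_assoc,
    whisker_exchange]

/-- The monoidality axiom of the pivotal structure, moved from double duals to evaluations: the cap
of a product is a pair of nested caps. -/
theorem pev_tensor (X Y : A) :
    (X ⊗ Y) ◁ (dualTensorIso X Y).hom ≫ P.pev (X ⊗ Y) =
      𝟙 _ ⊗≫ X ◁ P.pev Y ▷ Xᘁ ⊗≫ P.pev X := by
  have h := P.monoidal X Y
  unfold pev
  rw [whisker_exchange_assoc, ← rightAdjointMate_comp_evaluation, ← comp_whiskerRight_assoc, h,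
    comp_whiskerRight_assoc, dualTensorIso_hom_evaluation,
    MonoidalCategory.tensorHom_def']
  calc _ = 𝟙 _ ⊗≫ X ◁ (P.iso Y).hom ▷ (rightDual Y ⊗ rightDual X) ⊗≫
        ((P.iso X).hom ▷ (((rightDual (rightDual Y)) ⊗ rightDual Y) ⊗ rightDual X) ≫
          rightDual (rightDual X) ◁ ε_ Yᘁ Yᘁᘁ ▷ rightDual X) ⊗≫ ε_ Xᘁ Xᘁᘁ := by monoidal
    _ = _ := by rw [← whisker_exchange]; monoidal

theorem trace_comm {X Y : A} (f : X ⟶ Y) (g : Y ⟶ X) : P.trace (f ≫ g) = P.trace (g ≫ f) := by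
  unfold trace
  rw [comp_whiskerRight, Category.assoc, P.pev_naturality, ← whisker_exchange_assoc,
    coevaluation_comp_rightAdjointMate_assoc,
    comp_whiskerRight, Category.assoc]

end PivotalStructure

end PivotalCalculus

/-! ### Splittings in a semisimple category and the fusion formula. -/

section Semisimple

variable {A : Type u} [Category.{v} A] [Abelian A]

theorem exists_simple_decomposition (k : Type w) [Field k] [Linear k A] [IsFiniteSemisimple k A]
    (V : A) : ∃ (n : ℕ) (S : Fin n → A) (_ : ∀ i, Simple (S i))
    (p : ∀ i, V ⟶ S i) (q : ∀ i, S i ⟶ V), ∑ i, p i ≫ q i = 𝟙 V := by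
  obtain ⟨n, S, hS, b, ⟨hb⟩, ⟨e⟩⟩ := IsFiniteSemisimple.semisimple k V
  refine ⟨n, S, hS, fun i => e.inv ≫ b.π i, fun i => b.ι i ≫ e.hom, ?_⟩
  have h : ∑ i, b.π i ≫ b.ι i = 𝟙 b.pt := by
    refine hb.isLimit.hom_ext fun ⟨j⟩ => ?_
    have : ∀ i, (b.π i ≫ b.ι i) ≫ b.π j = if i = j then b.π j else 0 := by
      intro i
      rw [Category.assoc, b.ι_π]
      split_ifs with hij
      · subst hij; simp
      · simp
    change (∑ i, b.π i ≫ b.ι i) ≫ b.π j = 𝟙 _ ≫ b.π j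
    rw [Preadditive.sum_comp, Finset.sum_congr rfl fun i _ => this i]
    simp
  calc ∑ i, (e.inv ≫ b.π i) ≫ b.ι i ≫ e.hom = e.inv ≫ (∑ i, b.π i ≫ b.ι i) ≫ e.hom := by
        simp [Preadditive.sum_comp, Preadditive.comp_sum]
    _ = 𝟙 V := by rw [h]; simp

/-- A nonzero `f` is nonzero on some simple summand of `V`, and there it is invertible by Schur's
lemma. -/
theorem exists_comp_eq_id (k : Type w) [Field k] [Linear k A] [IsFiniteSemisimple k A]
    {V S : A} [Simple S] {f : V ⟶ S} (hf : f ≠ 0) :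
    ∃ g : S ⟶ V, g ≫ f = 𝟙 S := by
  obtain ⟨n, T, hT, p, q, h⟩ := exists_simple_decomposition k V
  obtain ⟨i, hi⟩ : ∃ i, q i ≫ f ≠ 0 := by
    by_contra! h0
    apply hf
    rw [← Category.id_comp f, ← h, Preadditive.sum_comp]
    exact Finset.sum_eq_zero fun i _ => by rw [Category.assoc, h0, comp_zero]
  have := hT i
  have := isIso_of_hom_simple hi
  exact ⟨inv (q i ≫ f) ≫ q i, by simp⟩

theorem exists_id_eq_comp (k : Type w) [Field k] [Linear k A] [IsFiniteSemisimple k A]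
    {V S : A} [Simple S] {g : S ⟶ V} (hg : g ≠ 0) :
    ∃ f : V ⟶ S, g ≫ f = 𝟙 S := by
  obtain ⟨n, T, hT, p, q, h⟩ := exists_simple_decomposition k V
  obtain ⟨i, hi⟩ : ∃ i, g ≫ p i ≠ 0 := by
    by_contra! h0
    apply hg
    rw [← Category.comp_id g, ← h, Preadditive.comp_sum]
    exact Finset.sum_eq_zero fun i _ => by rw [← Category.assoc, h0, zero_comp]
  have := hT i
  have := isIso_of_hom_simple hi
  exact ⟨p i ≫ inv (g ≫ p i), by rw [← Category.assoc]; simp⟩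

theorem hom_ext_to_simple (k : Type w) [Field k] [Linear k A] [IsFiniteSemisimple k A]
    {V W : A} {f g : V ⟶ W}
    (h : ∀ (S : A) [Simple S] (p : W ⟶ S), f ≫ p = g ≫ p) : f = g := by
  obtain ⟨n, T, hT, p, q, hpq⟩ := exists_simple_decomposition k W
  rw [← Category.comp_id f, ← Category.comp_id g, ← hpq, Preadditive.comp_sum, Preadditive.comp_sum]
  refine Finset.sum_congr rfl fun i _ => ?_
  have := hT i
  rw [← Category.assoc, h, Category.assoc]

theorem hom_ext_from_simple (k : Type w) [Field k] [Linear k A] [IsFiniteSemisimple k A]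
    {V W : A} {f g : V ⟶ W}
    (h : ∀ (S : A) [Simple S] (p : S ⟶ V), p ≫ f = p ≫ g) : f = g := by
  obtain ⟨n, T, hT, p, q, hpq⟩ := exists_simple_decomposition k V
  rw [← Category.id_comp f, ← Category.id_comp g, ← hpq, Preadditive.sum_comp, Preadditive.sum_comp]
  refine Finset.sum_congr rfl fun i _ => ?_
  have := hT i
  rw [Category.assoc, h, Category.assoc]

/-- Two endomorphisms of `V` agree if they agree after every morphism to a simple object. After a
basis element `f j β` the terms with `i ≠ j` vanish by Schur's lemma, and duality leaves the single
term `α = β`. The weights `a i` will be the dimensions, because the bases in use are dual for the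
trace and not for composition. -/
theorem gluing {k : Type w} [Field k] [Linear k A] [IsFiniteSemisimple k A]
    {ι : Type*} [Fintype ι] [DecidableEq ι] {S : ι → A} (hS : ∀ i, Simple (S i))
    (complete : ∀ T : A, Simple T → ∃ i, Nonempty (T ≅ S i))
    (irredundant : ∀ i j, Nonempty (S i ≅ S j) → i = j) {V : A} {κ : ι → Type*}
    [∀ i, Fintype (κ i)] [∀ i, DecidableEq (κ i)] (f : ∀ i, κ i → (V ⟶ S i))
    (g : ∀ i, κ i → (S i ⟶ V))
    (span : ∀ i, Submodule.span k (Set.range (f i)) = ⊤) (a : ι → k)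
    (dual : ∀ i α β, a i • (g i α ≫ f i β) = if α = β then 𝟙 (S i) else 0) :
    ∑ i, a i • ∑ α, f i α ≫ g i α = 𝟙 V := by
  refine hom_ext_to_simple k fun T _ p => ?_
  obtain ⟨j, ⟨e⟩⟩ := complete T inferInstance
  suffices h : ∀ p : V ⟶ S j, (∑ i, a i • ∑ α, f i α ≫ g i α) ≫ p = p by
    rw [← cancel_mono e.hom, Category.assoc, h, Category.id_comp]
  intro p
  have hp : p ∈ Submodule.span k (Set.range (f j)) := by rw [span]; trivial
  induction hp using Submodule.span_induction with
  | zero => simp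
  | add x y _ _ hx hy => rw [Preadditive.comp_add, hx, hy]
  | smul r x _ hx => rw [Linear.comp_smul, hx]
  | mem x hx =>
    obtain ⟨β, rfl⟩ := hx
    rw [Preadditive.sum_comp, Finset.sum_eq_single j]
    · rw [Linear.smul_comp, Preadditive.sum_comp, Finset.smul_sum]
      have : ∀ α, a j • ((f j α ≫ g j α) ≫ f j β) = if α = β then f j β else 0 := by
        intro α
        rw [Category.assoc, ← Linear.comp_smul, dual]
        split_ifs with h
        · subst h; simp
        · simp
      rw [Finset.sum_congr rfl fun α _ => this α]
      simp
    · intro i _ hij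
      rw [Linear.smul_comp, Preadditive.sum_comp, Finset.sum_eq_zero, smul_zero]
      intro α _
      have : g i α ≫ f j β = 0 := by
        by_contra h
        have := hS i
        have := hS j
        have := isIso_of_hom_simple h
        exact hij (irredundant i j ⟨asIso (g i α ≫ f j β)⟩)
      rw [Category.assoc, this, comp_zero]
    · simp

end Semisimple

/-! ### Nonvanishing of dimensions of simple objects. -/

section Bases

variable {k : Type w} [Field k] [IsAlgClosed k] {A : Type u} [Category.{v} A] [Abelian A]
  [Linear k A] [MonoidalCategory A] [MonoidalPreadditive A] [MonoidalLinear k A]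
  [BraidedCategory A] [RigidCategory A] [IsFiniteSemisimple k A]
  {P : PivotalStructure A}

open ExactPairing

set_option linter.unusedSectionVars false

variable (k) in
theorem exists_smul_id {S : A} [Simple S] (f : S ⟶ S) : ∃ a : k, f = a • 𝟙 S :=
  (endomorphism_simple_eq_smul_id k f).imp fun _ h => h.symm

theorem smul_id_injective {S : A} (hS : Simple S) {a b : k} (h : a • 𝟙 S = b • 𝟙 S) : a = b := by
  by_contra hab
  rw [← sub_eq_zero, ← sub_smul, smul_eq_zero, sub_eq_zero] at h
  exact h.elim hab (id_nonzero S)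

namespace PivotalStructure

variable (P : PivotalStructure A)

theorem trace_smul {X : A} (a : k) (f : X ⟶ X) : P.trace (a • f) = a • P.trace f := by
  simp [trace]

theorem trace_sum {X : A} {ι : Type*} (s : Finset ι) (f : ι → (X ⟶ X)) :
    P.trace (∑ i ∈ s, f i) = ∑ i ∈ s, P.trace (f i) := by
  simp [trace, Preadditive.sum_comp, Preadditive.comp_sum, sum_whiskerRight]

theorem trace_conj {X Y : A} (e : X ≅ Y) : P.trace (𝟙 X) = P.trace (𝟙 Y) := by
  rw [← e.hom_inv_id, P.trace_comm, e.inv_hom_id]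

/-- The coevaluation of `S` is a nonzero morphism out of the simple unit, so it has a retraction
`f`. As `f` must be a multiple of the pivotal evaluation, the composite of the coevaluation with the
latter, which is the trace, cannot vanish. -/
theorem trace_id_ne_zero (k : Type w) [Field k] [IsAlgClosed k] [Linear k A]
    [MonoidalLinear k A] [IsFiniteSemisimple k A] (hunit : Simple (𝟙_ A)) (S : A) [Simple S] : P.trace (𝟙 S) ≠ 0 := by
  have hη : η_ S Sᘁ ≠ 0 := by
    intro h
    have := evaluation_coevaluation'' S Sᘁ
    rw [h] at this
    apply id_nonzero S
    rw [← cancel_mono (ρ_ S).inv, ← cancel_epi (λ_ S).hom]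
    trans (⊗𝟙 : 𝟙_ A ⊗ S ≅ S ⊗ 𝟙_ A).hom
    · monoidal
    · rw [← this]; simp [monoidalComp]
  obtain ⟨f, hf⟩ := exists_id_eq_comp k hη
  -- Bending one leg of `f` down gives an endomorphism of `S`, a scalar; bending it back identifies
  -- `f` with that scalar times `P.pev S`.
  obtain ⟨a, ha⟩ := exists_smul_id k (𝟙 _ ⊗≫ S ◁ P.pcoev S ⊗≫ f ▷ S ⊗≫ 𝟙 S : S ⟶ S)
  have hf' : f = a • P.pev S := by
    calc f = 𝟙 _ ⊗≫ S ◁ (P.pcoev S ▷ Sᘁ ⊗≫ rightDual S ◁ P.pev S) ⊗≫ f ⊗≫ 𝟙 _ := by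
          rw [P.pev_pcoev]; monoidal
      _ = 𝟙 _ ⊗≫ S ◁ P.pcoev S ▷ Sᘁ ⊗≫ ((S ⊗ rightDual S) ◁ P.pev S ≫ f ▷ _) ⊗≫ 𝟙 _ := by
          monoidal
      _ = (𝟙 _ ⊗≫ S ◁ P.pcoev S ⊗≫ f ▷ S ⊗≫ 𝟙 S : S ⟶ S) ▷ Sᘁ ≫ P.pev S := by
          rw [whisker_exchange]; monoidal
      _ = _ := by rw [ha]; simp
  intro h
  rw [hf', Linear.comp_smul] at hf
  rw [trace, id_whiskerRight, Category.id_comp] at h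
  rw [h, smul_zero] at hf
  exact id_nonzero _ hf.symm

end PivotalStructure

end Bases

/-! ### Dual bases for the trace pairing and rotation of nodes. -/

section Nodes

local postfix:max "ᵛ" => rightDual

set_option linter.unusedSectionVars false

variable {k : Type w} [Field k] [IsAlgClosed k] {A : Type u} [Category.{v} A] [Abelian A]
  [Linear k A] [MonoidalCategory A] [MonoidalPreadditive A] [MonoidalLinear k A]
  [BraidedCategory A] [RigidCategory A] [IsFiniteSemisimple k A]
  {P : PivotalStructure A} {Irr : Type t} [Fintype Irr] (c : SimpleChoice k P Irr)

open ExactPairing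

namespace SimpleChoice

instance (i : Irr) : Simple (c.obj i) := c.simple i

theorem trace_id_obj (i : Irr) : P.trace (𝟙 (c.obj i)) = c.dim i • 𝟙 (𝟙_ A) :=
  (c.sqrtDim_sq i).symm

theorem dim_ne_zero (hunit : Simple (𝟙_ A)) (i : Irr) : c.dim i ≠ 0 := by
  intro h
  apply P.trace_id_ne_zero k hunit (c.obj i)
  rw [trace_id_obj, h, zero_smul]

theorem sqrtDim_ne_zero (hunit : Simple (𝟙_ A)) (i : Irr) : c.sqrtDim i ≠ 0 := fun h =>
  c.dim_ne_zero hunit i (by rw [dim, h]; simp)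

/-- A basis of `Hom(V, X_i)`. -/
def basisTo (V : A) (i : Irr) (α : Fin (Module.finrank k (V ⟶ c.obj i))) : V ⟶ c.obj i :=
  Module.finBasis k (V ⟶ c.obj i) α

/-- The basis of `Hom(X_i, V)` dual to `basisTo` for the trace pairing. -/
def basisFrom (V : A) (i : Irr) (α : Fin (Module.finrank k (V ⟶ c.obj i))) : c.obj i ⟶ V :=
  haveI : Nonempty (c.obj i ⟶ V) := ⟨0⟩
  Classical.epsilon fun g => ∀ β, P.trace (g ≫ c.basisTo V i β) = if β = α then 𝟙 (𝟙_ A) else 0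

theorem node_eq (B : A) (i j : Irr) (α) : c.node B i j α = c.basisTo (B ⊗ c.obj i) j α := rfl

theorem conode_eq (B : A) (i j : Irr) (α) : c.conode B i j α = c.basisFrom (B ⊗ c.obj i) j α := rfl

/-- The scalar by which an endomorphism of `X_i` acts. -/
def scalar (i : Irr) : (c.obj i ⟶ c.obj i) →ₗ[k] k where
  toFun f := (exists_smul_id k f).choose
  map_add' f g := smul_id_injective (c.simple i) (by
    rw [add_smul, ← (exists_smul_id k (f + g)).choose_spec, ← (exists_smul_id k f).choose_spec,
      ← (exists_smul_id k g).choose_spec])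
  map_smul' r f := smul_id_injective (c.simple i) (by
    rw [smul_assoc, RingHom.id_apply, ← (exists_smul_id k (r • f)).choose_spec,
      ← (exists_smul_id k f).choose_spec])

theorem scalar_smul_id (i : Irr) (f : c.obj i ⟶ c.obj i) : c.scalar i f • 𝟙 _ = f :=
  ((exists_smul_id k f).choose_spec).symm

theorem trace_eq (i : Irr) (f : c.obj i ⟶ c.obj i) :
    P.trace f = (c.scalar i f * c.dim i) • 𝟙 (𝟙_ A) := by
  conv_lhs => rw [← c.scalar_smul_id i f, P.trace_smul, trace_id_obj, smul_smul]

/-- The composition pairing of `Hom(X_i, V)` and `Hom(V, X_i)`. -/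
def compPairing (V : A) (i : Irr) : (c.obj i ⟶ V) →ₗ[k] (V ⟶ c.obj i) →ₗ[k] k :=
  LinearMap.mk₂ k (fun g f => c.scalar i (g ≫ f))
    (fun g g' f => by rw [Preadditive.add_comp, map_add])
    (fun r g f => by rw [Linear.smul_comp, map_smul])
    (fun g f f' => by rw [Preadditive.comp_add, map_add])
    (fun r g f => by rw [Linear.comp_smul, map_smul])

theorem scalar_id (i : Irr) : c.scalar i (𝟙 _) = 1 :=
  smul_id_injective (c.simple i) (by rw [scalar_smul_id, one_smul])

/-- Nonzero morphisms to or from a simple object split, so neither kernel contains a nonzero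
element. -/
theorem compPairing_isPerfPair (V : A) (i : Irr) : (c.compPairing V i).IsPerfPair := by
  refine LinearMap.IsPerfPair.of_injective ?_ ?_
  · rw [injective_iff_map_eq_zero]
    intro g hg
    by_contra h
    obtain ⟨f, hf⟩ := exists_id_eq_comp k h
    have := LinearMap.congr_fun hg f
    change c.scalar i (g ≫ f) = 0 at this
    rw [hf, scalar_id] at this
    exact one_ne_zero this
  · rw [injective_iff_map_eq_zero]
    intro f hf
    by_contra h
    obtain ⟨g, hg⟩ := exists_comp_eq_id k h
    have := LinearMap.congr_fun hf g
    change c.scalar i (g ≫ f) = 0 at this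
    rw [hg, scalar_id] at this
    exact one_ne_zero this

theorem finrank_hom_comm (V : A) (i : Irr) :
    Module.finrank k (c.obj i ⟶ V) = Module.finrank k (V ⟶ c.obj i) :=
  have := c.compPairing_isPerfPair V i
  Module.finrank_of_isPerfPair (c.compPairing V i)

/-- `basisFrom` is made by a choice operator and has its defining property only once a solution is
exhibited. The solution comes from the perfect composition pairing; the factor `d_i⁻¹` compensates
that the trace of an endomorphism of `X_i` is `d_i` times its scalar. -/
theorem trace_basisFrom_basisTo (hunit : Simple (𝟙_ A)) (V : A) (i : Irr) (α β) :
    P.trace (c.basisFrom V i α ≫ c.basisTo V i β) = if β = α then 𝟙 (𝟙_ A) else 0 := by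
  have := c.compPairing_isPerfPair V i
  have : Nonempty (c.obj i ⟶ V) := ⟨0⟩
  have key : ∃ g : c.obj i ⟶ V, ∀ β, P.trace (g ≫ c.basisTo V i β) =
      if β = α then 𝟙 (𝟙_ A) else 0 := by
    refine ⟨(c.dim i)⁻¹ • (c.compPairing V i).toPerfPair.symm
      ((Module.finBasis k (V ⟶ c.obj i)).coord α), fun β => ?_⟩
    have h := LinearMap.congr_fun (LinearMap.apply_symm_toPerfPair_self (p := c.compPairing V i)
      ((Module.finBasis k (V ⟶ c.obj i)).coord α)) (c.basisTo V i β)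
    change c.scalar i _ = _ at h
    rw [Linear.smul_comp, P.trace_smul, trace_eq, h, smul_smul, basisTo, Module.Basis.coord_apply,
      Module.Basis.repr_self, Finsupp.single_apply]
    have := c.dim_ne_zero hunit i
    split_ifs <;> simp [this]
  exact Classical.epsilon_spec key β

theorem basisFrom_basisTo (hunit : Simple (𝟙_ A)) (V : A) (i : Irr) (α β) :
    c.dim i • (c.basisFrom V i α ≫ c.basisTo V i β) = if α = β then 𝟙 (c.obj i) else 0 := by
  have h := c.trace_basisFrom_basisTo hunit V i α β
  rw [trace_eq] at h
  rw [← c.scalar_smul_id i (c.basisFrom V i α ≫ c.basisTo V i β), smul_smul, mul_comm]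
  split_ifs at h ⊢ with h1 h2 h2
  · rw [smul_id_injective hunit (h.trans (one_smul k _).symm), one_smul]
  · exact (h2 h1.symm).elim
  · exact (h1 h2.symm).elim
  · rw [smul_id_injective hunit (h.trans (zero_smul k _).symm), zero_smul]

/-- The fusion formula, used for `V = B ⊗ X_i` to cut a loop open on its left side. -/
theorem sum_basisTo_basisFrom (hunit : Simple (𝟙_ A)) (V : A) :
    ∑ i, c.dim i • ∑ α, c.basisTo V i α ≫ c.basisFrom V i α = 𝟙 V := by
  classical
  refine gluing c.simple c.exists_iso c.eq_of_iso (c.basisTo V) (c.basisFrom V)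
    (fun i => (Module.finBasis k (V ⟶ c.obj i)).span_eq) c.dim (c.basisFrom_basisTo hunit V)

/-- Rotation of a morphism `B ⊗ X_i ⟶ X_j`. -/
def corotate {B : A} {i j : Irr} (f : B ⊗ c.obj i ⟶ c.obj j) :
    (c.obj j)ᵛ ⊗ B ⟶ (c.obj i)ᵛ :=
  𝟙 _ ⊗≫ ((c.obj j)ᵛ ⊗ B) ◁ η_ (c.obj i) (c.obj i)ᵛ ⊗≫ (c.obj j)ᵛ ◁ f ▷ (c.obj i)ᵛ ⊗≫
    ε_ (c.obj j) (c.obj j)ᵛ ▷ (c.obj i)ᵛ ⊗≫ 𝟙 _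

/-- A node is moved around a cap by a zigzag. This and the next three lemmas treat the four
combinations of cup or cap with the two kinds of nodes. -/
theorem corotate_evaluation {B : A} {i j : Irr} (f : B ⊗ c.obj i ⟶ c.obj j) :
    c.corotate f ▷ c.obj i ≫ ε_ (c.obj i) (c.obj i)ᵛ =
      𝟙 _ ⊗≫ (c.obj j)ᵛ ◁ f ⊗≫ ε_ (c.obj j) (c.obj j)ᵛ := by
  unfold corotate
  calc _ = 𝟙 _ ⊗≫ ((c.obj j)ᵛ ⊗ B) ◁ η_ (c.obj i) (c.obj i)ᵛ ▷ c.obj i ⊗≫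
        (c.obj j)ᵛ ◁ f ▷ ((c.obj i)ᵛ ⊗ c.obj i) ⊗≫
        (ε_ (c.obj j) (c.obj j)ᵛ ▷ ((c.obj i)ᵛ ⊗ c.obj i) ≫
          𝟙_ A ◁ ε_ (c.obj i) (c.obj i)ᵛ) ⊗≫ 𝟙 _ := by monoidal
    _ = 𝟙 _ ⊗≫ ((c.obj j)ᵛ ⊗ B) ◁ η_ (c.obj i) (c.obj i)ᵛ ▷ c.obj i ⊗≫
        (c.obj j)ᵛ ◁ (f ▷ ((c.obj i)ᵛ ⊗ c.obj i) ≫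
          c.obj j ◁ ε_ (c.obj i) (c.obj i)ᵛ) ⊗≫ ε_ (c.obj j) (c.obj j)ᵛ ⊗≫ 𝟙 _ := by
        rw [← whisker_exchange]; monoidal
    _ = 𝟙 _ ⊗≫ ((c.obj j)ᵛ ⊗ B) ◁ (η_ (c.obj i) (c.obj i)ᵛ ▷ c.obj i ⊗≫
          c.obj i ◁ ε_ (c.obj i) (c.obj i)ᵛ) ⊗≫
        (c.obj j)ᵛ ◁ f ⊗≫ ε_ (c.obj j) (c.obj j)ᵛ ⊗≫ 𝟙 _ := by
        rw [← whisker_exchange]; monoidal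
    _ = _ := by rw [evaluation_coevaluation'']; monoidal

theorem coevaluation_corotate {B : A} {i j : Irr} (f : B ⊗ c.obj i ⟶ c.obj j) :
    𝟙 B ⊗≫ η_ (c.obj j) (c.obj j)ᵛ ▷ B ⊗≫ c.obj j ◁ c.corotate f =
      𝟙 B ⊗≫ B ◁ η_ (c.obj i) (c.obj i)ᵛ ⊗≫ f ▷ (c.obj i)ᵛ := by
  unfold corotate
  calc _ = 𝟙 _ ⊗≫ (η_ (c.obj j) (c.obj j)ᵛ ▷ (B ⊗ 𝟙_ A) ≫
        (c.obj j ⊗ (c.obj j)ᵛ) ◁ (B ◁ η_ (c.obj i) (c.obj i)ᵛ)) ⊗≫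
        (c.obj j ⊗ (c.obj j)ᵛ) ◁ f ▷ (c.obj i)ᵛ ⊗≫
        c.obj j ◁ ε_ (c.obj j) (c.obj j)ᵛ ▷ (c.obj i)ᵛ ⊗≫ 𝟙 _ := by monoidal
    _ = 𝟙 _ ⊗≫ B ◁ η_ (c.obj i) (c.obj i)ᵛ ⊗≫ (η_ (c.obj j) (c.obj j)ᵛ ▷
          (B ⊗ c.obj i ⊗ (c.obj i)ᵛ) ≫
        (c.obj j ⊗ (c.obj j)ᵛ) ◁ (𝟙 _ ⊗≫ f ▷ (c.obj i)ᵛ)) ⊗≫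
        c.obj j ◁ ε_ (c.obj j) (c.obj j)ᵛ ▷ (c.obj i)ᵛ ⊗≫ 𝟙 _ := by
        rw [← whisker_exchange]; monoidal
    _ = 𝟙 _ ⊗≫ B ◁ η_ (c.obj i) (c.obj i)ᵛ ⊗≫ f ▷ (c.obj i)ᵛ ⊗≫
        (η_ (c.obj j) (c.obj j)ᵛ ▷ c.obj j ⊗≫
        c.obj j ◁ ε_ (c.obj j) (c.obj j)ᵛ) ▷ (c.obj i)ᵛ ⊗≫ 𝟙 _ := by
        rw [← whisker_exchange]; monoidal
    _ = _ := by rw [evaluation_coevaluation'']; monoidal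

theorem pcoev_rotate {B : A} {i j : Irr} (g : c.obj j ⟶ B ⊗ c.obj i) :
    P.pcoev (c.obj i) ≫ c.rotate g ▷ c.obj i =
      P.pcoev (c.obj j) ≫ (c.obj j)ᵛ ◁ g ⊗≫ 𝟙 _ := by
  unfold rotate
  calc _ = 𝟙 _ ⊗≫ (𝟙_ A ◁ P.pcoev (c.obj i) ≫ P.pcoev (c.obj j) ▷ ((c.obj i)ᵛ ⊗ c.obj i)) ⊗≫
        (c.obj j)ᵛ ◁ g ▷ ((c.obj i)ᵛ ⊗ c.obj i) ⊗≫
        ((c.obj j)ᵛ ⊗ B) ◁ P.pev (c.obj i) ▷ c.obj i ⊗≫ 𝟙 _ := by monoidal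
    _ = 𝟙 _ ⊗≫ P.pcoev (c.obj j) ⊗≫ (c.obj j)ᵛ ◁ (c.obj j ◁ P.pcoev (c.obj i) ≫
        g ▷ ((c.obj i)ᵛ ⊗ c.obj i)) ⊗≫
        ((c.obj j)ᵛ ⊗ B) ◁ P.pev (c.obj i) ▷ c.obj i ⊗≫ 𝟙 _ := by
        rw [whisker_exchange]; monoidal
    _ = 𝟙 _ ⊗≫ P.pcoev (c.obj j) ⊗≫ (c.obj j)ᵛ ◁ g ⊗≫
        ((c.obj j)ᵛ ⊗ B) ◁ (c.obj i ◁ P.pcoev (c.obj i) ⊗≫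
          P.pev (c.obj i) ▷ c.obj i) ⊗≫ 𝟙 _ := by
        rw [whisker_exchange]; monoidal
    _ = _ := by rw [P.pcoev_pev]; monoidal

theorem rotate_pev {B : A} {i j : Irr} (g : c.obj j ⟶ B ⊗ c.obj i) :
    𝟙 _ ⊗≫ c.obj j ◁ c.rotate g ⊗≫ P.pev (c.obj j) ▷ B ⊗≫ 𝟙 _ =
      g ▷ (c.obj i)ᵛ ⊗≫ B ◁ P.pev (c.obj i) ⊗≫ 𝟙 B := by
  unfold rotate
  calc _ = 𝟙 _ ⊗≫ c.obj j ◁ P.pcoev (c.obj j) ▷ (c.obj i)ᵛ ⊗≫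
        c.obj j ◁ (c.obj j)ᵛ ◁ g ▷ (c.obj i)ᵛ ⊗≫
        ((c.obj j ⊗ (c.obj j)ᵛ) ◁ (B ◁ P.pev (c.obj i)) ≫
        P.pev (c.obj j) ▷ (B ⊗ 𝟙_ A)) ⊗≫ 𝟙 _ := by monoidal
    _ = 𝟙 _ ⊗≫ c.obj j ◁ P.pcoev (c.obj j) ▷ (c.obj i)ᵛ ⊗≫
        ((c.obj j ⊗ (c.obj j)ᵛ) ◁ (g ▷ (c.obj i)ᵛ) ≫
        P.pev (c.obj j) ▷ ((B ⊗ c.obj i) ⊗ (c.obj i)ᵛ)) ⊗≫ B ◁ P.pev (c.obj i) ⊗≫ 𝟙 _ := by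
        rw [whisker_exchange]; monoidal
    _ = 𝟙 _ ⊗≫ (c.obj j ◁ P.pcoev (c.obj j) ⊗≫ P.pev (c.obj j) ▷ c.obj j) ▷ (c.obj i)ᵛ ⊗≫
        g ▷ (c.obj i)ᵛ ⊗≫ B ◁ P.pev (c.obj i) ⊗≫ 𝟙 _ := by
        rw [whisker_exchange]; monoidal
    _ = _ := by rw [P.pcoev_pev]; monoidal

end SimpleChoice

end Nodes

/-! ### Dual simple objects, rotated bases and the global dimension. -/

section Duality

local postfix:max "ᵛ" => rightDual

open ExactPairing

/-- The evaluation is nondegenerate: a zigzag recovers `f` from its pairing with `X`. -/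
theorem hom_ext_of_evaluation {A : Type u} [Category.{v} A] [MonoidalCategory A] {V X Y : A}
    [ExactPairing X Y] {f g : V ⟶ Y} (h : f ▷ X ≫ ε_ X Y = g ▷ X ≫ ε_ X Y) : f = g := by
  have key : ∀ f : V ⟶ Y, f = 𝟙 _ ⊗≫ V ◁ η_ X Y ⊗≫ (f ▷ X ≫ ε_ X Y) ▷ Y ⊗≫ 𝟙 _ := by
    intro f
    calc f = 𝟙 _ ⊗≫ f ⊗≫ (Y ◁ η_ X Y ⊗≫ ε_ X Y ▷ Y) ⊗≫ 𝟙 _ := by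
          rw [coevaluation_evaluation'']; monoidal
      _ = 𝟙 _ ⊗≫ (f ▷ 𝟙_ A ≫ Y ◁ η_ X Y) ⊗≫ ε_ X Y ▷ Y ⊗≫ 𝟙 _ := by monoidal
      _ = _ := by rw [← whisker_exchange]; monoidal
  rw [key f, key g, h]

set_option linter.unusedSectionVars false

variable {k : Type w} [Field k] [IsAlgClosed k] {A : Type u} [Category.{v} A] [Abelian A]
  [Linear k A] [MonoidalCategory A] [MonoidalPreadditive A] [MonoidalLinear k A]
  [BraidedCategory A] [RigidCategory A] [IsFiniteSemisimple k A]
  {P : PivotalStructure A} {Irr : Type t} [Fintype Irr] (c : SimpleChoice k P Irr)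

/-- A nonzero monomorphism into `V` has a nonzero restriction to a simple summand of its source.
That restriction splits and yields a nonzero endomorphism of `V`; being a nonzero scalar, it
provides a section of the monomorphism. -/
theorem simple_of_forall_smul_id (V : A) (h0 : 𝟙 V ≠ 0) (h : ∀ f : V ⟶ V, ∃ a : k, f = a • 𝟙 V) :
    Simple V where
  mono_isIso_iff_nonzero {Y} f hf := by
    constructor
    · rintro hi rfl
      apply h0
      rw [← IsIso.inv_hom_id (0 : Y ⟶ V), comp_zero]
    · intro hne
      obtain ⟨n, S, hS, p, q, hpq⟩ := exists_simple_decomposition k Y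
      obtain ⟨i, hi⟩ : ∃ i, q i ≫ f ≠ 0 := by
        by_contra! h0
        apply hne
        rw [← Category.id_comp f, ← hpq, Preadditive.sum_comp]
        exact Finset.sum_eq_zero fun i _ => by rw [Category.assoc, h0, comp_zero]
      have := hS i
      obtain ⟨r, hr⟩ := exists_id_eq_comp k hi
      obtain ⟨a, ha⟩ := h (r ≫ q i ≫ f)
      have ha0 : a ≠ 0 := by
        rintro rfl
        have h2 : (q i ≫ f) ≫ (r ≫ q i ≫ f) ≫ r = 𝟙 _ := by
          rw [Category.assoc r, ← Category.assoc, hr, Category.id_comp]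
        rw [ha, zero_smul, zero_comp, comp_zero] at h2
        exact id_nonzero _ h2.symm
      have hs : (a⁻¹ • (r ≫ q i)) ≫ f = 𝟙 V := by
        rw [Linear.smul_comp, Category.assoc, ha, smul_smul, inv_mul_cancel₀ ha0, one_smul]
      exact ⟨a⁻¹ • (r ≫ q i), by
        rw [← cancel_mono f, Category.assoc, hs, Category.comp_id, Category.id_comp], hs⟩

theorem evaluation_ne_zero (S : A) [Simple S] : ε_ S Sᵛ ≠ 0 := by
  intro h
  have := evaluation_coevaluation'' S Sᵛ
  rw [h] at this
  apply id_nonzero S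
  rw [← cancel_mono (ρ_ S).inv, ← cancel_epi (λ_ S).hom]
  trans (⊗𝟙 : 𝟙_ A ⊗ S ≅ S ⊗ 𝟙_ A).hom
  · monoidal
  · rw [← this]; simp [monoidalComp]

/-- Bending turns endomorphisms of `S^*` into endomorphisms of `S`, which are scalars. -/
theorem simple_rightDual (k : Type w) [Field k] [IsAlgClosed k] [Linear k A] [MonoidalLinear k A]
    [IsFiniteSemisimple k A] (S : A) [Simple S] : Simple Sᵛ := by
  refine simple_of_forall_smul_id (k := k) _ ?_ fun f => ?_
  · intro h
    apply evaluation_ne_zero S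
    rw [← Category.id_comp (ε_ S Sᵛ), ← id_whiskerRight, h]
    simp
  · obtain ⟨a, ha⟩ := exists_smul_id k
      (tensorLeftHomEquiv S S Sᵛ (𝟙_ A) (f ▷ S ≫ ε_ S Sᵛ) ≫ (ρ_ S).hom)
    refine ⟨a, hom_ext_of_evaluation (X := S) ?_⟩
    apply (tensorLeftHomEquiv S S Sᵛ (𝟙_ A)).injective
    rw [← cancel_mono (ρ_ S).hom, ha]
    simp [tensorLeftHomEquiv]

/-- Isomorphic objects have isomorphic duals. -/
def rightDualCongr {X Y : A} (e : X ≅ Y) : Yᵛ ≅ Xᵛ where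
  hom := rightAdjointMate e.hom
  inv := rightAdjointMate e.inv
  hom_inv_id := by rw [← comp_rightAdjointMate, e.inv_hom_id, rightAdjointMate_id]
  inv_hom_id := by rw [← comp_rightAdjointMate, e.hom_inv_id, rightAdjointMate_id]

theorem coevaluation_dualTensorIso (X Y : A) :
    η_ (X ⊗ Y) (X ⊗ Y)ᵛ = (η_ X Xᵛ ⊗≫ X ◁ η_ Y Yᵛ ▷ Xᵛ ⊗≫ 𝟙 _) ≫
      (X ⊗ Y) ◁ (dualTensorIso X Y).hom := by
  have := @coevaluation_comp_rightAdjointMate A _ _ (X ⊗ Y) (X ⊗ Y)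
    ⟨Yᵛ ⊗ Xᵛ⟩ inferInstance (𝟙 _)
  rw [id_whiskerRight, Category.comp_id] at this
  rw [← cancel_mono ((X ⊗ Y) ◁ (dualTensorIso X Y).inv), Category.assoc,
    ← MonoidalCategory.whiskerLeft_comp, Iso.hom_inv_id, MonoidalCategory.whiskerLeft_id,
    Category.comp_id]
  refine Eq.trans ?_ (this.trans ?_)
  · rfl
  · exact ExactPairing.tensor_coevaluation.trans (by monoidal)

namespace SimpleChoice

theorem trace_tensor {X Y : A} {a b : k} (hX : P.trace (𝟙 X) = a • 𝟙 (𝟙_ A))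
    (hY : P.trace (𝟙 Y) = b • 𝟙 (𝟙_ A)) : P.trace (𝟙 (X ⊗ Y)) = (a * b) • 𝟙 (𝟙_ A) := by
  rw [PivotalStructure.trace, id_whiskerRight, Category.id_comp] at hX hY
  rw [PivotalStructure.trace, id_whiskerRight, Category.id_comp, coevaluation_dualTensorIso,
    Category.assoc, P.pev_tensor]
  calc _ = 𝟙 _ ⊗≫ η_ X Xᵛ ⊗≫ X ◁ (η_ Y Yᵛ ≫ P.pev Y) ▷ Xᵛ ⊗≫ P.pev X := by monoidal
    _ = b • (η_ X Xᵛ ≫ P.pev X) := by rw [hY]; simp [monoidalComp]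
    _ = _ := by rw [hX, smul_smul, mul_comm]

theorem exists_iso_rightDual (S : A) [Simple S] : ∃ i, Nonempty (S ≅ (c.obj i)ᵛ) := by
  have := simple_rightDual k S
  obtain ⟨i, ⟨e⟩⟩ := c.exists_iso Sᵛ inferInstance
  exact ⟨i, ⟨P.iso S ≪≫ (rightDualCongr e).symm⟩⟩

theorem eq_of_rightDual_iso (i j : Irr) (h : Nonempty ((c.obj i)ᵛ ≅ (c.obj j)ᵛ)) : i = j := by
  obtain ⟨e⟩ := h
  exact c.eq_of_iso i j ⟨P.iso _ ≪≫ (rightDualCongr e).symm ≪≫ (P.iso _).symm⟩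

/-- The equality of the dimensions of dual objects is read off from the choice of square roots. -/
theorem trace_id_rightDual (i : Irr) : P.trace (𝟙 (c.obj i)ᵛ) = c.dim i • 𝟙 (𝟙_ A) := by
  have := simple_rightDual k (c.obj i)
  obtain ⟨j, ⟨e⟩⟩ := c.exists_iso (c.obj i)ᵛ inferInstance
  rw [P.trace_conj e, trace_id_obj, dim, dim, c.sqrtDim_dual i j ⟨e⟩]

theorem corotate_add {B : A} {i j : Irr} (f g : B ⊗ c.obj i ⟶ c.obj j) :
    c.corotate (f + g) = c.corotate f + c.corotate g := by
  simp [corotate, monoidalComp]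

theorem corotate_smul {B : A} {i j : Irr} (a : k) (f : B ⊗ c.obj i ⟶ c.obj j) :
    c.corotate (a • f) = a • c.corotate f := by
  simp [corotate, monoidalComp]

theorem corotate_surjective {B : A} {i j : Irr} (h : (c.obj j)ᵛ ⊗ B ⟶ (c.obj i)ᵛ) :
    ∃ f : B ⊗ c.obj i ⟶ c.obj j, c.corotate f = h := by
  refine ⟨𝟙 _ ⊗≫ η_ (c.obj j) (c.obj j)ᵛ ▷ (B ⊗ c.obj i) ⊗≫ c.obj j ◁ h ▷ c.obj i ⊗≫
    c.obj j ◁ ε_ (c.obj i) (c.obj i)ᵛ ⊗≫ 𝟙 _, hom_ext_of_evaluation (X := c.obj i) ?_⟩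
  rw [corotate_evaluation]
  calc _ = 𝟙 _ ⊗≫ (c.obj j)ᵛ ◁ η_ (c.obj j) (c.obj j)ᵛ ▷ (B ⊗ c.obj i) ⊗≫
        (((c.obj j)ᵛ ⊗ c.obj j) ◁ (𝟙 ((c.obj j)ᵛ ⊗ B ⊗ c.obj i) ⊗≫ h ▷ c.obj i ⊗≫ ε_ (c.obj i) (c.obj i)ᵛ) ≫
          ε_ (c.obj j) (c.obj j)ᵛ ▷ 𝟙_ A) ⊗≫ 𝟙 _ := by monoidal
    _ = 𝟙 _ ⊗≫ ((c.obj j)ᵛ ◁ η_ (c.obj j) (c.obj j)ᵛ ⊗≫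
          ε_ (c.obj j) (c.obj j)ᵛ ▷ (c.obj j)ᵛ) ▷ (B ⊗ c.obj i) ⊗≫
        h ▷ c.obj i ≫ ε_ (c.obj i) (c.obj i)ᵛ := by rw [whisker_exchange]; monoidal
    _ = _ := by rw [coevaluation_evaluation'']; monoidal

/-- The composite is a scalar because `X_i^*` is simple. To find the scalar, the composite is closed
up; sliding the nodes around the cup and the cap gives the trace of `φ^α ≫ φ_β`, but closed on the
other side. Sphericity identifies it with the trace for which the bases are dual. -/
theorem rotate_corotate (hunit : Simple (𝟙_ A)) (hP : P.IsSpherical) {B : A} {i j : Irr} (α β) :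
    c.dim i • (c.rotate (c.conode B i j α) ≫ c.corotate (c.node B i j β)) =
      if α = β then 𝟙 (c.obj i)ᵛ else 0 := by
  have := simple_rightDual k (c.obj i)
  obtain ⟨a, ha⟩ := exists_smul_id k (c.rotate (c.conode B i j α) ≫ c.corotate (c.node B i j β))
  have h1 : P.pcoev (c.obj i) ≫ (c.rotate (c.conode B i j α) ≫ c.corotate (c.node B i j β)) ▷
      c.obj i ≫ ε_ (c.obj i) (c.obj i)ᵛ = P.trace (c.conode B i j α ≫ c.node B i j β) := by
    rw [hP, PivotalStructure.traceOther, comp_whiskerRight, Category.assoc, corotate_evaluation,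
      reassoc_of% pcoev_rotate]
    monoidal
  have h2 : P.pcoev (c.obj i) ≫ ε_ (c.obj i) (c.obj i)ᵛ = c.dim i • 𝟙 (𝟙_ A) := by
    rw [← trace_id_obj, hP, PivotalStructure.traceOther]; simp
  rw [ha] at h1
  simp only [MonoidalLinear.smul_whiskerRight, id_whiskerRight, Linear.smul_comp,
    Linear.comp_smul, Category.id_comp, h2] at h1
  rw [conode_eq, node_eq, trace_basisFrom_basisTo _ hunit, smul_smul] at h1
  rw [ha, smul_smul, mul_comm]
  split_ifs at h1 ⊢ with h3 h4 h4
  · rw [smul_id_injective hunit (h1.trans (one_smul k _).symm), one_smul]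
  · exact (h4 h3.symm).elim
  · exact (h3 h4.symm).elim
  · rw [smul_id_injective hunit (h1.trans (zero_smul k _).symm), zero_smul]

/-- The fusion formula for `X_j^* ⊗ B` in terms of the same nodes as for `B ⊗ X_i`, rotated. Having
the same nodes in both formulas is what lets a strand pass through the loop. -/
theorem sum_corotate_rotate (hunit : Simple (𝟙_ A)) (hP : P.IsSpherical) (B : A) (j : Irr) :
    ∑ i, c.dim i • ∑ α, c.corotate (c.node B i j α) ≫ c.rotate (c.conode B i j α) =
      𝟙 ((c.obj j)ᵛ ⊗ B) := by
  classical
  refine gluing (S := fun i => (c.obj i)ᵛ) (fun i => simple_rightDual k (c.obj i))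
    (fun T _ => c.exists_iso_rightDual T) c.eq_of_rightDual_iso
    (fun i α => c.corotate (c.node B i j α)) (fun i α => c.rotate (c.conode B i j α))
    (fun i => ?_) c.dim (fun i α β => c.rotate_corotate hunit hP α β)
  let L : (B ⊗ c.obj i ⟶ c.obj j) →ₗ[k] ((c.obj j)ᵛ ⊗ B ⟶ (c.obj i)ᵛ) :=
    { toFun := c.corotate, map_add' := c.corotate_add, map_smul' := c.corotate_smul }
  have : Set.range (fun α => c.corotate (c.node B i j α)) =
      L '' Set.range (Module.finBasis k (B ⊗ c.obj i ⟶ c.obj j)) := by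
    rw [← Set.range_comp]; rfl
  rw [this, ← Submodule.map_span, Module.Basis.span_eq, Submodule.map_top, LinearMap.range_eq_top]
  exact c.corotate_surjective

theorem trace_id_eq_sum (hunit : Simple (𝟙_ A)) (V : A) :
    P.trace (𝟙 V) = (∑ i, (Module.finrank k (V ⟶ c.obj i) : k) * c.dim i) • 𝟙 (𝟙_ A) := by
  rw [← c.sum_basisTo_basisFrom hunit V, P.trace_sum, Finset.sum_smul]
  refine Finset.sum_congr rfl fun i _ => ?_
  rw [P.trace_smul, P.trace_sum, Finset.sum_congr rfl fun α _ => by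
    rw [P.trace_comm, c.trace_basisFrom_basisTo hunit, if_pos rfl]]
  simp [mul_smul, smul_comm (c.dim i), Nat.cast_smul_eq_nsmul k]

variable [CharZero k]

/-- The fusion matrix `(N_i)_{jl} = dim Hom(X_i ⊗ X_j, X_l)`. -/
def fusionMatrix (i : Irr) : Matrix Irr Irr ℤ := fun j l =>
  Module.finrank k (c.obj i ⊗ c.obj j ⟶ c.obj l)

theorem finrank_rightDual_tensor (i j l : Irr) :
    Module.finrank k ((c.obj i)ᵛ ⊗ c.obj l ⟶ c.obj j) =
      Module.finrank k (c.obj i ⊗ c.obj j ⟶ c.obj l) := by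
  rw [← c.finrank_hom_comm (c.obj i ⊗ c.obj j)]
  refine LinearEquiv.finrank_eq
    { tensorLeftHomEquiv (c.obj l) (c.obj i) (c.obj i)ᵛ (c.obj j) with
      map_add' := fun f g => by simp [tensorLeftHomEquiv]
      map_smul' := fun a f => by simp [tensorLeftHomEquiv] }

/-- Dimensions are multiplicative and additive, so the vector of dimensions is an eigenvector of
every fusion matrix. Replacing `X_i` by its dual, which has the same dimension, gives the same for
the transposes. -/
theorem sum_fusionMatrix (hunit : Simple (𝟙_ A)) (i j : Irr) :
    ∑ l, (c.fusionMatrix i j l : k) * c.dim l = c.dim i * c.dim j := by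
  have h := c.trace_id_eq_sum hunit (c.obj i ⊗ c.obj j)
  rw [trace_tensor (c.trace_id_obj i) (c.trace_id_obj j)] at h
  rw [smul_id_injective hunit h]
  simp [fusionMatrix]

theorem sum_fusionMatrix_transpose (hunit : Simple (𝟙_ A)) (i l : Irr) :
    ∑ j, (c.fusionMatrix i j l : k) * c.dim j = c.dim i * c.dim l := by
  have h := c.trace_id_eq_sum hunit ((c.obj i)ᵛ ⊗ c.obj l)
  rw [trace_tensor (c.trace_id_rightDual i) (c.trace_id_obj l)] at h
  rw [smul_id_injective hunit h]
  simp [fusionMatrix, finrank_rightDual_tensor]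

theorem exists_unit (hunit : Simple (𝟙_ A)) : ∃ i, Nonempty (𝟙_ A ≅ c.obj i) :=
  c.exists_iso _ hunit

theorem fusionMatrix_unit [DecidableEq Irr] {i : Irr} (e : 𝟙_ A ≅ c.obj i) :
    c.fusionMatrix i = 1 := by
  ext j l
  have h : Module.finrank k (c.obj i ⊗ c.obj j ⟶ c.obj l) =
      Module.finrank k (c.obj j ⟶ c.obj l) :=
    LinearEquiv.finrank_eq (Linear.homCongr k
      ((whiskerRightIso e.symm (c.obj j)) ≪≫ λ_ (c.obj j)) (Iso.refl _))
  rw [fusionMatrix, h, Matrix.one_apply, finrank_hom_simple_simple]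
  split_ifs with h1 h2 h2
  · rfl
  · exact (h2 (c.eq_of_iso _ _ h1)).elim
  · subst h2; exact (h1 ⟨Iso.refl _⟩).elim
  · rfl

/-- The vector of dimensions is an eigenvector of `M = ∑ N_i N_i^T` with eigenvalue `D`. If `D` were
zero, the integer matrix `M` would be singular; but `M` is a sum of positive semidefinite matrices,
one of which is the identity, the summand of the unit object. -/
theorem globalDim_ne_zero (hunit : Simple (𝟙_ A)) : c.globalDim ≠ 0 := by
  classical
  intro h0
  obtain ⟨i₀, ⟨e⟩⟩ := c.exists_unit hunit
  let M : Matrix Irr Irr ℤ := ∑ i, c.fusionMatrix i * (c.fusionMatrix i).transpose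
  have hk : (M.map (Int.castRingHom k)).mulVec c.dim = 0 := by
    have h1 : ∀ i, ((c.fusionMatrix i).map (Int.castRingHom k)).mulVec c.dim =
        c.dim i • c.dim := by
      intro i; ext j
      exact c.sum_fusionMatrix hunit i j
    have h2 : ∀ i, ((c.fusionMatrix i).transpose.map (Int.castRingHom k)).mulVec c.dim =
        c.dim i • c.dim := by
      intro i; ext j
      exact c.sum_fusionMatrix_transpose hunit i j
    have h3 : M.map (Int.castRingHom k) = ∑ i, (c.fusionMatrix i).map (Int.castRingHom k) *
        (c.fusionMatrix i).transpose.map (Int.castRingHom k) := by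
      have := map_sum (Int.castRingHom k).mapMatrix
        (fun i => c.fusionMatrix i * (c.fusionMatrix i).transpose) Finset.univ
      simp only [map_mul] at this
      exact this
    rw [h3, Matrix.sum_mulVec]
    simp only [← Matrix.mulVec_mulVec, h1, h2, Matrix.mulVec_smul, smul_smul]
    rw [← Finset.sum_smul]
    have : ∑ i, c.dim i * c.dim i = c.globalDim := by
      rw [globalDim]; exact Finset.sum_congr rfl fun i _ => (sq _).symm
    rw [this, h0, zero_smul]
  -- Characteristic zero is used here: the determinant is an integer that vanishes in `k`, hence it
  -- is zero.
  have hdet : M.det = 0 := by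
    have : (M.map (Int.castRingHom k)).det = 0 := by
      rw [← Matrix.exists_mulVec_eq_zero_iff]
      refine ⟨c.dim, fun h => c.dim_ne_zero hunit i₀ (congrFun h i₀), hk⟩
    have h2 := (Int.castRingHom k).map_det M
    rw [RingHom.mapMatrix_apply, this] at h2
    simpa using h2
  obtain ⟨x, hx, hMx⟩ := Matrix.exists_mulVec_eq_zero_iff.mpr hdet
  apply hx
  -- Over the integers the quadratic form of `M` is a sum of squares, so every summand vanishes at
  -- `x`; the one of the unit object is the squared length of `x`.
  have h4 : ∑ i, ((c.fusionMatrix i).transpose.mulVec x) ⬝ᵥ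
      ((c.fusionMatrix i).transpose.mulVec x) = 0 := by
    have : x ⬝ᵥ M.mulVec x = 0 := by rw [hMx, dotProduct_zero]
    rw [Matrix.sum_mulVec, dotProduct_sum] at this
    rw [← this]
    refine Finset.sum_congr rfl fun i _ => ?_
    rw [← Matrix.mulVec_mulVec, Matrix.dotProduct_mulVec x, Matrix.mulVec_transpose]
  have h5 := (Finset.sum_eq_zero_iff_of_nonneg fun i _ =>
    Finset.sum_nonneg fun j _ => mul_self_nonneg _).mp h4 i₀ (Finset.mem_univ _)
  rw [c.fusionMatrix_unit e, Matrix.transpose_one, Matrix.one_mulVec] at h5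
  exact dotProduct_self_eq_zero.mp h5

end SimpleChoice

end Duality

/-! ### Averaging over the regular-coloured loop. -/

section Average

local postfix:max "ᵛ" => rightDual
local infixr:70 "⊠" => tbr

open ExactPairing

set_option linter.unusedSectionVars false

section Wrap

variable {A : Type u} [Category.{v} A] [MonoidalCategory A] [RightRigidCategory A]
  (P : PivotalStructure A) {X Y X' Y' V : A} {γ' : HB X'} {μ' : HB Y'} (γ : HB X) (μ : HB Y)

/-- The morphism `g` wrapped by a loop coloured by `C`, by means of `γ` and `μ`. -/
def wrap (g : X ⟶ Y) (C : A) : X ⟶ Y :=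
  𝟙 X ⊗≫ η_ C Cᵛ ▷ X ⊗≫ C ◁ γ Cᵛ ⊗≫ C ◁ g ▷ Cᵛ ⊗≫ μ C ▷ Cᵛ ⊗≫ Y ◁ P.pev C ⊗≫ 𝟙 Y

variable {γ μ}

theorem Cent.comp_wrap {f : X' ⟶ X} (hf : Cent γ' γ f) (g : X ⟶ Y) (C : A) :
    f ≫ wrap P γ μ g C = wrap P γ' μ (f ≫ g) C := by
  have h := hf Cᵛ
  unfold wrap
  calc _ = 𝟙 X' ⊗≫ (𝟙_ A ◁ f ≫ η_ C Cᵛ ▷ X) ⊗≫ C ◁ γ Cᵛ ⊗≫ C ◁ g ▷ Cᵛ ⊗≫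
        μ C ▷ Cᵛ ⊗≫ Y ◁ P.pev C ⊗≫ 𝟙 Y := by monoidal
    _ = 𝟙 X' ⊗≫ η_ C Cᵛ ▷ X' ⊗≫ C ◁ (Cᵛ ◁ f ≫ γ Cᵛ) ⊗≫ C ◁ g ▷ Cᵛ ⊗≫
        μ C ▷ Cᵛ ⊗≫ Y ◁ P.pev C ⊗≫ 𝟙 Y := by rw [whisker_exchange]; monoidal
    _ = _ := by rw [h]; monoidal

theorem Cent.wrap_comp {h : Y ⟶ Y'} (hh : Cent μ μ' h) (g : X ⟶ Y) (C : A) :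
    wrap P γ μ g C ≫ h = wrap P γ μ' (g ≫ h) C := by
  have e := hh C
  unfold wrap
  calc _ = 𝟙 X ⊗≫ η_ C Cᵛ ▷ X ⊗≫ C ◁ γ Cᵛ ⊗≫ C ◁ g ▷ Cᵛ ⊗≫
        μ C ▷ Cᵛ ⊗≫ (Y ◁ P.pev C ≫ h ▷ 𝟙_ A) ⊗≫ 𝟙 Y' := by monoidal
    _ = 𝟙 X ⊗≫ η_ C Cᵛ ▷ X ⊗≫ C ◁ γ Cᵛ ⊗≫ C ◁ g ▷ Cᵛ ⊗≫
        (μ C ≫ h ▷ C) ▷ Cᵛ ⊗≫ Y' ◁ P.pev C ⊗≫ 𝟙 Y' := by rw [whisker_exchange]; monoidal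
    _ = _ := by rw [← e]; monoidal

/-- An intertwiner slides out of the loop. The two remaining crossings combine, by the tensor axiom,
into one with `C ⊗ C^*`, through which the cap is pulled; a free circle remains. -/
theorem Cent.wrap_eq {g : X ⟶ Y} (hg : Cent γ μ g) (hμ : IsHalfBraiding Y μ) (C : A) :
    wrap P γ μ g C = 𝟙 X ⊗≫ (η_ C Cᵛ ≫ P.pev C) ▷ X ⊗≫ g := by
  have h1 := hg Cᵛ
  have h2 := hμ.tensor C Cᵛ
  have h3 := hμ.naturality (P.pev C)
  unfold wrap
  calc _ = 𝟙 X ⊗≫ η_ C Cᵛ ▷ X ⊗≫ C ◁ (γ Cᵛ ≫ g ▷ Cᵛ) ⊗≫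
        μ C ▷ Cᵛ ⊗≫ Y ◁ P.pev C ⊗≫ 𝟙 Y := by monoidal
    _ = 𝟙 X ⊗≫ η_ C Cᵛ ▷ X ⊗≫ (C ⊗ Cᵛ) ◁ g ⊗≫ (((α_ C Cᵛ Y).hom ≫ C ◁ μ Cᵛ ≫
        (α_ C Y Cᵛ).inv ≫ μ C ▷ Cᵛ ≫ (α_ Y C Cᵛ).hom) ≫ Y ◁ P.pev C) ⊗≫ 𝟙 Y := by
        rw [← h1]; monoidal
    _ = 𝟙 X ⊗≫ η_ C Cᵛ ▷ X ⊗≫ ((C ⊗ Cᵛ) ◁ g ≫ P.pev C ▷ Y) ⊗≫ 𝟙 Y := by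
        rw [← h2, ← h3, hμ.unit]; monoidal
    _ = _ := by rw [whisker_exchange]; monoidal

end Wrap

section BraidedWrap

variable {A : Type u} [Category.{v} A] [MonoidalCategory A] [BraidedCategory A]
  [RightRigidCategory A] (P : PivotalStructure A) {X Y : A} (γ : HB X) (μ : HB Y)

/-- The loop passes `V` twice by the same half-braiding, so the two crossings merge into one with `C
⊗ C^*` and are pulled off through the cup. On the right (`wrap_minus_whiskerRight`) they are pulled
off through the cap. These two facts are the source of associativity. -/
theorem wrap_plus_whiskerLeft (V : A) (g : X ⟶ Y) (C : A) :
    wrap P (plus V ⊠ γ) (plus V ⊠ μ) (V ◁ g) C = V ◁ wrap P γ μ g C := by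
  have h1 := (isHalfBraiding_plus V).tensor C Cᵛ
  have h2 := (isHalfBraiding_plus V).naturality (η_ C Cᵛ)
  unfold wrap tbr
  calc _ = 𝟙 (V ⊗ X) ⊗≫ η_ C Cᵛ ▷ (V ⊗ X) ⊗≫ C ◁ plus V Cᵛ ▷ X ⊗≫
        (C ⊗ V) ◁ (γ Cᵛ ≫ g ▷ Cᵛ) ⊗≫ (plus V C ▷ (Y ⊗ Cᵛ)) ⊗≫
        V ◁ μ C ▷ Cᵛ ⊗≫ (V ⊗ Y) ◁ P.pev C ⊗≫ 𝟙 _ := by monoidal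
    _ = 𝟙 (V ⊗ X) ⊗≫ η_ C Cᵛ ▷ (V ⊗ X) ⊗≫ C ◁ plus V Cᵛ ▷ X ⊗≫
        ((C ⊗ V) ◁ (γ Cᵛ ≫ g ▷ Cᵛ) ≫ plus V C ▷ (Y ⊗ Cᵛ)) ⊗≫
        V ◁ μ C ▷ Cᵛ ⊗≫ (V ⊗ Y) ◁ P.pev C ⊗≫ 𝟙 _ := by monoidal
    _ = 𝟙 (V ⊗ X) ⊗≫ (η_ C Cᵛ ▷ V ≫ ((α_ C Cᵛ V).hom ≫ C ◁ plus V Cᵛ ≫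
        (α_ C V Cᵛ).inv ≫ plus V C ▷ Cᵛ ≫ (α_ V C Cᵛ).hom)) ▷ X ⊗≫
        (V ⊗ C) ◁ (γ Cᵛ ≫ g ▷ Cᵛ) ⊗≫
        V ◁ μ C ▷ Cᵛ ⊗≫ (V ⊗ Y) ◁ P.pev C ⊗≫ 𝟙 _ := by rw [whisker_exchange]; monoidal
    _ = _ := by rw [← h1, h2, (isHalfBraiding_plus V).unit]; monoidal

theorem wrap_minus_whiskerRight (V : A) (g : X ⟶ Y) (C : A) :
    wrap P (γ ⊠ minus V) (μ ⊠ minus V) (g ▷ V) C = wrap P γ μ g C ▷ V := by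
  have h1 := (isHalfBraiding_minus V).tensor C Cᵛ
  have h2 := (isHalfBraiding_minus V).naturality (P.pev C)
  unfold wrap tbr
  calc _ = 𝟙 (X ⊗ V) ⊗≫ η_ C Cᵛ ▷ (X ⊗ V) ⊗≫ C ◁ γ Cᵛ ▷ V ⊗≫
        (C ◁ (X ◁ minus V Cᵛ ≫ g ▷ (V ⊗ Cᵛ))) ⊗≫ μ C ▷ (V ⊗ Cᵛ) ⊗≫
        Y ◁ minus V C ▷ Cᵛ ⊗≫ (Y ⊗ V) ◁ P.pev C ⊗≫ 𝟙 _ := by monoidal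
    _ = 𝟙 (X ⊗ V) ⊗≫ η_ C Cᵛ ▷ (X ⊗ V) ⊗≫ C ◁ γ Cᵛ ▷ V ⊗≫
        C ◁ g ▷ (Cᵛ ⊗ V) ⊗≫ ((C ⊗ Y) ◁ minus V Cᵛ ≫ μ C ▷ (V ⊗ Cᵛ)) ⊗≫
        Y ◁ minus V C ▷ Cᵛ ⊗≫ (Y ⊗ V) ◁ P.pev C ⊗≫ 𝟙 _ := by
        rw [whisker_exchange g]; monoidal
    _ = 𝟙 (X ⊗ V) ⊗≫ η_ C Cᵛ ▷ (X ⊗ V) ⊗≫ C ◁ γ Cᵛ ▷ V ⊗≫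
        C ◁ g ▷ (Cᵛ ⊗ V) ⊗≫ μ C ▷ (Cᵛ ⊗ V) ⊗≫ Y ◁ (((α_ C Cᵛ V).hom ≫ C ◁ minus V Cᵛ ≫
        (α_ C V Cᵛ).inv ≫ minus V C ▷ Cᵛ ≫ (α_ V C Cᵛ).hom) ≫ V ◁ P.pev C) ⊗≫ 𝟙 _ := by
        rw [whisker_exchange]; monoidal
    _ = _ := by rw [← h1, ← h2, (isHalfBraiding_minus V).unit]; monoidal

end BraidedWrap

section Avg

variable {k : Type w} [Field k] [IsAlgClosed k] {A : Type u} [Category.{v} A] [Abelian A]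
  [Linear k A] [MonoidalCategory A] [MonoidalPreadditive A] [MonoidalLinear k A]
  [BraidedCategory A] [RigidCategory A] [IsFiniteSemisimple k A]
  {P : PivotalStructure A} {Irr : Type t} [Fintype Irr] (c : SimpleChoice k P Irr)
  {X Y X' Y' : A} {γ' : HB X'} {μ' : HB Y'} (γ : HB X) (μ : HB Y)

/-- The average of `g` over all colours: a projection to the morphisms that intertwine `γ`
and `μ`. -/
def avg (g : X ⟶ Y) : X ⟶ Y :=
  (c.globalDim)⁻¹ • ∑ i, c.dim i • wrap P γ μ g (c.obj i)

variable {γ μ}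

theorem Cent.comp_avg {f : X' ⟶ X} (hf : Cent γ' γ f) (g : X ⟶ Y) :
    f ≫ avg c γ μ g = avg c γ' μ (f ≫ g) := by
  simp only [avg, Linear.comp_smul, Preadditive.comp_sum, hf.comp_wrap P]

theorem Cent.avg_comp {h : Y ⟶ Y'} (hh : Cent μ μ' h) (g : X ⟶ Y) :
    avg c γ μ g ≫ h = avg c γ μ' (g ≫ h) := by
  simp only [avg, Linear.smul_comp, Preadditive.sum_comp, hh.wrap_comp P]

/-- Each loop shrinks to a circle of value `d_i`, and the weights `d_i ^ 2 / D` add up to one. -/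
theorem Cent.avg_eq [CharZero k] (hunit : Simple (𝟙_ A)) {g : X ⟶ Y} (hg : Cent γ μ g)
    (hμ : IsHalfBraiding Y μ) : avg c γ μ g = g := by
  have h : ∀ i, wrap P γ μ g (c.obj i) = c.dim i • g := by
    intro i
    have := c.trace_id_obj i
    rw [PivotalStructure.trace, id_whiskerRight, Category.id_comp] at this
    rw [hg.wrap_eq P hμ, this]
    simp [monoidalComp]
  have h2 := c.globalDim_ne_zero hunit
  simp only [avg, h, smul_smul, ← Finset.sum_smul]
  rw [Finset.sum_congr rfl fun i _ => (sq (c.dim i)).symm]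
  rw [← SimpleChoice.globalDim, inv_mul_cancel₀ h2, one_smul]

theorem avg_plus_whiskerLeft (V : A) (g : X ⟶ Y) :
    avg c (plus V ⊠ γ) (plus V ⊠ μ) (V ◁ g) = V ◁ avg c γ μ g := by
  simp only [avg, wrap_plus_whiskerLeft, MonoidalLinear.whiskerLeft_smul, whiskerLeft_sum]

theorem avg_minus_whiskerRight (V : A) (g : X ⟶ Y) :
    avg c (γ ⊠ minus V) (μ ⊠ minus V) (g ▷ V) = avg c γ μ g ▷ V := by
  simp only [avg, wrap_minus_whiskerRight, MonoidalLinear.smul_whiskerRight, sum_whiskerRight]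

theorem avg_smul (a : k) (g : X ⟶ Y) : avg c γ μ (a • g) = a • avg c γ μ g := by
  have : ∀ i, wrap P γ μ (a • g) (c.obj i) = a • wrap P γ μ g (c.obj i) := fun i => by
    simp [wrap, monoidalComp]
  simp only [avg, this, Finset.smul_sum, smul_smul]
  refine Finset.sum_congr rfl fun i _ => ?_
  congr 1; ring

variable (γ μ)

/-- The loop around `g` with upper arc coloured by `X_i` and lower arc by `X_j`, joined by nodes
with a strand `B`. -/
def wrapNode (g : X ⟶ Y) {B : A} {i j : Irr} (p : (c.obj j)ᵛ ⊗ B ⟶ (c.obj i)ᵛ)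
    (q : (c.obj i)ᵛ ⟶ (c.obj j)ᵛ ⊗ B) : B ⊗ X ⟶ Y ⊗ B :=
  𝟙 (B ⊗ X) ⊗≫ η_ (c.obj j) (c.obj j)ᵛ ▷ (B ⊗ X) ⊗≫ c.obj j ◁ p ▷ X ⊗≫
    c.obj j ◁ γ (c.obj i)ᵛ ⊗≫ c.obj j ◁ g ▷ (c.obj i)ᵛ ⊗≫ μ (c.obj j) ▷ (c.obj i)ᵛ ⊗≫
    (Y ⊗ c.obj j) ◁ q ⊗≫ Y ◁ P.pev (c.obj j) ▷ B ⊗≫ 𝟙 (Y ⊗ B)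

/-- The loop around `g` with an endomorphism inserted on its left side. -/
def wrapLeft (g : X ⟶ Y) (B : A) (i : Irr) : (B ⊗ c.obj i ⟶ B ⊗ c.obj i) →ₗ[k] (B ⊗ X ⟶ Y ⊗ B) where
  toFun h := 𝟙 (B ⊗ X) ⊗≫ B ◁ η_ (c.obj i) (c.obj i)ᵛ ▷ X ⊗≫ (B ⊗ c.obj i) ◁ γ (c.obj i)ᵛ ⊗≫
    (B ⊗ c.obj i) ◁ g ▷ (c.obj i)ᵛ ⊗≫ h ▷ (Y ⊗ (c.obj i)ᵛ) ⊗≫ μ (B ⊗ c.obj i) ▷ (c.obj i)ᵛ ⊗≫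
    (Y ⊗ B) ◁ P.pev (c.obj i) ⊗≫ 𝟙 (Y ⊗ B)
  map_add' f g := by simp [monoidalComp]
  map_smul' a f := by simp [monoidalComp]

/-- The loop around `g` with an endomorphism inserted on its right side. -/
def wrapRight (g : X ⟶ Y) (B : A) (j : Irr) :
    ((c.obj j)ᵛ ⊗ B ⟶ (c.obj j)ᵛ ⊗ B) →ₗ[k] (B ⊗ X ⟶ Y ⊗ B) where
  toFun h := 𝟙 (B ⊗ X) ⊗≫ η_ (c.obj j) (c.obj j)ᵛ ▷ (B ⊗ X) ⊗≫ c.obj j ◁ h ▷ X ⊗≫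
    c.obj j ◁ γ ((c.obj j)ᵛ ⊗ B) ⊗≫ c.obj j ◁ g ▷ ((c.obj j)ᵛ ⊗ B) ⊗≫
    μ (c.obj j) ▷ ((c.obj j)ᵛ ⊗ B) ⊗≫ Y ◁ P.pev (c.obj j) ▷ B ⊗≫ 𝟙 (Y ⊗ B)
  map_add' f g := by simp [monoidalComp]
  map_smul' a f := by simp [monoidalComp]

variable {γ μ}

theorem wrapLeft_id (hμ : IsHalfBraiding Y μ) (g : X ⟶ Y) (B : A) (i : Irr) :
    wrapLeft c γ μ g B i (𝟙 _) = B ◁ wrap P γ μ g (c.obj i) ≫ μ B := by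
  simp only [wrapLeft, LinearMap.coe_mk, AddHom.coe_mk, hμ.tensor, wrap]
  symm
  calc _ = 𝟙 (B ⊗ X) ⊗≫ B ◁ η_ (c.obj i) (c.obj i)ᵛ ▷ X ⊗≫ (B ⊗ c.obj i) ◁ γ (c.obj i)ᵛ ⊗≫
        (B ⊗ c.obj i) ◁ g ▷ (c.obj i)ᵛ ⊗≫ B ◁ μ (c.obj i) ▷ (c.obj i)ᵛ ⊗≫
        ((B ⊗ Y) ◁ P.pev (c.obj i) ≫ μ B ▷ 𝟙_ A) ⊗≫ 𝟙 (Y ⊗ B) := by monoidal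
    _ = _ := by rw [whisker_exchange]; monoidal

/-- The lower factor passes through `μ` by naturality and around the cap to the right side; the
upper factor is turned around the cup. The result is written in rotated nodes so that it can be
matched with `wrapRight_comp`. -/
theorem wrapLeft_comp (hμ : IsHalfBraiding Y μ) (g : X ⟶ Y) {B : A} {i j : Irr}
    (f : B ⊗ c.obj i ⟶ c.obj j) (h : c.obj j ⟶ B ⊗ c.obj i) :
    wrapLeft c γ μ g B i (f ≫ h) = wrapNode c γ μ g (c.corotate f) (c.rotate h) := by
  have h1 := hμ.naturality h
  have h2 := c.rotate_pev h
  have h3 := c.coevaluation_corotate f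
  simp only [wrapLeft, LinearMap.coe_mk, AddHom.coe_mk, wrapNode]
  calc _ = 𝟙 (B ⊗ X) ⊗≫ B ◁ η_ (c.obj i) (c.obj i)ᵛ ▷ X ⊗≫
        ((B ⊗ c.obj i) ◁ (γ (c.obj i)ᵛ ≫ g ▷ (c.obj i)ᵛ) ≫ f ▷ (Y ⊗ (c.obj i)ᵛ)) ⊗≫
        (h ▷ Y ≫ μ (B ⊗ c.obj i)) ▷ (c.obj i)ᵛ ⊗≫
        (Y ⊗ B) ◁ P.pev (c.obj i) ⊗≫ 𝟙 (Y ⊗ B) := by monoidal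
    _ = 𝟙 (B ⊗ X) ⊗≫ (𝟙 B ⊗≫ B ◁ η_ (c.obj i) (c.obj i)ᵛ ⊗≫ f ▷ (c.obj i)ᵛ) ▷ X ⊗≫
        c.obj j ◁ (γ (c.obj i)ᵛ ≫ g ▷ (c.obj i)ᵛ) ⊗≫ μ (c.obj j) ▷ (c.obj i)ᵛ ⊗≫
        Y ◁ (h ▷ (c.obj i)ᵛ ⊗≫ B ◁ P.pev (c.obj i) ⊗≫ 𝟙 B) ⊗≫ 𝟙 (Y ⊗ B) := by
        rw [whisker_exchange, h1]; monoidal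
    _ = _ := by rw [← h2, ← h3]; monoidal

theorem wrapRight_id (hγ : IsHalfBraiding X γ) (g : X ⟶ Y) (B : A) (j : Irr) :
    wrapRight c γ μ g B j (𝟙 _) = γ B ≫ wrap P γ μ g (c.obj j) ▷ B := by
  simp only [wrapRight, LinearMap.coe_mk, AddHom.coe_mk, hγ.tensor, wrap]
  calc _ = 𝟙 (B ⊗ X) ⊗≫ (η_ (c.obj j) (c.obj j)ᵛ ▷ (B ⊗ X) ≫ (c.obj j ⊗ (c.obj j)ᵛ) ◁ γ B) ⊗≫
        c.obj j ◁ γ (c.obj j)ᵛ ▷ B ⊗≫ c.obj j ◁ g ▷ ((c.obj j)ᵛ ⊗ B) ⊗≫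
        μ (c.obj j) ▷ ((c.obj j)ᵛ ⊗ B) ⊗≫ Y ◁ P.pev (c.obj j) ▷ B ⊗≫ 𝟙 (Y ⊗ B) := by monoidal
    _ = _ := by rw [← whisker_exchange]; monoidal

theorem wrapRight_comp (hγ : IsHalfBraiding X γ) (g : X ⟶ Y) {B : A} {i j : Irr}
    (p : (c.obj j)ᵛ ⊗ B ⟶ (c.obj i)ᵛ) (q : (c.obj i)ᵛ ⟶ (c.obj j)ᵛ ⊗ B) :
    wrapRight c γ μ g B j (p ≫ q) = wrapNode c γ μ g p q := by
  have h1 := hγ.naturality q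
  simp only [wrapRight, LinearMap.coe_mk, AddHom.coe_mk, wrapNode]
  calc _ = 𝟙 (B ⊗ X) ⊗≫ η_ (c.obj j) (c.obj j)ᵛ ▷ (B ⊗ X) ⊗≫ c.obj j ◁ p ▷ X ⊗≫
        c.obj j ◁ (q ▷ X ≫ γ ((c.obj j)ᵛ ⊗ B)) ⊗≫
        c.obj j ◁ g ▷ ((c.obj j)ᵛ ⊗ B) ⊗≫
        μ (c.obj j) ▷ ((c.obj j)ᵛ ⊗ B) ⊗≫ Y ◁ P.pev (c.obj j) ▷ B ⊗≫ 𝟙 (Y ⊗ B) := by monoidal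
    _ = 𝟙 (B ⊗ X) ⊗≫ η_ (c.obj j) (c.obj j)ᵛ ▷ (B ⊗ X) ⊗≫ c.obj j ◁ p ▷ X ⊗≫
        c.obj j ◁ γ (c.obj i)ᵛ ⊗≫ (c.obj j ⊗ X) ◁ q ⊗≫
        (𝟙 ((c.obj j ⊗ X) ⊗ (c.obj j)ᵛ ⊗ B) ⊗≫ (c.obj j ◁ g) ▷ ((c.obj j)ᵛ ⊗ B) ≫
        μ (c.obj j) ▷ ((c.obj j)ᵛ ⊗ B)) ⊗≫ Y ◁ P.pev (c.obj j) ▷ B ⊗≫ 𝟙 (Y ⊗ B) := by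
        rw [h1]; monoidal
    _ = 𝟙 (B ⊗ X) ⊗≫ η_ (c.obj j) (c.obj j)ᵛ ▷ (B ⊗ X) ⊗≫ c.obj j ◁ p ▷ X ⊗≫
        c.obj j ◁ γ (c.obj i)ᵛ ⊗≫ ((c.obj j ⊗ X) ◁ q ≫
        (c.obj j ◁ g ≫ μ (c.obj j)) ▷ ((c.obj j)ᵛ ⊗ B)) ⊗≫
        Y ◁ P.pev (c.obj j) ▷ B ⊗≫ 𝟙 (Y ⊗ B) := by monoidal
    _ = _ := by rw [whisker_exchange]; monoidal

theorem whiskerLeft_wrap_comp (hunit : Simple (𝟙_ A)) (hμ : IsHalfBraiding Y μ) (g : X ⟶ Y)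
    (B : A) (i : Irr) : B ◁ wrap P γ μ g (c.obj i) ≫ μ B = ∑ j, c.dim j • ∑ α,
      wrapNode c γ μ g (c.corotate (c.node B i j α)) (c.rotate (c.conode B i j α)) := by
  rw [← wrapLeft_id c hμ, ← c.sum_basisTo_basisFrom hunit, map_sum]
  simp only [map_smul, map_sum, wrapLeft_comp c hμ]
  rfl

theorem comp_wrap_whiskerRight (hunit : Simple (𝟙_ A)) (hP : P.IsSpherical)
    (hγ : IsHalfBraiding X γ) (g : X ⟶ Y)
    (B : A) (j : Irr) : γ B ≫ wrap P γ μ g (c.obj j) ▷ B = ∑ i, c.dim i • ∑ α,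
      wrapNode c γ μ g (c.corotate (c.node B i j α)) (c.rotate (c.conode B i j α)) := by
  rw [← wrapRight_id c hγ, ← c.sum_corotate_rotate hunit hP, map_sum]
  simp only [map_smul, map_sum, wrapRight_comp c hγ]

/-- Opening the loop coloured by `X_i` on the left creates a sum over `j` with weights `d_j`;
opening the loop coloured by `X_j` on the right creates a sum over `i` with weights `d_i`. With the
weights of the average both become the same sum with coefficients `d_i d_j`. -/
theorem avg_cent (hunit : Simple (𝟙_ A)) (hP : P.IsSpherical)
    (hγ : IsHalfBraiding X γ) (hμ : IsHalfBraiding Y μ) (g : X ⟶ Y) :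
    Cent γ μ (avg c γ μ g) := by
  intro B
  simp only [avg, MonoidalLinear.whiskerLeft_smul, MonoidalLinear.smul_whiskerRight,
    whiskerLeft_sum, sum_whiskerRight, Linear.smul_comp, Linear.comp_smul, Preadditive.sum_comp,
    Preadditive.comp_sum, whiskerLeft_wrap_comp c hunit hμ, comp_wrap_whiskerRight c hunit hP hγ]
  congr 1
  simp only [Finset.smul_sum]
  rw [Finset.sum_comm]
  refine Finset.sum_congr rfl fun j _ => Finset.sum_congr rfl fun i _ =>
    Finset.sum_congr rfl fun α _ => smul_comm _ _ _

end Avg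

end Average

/-! ### The projector `Q` and the reduced half-braiding. -/

section Projector

local postfix:max "ᵛ" => rightDual
local infixr:70 "⊠" => tbr

open ExactPairing

set_option linter.unusedSectionVars false

/-- A family that is a retract of a half-braiding is a half-braiding. -/
theorem IsHalfBraiding.of_retract {A : Type u} [Category.{v} A] [MonoidalCategory A] {R X : A}
    {r : HB R} {γ : HB X} (hγ : IsHalfBraiding X γ) {i : R ⟶ X} {p : X ⟶ R} (hip : i ≫ p = 𝟙 R)
    (hi : Cent r γ i) (hp : Cent γ r p) : IsHalfBraiding R r := by
  have key : ∀ B, r B = B ◁ i ≫ γ B ≫ p ▷ B := fun B => by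
    rw [reassoc_of% hi B, ← comp_whiskerRight, hip, id_whiskerRight, Category.comp_id]
  have hi' : ∀ B, B ◁ i ≫ B ◁ p = 𝟙 _ := fun B => by
    rw [← MonoidalCategory.whiskerLeft_comp, hip, MonoidalCategory.whiskerLeft_id]
  have hp' : ∀ B, i ▷ B ≫ p ▷ B = 𝟙 _ := fun B => by
    rw [← comp_whiskerRight, hip, id_whiskerRight]
  refine ⟨fun B => ?_, fun {B B'} f => ?_, fun B B' => ?_⟩
  · have := hγ.isIso B
    refine ⟨i ▷ B ≫ inv (γ B) ≫ B ◁ p, ?_, ?_⟩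
    · rw [← reassoc_of% hi B, IsIso.hom_inv_id_assoc, hi']
    · rw [Category.assoc, Category.assoc, hp B, IsIso.inv_hom_id_assoc, hp']
  · rw [key, key, ← whisker_exchange_assoc, reassoc_of% hγ.naturality f]
    simp only [Category.assoc, whisker_exchange]
  · have : Mono (i ▷ (B ⊗ B')) :=
      (SplitMono.mk (p ▷ (B ⊗ B')) (hp' _)).mono
    rw [← cancel_mono (i ▷ (B ⊗ B')), ← hi, hγ.tensor]
    have h1 := hi B
    have h2 := hi B'
    calc _ = 𝟙 _ ⊗≫ B ◁ (B' ◁ i ≫ γ B') ⊗≫ γ B ▷ B' ⊗≫ 𝟙 _ := by monoidal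
      _ = 𝟙 _ ⊗≫ B ◁ r B' ⊗≫ (B ◁ i ≫ γ B) ▷ B' ⊗≫ 𝟙 _ := by rw [h2]; monoidal
      _ = _ := by rw [h1]; monoidal

section BraidedDuality

variable {A : Type u} [Category.{v} A] [MonoidalCategory A] [BraidedCategory A]

/-- A cup may be created on either side of a strand: this is naturality of the braiding at the
coevaluation, with one crossing moved to the other side of the equation. -/
theorem coevaluation_braiding_inv (C D X : A) [ExactPairing C D] :
    𝟙 X ⊗≫ X ◁ η_ C D ⊗≫ (β_ C X).inv ▷ D ⊗≫ 𝟙 (C ⊗ X ⊗ D) =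
      𝟙 X ⊗≫ η_ C D ▷ X ⊗≫ C ◁ (β_ D X).hom := by
  have h1 := (isHalfBraiding_plus X).tensor C D
  have h2 := (isHalfBraiding_plus X).naturality (η_ C D)
  rw [(isHalfBraiding_plus X).unit, h1] at h2
  unfold plus at h2
  calc _ = 𝟙 X ⊗≫ (((λ_ X).hom ≫ (ρ_ X).inv) ≫ X ◁ η_ C D) ⊗≫ (β_ C X).inv ▷ D ⊗≫
        𝟙 (C ⊗ X ⊗ D) := by monoidal
    _ = 𝟙 X ⊗≫ η_ C D ▷ X ⊗≫ C ◁ (β_ D X).hom ⊗≫ ((β_ C X).hom ≫ (β_ C X).inv) ▷ D ⊗≫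
        𝟙 (C ⊗ X ⊗ D) := by rw [← h2]; monoidal
    _ = _ := by rw [Iso.hom_inv_id]; monoidal

theorem braiding_evaluation (C D Y : A) (e : C ⊗ D ⟶ 𝟙_ A) :
    𝟙 (C ⊗ Y ⊗ D) ⊗≫ C ◁ (β_ Y D).hom ⊗≫ e ▷ Y ⊗≫ 𝟙 Y =
      𝟙 (C ⊗ Y ⊗ D) ⊗≫ (β_ Y C).inv ▷ D ⊗≫ Y ◁ e ⊗≫ 𝟙 Y := by
  have h1 := (isHalfBraiding_minus Y).tensor C D
  have h2 := (isHalfBraiding_minus Y).naturality e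
  rw [(isHalfBraiding_minus Y).unit, h1] at h2
  unfold minus at h2
  calc _ = 𝟙 (C ⊗ Y ⊗ D) ⊗≫ C ◁ (β_ Y D).hom ⊗≫ (e ▷ Y ≫ (λ_ Y).hom ≫ (ρ_ Y).inv) ⊗≫ 𝟙 Y := by
        monoidal
    _ = 𝟙 (C ⊗ Y ⊗ D) ⊗≫ C ◁ ((β_ Y D).hom ≫ (β_ Y D).inv) ⊗≫ (β_ Y C).inv ▷ D ⊗≫ Y ◁ e ⊗≫
        𝟙 Y := by rw [h2]; monoidal
    _ = _ := by rw [Iso.hom_inv_id]; monoidal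

end BraidedDuality

variable {k : Type w} [Field k] [IsAlgClosed k] {A : Type u} [Category.{v} A] [Abelian A]
  [Linear k A] [MonoidalCategory A] [MonoidalPreadditive A] [MonoidalLinear k A]
  [BraidedCategory A] [RigidCategory A] [IsFiniteSemisimple k A]
  {P : PivotalStructure A} {Irr : Type t} [Fintype Irr] (c : SimpleChoice k P Irr)
  (Z W : DCenter A)

/-- The half-braiding on `X ⊗ Y` that is `γ` on `X` and the inverse braiding on `Y`. -/
abbrev rho : HB (Z.X ⊗ W.X) := tbr Z.br (minus W.X)

/-- The half-braiding on `X ⊗ Y` that is the braiding on `X` and `μ` on `Y`. -/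
abbrev sig : HB (Z.X ⊗ W.X) := tbr (plus Z.X) W.br

theorem isHalfBraiding_rho : IsHalfBraiding _ (rho Z W) :=
  Z.isHalfBraiding.tbr (isHalfBraiding_minus _)

theorem isHalfBraiding_sig : IsHalfBraiding _ (sig Z W) :=
  (isHalfBraiding_plus _).tbr W.isHalfBraiding

/-- The cup, created between the two strands, is moved to the far left behind `Z`; the cap is moved
to the far right in front of `W`. Afterwards the right arc crosses both strands by `sig` and the
left arc crosses both by `rho`. -/
theorem loop_eq_wrap (i : Irr) : loop c Z W i = wrap P (sig Z W) (rho Z W) (𝟙 _) (c.obj i) := by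
  have h1 := coevaluation_braiding_inv (c.obj i) (c.obj i)ᵛ Z.X
  have h2 := braiding_evaluation (c.obj i) (c.obj i)ᵛ W.X (P.pev (c.obj i))
  unfold loop wrap rho sig tbr plus minus
  calc _ = (𝟙 Z.X ⊗≫ Z.X ◁ η_ (c.obj i) (c.obj i)ᵛ ⊗≫ (β_ (c.obj i) Z.X).inv ▷ (c.obj i)ᵛ ⊗≫
          𝟙 (c.obj i ⊗ Z.X ⊗ (c.obj i)ᵛ)) ▷ W.X ⊗≫ (c.obj i ⊗ Z.X) ◁ W.br (c.obj i)ᵛ ⊗≫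
        Z.br (c.obj i) ▷ (W.X ⊗ (c.obj i)ᵛ) ⊗≫ Z.X ◁ (𝟙 (c.obj i ⊗ W.X ⊗ (c.obj i)ᵛ) ⊗≫
          c.obj i ◁ (β_ W.X (c.obj i)ᵛ).hom ⊗≫ P.pev (c.obj i) ▷ W.X ⊗≫ 𝟙 W.X) := by monoidal
    _ = _ := by rw [h1, h2]; monoidal

theorem Q_eq_avg : Q c Z W = avg c (sig Z W) (rho Z W) (𝟙 _) := by
  simp only [Q, avg, loop_eq_wrap]

theorem nodeLoop_eq_wrapNode {B : A} {i j : Irr} (f : B ⊗ c.obj i ⟶ c.obj j)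
    (q : (c.obj i)ᵛ ⟶ (c.obj j)ᵛ ⊗ B) : nodeLoop c Z W B i j f q =
      wrapNode c (sig Z W) (rho Z W) (𝟙 _) (c.corotate f) q := by
  have h1 := coevaluation_braiding_inv (c.obj i) (c.obj i)ᵛ Z.X
  have h2 := braiding_evaluation (c.obj j) (c.obj j)ᵛ W.X (P.pev (c.obj j))
  have h3 := c.coevaluation_corotate f
  unfold nodeLoop wrapNode rho sig tbr plus minus
  symm
  calc _ = (𝟙 B ⊗≫ η_ (c.obj j) (c.obj j)ᵛ ▷ B ⊗≫ c.obj j ◁ c.corotate f) ▷ (Z.X ⊗ W.X) ⊗≫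
        c.obj j ◁ (β_ (c.obj i)ᵛ Z.X).hom ▷ W.X ⊗≫ (c.obj j ⊗ Z.X) ◁ W.br (c.obj i)ᵛ ⊗≫
        Z.br (c.obj j) ▷ (W.X ⊗ (c.obj i)ᵛ) ⊗≫ Z.X ◁ ((β_ W.X (c.obj j)).inv ▷ (c.obj i)ᵛ ≫
          (W.X ⊗ c.obj j) ◁ q) ⊗≫ (Z.X ⊗ W.X) ◁ P.pev (c.obj j) ▷ B ⊗≫ 𝟙 ((Z.X ⊗ W.X) ⊗ B) := by monoidal
    _ = 𝟙 _ ⊗≫ B ◁ η_ (c.obj i) (c.obj i)ᵛ ▷ (Z.X ⊗ W.X) ⊗≫ (f ▷ ((c.obj i)ᵛ ⊗ Z.X ⊗ W.X) ≫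
        c.obj j ◁ (𝟙 ((c.obj i)ᵛ ⊗ Z.X ⊗ W.X) ⊗≫ (β_ (c.obj i)ᵛ Z.X).hom ▷ W.X ⊗≫
          Z.X ◁ W.br (c.obj i)ᵛ ⊗≫ 𝟙 (Z.X ⊗ W.X ⊗ (c.obj i)ᵛ))) ⊗≫
        Z.br (c.obj j) ▷ (W.X ⊗ (c.obj i)ᵛ) ⊗≫ Z.X ◁ ((c.obj j ⊗ W.X) ◁ q ≫
          (β_ W.X (c.obj j)).inv ▷ ((c.obj j)ᵛ ⊗ B)) ⊗≫
        (Z.X ⊗ W.X) ◁ P.pev (c.obj j) ▷ B ⊗≫ 𝟙 ((Z.X ⊗ W.X) ⊗ B) := by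
        rw [h3, whisker_exchange (β_ W.X (c.obj j)).inv]; monoidal
    _ = 𝟙 _ ⊗≫ B ◁ (𝟙 Z.X ⊗≫ η_ (c.obj i) (c.obj i)ᵛ ▷ Z.X ⊗≫
          c.obj i ◁ (β_ (c.obj i)ᵛ Z.X).hom) ▷ W.X ⊗≫ (B ⊗ c.obj i ⊗ Z.X) ◁ W.br (c.obj i)ᵛ ⊗≫
        f ▷ (Z.X ⊗ W.X ⊗ (c.obj i)ᵛ) ⊗≫
        (Z.br (c.obj j) ▷ (W.X ⊗ (c.obj i)ᵛ) ≫ (Z.X ⊗ c.obj j) ◁ (W.X ◁ q)) ⊗≫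
        Z.X ◁ (𝟙 (c.obj j ⊗ W.X ⊗ (c.obj j)ᵛ) ⊗≫ (β_ W.X (c.obj j)).inv ▷ (c.obj j)ᵛ ⊗≫
          W.X ◁ P.pev (c.obj j) ⊗≫ 𝟙 W.X) ▷ B ⊗≫ 𝟙 ((Z.X ⊗ W.X) ⊗ B) := by
        rw [← whisker_exchange f]; monoidal
    _ = _ := by rw [← h1, ← h2, ← whisker_exchange]; monoidal

variable (hunit : Simple (𝟙_ A)) (hP : P.IsSpherical)

/-- The double sum that defines `redBr` is the one obtained by cutting the loop of `Q` open on its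
left when `B` passes below it. -/
theorem redBr_eq (hunit : Simple (𝟙_ A)) (B : A) :
    redBr c Z W B = B ◁ Q c Z W ≫ rho Z W B := by
  rw [Q_eq_avg, avg]
  simp only [MonoidalLinear.whiskerLeft_smul, whiskerLeft_sum, Linear.smul_comp,
    Preadditive.sum_comp, whiskerLeft_wrap_comp c hunit (isHalfBraiding_rho Z W), redBr,
    nodeLoop_eq_wrapNode, Finset.smul_sum, smul_smul, mul_assoc]

theorem Q_cent (hunit : Simple (𝟙_ A)) (hP : P.IsSpherical) :
    Cent (sig Z W) (rho Z W) (Q c Z W) := by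
  rw [Q_eq_avg]
  exact avg_cent c hunit hP (isHalfBraiding_sig Z W) (isHalfBraiding_rho Z W) _

theorem Cent.smul_sum {X Y : A} {γ : HB X} {μ : HB Y} {ι : Type*} [Fintype ι] (a : k) (b : ι → k)
    {f : ι → (X ⟶ Y)} (h : ∀ i, Cent γ μ (f i)) : Cent γ μ (a • ∑ i, b i • f i) := fun B => by
  have := fun i => h i B
  simp only [MonoidalLinear.whiskerLeft_smul, whiskerLeft_sum, Linear.smul_comp,
    Preadditive.sum_comp, this, MonoidalLinear.smul_whiskerRight, sum_whiskerRight,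
    Linear.comp_smul, Preadditive.comp_sum]

/-- With `minus` on everything to the right of `Z`, arbitrary morphisms of `A` there are central, in
particular those involving the half-braiding of `W`. The other pieces are a crossing of `Z` with a
`minus` strand and the half-braiding of `Z`, and both are central. For `sig` the roles of the two
factors are exchanged. -/
theorem loop_cent_rho (i : Irr) : Cent (rho Z W) (rho Z W) (loop c Z W i) := by
  have h : loop c Z W i =
      Z.X ◁ (𝟙 W.X ⊗≫ η_ (c.obj i) (c.obj i)ᵛ ▷ W.X ⊗≫ c.obj i ◁ W.br (c.obj i)ᵛ) ≫
      (α_ _ _ _).inv ≫ ((β_ (c.obj i) Z.X).inv ≫ Z.br (c.obj i)) ▷ (W.X ⊗ (c.obj i)ᵛ) ≫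
      (α_ _ _ _).hom ≫ Z.X ◁ (c.obj i ◁ (β_ W.X (c.obj i)ᵛ).hom ⊗≫ P.pev (c.obj i) ▷ W.X ⊗≫
        𝟙 W.X) := by
    unfold loop
    calc _ = 𝟙 _ ⊗≫ Z.X ◁ η_ (c.obj i) (c.obj i)ᵛ ▷ W.X ⊗≫
          ((β_ (c.obj i) Z.X).inv ▷ ((c.obj i)ᵛ ⊗ W.X) ≫ (c.obj i ⊗ Z.X) ◁ W.br (c.obj i)ᵛ) ⊗≫
          Z.br (c.obj i) ▷ (W.X ⊗ (c.obj i)ᵛ) ⊗≫ (Z.X ⊗ c.obj i) ◁ (β_ W.X (c.obj i)ᵛ).hom ⊗≫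
          Z.X ◁ P.pev (c.obj i) ▷ W.X ⊗≫ 𝟙 _ := by monoidal
      _ = _ := by rw [← whisker_exchange]; monoidal
  rw [h]
  have h1 : Cent (rho Z W) (tbr Z.br (minus (c.obj i) ⊠ minus (W.X ⊗ (c.obj i)ᵛ)))
      (Z.X ◁ (𝟙 W.X ⊗≫ η_ (c.obj i) (c.obj i)ᵛ ▷ W.X ⊗≫ c.obj i ◁ W.br (c.obj i)ᵛ)) := by
    rw [tbr_minus]; exact (Cent.minus _).whiskerLeft _
  refine h1.comp ((Cent.assoc_inv _ _ _).comp ((((Cent.braiding_minus_inv _ _).comp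
    (Cent.br _ Z.isHalfBraiding)).whiskerRight _).comp ((Cent.assoc _ _ _).comp ?_)))
  rw [tbr_minus]; exact (Cent.minus _).whiskerLeft _

theorem loop_cent_sig (i : Irr) : Cent (sig Z W) (sig Z W) (loop c Z W i) := by
  have h : loop c Z W i =
      (𝟙 Z.X ⊗≫ Z.X ◁ η_ (c.obj i) (c.obj i)ᵛ ⊗≫ (β_ (c.obj i) Z.X).inv ▷ (c.obj i)ᵛ ⊗≫
        Z.br (c.obj i) ▷ (c.obj i)ᵛ) ▷ W.X ≫ (α_ _ _ _).hom ≫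
      (Z.X ⊗ c.obj i) ◁ (W.br (c.obj i)ᵛ ≫ (β_ W.X (c.obj i)ᵛ).hom) ≫ (α_ _ _ _).inv ≫
      (𝟙 ((Z.X ⊗ c.obj i) ⊗ (c.obj i)ᵛ) ⊗≫ Z.X ◁ P.pev (c.obj i) ⊗≫ 𝟙 Z.X) ▷ W.X := by
    unfold loop
    calc _ = 𝟙 _ ⊗≫ Z.X ◁ η_ (c.obj i) (c.obj i)ᵛ ▷ W.X ⊗≫
          (β_ (c.obj i) Z.X).inv ▷ ((c.obj i)ᵛ ⊗ W.X) ⊗≫ ((c.obj i ⊗ Z.X) ◁ W.br (c.obj i)ᵛ ≫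
          Z.br (c.obj i) ▷ (W.X ⊗ (c.obj i)ᵛ)) ⊗≫ (Z.X ⊗ c.obj i) ◁ (β_ W.X (c.obj i)ᵛ).hom ⊗≫
          Z.X ◁ P.pev (c.obj i) ▷ W.X ⊗≫ 𝟙 _ := by monoidal
      _ = _ := by rw [whisker_exchange]; monoidal
  rw [h]
  have h1 : ∀ g : Z.X ⟶ (Z.X ⊗ c.obj i) ⊗ (c.obj i)ᵛ,
      Cent (sig Z W) ((plus (Z.X ⊗ c.obj i) ⊠ plus (c.obj i)ᵛ) ⊠ W.br) (g ▷ W.X) := by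
    intro g
    rw [tbr_plus]; exact (Cent.plus _).whiskerRight _
  refine (h1 _).comp ((Cent.assoc _ _ _).comp ((((Cent.br _ W.isHalfBraiding).comp
    (Cent.braiding_plus _ _)).whiskerLeft _).comp ((Cent.assoc_inv _ _ _).comp ?_)))
  rw [tbr_plus]; exact (Cent.plus _).whiskerRight _

theorem Q_cent_rho : Cent (rho Z W) (rho Z W) (Q c Z W) :=
  Cent.smul_sum _ _ fun i => loop_cent_rho c Z W i

theorem Q_cent_sig : Cent (sig Z W) (sig Z W) (Q c Z W) :=
  Cent.smul_sum _ _ fun i => loop_cent_sig c Z W i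

/-- As `Q` is central from `rho` to `rho`, it may be moved into the average that defines the first
`Q`. This gives the average of `Q` from `sig` to `rho`, and `Q` is already central from `sig` to
`rho`. -/
theorem Q_idem [CharZero k] (hunit : Simple (𝟙_ A)) (hP : P.IsSpherical) :
    Q c Z W ≫ Q c Z W = Q c Z W := by
  conv_lhs => enter [1]; rw [Q_eq_avg]
  rw [(Q_cent_rho c Z W).avg_comp, Category.id_comp,
    (Q_cent c Z W hunit hP).avg_eq c hunit (isHalfBraiding_rho Z W)]

theorem proj_incl : proj c Z W ≫ incl c Z W = Q c Z W := image.fac _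

variable [CharZero k]

theorem incl_proj (hunit : Simple (𝟙_ A)) (hP : P.IsSpherical) :
    incl c Z W ≫ proj c Z W = 𝟙 (redX c Z W) := by
  have : Mono (incl c Z W) := inferInstanceAs (Mono (image.ι _))
  have : Epi (proj c Z W) := inferInstanceAs (Epi (factorThruImage _))
  rw [← cancel_epi (proj c Z W), ← cancel_mono (incl c Z W)]
  simp only [Category.assoc, Category.comp_id]
  rw [← Category.assoc, proj_incl, Q_idem c Z W hunit hP]

theorem incl_Q (hunit : Simple (𝟙_ A)) (hP : P.IsSpherical) :
    incl c Z W ≫ Q c Z W = incl c Z W := by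
  rw [← proj_incl, ← Category.assoc, incl_proj c Z W hunit hP, Category.id_comp]

theorem Q_proj (hunit : Simple (𝟙_ A)) (hP : P.IsSpherical) :
    Q c Z W ≫ proj c Z W = proj c Z W := by
  rw [← proj_incl, Category.assoc, incl_proj c Z W hunit hP, Category.comp_id]

theorem redBrRes_eq_rho (hunit : Simple (𝟙_ A)) (hP : P.IsSpherical) (B : A) :
    redBrRes c Z W B = B ◁ incl c Z W ≫ rho Z W B ≫ proj c Z W ▷ B := by
  rw [redBrRes, redBr_eq c Z W hunit, Category.assoc, ← MonoidalCategory.whiskerLeft_comp_assoc,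
    incl_Q c Z W hunit hP]

/-- Since `Q` intertwines `sig` with `rho` and is the identity on its image, the two half-braidings
have the same restriction there. Having both descriptions is essential: some arguments need `minus`
on the second factor, others `plus` on the first. -/
theorem redBrRes_eq_sig (hunit : Simple (𝟙_ A)) (hP : P.IsSpherical) (B : A) :
    redBrRes c Z W B = B ◁ incl c Z W ≫ sig Z W B ≫ proj c Z W ▷ B := by
  rw [redBrRes, redBr_eq c Z W hunit, Q_cent c Z W hunit hP, Category.assoc, ← comp_whiskerRight,
    Q_proj c Z W hunit hP]

theorem incl_cent_rho (hunit : Simple (𝟙_ A)) (hP : P.IsSpherical) :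
    Cent (redBrRes c Z W) (rho Z W) (incl c Z W) := fun B => by
  rw [redBrRes_eq_rho c Z W hunit hP, Category.assoc, Category.assoc, ← comp_whiskerRight,
    proj_incl, ← Q_cent_rho c Z W, ← MonoidalCategory.whiskerLeft_comp_assoc, incl_Q c Z W hunit hP]

theorem incl_cent_sig (hunit : Simple (𝟙_ A)) (hP : P.IsSpherical) :
    Cent (redBrRes c Z W) (sig Z W) (incl c Z W) := fun B => by
  rw [redBrRes_eq_sig c Z W hunit hP, Category.assoc, Category.assoc, ← comp_whiskerRight,
    proj_incl, ← Q_cent_sig c Z W, ← MonoidalCategory.whiskerLeft_comp_assoc, incl_Q c Z W hunit hP]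

theorem proj_cent_rho (hunit : Simple (𝟙_ A)) (hP : P.IsSpherical) :
    Cent (rho Z W) (redBrRes c Z W) (proj c Z W) := fun B => by
  rw [redBrRes_eq_rho c Z W hunit hP, ← MonoidalCategory.whiskerLeft_comp_assoc, proj_incl,
    reassoc_of% Q_cent_rho c Z W, ← comp_whiskerRight, Q_proj c Z W hunit hP]

theorem proj_cent_sig (hunit : Simple (𝟙_ A)) (hP : P.IsSpherical) :
    Cent (sig Z W) (redBrRes c Z W) (proj c Z W) := fun B => by
  rw [redBrRes_eq_sig c Z W hunit hP, ← MonoidalCategory.whiskerLeft_comp_assoc, proj_incl,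
    reassoc_of% Q_cent_sig c Z W, ← comp_whiskerRight, Q_proj c Z W hunit hP]

theorem isHalfBraiding_redBrRes (hunit : Simple (𝟙_ A)) (hP : P.IsSpherical) :
    IsHalfBraiding (redX c Z W) (redBrRes c Z W) :=
  (isHalfBraiding_rho Z W).of_retract (incl_proj c Z W hunit hP) (incl_cent_rho c Z W hunit hP)
    (proj_cent_rho c Z W hunit hP)

theorem Q_commute (hunit : Simple (𝟙_ A)) (B : A) :
    B ◁ Q c Z W ≫ redBr c Z W B = redBr c Z W B ≫ Q c Z W ▷ B := by
  rw [redBr_eq c Z W hunit, Category.assoc, ← Q_cent_rho c Z W]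

end Projector

/-! ### Dual half-braidings and their conjugates by crossings. -/

section DualHalfBraidings

local postfix:max "ᵛ" => rightDual
local infixr:70 "⊠" => tbr

open ExactPairing

set_option linter.unusedSectionVars false

section Rigid

variable {A : Type u} [Category.{v} A] [MonoidalCategory A]

/-- The candidate for the inverse of `n_B`, obtained by rotating `n_D` for a dual `D` of `B`. -/
def rotInv {V : A} (n : HB V) (B D : A) [ExactPairing B D] : V ⊗ B ⟶ B ⊗ V :=
  𝟙 (V ⊗ B) ⊗≫ η_ B D ▷ (V ⊗ B) ⊗≫ B ◁ n D ▷ B ⊗≫ (B ⊗ V) ◁ ε_ B D ⊗≫ 𝟙 (B ⊗ V)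

section RotInv

variable {V : A} {n : HB V}

theorem hom_rotInv (nat : ∀ {B B' : A} (f : B ⟶ B'), f ▷ V ≫ n B' = n B ≫ V ◁ f)
    (ten : ∀ B B' : A, n (B ⊗ B') =
      (α_ B B' V).hom ≫ B ◁ n B' ≫ (α_ B V B').inv ≫ n B ▷ B' ≫ (α_ V B B').hom)
    (unit : n (𝟙_ A) = (λ_ V).hom ≫ (ρ_ V).inv)
    (B D : A) [ExactPairing B D] : n B ≫ rotInv n B D = 𝟙 _ := by
  have h1 := nat (ε_ B D)
  rw [ten, unit] at h1
  unfold rotInv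
  calc _ = 𝟙 _ ⊗≫ (𝟙_ A ◁ n B ≫ η_ B D ▷ (V ⊗ B)) ⊗≫ B ◁ n D ▷ B ⊗≫
        (B ⊗ V) ◁ ε_ B D ⊗≫ 𝟙 (B ⊗ V) := by monoidal
    _ = 𝟙 _ ⊗≫ η_ B D ▷ (B ⊗ V) ⊗≫ B ◁ (((α_ D B V).hom ≫ D ◁ n B ≫ (α_ D V B).inv ≫ n D ▷ B ≫
        (α_ V D B).hom) ≫ V ◁ ε_ B D) ⊗≫ 𝟙 (B ⊗ V) := by rw [whisker_exchange]; monoidal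
    _ = 𝟙 _ ⊗≫ (η_ B D ▷ B ⊗≫ B ◁ ε_ B D) ▷ V ⊗≫ 𝟙 (B ⊗ V) := by rw [← h1]; monoidal
    _ = _ := by rw [evaluation_coevaluation'']; monoidal

theorem rotInv_hom (nat : ∀ {B B' : A} (f : B ⟶ B'), f ▷ V ≫ n B' = n B ≫ V ◁ f)
    (ten : ∀ B B' : A, n (B ⊗ B') =
      (α_ B B' V).hom ≫ B ◁ n B' ≫ (α_ B V B').inv ≫ n B ▷ B' ≫ (α_ V B B').hom)
    (unit : n (𝟙_ A) = (λ_ V).hom ≫ (ρ_ V).inv)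
    (B D : A) [ExactPairing B D] : rotInv n B D ≫ n B = 𝟙 _ := by
  have h1 := nat (η_ B D)
  rw [ten, unit] at h1
  unfold rotInv
  calc _ = 𝟙 _ ⊗≫ η_ B D ▷ (V ⊗ B) ⊗≫ B ◁ n D ▷ B ⊗≫
        ((B ⊗ V) ◁ ε_ B D ≫ n B ▷ 𝟙_ A) ⊗≫ 𝟙 (V ⊗ B) := by monoidal
    _ = 𝟙 _ ⊗≫ (η_ B D ▷ V ≫ (α_ B D V).hom ≫ B ◁ n D ≫ (α_ B V D).inv ≫ n B ▷ D ≫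
        (α_ V B D).hom) ▷ B ⊗≫ (V ⊗ B) ◁ ε_ B D ⊗≫ 𝟙 (V ⊗ B) := by
        rw [whisker_exchange]; monoidal
    _ = 𝟙 _ ⊗≫ V ◁ (η_ B D ▷ B ⊗≫ B ◁ ε_ B D) ⊗≫ 𝟙 (V ⊗ B) := by rw [h1]; monoidal
    _ = _ := by rw [evaluation_coevaluation'']; monoidal

end RotInv

/-- In a rigid category invertibility is automatic: naturality at the evaluation and the
coevaluation shows that the rotation of `n` at the dual is a two-sided inverse, provided that `n` is
trivial at the unit. -/
theorem IsHalfBraiding.of_unit [RightRigidCategory A] {V : A} {n : HB V}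
    (nat : ∀ {B B' : A} (f : B ⟶ B'), f ▷ V ≫ n B' = n B ≫ V ◁ f)
    (ten : ∀ B B' : A, n (B ⊗ B') =
      (α_ B B' V).hom ≫ B ◁ n B' ≫ (α_ B V B').inv ≫ n B ▷ B' ≫ (α_ V B B').hom)
    (unit : n (𝟙_ A) = (λ_ V).hom ≫ (ρ_ V).inv) : IsHalfBraiding V n where
  isIso B := ⟨rotInv n B Bᵛ, hom_rotInv nat ten unit B Bᵛ, rotInv_hom nat ten unit B Bᵛ⟩
  naturality := nat
  tensor := ten

theorem IsHalfBraiding.inv_eq_rotInv {V : A} {n : HB V} (hn : IsHalfBraiding V n) (B D : A)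
    [ExactPairing B D] : @inv _ _ _ _ (n B) (hn.isIso B) = rotInv n B D := by
  have := hn.isIso B
  rw [IsIso.inv_eq_of_hom_inv_id (hom_rotInv hn.naturality hn.tensor hn.unit B D)]

section Sharp

variable {X Y : A} [ExactPairing X Y]

/-- The rotation `Y ⊗ B ⟶ B ⊗ Y` of a half-braiding on `X`, where `Y` is dual to `X`. -/
def sharp (γ : HB X) (B : A) : Y ⊗ B ⟶ B ⊗ Y :=
  𝟙 (Y ⊗ B) ⊗≫ (Y ⊗ B) ◁ η_ X Y ⊗≫ Y ◁ γ B ▷ Y ⊗≫ ε_ X Y ▷ (B ⊗ Y) ⊗≫ 𝟙 (B ⊗ Y)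

variable {γ : HB X}

theorem sharp_naturality (hγ : IsHalfBraiding X γ) {B B' : A} (f : B ⟶ B') :
    Y ◁ f ≫ sharp γ B' = sharp γ B ≫ f ▷ Y := by
  have h1 := hγ.naturality f
  unfold sharp
  calc _ = 𝟙 _ ⊗≫ Y ◁ (f ▷ 𝟙_ A ≫ B' ◁ η_ X Y) ⊗≫ Y ◁ γ B' ▷ Y ⊗≫
        ε_ X Y ▷ (B' ⊗ Y) ⊗≫ 𝟙 (B' ⊗ Y) := by monoidal
    _ = 𝟙 _ ⊗≫ (Y ⊗ B) ◁ η_ X Y ⊗≫ Y ◁ (f ▷ X ≫ γ B') ▷ Y ⊗≫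
        ε_ X Y ▷ (B' ⊗ Y) ⊗≫ 𝟙 (B' ⊗ Y) := by rw [← whisker_exchange]; monoidal
    _ = 𝟙 _ ⊗≫ (Y ⊗ B) ◁ η_ X Y ⊗≫ Y ◁ γ B ▷ Y ⊗≫ ((Y ⊗ X) ◁ (f ▷ Y) ≫
        ε_ X Y ▷ (B' ⊗ Y)) ⊗≫ 𝟙 (B' ⊗ Y) := by rw [h1]; monoidal
    _ = _ := by rw [whisker_exchange]; monoidal

theorem sharp_tensor (hγ : IsHalfBraiding X γ) (B B' : A) :
    sharp (Y := Y) γ (B ⊗ B') = (α_ Y B B').inv ≫ sharp γ B ▷ B' ≫ (α_ B Y B').hom ≫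
      B ◁ sharp γ B' ≫ (α_ B B' Y).inv := by
  symm
  unfold sharp
  rw [hγ.tensor]
  calc _ = 𝟙 _ ⊗≫ (Y ⊗ B) ◁ η_ X Y ▷ B' ⊗≫ Y ◁ γ B ▷ (Y ⊗ B') ⊗≫
        (ε_ X Y ▷ (B ⊗ Y ⊗ B') ≫ 𝟙_ A ◁ (𝟙 (B ⊗ Y ⊗ B') ⊗≫ (B ⊗ Y ⊗ B') ◁ η_ X Y ⊗≫
        (B ⊗ Y) ◁ γ B' ▷ Y)) ⊗≫ B ◁ ε_ X Y ▷ (B' ⊗ Y) ⊗≫ 𝟙 _ := by monoidal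
    _ = 𝟙 _ ⊗≫ (Y ⊗ B) ◁ η_ X Y ▷ B' ⊗≫ (Y ◁ (γ B ▷ (Y ⊗ B') ≫
        (X ⊗ B) ◁ (𝟙 (Y ⊗ B') ⊗≫ (Y ⊗ B') ◁ η_ X Y ⊗≫ Y ◁ γ B' ▷ Y))) ⊗≫
        ε_ X Y ▷ (B ⊗ ((Y ⊗ X) ⊗ B') ⊗ Y) ⊗≫ B ◁ ε_ X Y ▷ (B' ⊗ Y) ⊗≫ 𝟙 _ := by
        rw [← whisker_exchange]; monoidal
    _ = 𝟙 _ ⊗≫ (Y ⊗ B) ◁ (η_ X Y ▷ (B' ⊗ 𝟙_ A) ≫ (X ⊗ Y) ◁ (B' ◁ η_ X Y)) ⊗≫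
        (Y ⊗ B ⊗ X) ◁ Y ◁ γ B' ▷ Y ⊗≫ Y ◁ γ B ▷ (Y ⊗ X ⊗ B' ⊗ Y) ⊗≫
        (ε_ X Y ▷ (B ⊗ (Y ⊗ X) ⊗ B' ⊗ Y) ≫ 𝟙_ A ◁ B ◁ ε_ X Y ▷ (B' ⊗ Y)) ⊗≫ 𝟙 _ := by
        rw [← whisker_exchange]; monoidal
    _ = 𝟙 _ ⊗≫ (Y ⊗ B ⊗ B') ◁ η_ X Y ⊗≫ (Y ⊗ B) ◁ (η_ X Y ▷ (B' ⊗ X ⊗ Y) ≫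
        (X ⊗ Y) ◁ (𝟙 (B' ⊗ X ⊗ Y) ⊗≫ γ B' ▷ Y)) ⊗≫ Y ◁ (γ B ▷ (((Y ⊗ X) ⊗ B') ⊗ Y) ≫
          (X ⊗ B) ◁ ε_ X Y ▷ B' ▷ Y) ⊗≫
        ε_ X Y ▷ (B ⊗ B' ⊗ Y) ⊗≫ 𝟙 _ := by
        rw [← whisker_exchange, ← whisker_exchange]; monoidal
    _ = 𝟙 _ ⊗≫ (Y ⊗ B ⊗ B') ◁ η_ X Y ⊗≫ (Y ⊗ B) ◁ γ B' ▷ Y ⊗≫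
        (Y ⊗ B) ◁ (η_ X Y ▷ X ⊗≫ X ◁ ε_ X Y) ▷ (B' ⊗ Y) ⊗≫ Y ◁ γ B ▷ (B' ⊗ Y) ⊗≫
        ε_ X Y ▷ (B ⊗ B' ⊗ Y) ⊗≫ 𝟙 _ := by
        rw [← whisker_exchange, ← whisker_exchange]; monoidal
    _ = _ := by rw [evaluation_coevaluation'']; monoidal

theorem sharp_unit (hγ : IsHalfBraiding X γ) :
    sharp (Y := Y) γ (𝟙_ A) = (ρ_ Y).hom ≫ (λ_ Y).inv := by
  unfold sharp
  rw [hγ.unit]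
  calc _ = 𝟙 _ ⊗≫ (Y ◁ η_ X Y ⊗≫ ε_ X Y ▷ Y) ⊗≫ 𝟙 _ := by monoidal
    _ = _ := by rw [coevaluation_evaluation'']; monoidal

/-- The inverse of the rotation of a half-braiding on `X`, where `D` is a left dual of `B`. -/
def sharpInv (γ : HB X) (D B : A) [ExactPairing D B] : B ⊗ Y ⟶ Y ⊗ B :=
  𝟙 (B ⊗ Y) ⊗≫ (B ⊗ Y) ◁ η_ D B ⊗≫ B ◁ sharp (Y := Y) γ D ▷ B ⊗≫ ε_ D B ▷ (Y ⊗ B) ⊗≫ 𝟙 (Y ⊗ B)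

theorem sharp_sharpInv (hγ : IsHalfBraiding X γ) (D B : A) [ExactPairing D B] :
    sharp (Y := Y) γ B ≫ sharpInv γ D B = 𝟙 (Y ⊗ B) := by
  have h1 := sharp_naturality (Y := Y) hγ (ε_ D B)
  rw [sharp_tensor hγ, sharp_unit hγ] at h1
  unfold sharpInv
  calc _ = 𝟙 _ ⊗≫ (sharp γ B ▷ 𝟙_ A ≫ (B ⊗ Y) ◁ η_ D B) ⊗≫ B ◁ sharp (Y := Y) γ D ▷ B ⊗≫
        ε_ D B ▷ (Y ⊗ B) ⊗≫ 𝟙 (Y ⊗ B) := by monoidal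
    _ = 𝟙 _ ⊗≫ (Y ⊗ B) ◁ η_ D B ⊗≫ (((α_ Y B D).inv ≫ sharp γ B ▷ D ≫ (α_ B Y D).hom ≫
        B ◁ sharp γ D ≫ (α_ B D Y).inv) ≫ ε_ D B ▷ Y) ▷ B ⊗≫ 𝟙 (Y ⊗ B) := by
        rw [← whisker_exchange]; monoidal
    _ = 𝟙 _ ⊗≫ Y ◁ (B ◁ η_ D B ⊗≫ ε_ D B ▷ B) ⊗≫ 𝟙 (Y ⊗ B) := by rw [← h1]; monoidal
    _ = _ := by rw [coevaluation_evaluation'']; monoidal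

theorem sharpInv_sharp (hγ : IsHalfBraiding X γ) (D B : A) [ExactPairing D B] :
    sharpInv (Y := Y) γ D B ≫ sharp (Y := Y) γ B = 𝟙 _ := by
  have h1 := sharp_naturality (Y := Y) hγ (η_ D B)
  rw [sharp_tensor hγ, sharp_unit hγ] at h1
  unfold sharpInv
  calc _ = 𝟙 _ ⊗≫ (B ⊗ Y) ◁ η_ D B ⊗≫ B ◁ sharp (Y := Y) γ D ▷ B ⊗≫
        (ε_ D B ▷ (Y ⊗ B) ≫ 𝟙_ A ◁ sharp γ B) ⊗≫ 𝟙 (B ⊗ Y) := by monoidal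
    _ = 𝟙 _ ⊗≫ B ◁ (Y ◁ η_ D B ≫ (α_ Y D B).inv ≫ sharp γ D ▷ B ≫ (α_ D Y B).hom ≫
        D ◁ sharp γ B ≫ (α_ D B Y).inv) ⊗≫ ε_ D B ▷ (B ⊗ Y) ⊗≫ 𝟙 (B ⊗ Y) := by
        rw [← whisker_exchange]; monoidal
    _ = 𝟙 _ ⊗≫ (B ◁ η_ D B ⊗≫ ε_ D B ▷ B) ▷ Y ⊗≫ 𝟙 (B ⊗ Y) := by rw [h1]; monoidal
    _ = _ := by rw [coevaluation_evaluation'']; monoidal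

/-- The rotation of `γ` satisfies the axioms of a half-braiding with its direction reversed, so its
inverse satisfies the usual ones. -/
theorem isHalfBraiding_of_inv_sharp (hγ : IsHalfBraiding X γ) {n : HB Y}
    (h1 : ∀ B, sharp γ B ≫ n B = 𝟙 _) (h2 : ∀ B, n B ≫ sharp γ B = 𝟙 _) :
    IsHalfBraiding Y n := by
  have i1 : ∀ B, IsIso (sharp (Y := Y) γ B) := fun B => ⟨n B, h1 B, h2 B⟩
  refine ⟨fun B => ⟨sharp γ B, h2 B, h1 B⟩, fun {B B'} f => ?_, fun B B' => ?_⟩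
  · rw [← cancel_epi (sharp γ B), ← reassoc_of% sharp_naturality (Y := Y) hγ, h1, reassoc_of% h1 B,
      Category.comp_id]
  · rw [← cancel_epi (sharp γ (B ⊗ B')), h1, sharp_tensor hγ]
    simp only [Category.assoc, Iso.inv_hom_id_assoc, ← MonoidalCategory.whiskerLeft_comp_assoc, h1,
      MonoidalCategory.whiskerLeft_id, Category.id_comp, Iso.hom_inv_id_assoc,
      ← comp_whiskerRight_assoc, id_whiskerRight, Iso.inv_hom_id]

/-- The rotation `B ⊗ V ⟶ V ⊗ B` of a family of morphisms `X ⊗ B ⟶ B ⊗ X`, where `X` is dual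
to `V`. -/
def cosharp {V X : A} [ExactPairing V X] (u : ∀ B, X ⊗ B ⟶ B ⊗ X) : HB V := fun B =>
  𝟙 (B ⊗ V) ⊗≫ η_ V X ▷ (B ⊗ V) ⊗≫ V ◁ u B ▷ V ⊗≫ (V ⊗ B) ◁ ε_ V X ⊗≫ 𝟙 (V ⊗ B)

variable {V X : A} [ExactPairing V X] {γ : HB X} {u : ∀ B, X ⊗ B ⟶ B ⊗ X}

/-- The family `u` is inverse to `γ`, hence natural and multiplicative in the reversed direction;
rotation reverses the direction back. Invertibility comes from `IsHalfBraiding.of_unit`, so no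
inverse has to be drawn. -/
theorem isHalfBraiding_cosharp [RightRigidCategory A] (hγ : IsHalfBraiding X γ)
    (h1 : ∀ B, γ B ≫ u B = 𝟙 _) :
    IsHalfBraiding V (cosharp u) := by
  have i1 : ∀ B, IsIso (γ B) := hγ.isIso
  have nat : ∀ {B B' : A} (f : B ⟶ B'), X ◁ f ≫ u B' = u B ≫ f ▷ X := fun {B B'} f => by
    rw [← cancel_epi (γ B), ← reassoc_of% hγ.naturality f, h1, reassoc_of% h1 B,
      Category.comp_id]
  have ten : ∀ B B', u (B ⊗ B') = (α_ X B B').inv ≫ u B ▷ B' ≫ (α_ B X B').hom ≫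
      B ◁ u B' ≫ (α_ B B' X).inv := fun B B' => by
    rw [← cancel_epi (γ (B ⊗ B')), h1, hγ.tensor]
    simp only [Category.assoc, Iso.hom_inv_id_assoc, ← comp_whiskerRight_assoc, h1,
      id_whiskerRight, Category.id_comp, Iso.inv_hom_id_assoc,
      ← MonoidalCategory.whiskerLeft_comp_assoc, MonoidalCategory.whiskerLeft_id, Iso.hom_inv_id]
  have unit : u (𝟙_ A) = (ρ_ X).hom ≫ (λ_ X).inv := by
    rw [← cancel_epi (γ (𝟙_ A)), h1, hγ.unit]; simp
  refine IsHalfBraiding.of_unit (fun {B B'} f => ?_) (fun B B' => ?_) ?_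
  · unfold cosharp
    calc _ = 𝟙 _ ⊗≫ (𝟙_ A ◁ (f ▷ V) ≫ η_ V X ▷ (B' ⊗ V)) ⊗≫ V ◁ u B' ▷ V ⊗≫
          (V ⊗ B') ◁ ε_ V X ⊗≫ 𝟙 _ := by monoidal
      _ = 𝟙 _ ⊗≫ η_ V X ▷ (B ⊗ V) ⊗≫ V ◁ (X ◁ f ≫ u B') ▷ V ⊗≫
          (V ⊗ B') ◁ ε_ V X ⊗≫ 𝟙 _ := by rw [whisker_exchange]; monoidal
      _ = 𝟙 _ ⊗≫ η_ V X ▷ (B ⊗ V) ⊗≫ V ◁ u B ▷ V ⊗≫ V ◁ (f ▷ (X ⊗ V) ≫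
          B' ◁ ε_ V X) ⊗≫ 𝟙 _ := by rw [nat]; monoidal
      _ = _ := by rw [← whisker_exchange]; monoidal
  · symm
    unfold cosharp
    rw [ten]
    calc _ = 𝟙 _ ⊗≫ (𝟙_ A ◁ (𝟙 (B ⊗ B' ⊗ V) ⊗≫ B ◁ η_ V X ▷ (B' ⊗ V) ⊗≫ B ◁ V ◁ u B' ▷ V ⊗≫
          (B ⊗ V ⊗ B') ◁ ε_ V X ⊗≫ 𝟙 (B ⊗ V ⊗ B')) ≫ η_ V X ▷ (B ⊗ V ⊗ B')) ⊗≫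
          V ◁ u B ▷ (V ⊗ B') ⊗≫ (V ⊗ B) ◁ ε_ V X ▷ B' ⊗≫ 𝟙 (V ⊗ B ⊗ B') := by monoidal
      _ = 𝟙 _ ⊗≫ η_ V X ▷ (B ⊗ B' ⊗ V) ⊗≫ V ◁ ((X ⊗ B) ◁ (𝟙 (B' ⊗ V) ⊗≫ η_ V X ▷ (B' ⊗ V) ⊗≫
          V ◁ u B' ▷ V ⊗≫ (V ⊗ B') ◁ ε_ V X ⊗≫ 𝟙 (V ⊗ B')) ≫ u B ▷ (V ⊗ B')) ⊗≫
          (V ⊗ B) ◁ ε_ V X ▷ B' ⊗≫ 𝟙 (V ⊗ B ⊗ B') := by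
          rw [whisker_exchange]; monoidal
      _ = 𝟙 _ ⊗≫ η_ V X ▷ (B ⊗ B' ⊗ V) ⊗≫ V ◁ u B ▷ (B' ⊗ V) ⊗≫
          (V ⊗ B) ◁ (𝟙 (X ⊗ B' ⊗ V) ⊗≫ X ◁ η_ V X ▷ (B' ⊗ V) ⊗≫ ((X ⊗ V) ◁ (u B' ▷ V ⊗≫
          B' ◁ ε_ V X) ≫ ε_ V X ▷ (B' ⊗ 𝟙_ A))) ⊗≫ 𝟙 (V ⊗ B ⊗ B') := by
          rw [whisker_exchange]; monoidal
      _ = 𝟙 _ ⊗≫ η_ V X ▷ (B ⊗ B' ⊗ V) ⊗≫ V ◁ u B ▷ (B' ⊗ V) ⊗≫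
          (V ⊗ B) ◁ (X ◁ η_ V X ⊗≫ ε_ V X ▷ X) ▷ (B' ⊗ V) ⊗≫ (V ⊗ B) ◁ u B' ▷ V ⊗≫
          (V ⊗ B ⊗ B') ◁ ε_ V X ⊗≫ 𝟙 (V ⊗ B ⊗ B') := by
          rw [whisker_exchange]; monoidal
      _ = _ := by rw [coevaluation_evaluation'']; monoidal
  · unfold cosharp
    rw [unit]
    calc _ = 𝟙 _ ⊗≫ (η_ V X ▷ V ⊗≫ V ◁ ε_ V X) ⊗≫ 𝟙 _ := by monoidal
      _ = _ := by rw [evaluation_coevaluation'']; monoidal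

end Sharp

end Rigid

section BraidedRigid

variable {A : Type u} [Category.{v} A] [MonoidalCategory A] [BraidedCategory A]

theorem coevaluation_braiding (C D B : A) [ExactPairing C D] :
    𝟙 B ⊗≫ B ◁ η_ C D ⊗≫ (β_ B C).hom ▷ D ⊗≫ 𝟙 (C ⊗ B ⊗ D) =
      𝟙 B ⊗≫ η_ C D ▷ B ⊗≫ C ◁ (β_ B D).inv := by
  have h1 := (isHalfBraiding_minus B).tensor C D
  have h2 := (isHalfBraiding_minus B).naturality (η_ C D)
  rw [(isHalfBraiding_minus B).unit, h1] at h2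
  unfold minus at h2
  calc _ = 𝟙 B ⊗≫ (((λ_ B).hom ≫ (ρ_ B).inv) ≫ B ◁ η_ C D) ⊗≫ (β_ B C).hom ▷ D ⊗≫
        𝟙 (C ⊗ B ⊗ D) := by monoidal
    _ = 𝟙 B ⊗≫ η_ C D ▷ B ⊗≫ C ◁ (β_ B D).inv ⊗≫ ((β_ B C).inv ≫ (β_ B C).hom) ▷ D ⊗≫
        𝟙 (C ⊗ B ⊗ D) := by rw [← h2]; monoidal
    _ = _ := by rw [Iso.inv_hom_id]; monoidal

theorem braiding_inv_evaluation (C D B : A) (e : C ⊗ D ⟶ 𝟙_ A) :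
    𝟙 (C ⊗ B ⊗ D) ⊗≫ C ◁ (β_ D B).inv ⊗≫ e ▷ B ⊗≫ 𝟙 B =
      𝟙 (C ⊗ B ⊗ D) ⊗≫ (β_ C B).hom ▷ D ⊗≫ B ◁ e ⊗≫ 𝟙 B := by
  have h1 := (isHalfBraiding_plus B).tensor C D
  have h2 := (isHalfBraiding_plus B).naturality e
  rw [(isHalfBraiding_plus B).unit, h1] at h2
  unfold plus at h2
  calc _ = 𝟙 (C ⊗ B ⊗ D) ⊗≫ C ◁ (β_ D B).inv ⊗≫ (e ▷ B ≫ (λ_ B).hom ≫ (ρ_ B).inv) ⊗≫ 𝟙 B := by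
        monoidal
    _ = 𝟙 (C ⊗ B ⊗ D) ⊗≫ C ◁ ((β_ D B).inv ≫ (β_ D B).hom) ⊗≫ (β_ C B).hom ▷ D ⊗≫ B ◁ e ⊗≫
        𝟙 B := by rw [h2]; monoidal
    _ = _ := by rw [Iso.inv_hom_id]; monoidal

section Twist

variable {Y : A} {n : HB Y} (hn : IsHalfBraiding Y n)

/-- The half-braiding `n`, conjugated by a double braiding. -/
def tw (hn : IsHalfBraiding Y n) : HB Y := fun B =>
  (β_ B Y).hom ≫ @inv _ _ _ _ (n B) (hn.isIso B) ≫ (β_ Y B).inv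

/-- Only the tensor axiom has content: on `B ⊗ B'` the three factors of `tw` for `B` and for `B'`
appear interleaved, and the upper part for `B` has to commute with the lower part for `B'`. -/
theorem isHalfBraiding_tw : IsHalfBraiding Y (tw hn) := by
  have := hn.isIso
  refine ⟨fun B => ?_, fun {B B'} f => ?_, fun B B' => ?_⟩
  · unfold tw; infer_instance
  · have h1 : Y ◁ f ≫ inv (n B') = inv (n B) ≫ f ▷ Y := by
      rw [IsIso.eq_inv_comp, ← Category.assoc, IsIso.comp_inv_eq, hn.naturality]
    unfold tw
    rw [BraidedCategory.braiding_naturality_left_assoc, reassoc_of% h1]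
    simp
  · have hinv : inv (n (B ⊗ B')) = (α_ Y B B').inv ≫ inv (n B) ▷ B' ≫ (α_ B Y B').hom ≫
        B ◁ inv (n B') ≫ (α_ B B' Y).inv := by
      rw [IsIso.inv_eq_of_hom_inv_id]
      rw [hn.tensor]
      simp
    -- The upper part is a central endomorphism of `B ⊗ Y` when `B` carries `minus`. It therefore
    -- commutes with the double crossing of `B ⊗ Y` with `B'`, in which `B` contributes nothing
    -- because its two crossings cancel.
    have hP : Cent (minus B ⊠ n) (minus B ⊠ n) ((β_ B Y).hom ≫ inv (n B)) :=
      (Cent.braiding_minus _ _).comp ((Cent.br (minus B) hn).inv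
        (IsIso.hom_inv_id _) (IsIso.inv_hom_id _))
    set p := (β_ B Y).hom ≫ inv (n B) with hp
    have comm : (B ◁ ((β_ Y B').hom ≫ n B')) ≫ (α_ B Y B').inv ≫ p ▷ B' =
        (α_ B Y B').inv ≫ p ▷ B' ≫ (α_ B Y B').hom ≫ B ◁ ((β_ Y B').hom ≫ n B') ≫
          (α_ B Y B').inv := by
      have e : B ◁ ((β_ Y B').hom ≫ n B') =
          (α_ B Y B').inv ≫ (β_ (B ⊗ Y) B').hom ≫ (minus B ⊠ n) B' ≫ (α_ B Y B').hom := by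
        rw [BraidedCategory.braiding_tensor_left_hom, tbr, minus]
        simp
      rw [e]
      simp only [Category.assoc, Iso.hom_inv_id_assoc, Iso.hom_inv_id, Category.comp_id]
      rw [← hP B', BraidedCategory.braiding_naturality_left_assoc]
    have comm2 : B ◁ (inv (n B') ≫ (β_ Y B').inv) ≫ (α_ B Y B').inv ≫ p ▷ B' =
        (α_ B Y B').inv ≫ p ▷ B' ≫ (α_ B Y B').hom ≫ B ◁ (inv (n B') ≫ (β_ Y B').inv) ≫
          (α_ B Y B').inv := by
      rw [← cancel_epi (B ◁ ((β_ Y B').hom ≫ n B'))]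
      rw [reassoc_of% comm]
      simp only [← MonoidalCategory.whiskerLeft_comp_assoc, Category.assoc,
        IsIso.hom_inv_id_assoc, Iso.hom_inv_id, MonoidalCategory.whiskerLeft_id, Category.id_comp,
        Iso.inv_hom_id_assoc, Iso.hom_inv_id, Category.comp_id]
    unfold tw
    rw [hinv, BraidedCategory.braiding_tensor_left_hom, BraidedCategory.braiding_tensor_right_inv]
    calc _ = 𝟙 _ ⊗≫ B ◁ (β_ B' Y).hom ⊗≫ ((α_ B Y B').inv ≫ p ▷ B' ≫ (α_ B Y B').hom ≫
          B ◁ (inv (n B') ≫ (β_ Y B').inv) ≫ (α_ B Y B').inv) ⊗≫ (β_ Y B).inv ▷ B' ⊗≫ 𝟙 _ := by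
          rw [hp]; monoidal
      _ = _ := by rw [← comm2, hp]; monoidal

theorem twistOver_eq_tw [RigidCategory A] (B : A) : twistOver n B = tw hn B := by
  rw [tw, hn.inv_eq_rotInv B Bᵛ, twistOver, rotInv]
  monoidal

/-- Here the inverse of `n B` is not visible, unlike in `twistOver`. The crossing above the node is
written as `n B` followed by an endomorphism `r` of `Y ⊗ B`. Being central for `n ⊠ plus B`, `r` can
be moved below the node `n D`; then `n B` and `n D` meet and cancel at the coevaluation. The
self-crossings of `B` that this creates cancel as well. -/
theorem twistUnder_eq_tw [RigidCategory A] (B : A) : twistUnder n B = tw hn B := by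
  have := hn.isIso B
  have hR : Cent (n ⊠ plus B) (n ⊠ plus B) (inv (n B) ≫ (β_ Y B).inv) :=
    ((Cent.br (plus B) hn).inv (IsIso.hom_inv_id _) (IsIso.inv_hom_id _)).comp
      (Cent.braiding_plus_inv _ _)
  set r := inv (n B) ≫ (β_ Y B).inv with hr
  have e1 : (β_ Y B).inv = n B ≫ r := by rw [hr, IsIso.hom_inv_id_assoc]
  have e2 : tw hn B = (β_ B Y).hom ≫ r := rfl
  set D := leftDual B
  have h1 : D ◁ r ≫ (α_ D Y B).inv ≫ n D ▷ B ⊗≫ Y ◁ (β_ D B).hom ⊗≫ 𝟙 ((Y ⊗ B) ⊗ D) =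
      (α_ D Y B).inv ≫ n D ▷ B ⊗≫ Y ◁ (β_ D B).hom ⊗≫ r ▷ D := by
    have := hR D
    unfold tbr plus at this
    calc _ = D ◁ r ≫ (α_ D Y B).inv ≫ n D ▷ B ≫ (α_ Y D B).hom ≫ Y ◁ (β_ D B).hom ≫
          (α_ Y B D).inv := by monoidal
      _ = _ := by rw [this]; monoidal
  have h2 := hn.tensor D B
  have h3 := hn.naturality (η_ D B)
  have h4 := BraidedCategory.braiding_naturality_right B r
  rw [BraidedCategory.braiding_tensor_right_hom] at h4
  have h5 := BraidedCategory.braiding_naturality_left (ε_ D B) B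
  rw [BraidedCategory.braiding_tensor_left_hom, braiding_tensorUnit_left] at h5
  -- A strand `B` that crosses both legs of the cap of `B` and its dual can be pulled over the cap.
  -- It is used twice, here and in the inverse form `h5''`, so that the auxiliary crossings
  -- disappear.
  have h5' : 𝟙 (B ⊗ D ⊗ B) ⊗≫ B ◁ (β_ D B).hom ⊗≫ (β_ B B).hom ▷ D ⊗≫ B ◁ ε_ D B ⊗≫ 𝟙 B =
      𝟙 (B ⊗ D ⊗ B) ⊗≫ ε_ D B ▷ B ⊗≫ 𝟙 B := by
    calc _ = 𝟙 _ ⊗≫ (((α_ B D B).hom ≫ B ◁ (β_ D B).hom ≫ (α_ B B D).inv ≫ (β_ B B).hom ▷ D ≫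
          (α_ B B D).hom) ≫ B ◁ ε_ D B) ⊗≫ 𝟙 B := by monoidal
      _ = _ := by rw [← h5]; monoidal
  have h5'' : 𝟙 (B ⊗ B ⊗ D) ⊗≫ (β_ B B).inv ▷ D ⊗≫ B ◁ (β_ D B).inv ⊗≫ ε_ D B ▷ B ⊗≫ 𝟙 B =
      𝟙 (B ⊗ B ⊗ D) ⊗≫ B ◁ ε_ D B ⊗≫ 𝟙 B := by
    calc _ = 𝟙 _ ⊗≫ (β_ B B).inv ▷ D ⊗≫ B ◁ (β_ D B).inv ⊗≫
          (𝟙 (B ⊗ D ⊗ B) ⊗≫ ε_ D B ▷ B ⊗≫ 𝟙 B) := by monoidal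
      _ = 𝟙 _ ⊗≫ (β_ B B).inv ▷ D ⊗≫ B ◁ ((β_ D B).inv ≫ (β_ D B).hom) ⊗≫
          (β_ B B).hom ▷ D ⊗≫ B ◁ ε_ D B ⊗≫ 𝟙 B := by rw [← h5']; monoidal
      _ = 𝟙 _ ⊗≫ ((β_ B B).inv ≫ (β_ B B).hom) ▷ D ⊗≫ B ◁ ε_ D B ⊗≫ 𝟙 B := by
          rw [Iso.inv_hom_id]; monoidal
      _ = _ := by rw [Iso.inv_hom_id]; monoidal
  have h4' : 𝟙 (B ⊗ Y ⊗ B) ⊗≫ B ◁ r ⊗≫ (β_ B Y).hom ▷ B ⊗≫ 𝟙 (Y ⊗ B ⊗ B) =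
      𝟙 (B ⊗ Y ⊗ B) ⊗≫ (β_ B Y).hom ▷ B ⊗≫ Y ◁ (β_ B B).hom ⊗≫ r ▷ B ⊗≫ Y ◁ (β_ B B).inv ⊗≫
        𝟙 (Y ⊗ B ⊗ B) := by
    calc _ = 𝟙 _ ⊗≫ (B ◁ r ≫ (α_ B Y B).inv ≫ (β_ B Y).hom ▷ B ≫ (α_ Y B B).hom ≫
          Y ◁ (β_ B B).hom ≫ (α_ Y B B).inv) ⊗≫ Y ◁ (β_ B B).inv ⊗≫ 𝟙 (Y ⊗ B ⊗ B) := by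
          trans 𝟙 (B ⊗ Y ⊗ B) ⊗≫ B ◁ r ⊗≫ (β_ B Y).hom ▷ B ⊗≫
            Y ◁ ((β_ B B).hom ≫ (β_ B B).inv) ⊗≫ 𝟙 (Y ⊗ B ⊗ B)
          · rw [Iso.hom_inv_id]; monoidal
          · monoidal
      _ = _ := by rw [h4]; monoidal
  rw [e2]
  unfold twistUnder
  calc _ = 𝟙 (B ⊗ Y) ⊗≫ B ◁ η_ D B ▷ Y ⊗≫ (B ⊗ D) ◁ n B ⊗≫
        B ◁ (D ◁ r ≫ (α_ D Y B).inv ≫ n D ▷ B ⊗≫ Y ◁ (β_ D B).hom ⊗≫ 𝟙 ((Y ⊗ B) ⊗ D)) ⊗≫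
        (B ⊗ Y) ◁ (β_ D B).inv ⊗≫ (β_ B Y).hom ▷ (D ⊗ B) ⊗≫ Y ◁ ε_ D B ▷ B ⊗≫ 𝟙 (Y ⊗ B) := by
        rw [e1]
        trans 𝟙 (B ⊗ Y) ⊗≫ B ◁ η_ D B ▷ Y ⊗≫ (B ⊗ D) ◁ (n B ≫ r) ⊗≫ B ◁ n D ▷ B ⊗≫
          (B ⊗ Y) ◁ ((β_ D B).hom ≫ (β_ D B).inv) ⊗≫ (β_ B Y).hom ▷ (D ⊗ B) ⊗≫
          Y ◁ ε_ D B ▷ B ⊗≫ 𝟙 (Y ⊗ B)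
        · rw [Iso.hom_inv_id]; monoidal
        · monoidal
    _ = 𝟙 (B ⊗ Y) ⊗≫ B ◁ (η_ D B ▷ Y ≫ (α_ D B Y).hom ≫ D ◁ n B ≫ (α_ D Y B).inv ≫ n D ▷ B ≫
          (α_ Y D B).hom) ⊗≫ (B ⊗ Y) ◁ (β_ D B).hom ⊗≫ B ◁ r ▷ D ⊗≫
        ((B ⊗ Y) ◁ (β_ D B).inv ≫ (β_ B Y).hom ▷ (D ⊗ B)) ⊗≫ Y ◁ ε_ D B ▷ B ⊗≫
        𝟙 (Y ⊗ B) := by rw [h1]; monoidal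
    _ = 𝟙 (B ⊗ Y) ⊗≫ (B ⊗ Y) ◁ η_ D B ⊗≫ (B ⊗ Y) ◁ (β_ D B).hom ⊗≫
        (𝟙 (B ⊗ Y ⊗ B) ⊗≫ B ◁ r ⊗≫ (β_ B Y).hom ▷ B ⊗≫ 𝟙 (Y ⊗ B ⊗ B)) ▷ D ⊗≫
        (Y ⊗ B) ◁ (β_ D B).inv ⊗≫ Y ◁ ε_ D B ▷ B ⊗≫ 𝟙 (Y ⊗ B) := by
        rw [← h2, h3, hn.unit, whisker_exchange]; monoidal
    _ = 𝟙 (B ⊗ Y) ⊗≫ ((B ⊗ Y) ◁ (η_ D B ≫ (β_ D B).hom) ≫ (β_ B Y).hom ▷ (B ⊗ D)) ⊗≫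
        Y ◁ (β_ B B).hom ▷ D ⊗≫ r ▷ (B ⊗ D) ⊗≫
        Y ◁ (𝟙 (B ⊗ B ⊗ D) ⊗≫ (β_ B B).inv ▷ D ⊗≫ B ◁ (β_ D B).inv ⊗≫ ε_ D B ▷ B ⊗≫ 𝟙 B) ⊗≫
        𝟙 (Y ⊗ B) := by
        rw [h4']; monoidal
    _ = 𝟙 (B ⊗ Y) ⊗≫ (β_ B Y).hom ⊗≫ (Y ⊗ B) ◁ (η_ D B ≫ (β_ D B).hom) ⊗≫
        Y ◁ (β_ B B).hom ▷ D ⊗≫ (r ▷ (B ⊗ D) ≫ (Y ⊗ B) ◁ ε_ D B) ⊗≫ 𝟙 (Y ⊗ B) := by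
        rw [whisker_exchange, h5'']; monoidal
    _ = 𝟙 (B ⊗ Y) ⊗≫ (β_ B Y).hom ⊗≫ (Y ⊗ B) ◁ η_ D B ⊗≫ Y ◁ (𝟙 (B ⊗ D ⊗ B) ⊗≫
        B ◁ (β_ D B).hom ⊗≫ (β_ B B).hom ▷ D ⊗≫ B ◁ ε_ D B ⊗≫ 𝟙 B) ⊗≫ r ⊗≫ 𝟙 (Y ⊗ B) := by
        rw [← whisker_exchange]; monoidal
    _ = 𝟙 (B ⊗ Y) ⊗≫ (β_ B Y).hom ⊗≫ Y ◁ (B ◁ η_ D B ⊗≫ ε_ D B ▷ B) ⊗≫ r ⊗≫ 𝟙 (Y ⊗ B) := by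
        rw [h5']; monoidal
    _ = _ := by rw [coevaluation_evaluation'']; monoidal

end Twist

section Dual

variable [RigidCategory A]

theorem stdDualBr_eq (Z : DCenter A) (B : A) : stdDualBr Z B = sharpInv Z.br (leftDual B) B := by
  unfold stdDualBr sharpInv sharp
  monoidal

theorem isHalfBraiding_stdDualBr (Z : DCenter A) : IsHalfBraiding Z.Xᵛ (stdDualBr Z) :=
  isHalfBraiding_of_inv_sharp Z.isHalfBraiding
    (fun B => by rw [stdDualBr_eq, sharp_sharpInv Z.isHalfBraiding])
    (fun B => by rw [stdDualBr_eq, sharpInv_sharp Z.isHalfBraiding])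

theorem dualBr_eq_sharp (Z : DCenter A) (B : A) :
    dualBr Z B = (β_ B Z.Xᵛ).hom ≫ sharp Z.br B ≫ (β_ Z.Xᵛ B).inv := by
  unfold dualBr sharp
  monoidal

/-- The node in the middle of `dualBr` is the rotation `sharp`, which is the inverse of the standard
dual half-braiding. -/
theorem dualBr_eq_tw (Z : DCenter A) (B : A) :
    dualBr Z B = tw (isHalfBraiding_stdDualBr Z) B := by
  have := (isHalfBraiding_stdDualBr Z).isIso B
  have h : inv (stdDualBr Z B) = sharp Z.br B := by
    rw [IsIso.inv_eq_of_hom_inv_id]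
    rw [stdDualBr_eq, sharpInv_sharp Z.isHalfBraiding]
  rw [dualBr_eq_sharp, tw, h]

theorem isHalfBraiding_dualBr (Z : DCenter A) : IsHalfBraiding Z.Xᵛ (dualBr Z) := by
  rw [show dualBr Z = tw (isHalfBraiding_stdDualBr Z) from funext (dualBr_eq_tw Z)]
  exact isHalfBraiding_tw _

theorem stdLeftDualBr_eq (Z : DCenter A) :
    stdLeftDualBr Z = cosharp fun B => rotInv Z.br B Bᵛ := by
  funext B
  unfold stdLeftDualBr cosharp rotInv
  monoidal

theorem isHalfBraiding_stdLeftDualBr (Z : DCenter A) :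
    IsHalfBraiding (leftDual Z.X) (stdLeftDualBr Z) := by
  have h := Z.isHalfBraiding
  rw [stdLeftDualBr_eq]
  exact isHalfBraiding_cosharp h (fun B => hom_rotInv h.naturality h.tensor h.unit B Bᵛ)

/-- Once the inverse half-braiding inside the standard dual is drawn with `B` itself as the dual of
`leftDual B`, both diagrams differ only by zigzags of `B`. -/
theorem leftDualBr_eq_twistUnder (Z : DCenter A) (B : A) :
    leftDualBr Z B = twistUnder (stdLeftDualBr Z) B := by
  have h := Z.isHalfBraiding
  -- By definition the right dual of `leftDual B` occurs here. It can be replaced by `B`, because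
  -- rotations along any two choices of dual compute the same inverse half-braiding.
  have e : stdLeftDualBr Z (leftDual B) = 𝟙 _ ⊗≫ η_ (leftDual Z.X) Z.X ▷ (leftDual B ⊗ leftDual Z.X) ⊗≫
      leftDual Z.X ◁ rotInv Z.br (leftDual B) B ▷ leftDual Z.X ⊗≫
      (leftDual Z.X ⊗ leftDual B) ◁ ε_ (leftDual Z.X) Z.X ⊗≫ 𝟙 _ := by
    rw [stdLeftDualBr_eq, cosharp, ← h.inv_eq_rotInv, h.inv_eq_rotInv (leftDual B) B]
  unfold twistUnder
  rw [e]
  unfold leftDualBr rotInv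
  set V := leftDual Z.X
  set D := leftDual B
  calc _ = 𝟙 (B ⊗ V) ⊗≫ (B ◁ (𝟙 V ⊗≫ η_ D B ▷ V ⊗≫ D ◁ (β_ V B).inv) ≫
        (𝟙 B ⊗≫ B ◁ η_ V Z.X ⊗≫ (β_ B V).hom ▷ Z.X ⊗≫ V ◁ Z.br B) ▷ (D ⊗ V ⊗ B)) ⊗≫
        (V ⊗ Z.X) ◁ ε_ D B ▷ (V ⊗ B) ⊗≫ V ◁ ε_ V Z.X ▷ B ⊗≫ 𝟙 (V ⊗ B) := ?_
    _ = 𝟙 (B ⊗ V) ⊗≫ B ◁ η_ D B ▷ V ⊗≫ (B ⊗ D) ◁ (β_ V B).inv ⊗≫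
        B ◁ η_ V Z.X ▷ (D ⊗ V ⊗ B) ⊗≫ (β_ B V).hom ▷ (Z.X ⊗ D ⊗ V ⊗ B) ⊗≫
        V ◁ (B ◁ η_ D B ⊗≫ ε_ D B ▷ B) ▷ (Z.X ⊗ D ⊗ V ⊗ B) ⊗≫
        V ◁ Z.br B ▷ (D ⊗ V ⊗ B) ⊗≫ (V ⊗ Z.X) ◁ ε_ D B ▷ (V ⊗ B) ⊗≫ V ◁ ε_ V Z.X ▷ B ⊗≫
        𝟙 (V ⊗ B) := by rw [coevaluation_evaluation'']; monoidal
    _ = 𝟙 (B ⊗ V) ⊗≫ B ◁ η_ D B ▷ V ⊗≫ (B ⊗ D) ◁ (β_ V B).inv ⊗≫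
        B ◁ η_ V Z.X ▷ (D ⊗ V ⊗ B) ⊗≫ ((β_ B V).hom ▷ 𝟙_ A ≫ (V ⊗ B) ◁ η_ D B) ▷
          (Z.X ⊗ D ⊗ V ⊗ B) ⊗≫ (V ◁ ε_ D B ▷ (B ⊗ Z.X ⊗ D ⊗ V ⊗ B) ≫
        V ◁ 𝟙_ A ◁ (𝟙 (B ⊗ Z.X ⊗ D ⊗ V ⊗ B) ⊗≫
        Z.br B ▷ (D ⊗ V ⊗ B) ⊗≫ Z.X ◁ ε_ D B ▷ (V ⊗ B) ⊗≫ ε_ V Z.X ▷ B ⊗≫ 𝟙 B)) ⊗≫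
        𝟙 (V ⊗ B) := by monoidal
    _ = 𝟙 (B ⊗ V) ⊗≫ B ◁ η_ D B ▷ V ⊗≫ (B ⊗ D) ◁ (β_ V B).inv ⊗≫
        B ◁ η_ V Z.X ▷ (D ⊗ V ⊗ B) ⊗≫ (B ⊗ V) ◁ η_ D B ▷ (Z.X ⊗ D ⊗ V ⊗ B) ⊗≫
        ((β_ B V).hom ▷ (D ⊗ B ⊗ Z.X ⊗ D ⊗ V ⊗ B) ≫ (V ⊗ B) ◁ D ◁
        (𝟙 (B ⊗ Z.X ⊗ D ⊗ V ⊗ B) ⊗≫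
        Z.br B ▷ (D ⊗ V ⊗ B) ⊗≫ Z.X ◁ ε_ D B ▷ (V ⊗ B) ⊗≫ ε_ V Z.X ▷ B ⊗≫ 𝟙 B)) ⊗≫
        V ◁ ε_ D B ▷ B ⊗≫ 𝟙 (V ⊗ B) := by
        rw [← whisker_exchange, ← MonoidalCategory.whiskerLeft_comp, ← whisker_exchange]; monoidal
    _ = _ := by rw [← whisker_exchange]; monoidal
  symm
  rw [whisker_exchange]
  calc _ = 𝟙 (B ⊗ V) ⊗≫ B ◁ η_ V Z.X ▷ V ⊗≫ (β_ B V).hom ▷ (Z.X ⊗ V) ⊗≫ V ◁ Z.br B ▷ V ⊗≫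
        (V ⊗ Z.X ⊗ B) ◁ η_ D B ▷ V ⊗≫ (V ⊗ Z.X) ◁ ((B ⊗ D) ◁ (β_ V B).inv ≫ ε_ D B ▷ (V ⊗ B)) ⊗≫
        V ◁ ε_ V Z.X ▷ B ⊗≫ 𝟙 (V ⊗ B) := by monoidal
    _ = 𝟙 (B ⊗ V) ⊗≫ B ◁ η_ V Z.X ▷ V ⊗≫ (β_ B V).hom ▷ (Z.X ⊗ V) ⊗≫ V ◁ Z.br B ▷ V ⊗≫
        (V ⊗ Z.X) ◁ (B ◁ η_ D B ⊗≫ ε_ D B ▷ B) ▷ V ⊗≫ (V ⊗ Z.X) ◁ (β_ V B).inv ⊗≫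
        V ◁ ε_ V Z.X ▷ B ⊗≫ 𝟙 (V ⊗ B) := by rw [whisker_exchange]; monoidal
    _ = _ := by rw [coevaluation_evaluation'']; monoidal

theorem isHalfBraiding_leftDualBr (Z : DCenter A) :
    IsHalfBraiding (leftDual Z.X) (leftDualBr Z) := by
  rw [show leftDualBr Z = tw (isHalfBraiding_stdLeftDualBr Z) from
    funext fun B => (leftDualBr_eq_twistUnder Z B).trans (twistUnder_eq_tw _ B)]
  exact isHalfBraiding_tw _

/-- The two crossings with `^*X` become crossings with `X` when turned around the cup and the cap.
This is the identity needed to see `Z` as the right dual of its left dual, so that both kinds of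
duals are treated by one argument. -/
theorem sharp_leftDualBr (Z : DCenter A) (B : A) : sharp (leftDualBr Z) B =
    (β_ B Z.X).inv ≫ Z.br B ≫ (β_ Z.X B).hom := by
  unfold sharp leftDualBr
  set V := leftDual Z.X
  set X := Z.X
  have h1 : 𝟙 (X ⊗ B) ⊗≫ (X ⊗ B) ◁ η_ V X ⊗≫ X ◁ (β_ V B).inv ▷ X ⊗≫ ε_ V X ▷ (B ⊗ X) ⊗≫
      𝟙 (B ⊗ X) = (β_ X B).hom := by
    calc _ = 𝟙 (X ⊗ B) ⊗≫ (X ⊗ B) ◁ η_ V X ⊗≫ (𝟙 (X ⊗ B ⊗ V) ⊗≫ X ◁ (β_ V B).inv ⊗≫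
          ε_ V X ▷ B ⊗≫ 𝟙 B) ▷ X ⊗≫ 𝟙 (B ⊗ X) := by monoidal
      _ = 𝟙 (X ⊗ B) ⊗≫ ((X ⊗ B) ◁ η_ V X ≫ (β_ X B).hom ▷ (V ⊗ X)) ⊗≫ B ◁ ε_ V X ▷ X ⊗≫
          𝟙 (B ⊗ X) := by rw [braiding_inv_evaluation]; monoidal
      _ = (β_ X B).hom ⊗≫ B ◁ (X ◁ η_ V X ⊗≫ ε_ V X ▷ X) ⊗≫ 𝟙 (B ⊗ X) := by
          rw [whisker_exchange]; monoidal
      _ = _ := by rw [coevaluation_evaluation'']; monoidal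
  have h2 : 𝟙 (X ⊗ B) ⊗≫ (X ⊗ B) ◁ η_ V X ⊗≫ X ◁ (β_ B V).hom ▷ X ⊗≫ ε_ V X ▷ (B ⊗ X) ⊗≫
      𝟙 (B ⊗ X) = (β_ B X).inv := by
    calc _ = 𝟙 (X ⊗ B) ⊗≫ X ◁ (𝟙 B ⊗≫ B ◁ η_ V X ⊗≫ (β_ B V).hom ▷ X ⊗≫ 𝟙 (V ⊗ B ⊗ X)) ⊗≫
          ε_ V X ▷ (B ⊗ X) ⊗≫ 𝟙 (B ⊗ X) := by monoidal
      _ = 𝟙 (X ⊗ B) ⊗≫ X ◁ η_ V X ▷ B ⊗≫ ((X ⊗ V) ◁ (β_ B X).inv ≫ ε_ V X ▷ (B ⊗ X)) ⊗≫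
          𝟙 (B ⊗ X) := by rw [coevaluation_braiding]; monoidal
      _ = 𝟙 (X ⊗ B) ⊗≫ (X ◁ η_ V X ⊗≫ ε_ V X ▷ X) ▷ B ⊗≫ (β_ B X).inv := by
          rw [whisker_exchange]; monoidal
      _ = _ := by rw [coevaluation_evaluation'']; monoidal
  calc _ = 𝟙 (X ⊗ B) ⊗≫ ((X ⊗ B) ◁ η_ V X ≫ (𝟙 (X ⊗ B) ⊗≫ (X ⊗ B) ◁ η_ V X ⊗≫
        X ◁ (β_ B V).hom ▷ X ⊗≫ (X ⊗ V) ◁ Z.br B) ▷ (V ⊗ X)) ⊗≫ (X ⊗ V ⊗ X) ◁ (β_ V B).inv ▷ X ⊗≫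
        (X ⊗ V) ◁ ε_ V X ▷ (B ⊗ X) ⊗≫ ε_ V X ▷ (B ⊗ X) ⊗≫ 𝟙 (B ⊗ X) := by monoidal
    _ = 𝟙 (X ⊗ B) ⊗≫ (X ⊗ B) ◁ η_ V X ⊗≫ X ◁ (β_ B V).hom ▷ X ⊗≫ ((X ⊗ V) ◁ (Z.br B ⊗≫
        (X ⊗ B) ◁ η_ V X ⊗≫ X ◁ (β_ V B).inv ▷ X ⊗≫ ε_ V X ▷ (B ⊗ X) ⊗≫ 𝟙 (B ⊗ X)) ≫
        ε_ V X ▷ (B ⊗ X)) ⊗≫ 𝟙 (B ⊗ X) := by rw [whisker_exchange]; monoidal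
    _ = (𝟙 (X ⊗ B) ⊗≫ (X ⊗ B) ◁ η_ V X ⊗≫ X ◁ (β_ B V).hom ▷ X ⊗≫ ε_ V X ▷ (B ⊗ X) ⊗≫
        𝟙 (B ⊗ X)) ≫ Z.br B ≫ (𝟙 (X ⊗ B) ⊗≫ (X ⊗ B) ◁ η_ V X ⊗≫ X ◁ (β_ V B).inv ▷ X ⊗≫
        ε_ V X ▷ (B ⊗ X) ⊗≫ 𝟙 (B ⊗ X)) := by rw [whisker_exchange]; monoidal
    _ = _ := by rw [h1, h2]

end Dual

end BraidedRigid

end DualHalfBraidings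

/-! ### The unit object `I(𝟙)` as the target of a dinatural family. -/

section UnitObject

local postfix:max "ᵛ" => rightDual
local postfix:max "ᵐ" => rightAdjointMate
local infixr:70 "⊠" => tbr

open ExactPairing

set_option linter.unusedSectionVars false

section Rot

variable {A : Type u} [Category.{v} A] [MonoidalCategory A] [RightRigidCategory A]
  (P : PivotalStructure A)

/-- The rotation `C^* ⟶ D^* ⊗ B` of a morphism `D ⟶ B ⊗ C`. -/
def rot {B C D : A} (g : D ⟶ B ⊗ C) : Cᵛ ⟶ Dᵛ ⊗ B :=
  𝟙 _ ⊗≫ P.pcoev D ▷ Cᵛ ⊗≫ Dᵛ ◁ g ▷ Cᵛ ⊗≫ (Dᵛ ⊗ B) ◁ P.pev C ⊗≫ 𝟙 _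

theorem rot_precomp {B C D D' : A} (h : D' ⟶ D) (g : D ⟶ B ⊗ C) :
    rot P (h ≫ g) = rot P g ≫ hᵐ ▷ B := by
  unfold rot
  calc _ = 𝟙 _ ⊗≫ (P.pcoev D' ≫ D'ᵛ ◁ h) ▷ Cᵛ ⊗≫ D'ᵛ ◁ g ▷ Cᵛ ⊗≫ (D'ᵛ ⊗ B) ◁ P.pev C ⊗≫ 𝟙 _ := by
        monoidal
    _ = 𝟙 _ ⊗≫ P.pcoev D ▷ Cᵛ ⊗≫ (hᵐ ▷ (D ⊗ Cᵛ) ≫ D'ᵛ ◁ (g ▷ Cᵛ ⊗≫ B ◁ P.pev C)) ⊗≫ 𝟙 _ := by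
        rw [P.pcoev_naturality]; monoidal
    _ = _ := by rw [← whisker_exchange]; monoidal

theorem rot_postcomp_right {B C C' D : A} (g : D ⟶ B ⊗ C) (f : C ⟶ C') :
    rot P (g ≫ B ◁ f) = fᵐ ≫ rot P g := by
  unfold rot
  calc _ = 𝟙 _ ⊗≫ P.pcoev D ▷ C'ᵛ ⊗≫ Dᵛ ◁ g ▷ C'ᵛ ⊗≫ (Dᵛ ⊗ B) ◁ (f ▷ C'ᵛ ≫ P.pev C') ⊗≫ 𝟙 _ := by
        monoidal
    _ = 𝟙 _ ⊗≫ ((P.pcoev D ⊗≫ Dᵛ ◁ g) ▷ C'ᵛ ≫ (Dᵛ ⊗ B ⊗ C) ◁ fᵐ) ⊗≫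
          (Dᵛ ⊗ B) ◁ P.pev C ⊗≫ 𝟙 _ := by
        rw [P.pev_naturality]; monoidal
    _ = _ := by rw [← whisker_exchange]; monoidal

theorem rot_postcomp_left {B B' C D : A} (g : D ⟶ B ⊗ C) (f : B ⟶ B') :
    rot P (g ≫ f ▷ C) = rot P g ≫ Dᵛ ◁ f := by
  unfold rot
  calc _ = 𝟙 _ ⊗≫ P.pcoev D ▷ Cᵛ ⊗≫ Dᵛ ◁ g ▷ Cᵛ ⊗≫ Dᵛ ◁ (f ▷ (C ⊗ Cᵛ) ≫ B' ◁ P.pev C) ⊗≫ 𝟙 _ := by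
        monoidal
    _ = _ := by rw [← whisker_exchange]; monoidal

theorem rot_rot {B B' C D E : A} (g : D ⟶ B' ⊗ C) (h : E ⟶ B ⊗ D) :
    rot P g ≫ rot P h ▷ B' ≫ (α_ _ _ _).hom = rot P (h ≫ B ◁ g ≫ (α_ _ _ _).inv) := by
  unfold rot
  calc _ = 𝟙 _ ⊗≫ (𝟙_ A ◁ (P.pcoev D ▷ Cᵛ ⊗≫ Dᵛ ◁ g ▷ Cᵛ ⊗≫ (Dᵛ ⊗ B') ◁ P.pev C ⊗≫ 𝟙 (Dᵛ ⊗ B')) ≫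
        P.pcoev E ▷ (Dᵛ ⊗ B')) ⊗≫ Eᵛ ◁ h ▷ (Dᵛ ⊗ B') ⊗≫ (Eᵛ ⊗ B) ◁ P.pev D ▷ B' ⊗≫ 𝟙 _ := by
        monoidal
    _ = 𝟙 _ ⊗≫ P.pcoev E ▷ Cᵛ ⊗≫ ((Eᵛ ⊗ E) ◁ (𝟙 Cᵛ ⊗≫ P.pcoev D ▷ Cᵛ ⊗≫ Dᵛ ◁ g ▷ Cᵛ ⊗≫
        (Dᵛ ⊗ B') ◁ P.pev C) ≫ (Eᵛ ◁ h) ▷ ((Dᵛ ⊗ B') ⊗ 𝟙_ A)) ⊗≫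
        (Eᵛ ⊗ B) ◁ P.pev D ▷ B' ⊗≫ 𝟙 _ := by rw [whisker_exchange]; monoidal
    _ = 𝟙 _ ⊗≫ P.pcoev E ▷ Cᵛ ⊗≫ Eᵛ ◁ h ▷ Cᵛ ⊗≫ (Eᵛ ⊗ B) ◁ (𝟙 (D ⊗ Cᵛ) ⊗≫ D ◁ P.pcoev D ▷ Cᵛ ⊗≫
        ((D ⊗ Dᵛ) ◁ (g ▷ Cᵛ ⊗≫ B' ◁ P.pev C ⊗≫ 𝟙 B') ≫ P.pev D ▷ B')) ⊗≫ 𝟙 _ := by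
        rw [whisker_exchange]; monoidal
    _ = 𝟙 _ ⊗≫ P.pcoev E ▷ Cᵛ ⊗≫ Eᵛ ◁ h ▷ Cᵛ ⊗≫ (Eᵛ ⊗ B) ◁ (D ◁ P.pcoev D ⊗≫ P.pev D ▷ D) ▷ Cᵛ ⊗≫
        (Eᵛ ⊗ B) ◁ (g ▷ Cᵛ ⊗≫ B' ◁ P.pev C) ⊗≫ 𝟙 _ := by
        rw [whisker_exchange]; monoidal
    _ = _ := by rw [P.pcoev_pev]; monoidal

theorem rot_leftUnitor_inv (C : A) : rot P (λ_ C).inv = (ρ_ Cᵛ).inv := by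
  unfold rot
  calc _ = 𝟙 _ ⊗≫ (P.pcoev C ▷ Cᵛ ⊗≫ Cᵛ ◁ P.pev C) ⊗≫ 𝟙 _ := by monoidal
    _ = _ := by rw [P.pev_pcoev]; monoidal

end Rot

variable {k : Type w} [Field k] [IsAlgClosed k] {A : Type u} [Category.{v} A] [Abelian A]
  [Linear k A] [MonoidalCategory A] [MonoidalPreadditive A] [MonoidalLinear k A]
  [BraidedCategory A] [RigidCategory A] [IsFiniteSemisimple k A]
  {P : PivotalStructure A} {Irr : Type t} [Fintype Irr] (c : SimpleChoice k P Irr)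

namespace SimpleChoice

theorem rotate_eq_rot {B : A} {i j : Irr} (g : c.obj j ⟶ B ⊗ c.obj i) : c.rotate g = rot P g := rfl

theorem eq_sum_basisTo (hunit : Simple (𝟙_ A)) {V : A} {i : Irr} (f : V ⟶ c.obj i) :
    f = ∑ α, (c.dim i * c.scalar i (c.basisFrom V i α ≫ f)) • c.basisTo V i α := by
  have key : ∀ α, c.dim i * c.scalar i (c.basisFrom V i α ≫ f) =
      (Module.finBasis k (V ⟶ c.obj i)).repr f α := by
    intro α
    conv_lhs => rw [← (Module.finBasis k (V ⟶ c.obj i)).sum_repr f]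
    rw [Preadditive.comp_sum, map_sum, Finset.mul_sum, Finset.sum_eq_single α]
    · rw [Linear.comp_smul, map_smul, smul_eq_mul, mul_left_comm, ← smul_eq_mul (c.dim i), ← map_smul]
      have := c.basisFrom_basisTo hunit V i α α
      rw [if_pos rfl] at this
      rw [← basisTo, this, scalar_id, mul_one]
    · intro β _ hβ
      rw [Linear.comp_smul, map_smul, smul_eq_mul, mul_left_comm, ← smul_eq_mul (c.dim i), ← map_smul]
      have := c.basisFrom_basisTo hunit V i α β
      rw [if_neg (Ne.symm hβ)] at this
      rw [← basisTo, this, map_zero, mul_zero]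
    · simp
  simp only [key]
  exact ((Module.finBasis k (V ⟶ c.obj i)).sum_repr f).symm

theorem eq_sum_basisFrom (hunit : Simple (𝟙_ A)) {V : A} {i : Irr} (g : c.obj i ⟶ V) :
    g = ∑ α, (c.dim i * c.scalar i (g ≫ c.basisTo V i α)) • c.basisFrom V i α := by
  apply (c.compPairing_isPerfPair V i).bijective_left.injective
  refine (Module.finBasis k (V ⟶ c.obj i)).ext fun β => ?_
  change c.scalar i (_ ≫ c.basisTo V i β) = c.scalar i (_ ≫ c.basisTo V i β)
  rw [Preadditive.sum_comp, map_sum, Finset.sum_eq_single β]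
  · rw [Linear.smul_comp, map_smul, smul_eq_mul, mul_comm (c.dim i), mul_assoc,
      ← smul_eq_mul (c.dim i), ← map_smul, c.basisFrom_basisTo hunit, if_pos rfl, scalar_id, mul_one]
  · intro α _ hα
    rw [Linear.smul_comp, map_smul, smul_eq_mul, mul_comm (c.dim i), mul_assoc,
      ← smul_eq_mul (c.dim i), ← map_smul, c.basisFrom_basisTo hunit, if_neg hα, map_zero, mul_zero]
  · simp

theorem hom_eq_zero {i j : Irr} (h : i ≠ j) (f : c.obj i ⟶ c.obj j) : f = 0 := by
  by_contra hf
  have := isIso_of_hom_simple hf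
  exact h (c.eq_of_iso i j ⟨asIso f⟩)

theorem sum_basisTo_basisFrom_obj (hunit : Simple (𝟙_ A)) (i : Irr) :
    c.dim i • ∑ α, c.basisTo (c.obj i) i α ≫ c.basisFrom (c.obj i) i α = 𝟙 (c.obj i) := by
  classical
  rw [← c.sum_basisTo_basisFrom hunit (c.obj i), Finset.sum_eq_single i]
  · intro j _ hj
    rw [Finset.sum_eq_zero, smul_zero]
    intro α _
    rw [c.hom_eq_zero (Ne.symm hj) (c.basisTo (c.obj i) j α), zero_comp]
  · simp

end SimpleChoice

/-- The inclusion of a summand of `I(𝟙)`. -/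
def unitι (i : Irr) : c.obj i ⊗ (c.obj i)ᵛ ⟶ unitX c := biproduct.ι c.summand i

/-- The projection to a summand of `I(𝟙)`. -/
def unitπ (i : Irr) : unitX c ⟶ c.obj i ⊗ (c.obj i)ᵛ := biproduct.π c.summand i

theorem unitι_π_self (i : Irr) : unitι c i ≫ unitπ c i = 𝟙 _ := biproduct.ι_π_self _ _

theorem unitι_π_ne {i j : Irr} (h : i ≠ j) : unitι c i ≫ unitπ c j = 0 := biproduct.ι_π_ne _ h

theorem sum_unitπ_ι : ∑ i, unitπ c i ≫ unitι c i = 𝟙 (unitX c) := by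
  classical
  refine biproduct.hom_ext' _ _ fun j => ?_
  change unitι c j ≫ _ = unitι c j ≫ _
  rw [Preadditive.comp_sum, Finset.sum_eq_single j]
  · rw [← Category.assoc, unitι_π_self, Category.id_comp, Category.comp_id]
  · intro i _ hi
    rw [← Category.assoc, unitι_π_ne c (Ne.symm hi), zero_comp]
  · simp

theorem unitBr_def (B : A) : unitBr c B = ∑ i, ∑ j, (c.sqrtDim i * c.sqrtDim j) • ∑ α,
    B ◁ unitπ c i ≫ (𝟙 _ ⊗≫ c.node B i j α ▷ (c.obj i)ᵛ ⊗≫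
      c.obj j ◁ c.rotate (c.conode B i j α) ⊗≫ 𝟙 _) ≫ unitι c j ▷ B := rfl

/-- The canonical dinatural morphism from `C ⊗ C^*` to the underlying object of `I(𝟙)`. -/
def coendMap (C : A) : C ⊗ Cᵛ ⟶ unitX c :=
  ∑ i, c.sqrtDim i • ∑ α, (c.basisTo C i α ⊗ₘ (c.basisFrom C i α)ᵐ) ≫ unitι c i

theorem rightAdjointMate_sum {X Y : A} {ι : Type*} (s : Finset ι) (f : ι → (X ⟶ Y)) :
    (∑ i ∈ s, f i)ᵐ = ∑ i ∈ s, (f i)ᵐ := by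
  simp [rightAdjointMate, whiskerLeft_sum, sum_whiskerRight, Preadditive.comp_sum,
    Preadditive.sum_comp]

theorem rightAdjointMate_smul {X Y : A} (a : k) (f : X ⟶ Y) : (a • f)ᵐ = a • fᵐ := by
  simp [rightAdjointMate]

/-- Expanding `basisFrom ≫ h ≫ basisTo` in the basis of `Hom(C, X_i)` on one side and of `Hom(X_i,
C')` on the other produces the same matrix of coefficients. -/
theorem coendMap_dinatural (hunit : Simple (𝟙_ A)) {C C' : A} (h : C ⟶ C') :
    h ▷ C'ᵛ ≫ coendMap c C' = C ◁ hᵐ ≫ coendMap c C := by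
  simp only [coendMap, Preadditive.comp_sum, Linear.comp_smul]
  refine Finset.sum_congr rfl fun i _ => ?_
  congr 1
  have e1 : ∀ β, h ▷ C'ᵛ ≫ (c.basisTo C' i β ⊗ₘ (c.basisFrom C' i β)ᵐ) ≫ unitι c i =
      ∑ α, (c.dim i * c.scalar i (c.basisFrom C i α ≫ h ≫ c.basisTo C' i β)) •
        (c.basisTo C i α ⊗ₘ (c.basisFrom C' i β)ᵐ) ≫ unitι c i := fun β => by
    conv_lhs => rw [← Category.assoc, whiskerRight_comp_tensorHom, c.eq_sum_basisTo hunit (h ≫ c.basisTo C' i β)]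
    simp only [MonoidalCategory.tensorHom_def, sum_whiskerRight, MonoidalLinear.smul_whiskerRight,
      Preadditive.sum_comp, Linear.smul_comp]
  have e2 : ∀ α, C ◁ hᵐ ≫ (c.basisTo C i α ⊗ₘ (c.basisFrom C i α)ᵐ) ≫ unitι c i =
      ∑ β, (c.dim i * c.scalar i (c.basisFrom C i α ≫ h ≫ c.basisTo C' i β)) •
        (c.basisTo C i α ⊗ₘ (c.basisFrom C' i β)ᵐ) ≫ unitι c i := fun α => by
    conv_lhs => rw [← Category.assoc, whiskerLeft_comp_tensorHom, ← comp_rightAdjointMate,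
      c.eq_sum_basisFrom hunit (c.basisFrom C i α ≫ h)]
    simp only [rightAdjointMate_sum, rightAdjointMate_smul, MonoidalCategory.tensorHom_def,
      whiskerLeft_sum, MonoidalLinear.whiskerLeft_smul, Preadditive.comp_sum, Linear.comp_smul,
      Preadditive.sum_comp, Linear.smul_comp, Category.assoc]
  simp only [e1, e2]
  exact Finset.sum_comm

/-- At a simple object only its own summand survives and the dual bases collapse to the identity.
Hence the family `coendMap` is jointly epic, and equations out of `I(𝟙)` can be tested on all `C`
without any sums. -/
theorem coendMap_obj (hunit : Simple (𝟙_ A)) (i : Irr) :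
    c.sqrtDim i • coendMap c (c.obj i) = unitι c i := by
  classical
  rw [coendMap, Finset.sum_eq_single i]
  · have h : ∀ α, (c.basisTo (c.obj i) i α ⊗ₘ (c.basisFrom (c.obj i) i α)ᵐ) =
        c.obj i ◁ (c.basisTo (c.obj i) i α ≫ c.basisFrom (c.obj i) i α)ᵐ := fun α => by
      have e := c.scalar_smul_id i (c.basisTo (c.obj i) i α)
      rw [← e]
      simp [MonoidalCategory.tensorHom_def, rightAdjointMate_smul]
    simp only [h]
    rw [smul_smul, ← Preadditive.sum_comp, ← whiskerLeft_sum, ← rightAdjointMate_sum, ← sq,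
      ← SimpleChoice.dim, ← Linear.smul_comp, ← MonoidalLinear.whiskerLeft_smul,
      ← rightAdjointMate_smul, c.sum_basisTo_basisFrom_obj hunit]
    simp
  · intro j _ hj
    rw [Finset.sum_eq_zero, smul_zero]
    intro α _
    rw [c.hom_eq_zero (Ne.symm hj) (c.basisTo (c.obj i) j α)]
    simp
  · simp

theorem hom_ext_whiskerLeft_unitX {B Y : A} {f g : B ⊗ unitX c ⟶ Y}
    (h : ∀ i, B ◁ unitι c i ≫ f = B ◁ unitι c i ≫ g) : f = g := by
  have e : B ◁ (∑ i, unitπ c i ≫ unitι c i) = 𝟙 (B ⊗ unitX c) := by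
    rw [sum_unitπ_ι, MonoidalCategory.whiskerLeft_id]
  rw [whiskerLeft_sum] at e
  rw [← Category.id_comp f, ← Category.id_comp g, ← e]
  simp only [Preadditive.sum_comp, MonoidalCategory.whiskerLeft_comp, Category.assoc, h]

theorem hom_ext_whiskerRight_unitX {B Y : A} {f g : unitX c ⊗ B ⟶ Y}
    (h : ∀ i, unitι c i ▷ B ≫ f = unitι c i ▷ B ≫ g) : f = g := by
  have e : (∑ i, unitπ c i ≫ unitι c i) ▷ B = 𝟙 (unitX c ⊗ B) := by
    rw [sum_unitπ_ι, id_whiskerRight]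
  rw [sum_whiskerRight] at e
  rw [← Category.id_comp f, ← Category.id_comp g, ← e]
  simp only [Preadditive.sum_comp, MonoidalCategory.comp_whiskerRight, Category.assoc, h]

theorem hom_ext_whiskerLeft_coendMap (hunit : Simple (𝟙_ A)) {B Y : A} {f g : B ⊗ unitX c ⟶ Y}
    (h : ∀ C, B ◁ coendMap c C ≫ f = B ◁ coendMap c C ≫ g) : f = g :=
  hom_ext_whiskerLeft_unitX c fun i => by
    rw [← coendMap_obj c hunit]
    simp only [MonoidalLinear.whiskerLeft_smul, Linear.smul_comp, h]

theorem hom_ext_whiskerRight_coendMap (hunit : Simple (𝟙_ A)) {B Y : A} {f g : unitX c ⊗ B ⟶ Y}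
    (h : ∀ C, coendMap c C ▷ B ≫ f = coendMap c C ▷ B ≫ g) : f = g :=
  hom_ext_whiskerRight_unitX c fun i => by
    rw [← coendMap_obj c hunit]
    simp only [MonoidalLinear.smul_whiskerRight, Linear.smul_comp, h]

/-- The half-braiding of `I(𝟙)`, restricted along the dinatural morphism. -/
def coendBr (B C : A) : B ⊗ (C ⊗ Cᵛ) ⟶ unitX c ⊗ B :=
  𝟙 _ ⊗≫ (B ⊗ C) ◁ rot P (𝟙 (B ⊗ C)) ⊗≫ coendMap c (B ⊗ C) ▷ B

theorem coendBr_comp (hunit : Simple (𝟙_ A)) {B C C' : A} (f : C ⟶ C') (g : C' ⟶ C) :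
    B ◁ (f ⊗ₘ gᵐ) ≫ coendBr c B C' =
      𝟙 _ ⊗≫ (B ⊗ C) ◁ rot P (B ◁ (f ≫ g)) ⊗≫ coendMap c (B ⊗ C) ▷ B := by
  have h1 := coendMap_dinatural c hunit (B ◁ f)
  have h2 : gᵐ ≫ rot P (𝟙 (B ⊗ C')) = rot P (B ◁ g) := by
    rw [← rot_postcomp_right, Category.id_comp]
  have h3 := rot_precomp P (B ◁ f) (B ◁ g)
  rw [← MonoidalCategory.whiskerLeft_comp] at h3
  unfold coendBr
  calc _ = 𝟙 _ ⊗≫ (((B ◁ f) ▷ Cᵛ) ≫ (B ⊗ C') ◁ (gᵐ ≫ rot P (𝟙 (B ⊗ C')))) ⊗≫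
        coendMap c (B ⊗ C') ▷ B := by
        rw [MonoidalCategory.tensorHom_def]; monoidal
    _ = 𝟙 _ ⊗≫ (B ⊗ C) ◁ rot P (B ◁ g) ⊗≫ ((B ◁ f) ▷ (B ⊗ C')ᵛ ≫
        coendMap c (B ⊗ C')) ▷ B := by
        rw [h2, ← whisker_exchange]; monoidal
    _ = _ := by rw [h1, h3]; monoidal

/-- The rotated conode factors as the rotated identity of `B ⊗ X_i` followed by a dual morphism. The
sum over `j` and over the nodes is then, term by term, the sum that defines `coendMap c (B ⊗ X_i)`.
-/
theorem ι_unitBr (B : A) (i : Irr) :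
    B ◁ unitι c i ≫ unitBr c B = c.sqrtDim i • coendBr c B (c.obj i) := by
  classical
  have h : ∀ j α, (𝟙 (B ⊗ c.obj i ⊗ (c.obj i)ᵛ) ⊗≫ c.node B i j α ▷ (c.obj i)ᵛ ⊗≫
      c.obj j ◁ c.rotate (c.conode B i j α) ⊗≫ 𝟙 ((c.obj j ⊗ (c.obj j)ᵛ) ⊗ B)) ≫
      unitι c j ▷ B =
      𝟙 _ ⊗≫ (B ⊗ c.obj i) ◁ rot P (𝟙 (B ⊗ c.obj i)) ⊗≫ ((c.basisTo (B ⊗ c.obj i) j α ⊗ₘ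
        (c.basisFrom (B ⊗ c.obj i) j α)ᵐ) ≫ unitι c j) ▷ B := fun j α => by
    rw [SimpleChoice.rotate_eq_rot, SimpleChoice.node_eq, SimpleChoice.conode_eq,
      ← Category.comp_id (c.basisFrom _ _ _), rot_precomp, Category.comp_id,
      MonoidalCategory.tensorHom_def]
    calc _ = 𝟙 _ ⊗≫ (c.basisTo (B ⊗ c.obj i) j α ▷ (c.obj i)ᵛ ≫ c.obj j ◁
          rot P (𝟙 (B ⊗ c.obj i))) ⊗≫ (c.obj j ◁ (c.basisFrom (B ⊗ c.obj i) j α)ᵐ) ▷ B ⊗≫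
          unitι c j ▷ B := by monoidal
      _ = _ := by rw [← whisker_exchange]; monoidal
  rw [unitBr_def]
  simp only [Preadditive.comp_sum, Linear.comp_smul]
  rw [Finset.sum_eq_single i]
  · have e : ∀ Y (g : B ⊗ c.summand i ⟶ Y), B ◁ unitι c i ≫
        B ◁ unitπ c i ≫ g = g := fun Y g => by
      rw [← MonoidalCategory.whiskerLeft_comp_assoc, unitι_π_self]; simp
    simp only [e, h, coendBr, coendMap, ← smul_smul, ← Finset.smul_sum]
    congr 1
    simp [monoidalComp, Preadditive.comp_sum, sum_whiskerRight]
  · intro j _ hj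
    have e : ∀ Y (g : B ⊗ c.summand j ⟶ Y), B ◁ unitι c i ≫
        B ◁ unitπ c j ≫ g = 0 := fun Y g => by
      rw [← MonoidalCategory.whiskerLeft_comp_assoc, unitι_π_ne c (Ne.symm hj)]; simp
    simp only [e, Finset.sum_const_zero, smul_zero]
  · simp

theorem coendMap_unitBr (hunit : Simple (𝟙_ A)) (B C : A) :
    B ◁ coendMap c C ≫ unitBr c B = coendBr c B C := by
  have h : ∀ i α, B ◁ ((c.basisTo C i α ⊗ₘ (c.basisFrom C i α)ᵐ) ≫ unitι c i) ≫
      unitBr c B = c.sqrtDim i • (𝟙 _ ⊗≫ (B ⊗ C) ◁ rot P (B ◁ (c.basisTo C i α ≫ c.basisFrom C i α))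
        ⊗≫ coendMap c (B ⊗ C) ▷ B) := fun i α => by
    rw [MonoidalCategory.whiskerLeft_comp, Category.assoc, ι_unitBr, Linear.comp_smul,
      coendBr_comp c hunit]
  conv_lhs => rw [coendMap]
  simp only [whiskerLeft_sum, MonoidalLinear.whiskerLeft_smul, Preadditive.sum_comp,
    Linear.smul_comp, h, ← Finset.smul_sum, smul_smul, ← sq]
  have e : rot P (𝟙 (B ⊗ C)) =
      rot P (B ◁ ∑ i, c.dim i • ∑ α, c.basisTo C i α ≫ c.basisFrom C i α) := by
    rw [c.sum_basisTo_basisFrom hunit C, MonoidalCategory.whiskerLeft_id]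
  unfold coendBr
  rw [e]
  simp [rot, monoidalComp, whiskerLeft_sum, sum_whiskerRight, Preadditive.comp_sum,
    Preadditive.sum_comp, SimpleChoice.dim]

/-- On the dinatural family the half-braiding absorbs `B`: it passes from the component at `C` to
the one at `B ⊗ C` and lets `B` out on the right by a rotation. The axioms become dinaturality along
`f ▷ C`, along the associator and along the unitor, together with functoriality of rotation. -/
theorem isHalfBraiding_unitBr (hunit : Simple (𝟙_ A)) : IsHalfBraiding (unitX c) (unitBr c) := by
  refine IsHalfBraiding.of_unit (fun {B B'} f => ?_) (fun B B' => ?_) ?_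
  · refine hom_ext_whiskerLeft_coendMap c hunit fun C => ?_
    rw [whisker_exchange_assoc, coendMap_unitBr c hunit, reassoc_of% coendMap_unitBr c hunit B C]
    have h1 := coendMap_dinatural c hunit (f ▷ C)
    have h2 : rot P (𝟙 (B' ⊗ C)) ≫ (f ▷ C)ᵐ ▷ B' = rot P (𝟙 (B ⊗ C)) ≫ (B ⊗ C)ᵛ ◁ f := by
      rw [← rot_precomp, ← rot_postcomp_left, Category.comp_id, Category.id_comp]
    unfold coendBr
    calc _ = 𝟙 _ ⊗≫ ((f ▷ C) ▷ Cᵛ ≫ (B' ⊗ C) ◁ rot P (𝟙 (B' ⊗ C))) ⊗≫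
          coendMap c (B' ⊗ C) ▷ B' := by monoidal
      _ = 𝟙 _ ⊗≫ (B ⊗ C) ◁ rot P (𝟙 (B' ⊗ C)) ⊗≫ ((f ▷ C) ▷ (B' ⊗ C)ᵛ ≫
          coendMap c (B' ⊗ C)) ▷ B' := by rw [← whisker_exchange]; monoidal
      _ = 𝟙 _ ⊗≫ (B ⊗ C) ◁ (rot P (𝟙 (B' ⊗ C)) ≫ (f ▷ C)ᵐ ▷ B') ⊗≫
          coendMap c (B ⊗ C) ▷ B' := by rw [h1]; monoidal
      _ = 𝟙 _ ⊗≫ (B ⊗ C) ◁ rot P (𝟙 (B ⊗ C)) ⊗≫ (((B ⊗ C) ⊗ (B ⊗ C)ᵛ) ◁ f ≫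
          coendMap c (B ⊗ C) ▷ B') := by rw [h2]; monoidal
      _ = _ := by rw [whisker_exchange]; monoidal
  · refine hom_ext_whiskerLeft_coendMap c hunit fun C => ?_
    rw [coendMap_unitBr c hunit]
    have h1 := coendMap_unitBr c hunit B' C
    have h2 := coendMap_unitBr c hunit B (B' ⊗ C)
    have h3 := rot_rot P (𝟙 (B' ⊗ C)) (𝟙 (B ⊗ B' ⊗ C))
    have h4 : rot P (𝟙 (B ⊗ B' ⊗ C) ≫ B ◁ 𝟙 (B' ⊗ C) ≫ (α_ B B' C).inv) ≫ ((α_ B B' C).hom)ᵐ ▷ (B ⊗ B') =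
        rot P (𝟙 ((B ⊗ B') ⊗ C)) := by
      rw [← rot_precomp]; simp
    have h5 := coendMap_dinatural c hunit (α_ B B' C).hom
    symm
    calc _ = 𝟙 _ ⊗≫ B ◁ (B' ◁ coendMap c C ≫ unitBr c B') ⊗≫ unitBr c B ▷ B' ⊗≫ 𝟙 _ := by monoidal
      _ = 𝟙 _ ⊗≫ (B ⊗ B' ⊗ C) ◁ rot P (𝟙 (B' ⊗ C)) ⊗≫ (B ◁ coendMap c (B' ⊗ C) ≫ unitBr c B) ▷ B' ⊗≫
          𝟙 _ := by rw [h1, coendBr]; monoidal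
      _ = 𝟙 _ ⊗≫ (α_ B B' C).hom ▷ Cᵛ ⊗≫ (B ⊗ B' ⊗ C) ◁ (rot P (𝟙 (B' ⊗ C)) ≫
          rot P (𝟙 (B ⊗ B' ⊗ C)) ▷ B' ≫ (α_ _ _ _).hom) ⊗≫
          coendMap c (B ⊗ B' ⊗ C) ▷ (B ⊗ B') := by rw [h2, coendBr]; monoidal
      _ = 𝟙 _ ⊗≫ ((α_ B B' C).hom ▷ Cᵛ ≫ (B ⊗ B' ⊗ C) ◁ rot P (𝟙 (B ⊗ B' ⊗ C) ≫
            B ◁ 𝟙 (B' ⊗ C) ≫ (α_ B B' C).inv)) ⊗≫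
          coendMap c (B ⊗ B' ⊗ C) ▷ (B ⊗ B') := by rw [h3]; monoidal
      _ = 𝟙 _ ⊗≫ ((B ⊗ B') ⊗ C) ◁ rot P (𝟙 (B ⊗ B' ⊗ C) ≫
            B ◁ 𝟙 (B' ⊗ C) ≫ (α_ B B' C).inv) ⊗≫ ((α_ B B' C).hom ▷ (B ⊗ B' ⊗ C)ᵛ ≫
          coendMap c (B ⊗ B' ⊗ C)) ▷ (B ⊗ B') := by rw [← whisker_exchange]; monoidal
      _ = 𝟙 _ ⊗≫ ((B ⊗ B') ⊗ C) ◁ (rot P (𝟙 (B ⊗ B' ⊗ C) ≫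
            B ◁ 𝟙 (B' ⊗ C) ≫ (α_ B B' C).inv) ≫ ((α_ B B' C).hom)ᵐ ▷ (B ⊗ B')) ⊗≫
          coendMap c ((B ⊗ B') ⊗ C) ▷ (B ⊗ B') := by rw [h5]; monoidal
      _ = _ := by rw [h4, coendBr]; monoidal
  · refine hom_ext_whiskerLeft_coendMap c hunit fun C => ?_
    rw [coendMap_unitBr c hunit]
    have h5 := coendMap_dinatural c hunit (λ_ C).hom
    have h4 : rot P (𝟙 (𝟙_ A ⊗ C)) = (ρ_ Cᵛ).inv ≫ ((λ_ C).hom)ᵐ ▷ 𝟙_ A := by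
      rw [← rot_leftUnitor_inv P, ← rot_precomp, Iso.hom_inv_id]
    rw [coendBr, h4]
    calc _ = 𝟙 _ ⊗≫ ((𝟙_ A ⊗ C) ◁ ((λ_ C).hom)ᵐ ≫ coendMap c (𝟙_ A ⊗ C)) ⊗≫ 𝟙 _ := by monoidal
      _ = 𝟙 _ ⊗≫ coendMap c C ⊗≫ 𝟙 _ := by rw [← h5]; monoidal
      _ = _ := by monoidal

variable (A) in
/-- The dual of the unit object given by the rigid structure. -/
abbrev unitDual : A := @rightDual A _ _ (𝟙_ A) (RightRigidCategory.rightDual (𝟙_ A))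

/-- The inverse of the evaluation `𝟙 ⊗ 𝟙^* ⟶ 𝟙`. -/
def unitCoev (P : PivotalStructure A) : 𝟙_ A ⟶ 𝟙_ A ⊗ unitDual A :=
  P.pcoev (𝟙_ A) ⊗≫ 𝟙 (𝟙_ A ⊗ unitDual A)

theorem unitCoev_pev : unitCoev P ≫ P.pev (𝟙_ A) = 𝟙 (𝟙_ A) := by
  unfold unitCoev
  calc _ = 𝟙 _ ⊗≫ (𝟙_ A ◁ P.pcoev (𝟙_ A) ⊗≫ P.pev (𝟙_ A) ▷ 𝟙_ A) ⊗≫ 𝟙 (𝟙_ A) := by monoidal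
    _ = 𝟙 _ ⊗≫ 𝟙 (𝟙_ A) := by
        have h : 𝟙_ A ◁ P.pcoev (𝟙_ A) ⊗≫ P.pev (𝟙_ A) ▷ 𝟙_ A = ⊗𝟙.hom := by
          refine Eq.trans ?_ ((P.pcoev_pev (𝟙_ A)).trans ?_) <;> monoidal
        rw [h]; monoidal
    _ = _ := by monoidal

/-- The canonical morphism from the unit object to the underlying object of `I(𝟙)`. -/
def unitIncl : 𝟙_ A ⟶ unitX c := unitCoev P ≫ coendMap c (𝟙_ A)

theorem unitIncl_unitBr (hunit : Simple (𝟙_ A)) (C : A) : C ◁ unitIncl c ≫ unitBr c C =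
    𝟙 (C ⊗ 𝟙_ A) ⊗≫ C ◁ P.pcoev C ⊗≫ coendMap c C ▷ C := by
  have h1 := coendMap_unitBr c hunit C (𝟙_ A)
  have h2 : rot P (𝟙 (C ⊗ 𝟙_ A)) = rot P (ρ_ C).inv ≫ ((ρ_ C).hom)ᵐ ▷ C := by
    rw [← rot_precomp, Iso.hom_inv_id]
  have h3 := coendMap_dinatural c hunit (ρ_ C).hom
  have h4 : 𝟙 (𝟙_ A) ⊗≫ unitCoev P ⊗≫ 𝟙_ A ◁ rot P (ρ_ C).inv ⊗≫ 𝟙 (Cᵛ ⊗ C) = P.pcoev C := by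
    unfold rot
    calc _ = 𝟙 _ ⊗≫ (𝟙_ A ◁ unitCoev P ≫ P.pcoev C ▷ (𝟙_ A ⊗ unitDual A)) ⊗≫
          (Cᵛ ⊗ C) ◁ P.pev (𝟙_ A) ⊗≫ 𝟙 _ := by monoidal
      _ = 𝟙 _ ⊗≫ P.pcoev C ⊗≫ (Cᵛ ⊗ C) ◁ (unitCoev P ≫ P.pev (𝟙_ A)) ⊗≫ 𝟙 _ := by
          rw [whisker_exchange]; monoidal
      _ = _ := by rw [unitCoev_pev]; monoidal
  rw [unitIncl, MonoidalCategory.whiskerLeft_comp, Category.assoc, h1, coendBr, h2]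
  calc _ = 𝟙 _ ⊗≫ C ◁ unitCoev P ⊗≫ C ◁ rot P (ρ_ C).inv ⊗≫
        ((C ⊗ 𝟙_ A) ◁ ((ρ_ C).hom)ᵐ ≫ coendMap c (C ⊗ 𝟙_ A)) ▷ C := by monoidal
    _ = 𝟙 _ ⊗≫ C ◁ (𝟙 (𝟙_ A) ⊗≫ unitCoev P ⊗≫ 𝟙_ A ◁ rot P (ρ_ C).inv ⊗≫ 𝟙 (Cᵛ ⊗ C)) ⊗≫
        coendMap c C ▷ C := by rw [← h3]; monoidal
    _ = _ := by rw [h4]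

/-- The whole dinatural family is generated from `𝟙 ⟶ I(𝟙)` by the half-braiding. This is the
freeness of `I(𝟙)` on the unit object. -/
theorem coendMap_eq (hunit : Simple (𝟙_ A)) (C : A) : coendMap c C =
    𝟙 (C ⊗ Cᵛ) ⊗≫ C ◁ unitIncl c ▷ Cᵛ ⊗≫ unitBr c C ▷ Cᵛ ⊗≫ unitX c ◁ P.pev C ⊗≫ 𝟙 (unitX c) := by
  have h1 := unitIncl_unitBr c hunit C
  symm
  calc _ = 𝟙 (C ⊗ Cᵛ) ⊗≫ (C ◁ unitIncl c ≫ unitBr c C) ▷ Cᵛ ⊗≫ unitX c ◁ P.pev C ⊗≫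
        𝟙 (unitX c) := by monoidal
    _ = 𝟙 (C ⊗ Cᵛ) ⊗≫ C ◁ P.pcoev C ▷ Cᵛ ⊗≫ (coendMap c C ▷ (C ⊗ Cᵛ) ≫ unitX c ◁ P.pev C) ⊗≫
        𝟙 (unitX c) := by rw [h1]; monoidal
    _ = 𝟙 (C ⊗ Cᵛ) ⊗≫ C ◁ (P.pcoev C ▷ Cᵛ ⊗≫ Cᵛ ◁ P.pev C) ⊗≫ coendMap c C := by
        rw [← whisker_exchange]; monoidal
    _ = _ := by rw [P.pev_pcoev]; monoidal

variable [CharZero k] in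
theorem objectsDefined (hunit : Simple (𝟙_ A)) (hP : P.IsSpherical) : ObjectsDefined c where
  idempotent Z W := Q_idem c Z W hunit hP
  commute Z W B := Q_commute c Z W hunit B
  tensor Z W := isHalfBraiding_redBrRes c Z W hunit hP
  unit := isHalfBraiding_unitBr c hunit
  dual := isHalfBraiding_dualBr
  leftDual := isHalfBraiding_leftDualBr

end UnitObject

/-! ### Associativity of the reduced tensor product. -/

section Associativity

local infixr:70 "⊠" => tbr

set_option linter.unusedSectionVars false

variable {k : Type w} [Field k] [IsAlgClosed k] [CharZero k] {A : Type u} [Category.{v} A] [Abelian A]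
  [Linear k A] [MonoidalCategory A] [MonoidalPreadditive A] [MonoidalLinear k A]
  [BraidedCategory A] [RigidCategory A] [IsFiniteSemisimple k A]
  {P : PivotalStructure A} {Irr : Type t} [Fintype Irr] {c : SimpleChoice k P Irr}
  (hunit : Simple (𝟙_ A)) (hP : P.IsSpherical) (h : ObjectsDefined c)

/-- The inclusion of the underlying object of the reduced tensor product. -/
def redIncl (Z W : DCenter A) : (redTensor h Z W).X ⟶ Z.X ⊗ W.X := incl c Z W

/-- The projection to the underlying object of the reduced tensor product. -/
def redProj (Z W : DCenter A) : Z.X ⊗ W.X ⟶ (redTensor h Z W).X := proj c Z W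

instance (Z W : DCenter A) : Epi (redProj h Z W) := inferInstanceAs (Epi (factorThruImage _))

section Basic

variable (Z W : DCenter A)

theorem redProj_redIncl : redProj h Z W ≫ redIncl h Z W = Q c Z W := proj_incl c Z W

theorem redProj_redIncl_assoc {V : A} (f : Z.X ⊗ W.X ⟶ V) :
    redProj h Z W ≫ redIncl h Z W ≫ f = Q c Z W ≫ f := by
  rw [← Category.assoc, redProj_redIncl]

theorem redIncl_redProj (hunit : Simple (𝟙_ A)) (hP : P.IsSpherical) :
    redIncl h Z W ≫ redProj h Z W = 𝟙 (redTensor h Z W).X := incl_proj c Z W hunit hP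

theorem Q_redProj (hunit : Simple (𝟙_ A)) (hP : P.IsSpherical) :
    Q c Z W ≫ redProj h Z W = redProj h Z W := Q_proj c Z W hunit hP

theorem redIncl_cent_rho (hunit : Simple (𝟙_ A)) (hP : P.IsSpherical) :
    Cent (redTensor h Z W).br (rho Z W) (redIncl h Z W) := incl_cent_rho c Z W hunit hP

theorem redIncl_cent_sig (hunit : Simple (𝟙_ A)) (hP : P.IsSpherical) :
    Cent (redTensor h Z W).br (sig Z W) (redIncl h Z W) := incl_cent_sig c Z W hunit hP

theorem redProj_cent_rho (hunit : Simple (𝟙_ A)) (hP : P.IsSpherical) :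
    Cent (rho Z W) (redTensor h Z W).br (redProj h Z W) := proj_cent_rho c Z W hunit hP

theorem redProj_cent_sig (hunit : Simple (𝟙_ A)) (hP : P.IsSpherical) :
    Cent (sig Z W) (redTensor h Z W).br (redProj h Z W) := proj_cent_sig c Z W hunit hP

end Basic

/-- The restriction of `f ⊗ g` to the reduced tensor products. -/
def redMap {Z Z' W W' : DCenter A} (f : Z ⟶ Z') (g : W ⟶ W') :
    (redTensor h Z W).X ⟶ (redTensor h Z' W').X :=
  redIncl h Z W ≫ (f.f ⊗ₘ g.f) ≫ redProj h Z' W'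

theorem redMap_cent (hunit : Simple (𝟙_ A)) (hP : P.IsSpherical)
    {Z Z' W W' : DCenter A} (f : Z ⟶ Z') (g : W ⟶ W') :
    Cent (redTensor h Z W).br (redTensor h Z' W').br (redMap h f g) :=
  (redIncl_cent_rho h Z W hunit hP).comp ((Cent.tensorHom f.central (Cent.minus g.f)).comp
    (redProj_cent_rho h Z' W' hunit hP))

variable (Z₁ Z₂ Z₃ : DCenter A)

/-- The loop for `R` and `Z₃` is moved through `p`, where it meets `Z₁` and `Z₂`. Since `p` is
central for `sig`, the strand `Z₁` carries `plus` throughout and drops out of the loop, which then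
links only `Z₂` and `Z₃`. In `Q_whiskerLeft` it is `Z₃` that carries `minus` and drops out. -/
theorem whiskerRight_Q {R : DCenter A} {p : Z₁.X ⊗ Z₂.X ⟶ R.X} (hp : Cent (sig Z₁ Z₂) R.br p) :
    p ▷ Z₃.X ≫ Q c R Z₃ = (α_ _ _ _).hom ≫ Z₁.X ◁ Q c Z₂ Z₃ ≫ (α_ _ _ _).inv ≫ p ▷ Z₃.X := by
  have h1 : Cent ((plus Z₁.X ⊠ plus Z₂.X) ⊠ Z₃.br) (sig R Z₃) (p ▷ Z₃.X) := by
    rw [tbr_plus]; exact (Cent.plus _).whiskerRight _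
  have h2 : Cent ((plus Z₁.X ⊠ Z₂.br) ⊠ minus Z₃.X) (rho R Z₃) (p ▷ Z₃.X) := hp.whiskerRight _
  have h3 := h2.avg_comp c (γ := (plus Z₁.X ⊠ plus Z₂.X) ⊠ Z₃.br) (𝟙 _)
  have h4 := (Cent.assoc (plus Z₁.X) (plus Z₂.X) Z₃.br).comp_avg c
    (μ := (plus Z₁.X ⊠ Z₂.br) ⊠ minus Z₃.X) (α_ _ _ _).inv
  have h5 := (Cent.assoc_inv (plus Z₁.X) Z₂.br (minus Z₃.X)).avg_comp c
    (γ := plus Z₁.X ⊠ (plus Z₂.X ⊠ Z₃.br)) (𝟙 _)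
  rw [Q_eq_avg, Q_eq_avg, h1.comp_avg c, Category.comp_id, ← avg_plus_whiskerLeft]
  rw [Category.id_comp] at h3 h5
  rw [Iso.hom_inv_id] at h4
  rw [← h3, ← h4, ← h5, MonoidalCategory.whiskerLeft_id]
  simp

theorem Q_whiskerLeft {R : DCenter A} {i : R.X ⟶ Z₂.X ⊗ Z₃.X} (hi : Cent R.br (rho Z₂ Z₃) i) :
    Q c Z₁ R ≫ Z₁.X ◁ i = Z₁.X ◁ i ≫ (α_ _ _ _).inv ≫ Q c Z₁ Z₂ ▷ Z₃.X ≫ (α_ _ _ _).hom := by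
  have h1 : Cent (rho Z₁ R) (Z₁.br ⊠ (minus Z₂.X ⊠ minus Z₃.X)) (Z₁.X ◁ i) := by
    rw [tbr_minus]; exact (Cent.minus _).whiskerLeft _
  have h2 : Cent (sig Z₁ R) (plus Z₁.X ⊠ (Z₂.br ⊠ minus Z₃.X)) (Z₁.X ◁ i) := hi.whiskerLeft _
  have h3 := h2.comp_avg c (μ := Z₁.br ⊠ (minus Z₂.X ⊠ minus Z₃.X)) (𝟙 _)
  have h4 := (Cent.assoc_inv (plus Z₁.X) Z₂.br (minus Z₃.X)).comp_avg c
    (μ := Z₁.br ⊠ (minus Z₂.X ⊠ minus Z₃.X)) (α_ _ _ _).hom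
  have h5 := (Cent.assoc Z₁.br (minus Z₂.X) (minus Z₃.X)).avg_comp c
    (γ := (plus Z₁.X ⊠ Z₂.br) ⊠ minus Z₃.X) (𝟙 _)
  have h6 := avg_minus_whiskerRight c (γ := sig Z₁ Z₂) (μ := rho Z₁ Z₂) Z₃.X (𝟙 _)
  rw [Q_eq_avg, Q_eq_avg, h1.avg_comp c, Category.id_comp, ← h6]
  rw [Category.comp_id] at h3
  rw [Category.id_comp] at h5
  rw [Iso.inv_hom_id] at h4
  rw [← h3, ← h4, ← h5, id_whiskerRight]

/-- The projection to `(Z₁ ⊗̄ Z₂) ⊗̄ Z₃`. -/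
def projLeft : (Z₁.X ⊗ Z₂.X) ⊗ Z₃.X ⟶ (redTensor h (redTensor h Z₁ Z₂) Z₃).X :=
  redProj h Z₁ Z₂ ▷ Z₃.X ≫ redProj h (redTensor h Z₁ Z₂) Z₃

/-- The projection to `Z₁ ⊗̄ (Z₂ ⊗̄ Z₃)`. -/
def projRight : Z₁.X ⊗ (Z₂.X ⊗ Z₃.X) ⟶ (redTensor h Z₁ (redTensor h Z₂ Z₃)).X :=
  Z₁.X ◁ redProj h Z₂ Z₃ ≫ redProj h Z₁ (redTensor h Z₂ Z₃)

theorem inclLeft_eq : inclLeft h Z₁ Z₂ Z₃ =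
    redIncl h (redTensor h Z₁ Z₂) Z₃ ≫ redIncl h Z₁ Z₂ ▷ Z₃.X := rfl

theorem inclRight_eq : inclRight h Z₁ Z₂ Z₃ =
    redIncl h Z₁ (redTensor h Z₂ Z₃) ≫ Z₁.X ◁ redIncl h Z₂ Z₃ := rfl

theorem inclLeft_projLeft (hunit : Simple (𝟙_ A)) (hP : P.IsSpherical) :
    inclLeft h Z₁ Z₂ Z₃ ≫ projLeft h Z₁ Z₂ Z₃ = 𝟙 _ := by
  rw [inclLeft_eq, projLeft, Category.assoc, ← comp_whiskerRight_assoc,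
    redIncl_redProj h _ _ hunit hP, id_whiskerRight, Category.id_comp,
    redIncl_redProj h _ _ hunit hP]

theorem inclRight_projRight (hunit : Simple (𝟙_ A)) (hP : P.IsSpherical) :
    inclRight h Z₁ Z₂ Z₃ ≫ projRight h Z₁ Z₂ Z₃ = 𝟙 _ := by
  rw [inclRight_eq, projRight, Category.assoc, ← MonoidalCategory.whiskerLeft_comp_assoc,
    redIncl_redProj h _ _ hunit hP, MonoidalCategory.whiskerLeft_id, Category.id_comp,
    redIncl_redProj h _ _ hunit hP]

/-- The idempotent that cuts out the left bracketing is `Q` on the last two factors followed by `Q`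
on the first two. The right bracketing gives the same one up to the associator
(`projRight_inclRight`), hence the associator restricts to an isomorphism. -/
theorem projLeft_inclLeft (hunit : Simple (𝟙_ A)) (hP : P.IsSpherical) :
    projLeft h Z₁ Z₂ Z₃ ≫ inclLeft h Z₁ Z₂ Z₃ =
      (α_ _ _ _).hom ≫ Z₁.X ◁ Q c Z₂ Z₃ ≫ (α_ _ _ _).inv ≫ Q c Z₁ Z₂ ▷ Z₃.X := by
  rw [projLeft, inclLeft_eq, Category.assoc, redProj_redIncl_assoc,
    reassoc_of% whiskerRight_Q (c := c) Z₁ Z₂ Z₃ (redProj_cent_sig h Z₁ Z₂ hunit hP),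
    ← comp_whiskerRight, redProj_redIncl]

theorem projRight_inclRight (hunit : Simple (𝟙_ A)) (hP : P.IsSpherical) :
    projRight h Z₁ Z₂ Z₃ ≫ inclRight h Z₁ Z₂ Z₃ =
      Z₁.X ◁ Q c Z₂ Z₃ ≫ (α_ _ _ _).inv ≫ Q c Z₁ Z₂ ▷ Z₃.X ≫ (α_ _ _ _).hom := by
  rw [projRight, inclRight_eq, Category.assoc, redProj_redIncl_assoc,
    Q_whiskerLeft (c := c) Z₁ Z₂ Z₃ (redIncl_cent_rho h Z₂ Z₃ hunit hP),
    ← MonoidalCategory.whiskerLeft_comp_assoc, redProj_redIncl]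

theorem projLeft_inclLeft_assoc' (hunit : Simple (𝟙_ A)) (hP : P.IsSpherical) :
    projLeft h Z₁ Z₂ Z₃ ≫ inclLeft h Z₁ Z₂ Z₃ ≫ (α_ _ _ _).hom =
      (α_ _ _ _).hom ≫ projRight h Z₁ Z₂ Z₃ ≫ inclRight h Z₁ Z₂ Z₃ := by
  rw [reassoc_of% projLeft_inclLeft h Z₁ Z₂ Z₃ hunit hP, projRight_inclRight h Z₁ Z₂ Z₃ hunit hP]

theorem redAssoc_eq : redAssoc h Z₁ Z₂ Z₃ =
    inclLeft h Z₁ Z₂ Z₃ ≫ (α_ _ _ _).hom ≫ projRight h Z₁ Z₂ Z₃ := rfl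

theorem projLeft_redAssoc (hunit : Simple (𝟙_ A)) (hP : P.IsSpherical) :
    projLeft h Z₁ Z₂ Z₃ ≫ redAssoc h Z₁ Z₂ Z₃ = (α_ _ _ _).hom ≫ projRight h Z₁ Z₂ Z₃ := by
  rw [redAssoc_eq, reassoc_of% projLeft_inclLeft_assoc' h Z₁ Z₂ Z₃ hunit hP,
    inclRight_projRight h Z₁ Z₂ Z₃ hunit hP, Category.comp_id]

theorem redAssoc_inclRight (hunit : Simple (𝟙_ A)) (hP : P.IsSpherical) :
    redAssoc h Z₁ Z₂ Z₃ ≫ inclRight h Z₁ Z₂ Z₃ = inclLeft h Z₁ Z₂ Z₃ ≫ (α_ _ _ _).hom := by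
  rw [redAssoc_eq, Category.assoc, Category.assoc,
    ← projLeft_inclLeft_assoc' h Z₁ Z₂ Z₃ hunit hP,
    reassoc_of% inclLeft_projLeft h Z₁ Z₂ Z₃ hunit hP]

theorem redAssoc_isIso (hunit : Simple (𝟙_ A)) (hP : P.IsSpherical) :
    IsIso (redAssoc h Z₁ Z₂ Z₃) := by
  refine ⟨inclRight h Z₁ Z₂ Z₃ ≫ (α_ _ _ _).inv ≫ projLeft h Z₁ Z₂ Z₃, ?_, ?_⟩
  · rw [reassoc_of% redAssoc_inclRight h Z₁ Z₂ Z₃ hunit hP, Iso.hom_inv_id_assoc,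
      inclLeft_projLeft h Z₁ Z₂ Z₃ hunit hP]
  · rw [Category.assoc, Category.assoc, projLeft_redAssoc h Z₁ Z₂ Z₃ hunit hP,
      Iso.inv_hom_id_assoc, inclRight_projRight h Z₁ Z₂ Z₃ hunit hP]

theorem redAssoc_cent (hunit : Simple (𝟙_ A)) (hP : P.IsSpherical) :
    Cent (redTensor h (redTensor h Z₁ Z₂) Z₃).br (redTensor h Z₁ (redTensor h Z₂ Z₃)).br
      (redAssoc h Z₁ Z₂ Z₃) := by
  have h1 : Cent (Z₁.br ⊠ (minus Z₂.X ⊠ minus Z₃.X)) (rho Z₁ (redTensor h Z₂ Z₃))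
      (Z₁.X ◁ redProj h Z₂ Z₃) := by
    rw [tbr_minus]; exact (Cent.minus _).whiskerLeft _
  exact ((redIncl_cent_rho h (redTensor h Z₁ Z₂) Z₃ hunit hP).comp
    ((redIncl_cent_rho h Z₁ Z₂ hunit hP).whiskerRight _)).comp ((Cent.assoc _ _ _).comp
      (h1.comp (redProj_cent_rho h Z₁ (redTensor h Z₂ Z₃) hunit hP)))

end Associativity

/-! ### Unit constraints before restriction, and freeness of `I(𝟙)`. -/

section UnitConstraints

local postfix:max "ᵛ" => rightDual
local postfix:max "ᵐ" => rightAdjointMate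
local infixr:70 "⊠" => tbr

set_option linter.unusedSectionVars false

theorem minus_evaluation {A : Type u} [Category.{v} A] [MonoidalCategory A] [BraidedCategory A]
    (C D X : A) (e : C ⊗ D ⟶ 𝟙_ A) : e ▷ X ≫ (λ_ X).hom ≫ (ρ_ X).inv =
      ((α_ C D X).hom ≫ C ◁ (β_ X D).inv ≫ (α_ C X D).inv ≫ (β_ X C).inv ▷ D ≫
        (α_ X C D).hom) ≫ X ◁ e := by
  have h2 := (isHalfBraiding_minus X).tensor C D
  have h3 := (isHalfBraiding_minus X).naturality e
  rw [(isHalfBraiding_minus X).unit, h2] at h3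
  exact h3

section CloseUp

variable {A : Type u} [Category.{v} A] [MonoidalCategory A] [RightRigidCategory A]
  (P : PivotalStructure A) {X : A} {γ : HB X}

/-- The partial closure of a half-braiding. -/
def closeUp (γ : HB X) (C : A) : C ⊗ X ⊗ Cᵛ ⟶ X :=
  𝟙 _ ⊗≫ γ C ▷ Cᵛ ⊗≫ X ◁ P.pev C ⊗≫ 𝟙 X

theorem closeUp_dinatural (hγ : IsHalfBraiding X γ) {C C' : A} (f : C ⟶ C') :
    f ▷ (X ⊗ C'ᵛ) ≫ closeUp P γ C' = C ◁ X ◁ fᵐ ≫ closeUp P γ C := by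
  have h1 := hγ.naturality f
  have h2 := P.pev_naturality f
  unfold closeUp
  calc _ = 𝟙 _ ⊗≫ (f ▷ X ≫ γ C') ▷ C'ᵛ ⊗≫ X ◁ P.pev C' ⊗≫ 𝟙 X := by monoidal
    _ = 𝟙 _ ⊗≫ γ C ▷ C'ᵛ ⊗≫ X ◁ (f ▷ C'ᵛ ≫ P.pev C') ⊗≫ 𝟙 X := by rw [h1]; monoidal
    _ = 𝟙 _ ⊗≫ (γ C ▷ C'ᵛ ≫ (X ⊗ C) ◁ fᵐ) ⊗≫ X ◁ P.pev C ⊗≫ 𝟙 X := by rw [h2]; monoidal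
    _ = _ := by rw [← whisker_exchange]; monoidal

theorem rot_pev {B C D : A} (g : D ⟶ B ⊗ C) :
    𝟙 (D ⊗ Cᵛ) ⊗≫ D ◁ rot P g ⊗≫ P.pev D ▷ B ⊗≫ 𝟙 B =
      𝟙 (D ⊗ Cᵛ) ⊗≫ g ▷ Cᵛ ⊗≫ B ◁ P.pev C ⊗≫ 𝟙 B := by
  unfold rot
  calc _ = 𝟙 _ ⊗≫ D ◁ P.pcoev D ▷ Cᵛ ⊗≫
        ((D ⊗ Dᵛ) ◁ (g ▷ Cᵛ ⊗≫ B ◁ P.pev C) ≫ P.pev D ▷ (B ⊗ 𝟙_ A)) ⊗≫ 𝟙 B := by monoidal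
    _ = 𝟙 _ ⊗≫ (D ◁ P.pcoev D ⊗≫ P.pev D ▷ D) ▷ Cᵛ ⊗≫ g ▷ Cᵛ ⊗≫
        B ◁ P.pev C ⊗≫ 𝟙 B := by rw [whisker_exchange]; monoidal
    _ = _ := by rw [P.pcoev_pev]; monoidal

/-- The half-braiding with `B ⊗ C` splits into those with `B` and with `C`; the rotated identity
turns the cap of `B ⊗ C` into the cap of `C`, while `B` leaves to the right. -/
theorem rot_closeUp (hγ : IsHalfBraiding X γ) (B C : A) :
    𝟙 (B ⊗ C ⊗ X ⊗ Cᵛ) ⊗≫ (B ⊗ C ⊗ X) ◁ rot P (𝟙 (B ⊗ C)) ⊗≫ closeUp P γ (B ⊗ C) ▷ B =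
      B ◁ closeUp P γ C ≫ γ B := by
  have h1 := hγ.tensor B C
  have h2 : 𝟙 ((B ⊗ C) ⊗ Cᵛ) ⊗≫ (B ⊗ C) ◁ rot P (𝟙 (B ⊗ C)) ⊗≫ P.pev (B ⊗ C) ▷ B ⊗≫ 𝟙 B =
      𝟙 ((B ⊗ C) ⊗ Cᵛ) ⊗≫ B ◁ P.pev C ⊗≫ 𝟙 B := by
    refine Eq.trans ?_ ((rot_pev P (𝟙 (B ⊗ C))).trans ?_) <;> monoidal
  unfold closeUp
  rw [h1]
  calc _ = 𝟙 _ ⊗≫ (((B ⊗ C) ⊗ X) ◁ rot P (𝟙 (B ⊗ C)) ≫ ((α_ B C X).hom ≫ B ◁ γ C ≫ (α_ B X C).inv ≫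
        γ B ▷ C ≫ (α_ X B C).hom) ▷ ((B ⊗ C)ᵛ ⊗ B)) ⊗≫ X ◁ P.pev (B ⊗ C) ▷ B ⊗≫ 𝟙 (X ⊗ B) := by
        monoidal
    _ = 𝟙 _ ⊗≫ B ◁ γ C ▷ Cᵛ ⊗≫ γ B ▷ C ▷ Cᵛ ⊗≫ X ◁ (𝟙 ((B ⊗ C) ⊗ Cᵛ) ⊗≫
        (B ⊗ C) ◁ rot P (𝟙 (B ⊗ C)) ⊗≫ P.pev (B ⊗ C) ▷ B ⊗≫ 𝟙 B) ⊗≫ 𝟙 (X ⊗ B) := by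
        rw [whisker_exchange]; monoidal
    _ = 𝟙 _ ⊗≫ B ◁ γ C ▷ Cᵛ ⊗≫ (γ B ▷ (C ⊗ Cᵛ) ≫ (X ⊗ B) ◁ P.pev C) ⊗≫ 𝟙 (X ⊗ B) := by
        rw [h2]; monoidal
    _ = _ := by rw [← whisker_exchange]; monoidal

end CloseUp

variable {k : Type w} [Field k] [IsAlgClosed k] [CharZero k] {A : Type u} [Category.{v} A] [Abelian A]
  [Linear k A] [MonoidalCategory A] [MonoidalPreadditive A] [MonoidalLinear k A]
  [BraidedCategory A] [RigidCategory A] [IsFiniteSemisimple k A]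
  {P : PivotalStructure A} {Irr : Type t} [Fintype Irr] (c : SimpleChoice k P Irr)
  (Z : DCenter A)

theorem SimpleChoice.sqrtGlobal_mul_self : c.sqrtGlobal * c.sqrtGlobal = c.globalDim := by
  rw [← sq, c.sqrtGlobal_sq]; rfl

theorem SimpleChoice.sqrtGlobal_ne_zero (hunit : Simple (𝟙_ A)) : c.sqrtGlobal ≠ 0 := fun h =>
  c.globalDim_ne_zero hunit (by rw [← c.sqrtGlobal_mul_self, h, mul_zero])

theorem unitι_leftUnit (i : Irr) : unitι c i ▷ Z.X ≫ leftUnit c Z =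
    c.coeff i • (𝟙 _ ⊗≫ c.obj i ◁ (β_ Z.X (c.obj i)ᵛ).inv ⊗≫ closeUp P Z.br (c.obj i)) := by
  classical
  have h : leftUnit c Z = ∑ i, c.coeff i • (unitπ c i ▷ Z.X ≫
      (𝟙 _ ⊗≫ c.obj i ◁ (β_ Z.X (c.obj i)ᵛ).inv ⊗≫ Z.br (c.obj i) ▷ (c.obj i)ᵛ
      ⊗≫ Z.X ◁ P.pev (c.obj i) ⊗≫ 𝟙 _)) := rfl
  rw [h, Preadditive.comp_sum, Finset.sum_eq_single i]
  · rw [Linear.comp_smul, ← comp_whiskerRight_assoc, unitι_π_self, id_whiskerRight,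
      Category.id_comp]
    unfold closeUp
    congr 1; monoidal
  · intro j _ hj
    rw [Linear.comp_smul, ← comp_whiskerRight_assoc, unitι_π_ne c (Ne.symm hj)]
    simp
  · simp

theorem unitι_rightUnit (i : Irr) : Z.X ◁ unitι c i ≫ rightUnit c Z =
    c.coeff i • (𝟙 _ ⊗≫ (β_ (c.obj i) Z.X).inv ▷ (c.obj i)ᵛ ⊗≫ closeUp P Z.br (c.obj i)) := by
  classical
  have h : rightUnit c Z = ∑ i, c.coeff i • (Z.X ◁ unitπ c i ≫
      (𝟙 _ ⊗≫ (β_ (c.obj i) Z.X).inv ▷ (c.obj i)ᵛ ⊗≫ Z.br (c.obj i) ▷ (c.obj i)ᵛ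
      ⊗≫ Z.X ◁ P.pev (c.obj i) ⊗≫ 𝟙 _)) := rfl
  rw [h, Preadditive.comp_sum, Finset.sum_eq_single i]
  · rw [Linear.comp_smul, ← MonoidalCategory.whiskerLeft_comp_assoc, unitι_π_self,
      MonoidalCategory.whiskerLeft_id, Category.id_comp]
    unfold closeUp
    congr 1; monoidal
  · intro j _ hj
    rw [Linear.comp_smul, ← MonoidalCategory.whiskerLeft_comp_assoc, unitι_π_ne c (Ne.symm hj)]
    simp
  · simp

theorem SimpleChoice.sqrtDim_mul_coeff (i : Irr) :
    c.sqrtDim i * c.coeff i = c.sqrtGlobal⁻¹ * c.dim i := by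
  rw [coeff, dim]; ring

/-- The factor `√d_i` of the dinatural family and the factor `√d_i / √D` of the constraint multiply
to `d_i / √D`. The partial closure is dinatural, so the dual bases come together and are removed by
the fusion formula. -/
theorem coendMap_leftUnit (hunit : Simple (𝟙_ A)) (C : A) : coendMap c C ▷ Z.X ≫ leftUnit c Z =
    c.sqrtGlobal⁻¹ • (𝟙 _ ⊗≫ C ◁ (β_ Z.X Cᵛ).inv ⊗≫ closeUp P Z.br C) := by
  have h : ∀ i α, ((c.basisTo C i α ⊗ₘ (c.basisFrom C i α)ᵐ) ≫ unitι c i) ▷ Z.X ≫ leftUnit c Z =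
      c.coeff i • (𝟙 _ ⊗≫ C ◁ (β_ Z.X Cᵛ).inv ⊗≫
        (c.basisTo C i α ≫ c.basisFrom C i α) ▷ (Z.X ⊗ Cᵛ) ≫ closeUp P Z.br C) := fun i α => by
    have h1 := closeUp_dinatural P Z.isHalfBraiding (c.basisFrom C i α)
    have h2 := BraidedCategory.braiding_inv_naturality_left (c.basisFrom C i α)ᵐ Z.X
    rw [comp_whiskerRight, Category.assoc, unitι_leftUnit, Linear.comp_smul,
      MonoidalCategory.tensorHom_def]
    congr 1
    calc _ = 𝟙 _ ⊗≫ c.basisTo C i α ▷ (Cᵛ ⊗ Z.X) ⊗≫ c.obj i ◁ ((c.basisFrom C i α)ᵐ ▷ Z.X ≫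
          (β_ Z.X (c.obj i)ᵛ).inv) ⊗≫ closeUp P Z.br (c.obj i) := by monoidal
      _ = 𝟙 _ ⊗≫ (c.basisTo C i α ▷ (Cᵛ ⊗ Z.X) ≫ c.obj i ◁ (β_ Z.X Cᵛ).inv) ⊗≫
          c.obj i ◁ Z.X ◁ (c.basisFrom C i α)ᵐ ≫ closeUp P Z.br (c.obj i) := by rw [h2]; monoidal
      _ = _ := by rw [← h1, ← whisker_exchange]; monoidal
  conv_lhs => rw [coendMap]
  simp only [sum_whiskerRight, MonoidalLinear.smul_whiskerRight, Preadditive.sum_comp,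
    Linear.smul_comp, h, ← Finset.smul_sum, smul_smul, c.sqrtDim_mul_coeff]
  simp only [← smul_smul, ← Finset.smul_sum]
  congr 1
  have e : closeUp P Z.br C = (∑ i, c.dim i • ∑ α, c.basisTo C i α ≫ c.basisFrom C i α) ▷
      (Z.X ⊗ Cᵛ) ≫ closeUp P Z.br C := by
    rw [c.sum_basisTo_basisFrom hunit C, id_whiskerRight, Category.id_comp]
  conv_rhs => rw [e]
  simp [monoidalComp, sum_whiskerRight, Preadditive.comp_sum, Preadditive.sum_comp]

theorem coendMap_rightUnit (hunit : Simple (𝟙_ A)) (C : A) : Z.X ◁ coendMap c C ≫ rightUnit c Z =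
    c.sqrtGlobal⁻¹ • (𝟙 _ ⊗≫ (β_ C Z.X).inv ▷ Cᵛ ⊗≫ closeUp P Z.br C) := by
  have h : ∀ i α, Z.X ◁ ((c.basisTo C i α ⊗ₘ (c.basisFrom C i α)ᵐ) ≫ unitι c i) ≫ rightUnit c Z =
      c.coeff i • (𝟙 _ ⊗≫ (β_ C Z.X).inv ▷ Cᵛ ⊗≫
        (c.basisTo C i α ≫ c.basisFrom C i α) ▷ (Z.X ⊗ Cᵛ) ≫ closeUp P Z.br C) := fun i α => by
    have h1 := closeUp_dinatural P Z.isHalfBraiding (c.basisFrom C i α)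
    have h2 := BraidedCategory.braiding_inv_naturality_right Z.X (c.basisTo C i α)
    rw [MonoidalCategory.whiskerLeft_comp, Category.assoc, unitι_rightUnit, Linear.comp_smul,
      MonoidalCategory.tensorHom_def]
    congr 1
    calc _ = 𝟙 _ ⊗≫ (Z.X ◁ c.basisTo C i α) ▷ Cᵛ ⊗≫ ((Z.X ⊗ c.obj i) ◁ (c.basisFrom C i α)ᵐ ≫
          (β_ (c.obj i) Z.X).inv ▷ (c.obj i)ᵛ) ⊗≫ closeUp P Z.br (c.obj i) := by monoidal
      _ = 𝟙 _ ⊗≫ (Z.X ◁ c.basisTo C i α ≫ (β_ (c.obj i) Z.X).inv) ▷ Cᵛ ⊗≫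
          c.obj i ◁ Z.X ◁ (c.basisFrom C i α)ᵐ ≫ closeUp P Z.br (c.obj i) := by
          rw [whisker_exchange]; monoidal
      _ = _ := by rw [← h1, h2]; monoidal
  conv_lhs => rw [coendMap]
  simp only [whiskerLeft_sum, MonoidalLinear.whiskerLeft_smul, Preadditive.sum_comp,
    Linear.smul_comp, h, ← Finset.smul_sum, smul_smul, c.sqrtDim_mul_coeff]
  simp only [← smul_smul, ← Finset.smul_sum]
  congr 1
  have e : closeUp P Z.br C = (∑ i, c.dim i • ∑ α, c.basisTo C i α ≫ c.basisFrom C i α) ▷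
      (Z.X ⊗ Cᵛ) ≫ closeUp P Z.br C := by
    rw [c.sum_basisTo_basisFrom hunit C, id_whiskerRight, Category.id_comp]
  conv_rhs => rw [e]
  simp [monoidalComp, sum_whiskerRight, Preadditive.comp_sum, Preadditive.sum_comp]

theorem Cent.of_coendMap_left (hunit : Simple (𝟙_ A)) {X Y : A} {γ : HB (unitX c ⊗ X)} {μ : HB Y}
    {f : unitX c ⊗ X ⟶ Y} (h : ∀ B C, B ◁ coendMap c C ▷ X ≫ B ◁ f ≫ μ B =
      B ◁ coendMap c C ▷ X ≫ γ B ≫ f ▷ B) : Cent γ μ f := fun B => by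
  rw [← cancel_epi (α_ B _ X).hom]
  have e : ∀ {Y' : A} (p q : (B ⊗ unitX c) ⊗ X ⟶ Y'), (∀ C, (B ◁ coendMap c C) ▷ X ≫ p =
      (B ◁ coendMap c C) ▷ X ≫ q) → p = q := fun p q hpq => by
    have t : (∑ i, (B ◁ unitπ c i) ▷ X ≫ (B ◁ unitι c i) ▷ X) = 𝟙 _ := by
      have := congrArg (fun t => (B ◁ t) ▷ X) (sum_unitπ_ι c)
      simpa [whiskerLeft_sum, sum_whiskerRight] using this
    rw [← Category.id_comp p, ← Category.id_comp q, ← t]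
    simp only [Preadditive.sum_comp, Category.assoc, ← coendMap_obj c hunit,
      MonoidalLinear.whiskerLeft_smul, MonoidalLinear.smul_whiskerRight, Linear.smul_comp, hpq]
  refine e _ _ fun C => ?_
  rw [associator_naturality_middle_assoc, associator_naturality_middle_assoc, h]

theorem Cent.of_coendMap_right (hunit : Simple (𝟙_ A)) {X Y : A} {γ : HB (X ⊗ unitX c)} {μ : HB Y}
    {f : X ⊗ unitX c ⟶ Y} (h : ∀ B C, B ◁ X ◁ coendMap c C ≫ B ◁ f ≫ μ B =
      B ◁ X ◁ coendMap c C ≫ γ B ≫ f ▷ B) : Cent γ μ f := fun B => by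
  rw [← cancel_epi (α_ B X _).hom]
  refine hom_ext_whiskerLeft_coendMap c hunit fun C => ?_
  rw [associator_naturality_right_assoc, associator_naturality_right_assoc, h]

/-- Tested on the dinatural family, `B` enters the colour `C` to form `B ⊗ C`, and `rot_closeUp`
pulls it out of the partial closure through the half-braiding of `Z`. -/
theorem leftUnit_cent_rho (hunit : Simple (𝟙_ A)) :
    Cent (unitBr c ⊠ minus Z.X) Z.br (leftUnit c Z) := by
  refine Cent.of_coendMap_left c hunit fun B C => ?_
  have h1 := coendMap_unitBr c hunit B C
  have h2 := coendMap_leftUnit c Z hunit C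
  have h3 := coendMap_leftUnit c Z hunit (B ⊗ C)
  have h4 := rot_closeUp P Z.isHalfBraiding B C
  have h5 := BraidedCategory.braiding_inv_naturality_left (rot P (𝟙 (B ⊗ C))) Z.X
  rw [BraidedCategory.braiding_tensor_right_inv] at h5
  unfold tbr minus
  symm
  calc _ = 𝟙 _ ⊗≫ (B ◁ coendMap c C ≫ unitBr c B) ▷ Z.X ⊗≫ (unitX c ◁ (β_ Z.X B).inv ⊗≫
        leftUnit c Z ▷ B) := by monoidal
    _ = 𝟙 _ ⊗≫ (B ⊗ C) ◁ rot P (𝟙 (B ⊗ C)) ▷ Z.X ⊗≫ (coendMap c (B ⊗ C) ▷ (B ⊗ Z.X) ≫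
        unitX c ◁ (β_ Z.X B).inv) ⊗≫ leftUnit c Z ▷ B := by rw [h1, coendBr]; monoidal
    _ = 𝟙 _ ⊗≫ (B ⊗ C) ◁ rot P (𝟙 (B ⊗ C)) ▷ Z.X ⊗≫ ((B ⊗ C) ⊗ (B ⊗ C)ᵛ) ◁ (β_ Z.X B).inv ⊗≫
        (coendMap c (B ⊗ C) ▷ Z.X ≫ leftUnit c Z) ▷ B := by rw [← whisker_exchange]; monoidal
    _ = c.sqrtGlobal⁻¹ • (𝟙 _ ⊗≫ (B ⊗ C) ◁ rot P (𝟙 (B ⊗ C)) ▷ Z.X ⊗≫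
        ((B ⊗ C) ⊗ (B ⊗ C)ᵛ) ◁ (β_ Z.X B).inv ⊗≫
        (𝟙 (((B ⊗ C) ⊗ (B ⊗ C)ᵛ) ⊗ Z.X) ⊗≫ (B ⊗ C) ◁ (β_ Z.X (B ⊗ C)ᵛ).inv ⊗≫ closeUp P Z.br (B ⊗ C)) ▷ B) := by
        rw [h3]
        simp only [monoidalComp, MonoidalLinear.smul_whiskerRight, Linear.comp_smul]
        congr 1; monoidal
    _ = c.sqrtGlobal⁻¹ • (𝟙 _ ⊗≫ (B ⊗ C) ◁ (rot P (𝟙 (B ⊗ C)) ▷ Z.X ≫ (α_ (B ⊗ C)ᵛ B Z.X).hom ≫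
        (B ⊗ C)ᵛ ◁ (β_ Z.X B).inv ≫ (α_ (B ⊗ C)ᵛ Z.X B).inv ≫ (β_ Z.X (B ⊗ C)ᵛ).inv ▷ B ≫
          (α_ Z.X (B ⊗ C)ᵛ B).hom) ⊗≫ closeUp P Z.br (B ⊗ C) ▷ B) := by
        congr 1; monoidal
    _ = c.sqrtGlobal⁻¹ • (𝟙 _ ⊗≫ B ◁ C ◁ (β_ Z.X Cᵛ).inv ⊗≫ (𝟙 (B ⊗ C ⊗ Z.X ⊗ Cᵛ) ⊗≫
        (B ⊗ C ⊗ Z.X) ◁ rot P (𝟙 (B ⊗ C)) ⊗≫ closeUp P Z.br (B ⊗ C) ▷ B)) := by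
        rw [h5]; congr 1; monoidal
    _ = B ◁ (c.sqrtGlobal⁻¹ • (𝟙 _ ⊗≫ C ◁ (β_ Z.X Cᵛ).inv ⊗≫ closeUp P Z.br C)) ≫ Z.br B := by
        rw [h4]
        trans c.sqrtGlobal⁻¹ • (B ◁ (𝟙 ((C ⊗ Cᵛ) ⊗ Z.X) ⊗≫ C ◁ (β_ Z.X Cᵛ).inv ⊗≫ closeUp P Z.br C) ≫
          Z.br B)
        · congr 1; monoidal
        · simp only [MonoidalLinear.whiskerLeft_smul, Linear.smul_comp]
    _ = _ := by rw [← h2]; monoidal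

theorem rightUnit_cent_sig (hunit : Simple (𝟙_ A)) :
    Cent (plus Z.X ⊠ unitBr c) Z.br (rightUnit c Z) := by
  refine Cent.of_coendMap_right c hunit fun B C => ?_
  have h1 := coendMap_unitBr c hunit B C
  have h2 := coendMap_rightUnit c Z hunit C
  have h3 := coendMap_rightUnit c Z hunit (B ⊗ C)
  have h4 := rot_closeUp P Z.isHalfBraiding B C
  have h5 : (β_ B Z.X).hom ▷ C ≫ (α_ _ _ _).hom ≫ (β_ (B ⊗ C) Z.X).inv =
      (α_ _ _ _).hom ≫ B ◁ (β_ C Z.X).inv ≫ (α_ _ _ _).inv := by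
    rw [BraidedCategory.braiding_tensor_left_inv]; simp
  unfold tbr plus
  symm
  calc _ = 𝟙 _ ⊗≫ (B ⊗ Z.X) ◁ coendMap c C ⊗≫ ((β_ B Z.X).hom ▷ unitX c) ⊗≫
        Z.X ◁ unitBr c B ⊗≫ rightUnit c Z ▷ B := by monoidal
    _ = 𝟙 _ ⊗≫ ((B ⊗ Z.X) ◁ coendMap c C ≫ (β_ B Z.X).hom ▷ unitX c) ⊗≫
        Z.X ◁ unitBr c B ⊗≫ rightUnit c Z ▷ B := by monoidal
    _ = 𝟙 _ ⊗≫ (β_ B Z.X).hom ▷ (C ⊗ Cᵛ) ⊗≫ Z.X ◁ (B ◁ coendMap c C ≫ unitBr c B) ⊗≫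
        rightUnit c Z ▷ B := by rw [whisker_exchange]; monoidal
    _ = 𝟙 _ ⊗≫ (β_ B Z.X).hom ▷ (C ⊗ Cᵛ) ⊗≫ Z.X ◁ (B ⊗ C) ◁ rot P (𝟙 (B ⊗ C)) ⊗≫
        (Z.X ◁ coendMap c (B ⊗ C) ≫ rightUnit c Z) ▷ B := by rw [h1, coendBr]; monoidal
    _ = c.sqrtGlobal⁻¹ • (𝟙 _ ⊗≫ (β_ B Z.X).hom ▷ (C ⊗ Cᵛ) ⊗≫
        Z.X ◁ (B ⊗ C) ◁ rot P (𝟙 (B ⊗ C)) ⊗≫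
        (𝟙 (Z.X ⊗ (B ⊗ C) ⊗ (B ⊗ C)ᵛ) ⊗≫ (β_ (B ⊗ C) Z.X).inv ▷ (B ⊗ C)ᵛ ⊗≫ closeUp P Z.br (B ⊗ C)) ▷ B) := by
        rw [h3]
        simp only [monoidalComp, MonoidalLinear.smul_whiskerRight, Linear.comp_smul]
        congr 1; monoidal
    _ = c.sqrtGlobal⁻¹ • (𝟙 _ ⊗≫ (β_ B Z.X).hom ▷ (C ⊗ Cᵛ) ⊗≫
        ((Z.X ⊗ B ⊗ C) ◁ rot P (𝟙 (B ⊗ C)) ≫ (β_ (B ⊗ C) Z.X).inv ▷ ((B ⊗ C)ᵛ ⊗ B)) ⊗≫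
        closeUp P Z.br (B ⊗ C) ▷ B) := by
        congr 1; monoidal
    _ = c.sqrtGlobal⁻¹ • (𝟙 _ ⊗≫ ((β_ B Z.X).hom ▷ C ≫ (α_ Z.X B C).hom ≫ (β_ (B ⊗ C) Z.X).inv) ▷ Cᵛ
         ⊗≫ (𝟙 (B ⊗ C ⊗ Z.X ⊗ Cᵛ) ⊗≫ (B ⊗ C ⊗ Z.X) ◁ rot P (𝟙 (B ⊗ C)) ⊗≫
        closeUp P Z.br (B ⊗ C) ▷ B)) := by
        rw [whisker_exchange]; congr 1; monoidal
    _ = B ◁ (c.sqrtGlobal⁻¹ • (𝟙 _ ⊗≫ (β_ C Z.X).inv ▷ Cᵛ ⊗≫ closeUp P Z.br C)) ≫ Z.br B := by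
        rw [h4, h5]
        trans c.sqrtGlobal⁻¹ • (B ◁ (𝟙 (Z.X ⊗ C ⊗ Cᵛ) ⊗≫ (β_ C Z.X).inv ▷ Cᵛ ⊗≫ closeUp P Z.br C) ≫
          Z.br B)
        · congr 1; monoidal
        · simp only [MonoidalLinear.whiskerLeft_smul, Linear.smul_comp]
    _ = _ := by rw [← h2]; monoidal

theorem Cent.rightUnitor_minus {X : A} (γ : HB X) :
    Cent (γ ⊠ RedCenter.minus (𝟙_ A)) γ (ρ_ X).hom := by
  rw [← plus_unit]; exact Cent.rightUnitor γ

theorem Cent.rightUnitor_minus_inv {X : A} (γ : HB X) :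
    Cent γ (γ ⊠ RedCenter.minus (𝟙_ A)) (ρ_ X).inv := by
  rw [← plus_unit]; exact Cent.rightUnitor_inv γ

theorem Cent.sum {X Y : A} {γ : HB X} {μ : HB Y} {ι : Type*} [Fintype ι] {f : ι → (X ⟶ Y)}
    (a : ι → k) (h : ∀ i, Cent γ μ (f i)) : Cent γ μ (∑ i, a i • f i) := by
  simpa using Cent.smul_sum (1 : k) a h

/-- With `plus` on `I(𝟙)` nothing has to be known about its half-braiding: each component is
composed of morphisms central for `plus` strands. -/
theorem leftUnit_cent_sig : Cent (plus (unitX c) ⊠ Z.br) Z.br (leftUnit c Z) := by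
  refine Cent.sum _ fun i => ((Cent.plus _).whiskerRight _).comp ?_
  rw [← tbr_plus]
  have e : (𝟙 (c.summand i ⊗ Z.X) ⊗≫ c.obj i ◁ (β_ Z.X (c.obj i)ᵛ).inv ⊗≫
      Z.br (c.obj i) ▷ (c.obj i)ᵛ ⊗≫ Z.X ◁ P.pev (c.obj i) ⊗≫ 𝟙 Z.X) =
      (α_ _ _ _).hom ≫ c.obj i ◁ (β_ Z.X (c.obj i)ᵛ).inv ≫ (α_ _ _ _).inv ≫
      Z.br (c.obj i) ▷ (c.obj i)ᵛ ≫ (α_ _ _ _).hom ≫ Z.X ◁ P.pev (c.obj i) ≫ (ρ_ _).hom := by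
    monoidal
  rw [e]
  refine (Cent.assoc _ _ _).comp (((Cent.braiding_plus_inv _ _).whiskerLeft _).comp
    ((Cent.assoc_inv _ _ _).comp (((Cent.br _ Z.isHalfBraiding).whiskerRight _).comp
      ((Cent.assoc _ _ _).comp (Cent.comp ?_ (Cent.rightUnitor _))))))
  rw [tbr_plus]
  exact (Cent.plus _).whiskerLeft _

theorem rightUnit_cent_rho : Cent (Z.br ⊠ minus (unitX c)) Z.br (rightUnit c Z) := by
  refine Cent.sum _ fun i => ((Cent.minus _).whiskerLeft _).comp ?_
  rw [← tbr_minus]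
  have e : (𝟙 (Z.X ⊗ c.summand i) ⊗≫ (β_ (c.obj i) Z.X).inv ▷ (c.obj i)ᵛ ⊗≫
      Z.br (c.obj i) ▷ (c.obj i)ᵛ ⊗≫ Z.X ◁ P.pev (c.obj i) ⊗≫ 𝟙 Z.X) =
      (α_ _ _ _).inv ≫ (β_ (c.obj i) Z.X).inv ▷ (c.obj i)ᵛ ≫
      Z.br (c.obj i) ▷ (c.obj i)ᵛ ≫ (α_ _ _ _).hom ≫ Z.X ◁ P.pev (c.obj i) ≫ (ρ_ _).hom := by
    monoidal
  rw [e]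
  refine (Cent.assoc_inv _ _ _).comp (((Cent.braiding_minus_inv _ _).whiskerRight _).comp
    (((Cent.br _ Z.isHalfBraiding).whiskerRight _).comp
      ((Cent.assoc _ _ _).comp (Cent.comp ?_ (Cent.rightUnitor_minus _)))))
  rw [tbr_minus]
  exact (Cent.minus _).whiskerLeft _

theorem coendMap_comp_left (hunit : Simple (𝟙_ A)) {V Y : A} {μ : HB Y} {f : unitX c ⊗ V ⟶ Y}
    (hf : Cent (unitBr c ⊠ minus V) μ f) (C : A) : coendMap c C ▷ V ≫ f =
      𝟙 _ ⊗≫ C ◁ (β_ V Cᵛ).inv ⊗≫ C ◁ (unitIncl c ▷ V ≫ f) ▷ Cᵛ ⊗≫ μ C ▷ Cᵛ ⊗≫ Y ◁ P.pev C ⊗≫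
        𝟙 Y := by
  have h1 := hf C
  have h3 := minus_evaluation C Cᵛ V (P.pev C)
  unfold tbr minus at h1
  rw [coendMap_eq c hunit]
  calc _ = 𝟙 _ ⊗≫ C ◁ unitIncl c ▷ Cᵛ ▷ V ⊗≫ unitBr c C ▷ Cᵛ ▷ V ⊗≫
        unitX c ◁ (P.pev C ▷ V ≫ (λ_ V).hom ≫ (ρ_ V).inv) ⊗≫ f ⊗≫ 𝟙 Y := by monoidal
    _ = 𝟙 _ ⊗≫ C ◁ unitIncl c ▷ Cᵛ ▷ V ⊗≫ (unitBr c C ▷ (Cᵛ ⊗ V) ≫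
        (unitX c ⊗ C) ◁ (β_ V Cᵛ).inv) ⊗≫ unitX c ◁ (β_ V C).inv ▷ Cᵛ ⊗≫
        ((unitX c ⊗ V) ◁ P.pev C ≫ f ▷ 𝟙_ A) ⊗≫ 𝟙 Y := by rw [h3]; monoidal
    _ = 𝟙 _ ⊗≫ C ◁ (unitIncl c ▷ (Cᵛ ⊗ V) ≫ unitX c ◁ (β_ V Cᵛ).inv) ⊗≫ (unitBr c C ▷ V ⊗≫
        unitX c ◁ (β_ V C).inv ⊗≫ f ▷ C) ▷ Cᵛ ⊗≫ Y ◁ P.pev C ⊗≫ 𝟙 Y := by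
        rw [← whisker_exchange (unitBr c C) (β_ V Cᵛ).inv, whisker_exchange f (P.pev C)]; monoidal
    _ = 𝟙 _ ⊗≫ C ◁ (β_ V Cᵛ).inv ⊗≫ C ◁ unitIncl c ▷ (V ⊗ Cᵛ) ⊗≫ (((α_ C (unitX c) V).inv ≫
        unitBr c C ▷ V ≫ (α_ _ _ _).hom ≫
        unitX c ◁ (β_ V C).inv ≫ (α_ _ _ _).inv) ≫ f ▷ C) ▷ Cᵛ ⊗≫ Y ◁ P.pev C ⊗≫ 𝟙 Y := by
        rw [← whisker_exchange]; monoidal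
    _ = _ := by rw [← h1]; monoidal

theorem coendMap_comp_right (hunit : Simple (𝟙_ A)) {V Y : A} {μ : HB Y} {f : V ⊗ unitX c ⟶ Y}
    (hf : Cent (plus V ⊠ unitBr c) μ f) (C : A) : V ◁ coendMap c C ≫ f =
      𝟙 _ ⊗≫ (β_ C V).inv ▷ Cᵛ ⊗≫ C ◁ (V ◁ unitIncl c ≫ f) ▷ Cᵛ ⊗≫ μ C ▷ Cᵛ ⊗≫ Y ◁ P.pev C ⊗≫
        𝟙 Y := by
  have h1 := hf C
  unfold tbr plus at h1
  rw [coendMap_eq c hunit]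
  symm
  calc _ = 𝟙 _ ⊗≫ (β_ C V).inv ▷ Cᵛ ⊗≫ (C ⊗ V) ◁ unitIncl c ▷ Cᵛ ⊗≫ (C ◁ f ≫ μ C) ▷ Cᵛ ⊗≫
        Y ◁ P.pev C ⊗≫ 𝟙 Y := by monoidal
    _ = 𝟙 _ ⊗≫ (β_ C V).inv ▷ Cᵛ ⊗≫ ((C ⊗ V) ◁ unitIncl c ≫ (β_ C V).hom ▷ unitX c) ▷ Cᵛ ⊗≫
        V ◁ unitBr c C ▷ Cᵛ ⊗≫ (f ▷ (C ⊗ Cᵛ) ≫ Y ◁ P.pev C) ⊗≫ 𝟙 Y := by rw [h1]; monoidal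
    _ = 𝟙 _ ⊗≫ ((β_ C V).inv ≫ (β_ C V).hom) ▷ Cᵛ ⊗≫ V ◁ C ◁ unitIncl c ▷ Cᵛ ⊗≫
        V ◁ unitBr c C ▷ Cᵛ ⊗≫ V ◁ unitX c ◁ P.pev C ⊗≫ f ⊗≫ 𝟙 Y := by
        rw [whisker_exchange (β_ C V).hom (unitIncl c), ← whisker_exchange f (P.pev C)]; monoidal
    _ = _ := by rw [Iso.inv_hom_id]; monoidal

/-- The colour `C` is produced from `𝟙 ⟶ I(𝟙)` by the half-braiding; centrality moves this
half-braiding below `f`, where it becomes `μ`, so that only the restriction of `f` to the unit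
remains. -/
theorem hom_ext_unitX_left (hunit : Simple (𝟙_ A)) {V Y : A} {μ : HB Y} {f g : unitX c ⊗ V ⟶ Y}
    (hf : Cent (unitBr c ⊠ minus V) μ f) (hg : Cent (unitBr c ⊠ minus V) μ g)
    (e : unitIncl c ▷ V ≫ f = unitIncl c ▷ V ≫ g) : f = g :=
  hom_ext_whiskerRight_coendMap c hunit fun C => by
    rw [coendMap_comp_left c hunit hf, coendMap_comp_left c hunit hg, e]

theorem hom_ext_unitX_right (hunit : Simple (𝟙_ A)) {V Y : A} {μ : HB Y} {f g : V ⊗ unitX c ⟶ Y}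
    (hf : Cent (plus V ⊠ unitBr c) μ f) (hg : Cent (plus V ⊠ unitBr c) μ g)
    (e : V ◁ unitIncl c ≫ f = V ◁ unitIncl c ≫ g) : f = g :=
  hom_ext_whiskerLeft_coendMap c hunit fun C => by
    rw [coendMap_comp_right c hunit hf, coendMap_comp_right c hunit hg, e]

theorem unitIncl_leftUnit (hunit : Simple (𝟙_ A)) :
    unitIncl c ▷ Z.X ≫ leftUnit c Z = c.sqrtGlobal⁻¹ • (λ_ Z.X).hom := by
  have h1 := minus_evaluation (𝟙_ A) (unitDual A) Z.X (P.pev (𝟙_ A))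
  have h2 := unitCoev_pev (P := P)
  rw [braiding_inv_tensorUnit_right] at h1
  rw [unitIncl, comp_whiskerRight, Category.assoc, coendMap_leftUnit c Z hunit, Linear.comp_smul]
  congr 1
  unfold closeUp
  rw [Z.isHalfBraiding.unit]
  calc _ = 𝟙 _ ⊗≫ unitCoev P ▷ Z.X ⊗≫ (((α_ (𝟙_ A) (unitDual A) Z.X).hom ≫
        𝟙_ A ◁ (β_ Z.X (unitDual A)).inv ≫ (α_ (𝟙_ A) Z.X (unitDual A)).inv ≫
        ((λ_ Z.X).hom ≫ (ρ_ Z.X).inv) ▷ unitDual A ≫ (α_ Z.X (𝟙_ A) (unitDual A)).hom) ≫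
        Z.X ◁ P.pev (𝟙_ A)) ⊗≫ 𝟙 Z.X := by monoidal
    _ = 𝟙 _ ⊗≫ (unitCoev P ≫ P.pev (𝟙_ A)) ▷ Z.X ⊗≫ 𝟙 Z.X := by rw [← h1]; monoidal
    _ = _ := by rw [h2]; monoidal

theorem unitIncl_rightUnit (hunit : Simple (𝟙_ A)) :
    Z.X ◁ unitIncl c ≫ rightUnit c Z = c.sqrtGlobal⁻¹ • (ρ_ Z.X).hom := by
  have h2 := unitCoev_pev (P := P)
  rw [unitIncl, MonoidalCategory.whiskerLeft_comp, Category.assoc, coendMap_rightUnit c Z hunit,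
    Linear.comp_smul]
  congr 1
  unfold closeUp
  rw [Z.isHalfBraiding.unit, braiding_inv_tensorUnit_left]
  calc _ = Z.X ◁ (unitCoev P ≫ P.pev (𝟙_ A)) ⊗≫ 𝟙 Z.X := by monoidal
    _ = _ := by rw [h2]; monoidal

end UnitConstraints

/-! ### Unit constraints and morphisms on the reduced products. -/

section ReducedUnit

local postfix:max "ᵛ" => rightDual
local infixr:70 "⊠" => tbr

set_option linter.unusedSectionVars false

variable {k : Type w} [Field k] [IsAlgClosed k] [CharZero k] {A : Type u} [Category.{v} A] [Abelian A]
  [Linear k A] [MonoidalCategory A] [MonoidalPreadditive A] [MonoidalLinear k A]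
  [BraidedCategory A] [RigidCategory A] [IsFiniteSemisimple k A]
  {P : PivotalStructure A} {Irr : Type t} [Fintype Irr] {c : SimpleChoice k P Irr}
  (hunit : Simple (𝟙_ A)) (hP : P.IsSpherical) (h : ObjectsDefined c) (Z W : DCenter A)

/-- The left unit constraint before restriction. -/
def leftU : (redUnit h).X ⊗ Z.X ⟶ Z.X := leftUnit c Z

/-- The right unit constraint before restriction. -/
def rightU : Z.X ⊗ (redUnit h).X ⟶ Z.X := rightUnit c Z

/-- The inclusion of the unit of `A` in `I(𝟙)`. -/
def unitI : 𝟙_ A ⟶ (redUnit h).X := unitIncl c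

/-- The dinatural family `C ⊗ C^* ⟶ I(𝟙)`. -/
def coendI (C : A) : C ⊗ Cᵛ ⟶ (redUnit h).X := coendMap c C

theorem leftU_cent_rho (hunit : Simple (𝟙_ A)) : Cent (rho (redUnit h) Z) Z.br (leftU h Z) :=
  leftUnit_cent_rho c Z hunit

theorem leftU_cent_sig : Cent (sig (redUnit h) Z) Z.br (leftU h Z) := leftUnit_cent_sig c Z

theorem rightU_cent_rho : Cent (rho Z (redUnit h)) Z.br (rightU h Z) := rightUnit_cent_rho c Z

theorem rightU_cent_sig (hunit : Simple (𝟙_ A)) : Cent (sig Z (redUnit h)) Z.br (rightU h Z) :=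
  rightUnit_cent_sig c Z hunit

theorem unitI_leftU (hunit : Simple (𝟙_ A)) :
    unitI h ▷ Z.X ≫ leftU h Z = c.sqrtGlobal⁻¹ • (λ_ Z.X).hom := unitIncl_leftUnit c Z hunit

theorem unitI_rightU (hunit : Simple (𝟙_ A)) :
    Z.X ◁ unitI h ≫ rightU h Z = c.sqrtGlobal⁻¹ • (ρ_ Z.X).hom := unitIncl_rightUnit c Z hunit

theorem coendI_leftU (hunit : Simple (𝟙_ A)) (C : A) : coendI h C ▷ Z.X ≫ leftU h Z =
    c.sqrtGlobal⁻¹ • (𝟙 _ ⊗≫ C ◁ (β_ Z.X Cᵛ).inv ⊗≫ closeUp P Z.br C) :=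
  coendMap_leftUnit c Z hunit C

theorem coendI_rightU (hunit : Simple (𝟙_ A)) (C : A) : Z.X ◁ coendI h C ≫ rightU h Z =
    c.sqrtGlobal⁻¹ • (𝟙 _ ⊗≫ (β_ C Z.X).inv ▷ Cᵛ ⊗≫ closeUp P Z.br C) :=
  coendMap_rightUnit c Z hunit C

theorem hom_ext_redUnit_left (hunit : Simple (𝟙_ A)) {V Y : A} {μ : HB Y}
    {f g : (redUnit h).X ⊗ V ⟶ Y} (hf : Cent ((redUnit h).br ⊠ minus V) μ f)
    (hg : Cent ((redUnit h).br ⊠ minus V) μ g) (e : unitI h ▷ V ≫ f = unitI h ▷ V ≫ g) : f = g :=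
  hom_ext_unitX_left c hunit hf hg e

theorem hom_ext_redUnit_right (hunit : Simple (𝟙_ A)) {V Y : A} {μ : HB Y}
    {f g : V ⊗ (redUnit h).X ⟶ Y} (hf : Cent (plus V ⊠ (redUnit h).br) μ f)
    (hg : Cent (plus V ⊠ (redUnit h).br) μ g) (e : V ◁ unitI h ≫ f = V ◁ unitI h ≫ g) : f = g :=
  hom_ext_unitX_right c hunit hf hg e

theorem hom_ext_unitX_middle (c : SimpleChoice k P Irr) (hunit : Simple (𝟙_ A)) {V V' Y : A}
    {f g : V ⊗ (unitX c ⊗ V') ⟶ Y}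
    (e : ∀ C, V ◁ coendMap c C ▷ V' ≫ f = V ◁ coendMap c C ▷ V' ≫ g) : f = g := by
  rw [← cancel_epi (α_ V _ V').hom]
  have t : (∑ i, (V ◁ unitπ c i) ▷ V' ≫ (V ◁ unitι c i) ▷ V') = 𝟙 _ := by
    have := congrArg (fun t => (V ◁ t) ▷ V') (sum_unitπ_ι c)
    simpa [whiskerLeft_sum, sum_whiskerRight] using this
  have e2 : ∀ C, (V ◁ coendMap c C) ▷ V' ≫ (α_ V (unitX c) V').hom ≫ f =
      (V ◁ coendMap c C) ▷ V' ≫ (α_ V (unitX c) V').hom ≫ g := fun C => by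
    rw [associator_naturality_middle_assoc, associator_naturality_middle_assoc, e]
  rw [← Category.id_comp ((α_ V (unitX c) V').hom ≫ f),
    ← Category.id_comp ((α_ V (unitX c) V').hom ≫ g), ← t]
  simp only [Preadditive.sum_comp, Category.assoc, ← coendMap_obj c hunit,
    MonoidalLinear.whiskerLeft_smul, MonoidalLinear.smul_whiskerRight, Linear.smul_comp, e2]

theorem hom_ext_redUnit_middle (hunit : Simple (𝟙_ A)) {V V' Y : A}
    {f g : V ⊗ ((redUnit h).X ⊗ V') ⟶ Y}
    (e : ∀ C, V ◁ coendI h C ▷ V' ≫ f = V ◁ coendI h C ▷ V' ≫ g) : f = g :=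
  hom_ext_unitX_middle c hunit e

theorem Q_leftU (hunit : Simple (𝟙_ A)) : Q c (redUnit h) Z ≫ leftU h Z = leftU h Z := by
  rw [Q_eq_avg, (leftU_cent_rho h Z hunit).avg_comp c, Category.id_comp,
    (leftU_cent_sig h Z).avg_eq c hunit Z.isHalfBraiding]

theorem Q_rightU (hunit : Simple (𝟙_ A)) : Q c Z (redUnit h) ≫ rightU h Z = rightU h Z := by
  rw [Q_eq_avg, (rightU_cent_rho h Z).avg_comp c, Category.id_comp,
    (rightU_cent_sig h Z hunit).avg_eq c hunit Z.isHalfBraiding]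

theorem redLeftUnitor_eq : redLeftUnitor h Z = redIncl h (redUnit h) Z ≫ leftU h Z := rfl

theorem redRightUnitor_eq : redRightUnitor h Z = redIncl h Z (redUnit h) ≫ rightU h Z := rfl

theorem redProj_redLeftUnitor (hunit : Simple (𝟙_ A)) :
    redProj h (redUnit h) Z ≫ redLeftUnitor h Z = leftU h Z := by
  rw [redLeftUnitor_eq, redProj_redIncl_assoc, Q_leftU h Z hunit]

theorem redProj_redRightUnitor (hunit : Simple (𝟙_ A)) :
    redProj h Z (redUnit h) ≫ redRightUnitor h Z = rightU h Z := by
  rw [redRightUnitor_eq, redProj_redIncl_assoc, Q_rightU h Z hunit]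

theorem redLeftUnitor_cent (hunit : Simple (𝟙_ A)) (hP : P.IsSpherical) :
    Cent (redTensor h (redUnit h) Z).br Z.br (redLeftUnitor h Z) :=
  (redIncl_cent_rho h (redUnit h) Z hunit hP).comp (leftU_cent_rho h Z hunit)

theorem redRightUnitor_cent (hunit : Simple (𝟙_ A)) (hP : P.IsSpherical) :
    Cent (redTensor h Z (redUnit h)).br Z.br (redRightUnitor h Z) :=
  (redIncl_cent_rho h Z (redUnit h) hunit hP).comp (rightU_cent_rho h Z)

/-- The inverse is `√D` times the inclusion of `𝟙` in `I(𝟙)`, projected; the factor cancels the `1 /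
√D` of the constraint on the unit. One composite is then immediate. The other is an equation between
central morphisms out of `I(𝟙) ⊗ X`, so it is checked on the unit. The inclusion itself is central
for `sig` but the equation lives over `rho`; both restrict to the reduced half-braiding. -/
theorem redLeftUnitor_isIso (hunit : Simple (𝟙_ A)) (hP : P.IsSpherical) :
    IsIso (redLeftUnitor h Z) := by
  have hD := c.sqrtGlobal_ne_zero hunit
  have hv : Cent (Z.br) (redTensor h (redUnit h) Z).br
      ((λ_ Z.X).inv ≫ unitI h ▷ Z.X ≫ redProj h (redUnit h) Z) := by
    refine (Cent.leftUnitor_inv Z.br).comp (Cent.comp ?_ (redProj_cent_sig h _ Z hunit hP))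
    exact (Cent.plus (unitI h)).whiskerRight _
  refine ⟨c.sqrtGlobal • ((λ_ Z.X).inv ≫ unitI h ▷ Z.X ≫ redProj h (redUnit h) Z), ?_, ?_⟩
  · rw [← cancel_epi (redProj h (redUnit h) Z), ← Category.assoc, redProj_redLeftUnitor h Z hunit,
      Linear.comp_smul, Category.comp_id]
    have h1 := (leftU_cent_rho h Z hunit).comp hv
    have h2 : Cent (rho (redUnit h) Z) (redTensor h (redUnit h) Z).br
        (c.sqrtGlobal⁻¹ • redProj h (redUnit h) Z) := fun B => by
      have := redProj_cent_rho h (redUnit h) Z hunit hP B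
      simp [this]
    have h3 : leftU h Z ≫ (λ_ Z.X).inv ≫ unitI h ▷ Z.X ≫ redProj h (redUnit h) Z =
        c.sqrtGlobal⁻¹ • redProj h (redUnit h) Z := by
      refine hom_ext_redUnit_left h hunit h1 h2 ?_
      rw [← Category.assoc, unitI_leftU h Z hunit]
      simp
    rw [h3, smul_smul, mul_inv_cancel₀ hD, one_smul]
  · rw [Linear.smul_comp, Category.assoc, Category.assoc, redProj_redLeftUnitor h Z hunit,
      unitI_leftU h Z hunit, Linear.comp_smul, smul_smul, mul_inv_cancel₀ hD, one_smul,
      Iso.inv_hom_id]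

theorem redRightUnitor_isIso (hunit : Simple (𝟙_ A)) (hP : P.IsSpherical) :
    IsIso (redRightUnitor h Z) := by
  have hD := c.sqrtGlobal_ne_zero hunit
  have hv : Cent (Z.br) (redTensor h Z (redUnit h)).br
      ((ρ_ Z.X).inv ≫ Z.X ◁ unitI h ≫ redProj h Z (redUnit h)) := by
    refine (Cent.rightUnitor_minus_inv Z.br).comp (Cent.comp ?_ (redProj_cent_rho h Z _ hunit hP))
    exact (Cent.minus (unitI h)).whiskerLeft _
  refine ⟨c.sqrtGlobal • ((ρ_ Z.X).inv ≫ Z.X ◁ unitI h ≫ redProj h Z (redUnit h)), ?_, ?_⟩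
  · rw [← cancel_epi (redProj h Z (redUnit h)), ← Category.assoc, redProj_redRightUnitor h Z hunit,
      Linear.comp_smul, Category.comp_id]
    have h1 := (rightU_cent_sig h Z hunit).comp hv
    have h2 : Cent (sig Z (redUnit h)) (redTensor h Z (redUnit h)).br
        (c.sqrtGlobal⁻¹ • redProj h Z (redUnit h)) := fun B => by
      have := redProj_cent_sig h Z (redUnit h) hunit hP B
      simp [this]
    have h3 : rightU h Z ≫ (ρ_ Z.X).inv ≫ Z.X ◁ unitI h ≫ redProj h Z (redUnit h) =
        c.sqrtGlobal⁻¹ • redProj h Z (redUnit h) := by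
      refine hom_ext_redUnit_right h hunit h1 h2 ?_
      rw [← Category.assoc, unitI_rightU h Z hunit]
      simp
    rw [h3, smul_smul, mul_inv_cancel₀ hD, one_smul]
  · rw [Linear.smul_comp, Category.assoc, Category.assoc, redProj_redRightUnitor h Z hunit,
      unitI_rightU h Z hunit, Linear.comp_smul, smul_smul, mul_inv_cancel₀ hD, one_smul,
      Iso.inv_hom_id]

/-- The triangle axiom before restriction. On the component at `C` one side closes the strand `C` up
against `Z`, the other against `W`; after `p` both amount to the action of `r`. -/
theorem rightU_whiskerRight (hunit : Simple (𝟙_ A)) {R : A} {r : HB R} {p : Z.X ⊗ W.X ⟶ R}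
    (h1 : Cent (rho Z W) r p) (h2 : Cent (sig Z W) r p) :
    rightU h Z ▷ W.X ≫ p = (α_ _ _ _).hom ≫ Z.X ◁ leftU h W ≫ p := by
  rw [← cancel_epi (α_ Z.X (redUnit h).X W.X).inv, Iso.inv_hom_id_assoc]
  refine hom_ext_redUnit_middle h hunit fun C => ?_
  -- Being central for `rho` and for `sig` with the same target half-braiding, `p` equalizes the two
  -- ways of moving `C` across `Z ⊗ W`.
  have h3 : (β_ C Z.X).hom ▷ W.X ⊗≫ Z.X ◁ W.br C ⊗≫ p ▷ C =
      𝟙 ((C ⊗ Z.X) ⊗ W.X) ⊗≫ Z.br C ▷ W.X ⊗≫ Z.X ◁ (β_ W.X C).inv ⊗≫ p ▷ C := by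
    have e1 := h1 C
    have e2 := h2 C
    rw [e1] at e2
    unfold rho sig tbr plus minus at e2
    calc _ = (α_ C Z.X W.X).hom ≫ (((α_ C Z.X W.X).inv ≫ (β_ C Z.X).hom ▷ W.X ≫ (α_ _ _ _).hom ≫
        Z.X ◁ W.br C ≫ (α_ _ _ _).inv) ≫ p ▷ C) := by monoidal
      _ = _ := by rw [← e2]; monoidal
  have h4 := minus_evaluation C Cᵛ W.X (P.pev C)
  have e1 : Z.X ◁ coendI h C ▷ W.X ≫ (α_ Z.X (redUnit h).X W.X).inv ≫ rightU h Z ▷ W.X ≫ p =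
      c.sqrtGlobal⁻¹ • (𝟙 _ ⊗≫ (β_ C Z.X).inv ▷ Cᵛ ▷ W.X ⊗≫ Z.br C ▷ Cᵛ ▷ W.X ⊗≫
        Z.X ◁ (P.pev C ▷ W.X ≫ (λ_ W.X).hom ≫ (ρ_ W.X).inv) ⊗≫ p) := by
    calc _ = 𝟙 _ ⊗≫ (Z.X ◁ coendI h C ≫ rightU h Z) ▷ W.X ⊗≫ p := by monoidal
      _ = _ := by
        rw [coendI_rightU h Z hunit C]
        simp only [monoidalComp, MonoidalLinear.smul_whiskerRight, Linear.comp_smul,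
          Linear.smul_comp]
        congr 1
        unfold closeUp
        monoidal
  have e2 : Z.X ◁ coendI h C ▷ W.X ≫ Z.X ◁ leftU h W ≫ p =
      c.sqrtGlobal⁻¹ • (𝟙 _ ⊗≫ Z.X ◁ C ◁ (β_ W.X Cᵛ).inv ⊗≫ Z.X ◁ W.br C ▷ Cᵛ ⊗≫
        ((Z.X ⊗ W.X) ◁ P.pev C ≫ p ▷ 𝟙_ A) ⊗≫ 𝟙 R) := by
    calc _ = Z.X ◁ (coendI h C ▷ W.X ≫ leftU h W) ≫ p := by monoidal
      _ = _ := by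
        rw [coendI_leftU h W hunit C]
        simp only [MonoidalLinear.whiskerLeft_smul, Linear.smul_comp]
        congr 1
        unfold closeUp
        monoidal
  rw [e1, e2, h4]
  congr 1
  symm
  calc _ = 𝟙 _ ⊗≫ ((β_ C Z.X).inv ≫ (β_ C Z.X).hom) ▷ (Cᵛ ⊗ W.X) ⊗≫ (Z.X ⊗ C) ◁ (β_ W.X Cᵛ).inv ⊗≫
        Z.X ◁ W.br C ▷ Cᵛ ⊗≫ p ▷ (C ⊗ Cᵛ) ⊗≫ R ◁ P.pev C ⊗≫ 𝟙 R := by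
        rw [whisker_exchange p (P.pev C), Iso.inv_hom_id]; monoidal
    _ = 𝟙 _ ⊗≫ (β_ C Z.X).inv ▷ (Cᵛ ⊗ W.X) ⊗≫ ((β_ C Z.X).hom ▷ (Cᵛ ⊗ W.X) ≫
        (Z.X ⊗ C) ◁ (β_ W.X Cᵛ).inv) ⊗≫
        Z.X ◁ W.br C ▷ Cᵛ ⊗≫ p ▷ (C ⊗ Cᵛ) ⊗≫ R ◁ P.pev C ⊗≫ 𝟙 R := by monoidal
    _ = 𝟙 _ ⊗≫ (β_ C Z.X).inv ▷ (Cᵛ ⊗ W.X) ⊗≫ (C ⊗ Z.X) ◁ (β_ W.X Cᵛ).inv ⊗≫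
        ((β_ C Z.X).hom ▷ W.X ⊗≫ Z.X ◁ W.br C ⊗≫ p ▷ C) ▷ Cᵛ ⊗≫ R ◁ P.pev C ⊗≫ 𝟙 R := by
        rw [← whisker_exchange]; monoidal
    _ = 𝟙 _ ⊗≫ (β_ C Z.X).inv ▷ (Cᵛ ⊗ W.X) ⊗≫ ((C ⊗ Z.X) ◁ (β_ W.X Cᵛ).inv ≫
        Z.br C ▷ (W.X ⊗ Cᵛ)) ⊗≫ Z.X ◁ (β_ W.X C).inv ▷ Cᵛ ⊗≫
        (p ▷ (C ⊗ Cᵛ) ≫ R ◁ P.pev C) ⊗≫ 𝟙 R := by rw [h3]; monoidal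
    _ = _ := by rw [whisker_exchange (Z.br C), ← whisker_exchange p (P.pev C)]; monoidal

/-- The morphism `f ⊗ g` is central for `sig` and for `rho`, so it commutes with the average of the
identity. With this form, identities on reduced products are checked on full tensor products and the
idempotents need not be carried along. -/
theorem redProj_redMap (hunit : Simple (𝟙_ A)) (hP : P.IsSpherical) {Z Z' W W' : DCenter A}
    (f : Z ⟶ Z') (g : W ⟶ W') :
    redProj h Z W ≫ redMap h f g = (f.f ⊗ₘ g.f) ≫ redProj h Z' W' := by
  have h1 : Cent (sig Z W) (sig Z' W') (f.f ⊗ₘ g.f) := Cent.tensorHom (Cent.plus f.f) g.central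
  have h2 : Cent (rho Z W) (rho Z' W') (f.f ⊗ₘ g.f) := Cent.tensorHom f.central (Cent.minus g.f)
  have h3 : Q c Z W ≫ (f.f ⊗ₘ g.f) = (f.f ⊗ₘ g.f) ≫ Q c Z' W' := by
    rw [Q_eq_avg, Q_eq_avg, h1.comp_avg c, h2.avg_comp c]; simp
  rw [redMap, redProj_redIncl_assoc, reassoc_of% h3, Q_redProj h Z' W' hunit hP]

end ReducedUnit

/-! ### Evaluations and coevaluations before restriction. -/

section Duality

local postfix:max "ᵛ" => rightDual
local infixr:70 "⊠" => tbr

open ExactPairing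

set_option linter.unusedSectionVars false

section Sharp

variable {A : Type u} [Category.{v} A] [MonoidalCategory A] {X Y : A} [ExactPairing X Y] (γ : HB X)

theorem sharp_evaluation (B : A) : sharp γ B ▷ X ⊗≫ B ◁ ε_ X Y ⊗≫ 𝟙 B =
    𝟙 ((Y ⊗ B) ⊗ X) ⊗≫ Y ◁ γ B ⊗≫ ε_ X Y ▷ B ⊗≫ 𝟙 B := by
  unfold sharp
  calc _ = 𝟙 ((Y ⊗ B) ⊗ X) ⊗≫ (Y ⊗ B) ◁ η_ X Y ▷ X ⊗≫ Y ◁ γ B ▷ (Y ⊗ X) ⊗≫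
        (ε_ X Y ▷ (B ⊗ Y ⊗ X) ≫ 𝟙_ A ◁ B ◁ ε_ X Y) ⊗≫ 𝟙 B := by monoidal
    _ = 𝟙 ((Y ⊗ B) ⊗ X) ⊗≫ (Y ⊗ B) ◁ η_ X Y ▷ X ⊗≫ Y ◁ (γ B ▷ (Y ⊗ X) ≫ (X ⊗ B) ◁ ε_ X Y) ⊗≫
        ε_ X Y ▷ B ⊗≫ 𝟙 B := by rw [← whisker_exchange]; monoidal
    _ = 𝟙 ((Y ⊗ B) ⊗ X) ⊗≫ (Y ⊗ B) ◁ (η_ X Y ▷ X ⊗≫ X ◁ ε_ X Y) ⊗≫ Y ◁ γ B ⊗≫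
        ε_ X Y ▷ B ⊗≫ 𝟙 B := by rw [← whisker_exchange]; monoidal
    _ = _ := by rw [evaluation_coevaluation'']; monoidal

end Sharp

theorem minus_unit_apply {A : Type u} [Category.{v} A] [MonoidalCategory A] [BraidedCategory A]
    (B : A) : minus (𝟙_ A) B = (ρ_ B).hom ≫ (λ_ B).inv := by simp [minus]

section CenterDual

variable {A : Type u} [Category.{v} A] [MonoidalCategory A] [BraidedCategory A] (Z W : DCenter A)
  [ExactPairing Z.X W.X]

/-- The half-braiding of `W` is that of a dual of `Z` for the reduced tensor product. -/
def IsCenterDual : Prop :=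
  ∀ B, W.br B = (β_ B W.X).hom ≫ sharp Z.br B ≫ (β_ W.X B).inv

variable {Z W}

/-- Below the rotated half-braiding, the crossings of `B` with `W` and with `Z` are pulled off the
evaluation together. What remains is the rotation of the half-braiding of `Z`, which the evaluation
turns back into that half-braiding. -/
theorem IsCenterDual.evaluation (hd : IsCenterDual Z W) (B : A) :
    rho W Z B ≫ ε_ Z.X W.X ▷ B = sig W Z B ≫ ε_ Z.X W.X ▷ B := by
  have h1 : Cent (minus W.X ⊠ minus Z.X) (minus (𝟙_ A)) (ε_ Z.X W.X) := by
    rw [tbr_minus]; exact Cent.minus _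
  have h2 := h1 B
  rw [minus_unit_apply] at h2
  have h3 := sharp_evaluation (Y := W.X) Z.br B
  unfold tbr minus at h2
  unfold rho sig tbr minus plus
  rw [hd B]
  calc _ = 𝟙 _ ⊗≫ ((β_ B W.X).hom ≫ sharp (Y := W.X) Z.br B) ▷ Z.X ⊗≫ (((α_ B W.X Z.X).inv ≫
        (β_ W.X B).inv ▷ Z.X ≫ (α_ _ _ _).hom ≫ W.X ◁ (β_ Z.X B).inv ≫ (α_ _ _ _).inv) ≫
        ε_ Z.X W.X ▷ B) ⊗≫ 𝟙 (𝟙_ A ⊗ B) := by monoidal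
    _ = 𝟙 _ ⊗≫ (β_ B W.X).hom ▷ Z.X ⊗≫ (sharp (Y := W.X) Z.br B ▷ Z.X ⊗≫ B ◁ ε_ Z.X W.X ⊗≫ 𝟙 B) ⊗≫
        𝟙 (𝟙_ A ⊗ B) := by rw [← h2]; monoidal
    _ = _ := by rw [h3]; monoidal

end CenterDual

section Maps

variable {k : Type w} [Field k] [IsAlgClosed k] [CharZero k] {A : Type u} [Category.{v} A] [Abelian A]
  [Linear k A] [MonoidalCategory A] [MonoidalPreadditive A] [MonoidalLinear k A]
  [BraidedCategory A] [RigidCategory A] [IsFiniteSemisimple k A]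
  {P : PivotalStructure A} {Irr : Type t} [Fintype Irr] (c : SimpleChoice k P Irr)
  (Z W : DCenter A) [ExactPairing Z.X W.X]

theorem coendMap_obj' (hunit : Simple (𝟙_ A)) (i : Irr) :
    coendMap c (c.obj i) = (c.sqrtDim i)⁻¹ • unitι c i := by
  rw [← coendMap_obj c hunit i, smul_smul, inv_mul_cancel₀ (c.sqrtDim_ne_zero hunit i), one_smul]

theorem wrap_evaluation (hunit : Simple (𝟙_ A)) (γ : HB (W.X ⊗ Z.X)) (i : Irr) :
    wrap P γ (unitBr c) (ε_ Z.X W.X ≫ unitIncl c) (c.obj i) = (c.sqrtDim i)⁻¹ •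
      ((𝟙 _ ⊗≫ η_ (c.obj i) (c.obj i)ᵛ ▷ (W.X ⊗ Z.X) ⊗≫
        c.obj i ◁ (γ (c.obj i)ᵛ ≫ ε_ Z.X W.X ▷ (c.obj i)ᵛ) ⊗≫ 𝟙 (c.obj i ⊗ (c.obj i)ᵛ)) ≫
        unitι c i) := by
  have h := coendMap_eq c hunit (c.obj i)
  rw [← Linear.comp_smul, ← coendMap_obj' c hunit i, h]
  unfold wrap
  monoidal

theorem coeff_eq (hunit : Simple (𝟙_ A)) (i : Irr) :
    c.coeff i = c.sqrtGlobal * (c.globalDim⁻¹ * (c.dim i * (c.sqrtDim i)⁻¹)) := by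
  have h1 := c.sqrtGlobal_ne_zero hunit
  have h2 := c.sqrtDim_ne_zero hunit i
  rw [← c.sqrtGlobal_mul_self, SimpleChoice.coeff, SimpleChoice.dim]
  field_simp

theorem sqrtGlobal_smul_avg_evaluation (hunit : Simple (𝟙_ A)) (γ : HB (W.X ⊗ Z.X)) :
    c.sqrtGlobal • avg c γ (unitBr c) (ε_ Z.X W.X ≫ unitIncl c) = ∑ i, c.coeff i •
      ((𝟙 _ ⊗≫ η_ (c.obj i) (c.obj i)ᵛ ▷ (W.X ⊗ Z.X) ⊗≫
        c.obj i ◁ (γ (c.obj i)ᵛ ≫ ε_ Z.X W.X ▷ (c.obj i)ᵛ) ⊗≫ 𝟙 (c.obj i ⊗ (c.obj i)ᵛ)) ≫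
        unitι c i) := by
  rw [avg]
  simp only [Finset.smul_sum, wrap_evaluation c Z W hunit, smul_smul]
  refine Finset.sum_congr rfl fun i _ => ?_
  rw [coeff_eq c hunit]

/-- Around `ε` followed by `𝟙 ⟶ I(𝟙)` the lower half of the loop produces the component `coendMap`
at `X_i`, which is the inclusion divided by `√d_i`. The weight `d_i / D` thus becomes `√d_i / D`,
and the factor `√D` turns it into the coefficient `√d_i / √D`. -/
theorem evMapAlt_eq_sig (hunit : Simple (𝟙_ A)) : evMapAlt c Z W =
    c.sqrtGlobal • avg c (sig W Z) (unitBr c) (ε_ Z.X W.X ≫ unitIncl c) := by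
  rw [sqrtGlobal_smul_avg_evaluation c Z W hunit]
  refine Finset.sum_congr rfl fun i => fun _ => ?_
  congr 1
  refine congrArg (· ≫ unitι c i) ?_
  have h := coevaluation_braiding_inv (c.obj i) (c.obj i)ᵛ W.X
  unfold sig tbr plus
  calc _ = 𝟙 _ ⊗≫ (𝟙 W.X ⊗≫ W.X ◁ η_ (c.obj i) (c.obj i)ᵛ ⊗≫ (β_ (c.obj i) W.X).inv ▷ (c.obj i)ᵛ ⊗≫
        𝟙 (c.obj i ⊗ W.X ⊗ (c.obj i)ᵛ)) ▷ Z.X ⊗≫ (c.obj i ⊗ W.X) ◁ Z.br (c.obj i)ᵛ ⊗≫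
        c.obj i ◁ ε_ Z.X W.X ▷ (c.obj i)ᵛ ⊗≫ 𝟙 _ := by monoidal
    _ = _ := by rw [h]; monoidal

variable {Z W}

theorem IsCenterDual.evMapAlt_eq_rho (hd : IsCenterDual Z W) (hunit : Simple (𝟙_ A)) :
    evMapAlt c Z W = c.sqrtGlobal • avg c (rho W Z) (unitBr c) (ε_ Z.X W.X ≫ unitIncl c) := by
  rw [evMapAlt_eq_sig c Z W hunit, sqrtGlobal_smul_avg_evaluation c Z W hunit,
    sqrtGlobal_smul_avg_evaluation c Z W hunit]
  simp only [hd.evaluation]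

theorem Cent.smul {X Y : A} {γ : HB X} {μ : HB Y} {f : X ⟶ Y} (a : k) (hf : Cent γ μ f) :
    Cent γ μ (a • f) := fun B => by
  have := hf B
  simp [this]

theorem evMapAlt_cent_sig (hunit : Simple (𝟙_ A)) (hP : P.IsSpherical) :
    Cent (sig W Z) (unitBr c) (evMapAlt c Z W) := by
  rw [evMapAlt_eq_sig c Z W hunit]
  exact (avg_cent c hunit hP (isHalfBraiding_sig _ _) (isHalfBraiding_unitBr c hunit) _).smul _

theorem IsCenterDual.evMapAlt_cent_rho (hd : IsCenterDual Z W) (hunit : Simple (𝟙_ A))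
    (hP : P.IsSpherical) : Cent (rho W Z) (unitBr c) (evMapAlt c Z W) := by
  rw [hd.evMapAlt_eq_rho c hunit]
  exact (avg_cent c hunit hP (isHalfBraiding_rho _ _) (isHalfBraiding_unitBr c hunit) _).smul _

theorem IsCenterDual.Q_evMapAlt (hd : IsCenterDual Z W) (hunit : Simple (𝟙_ A))
    (hP : P.IsSpherical) : Q c W Z ≫ evMapAlt c Z W = evMapAlt c Z W := by
  rw [Q_eq_avg, (hd.evMapAlt_cent_rho c hunit hP).avg_comp c, Category.id_comp,
    (evMapAlt_cent_sig c hunit hP).avg_eq c hunit (isHalfBraiding_unitBr c hunit)]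

/-- The reduced half-braiding in `evMap` is `Q` followed by `rho`, and `Q` is absorbed because the
evaluation is central for `sig` and for `rho`. -/
theorem IsCenterDual.evMap_eq (hd : IsCenterDual Z W) (hunit : Simple (𝟙_ A))
    (hP : P.IsSpherical) : evMap c Z W = evMapAlt c Z W := by
  rw [← hd.Q_evMapAlt c hunit hP, hd.evMapAlt_eq_rho c hunit,
    sqrtGlobal_smul_avg_evaluation c Z W hunit, Preadditive.comp_sum]
  refine Finset.sum_congr rfl fun i _ => ?_
  rw [Linear.comp_smul]
  congr 1
  refine Eq.trans (congrArg (· ≫ unitι c i) ?_) (Category.assoc _ _ _)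
  rw [redBr_eq c W Z hunit]
  calc _ = 𝟙 _ ⊗≫ (η_ (c.obj i) (c.obj i)ᵛ ▷ (W.X ⊗ Z.X) ≫ (c.obj i ⊗ (c.obj i)ᵛ) ◁ Q c W Z) ⊗≫
        c.obj i ◁ (rho W Z (c.obj i)ᵛ ≫ ε_ Z.X W.X ▷ (c.obj i)ᵛ) ⊗≫
        𝟙 (c.obj i ⊗ (c.obj i)ᵛ) := by monoidal
    _ = _ := by rw [← whisker_exchange]; monoidal

/-- The object `(X ⊗ Y, γ ⊗ c^{-1})` of the center. -/
def rhoCenter (Z W : DCenter A) : DCenter A := ⟨Z.X ⊗ W.X, rho Z W, isHalfBraiding_rho Z W⟩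

variable (Z W) in
/-- The left unit constraint of `(X ⊗ Y, γ ⊗ c^{-1})`. -/
def leftRho : unitX c ⊗ (Z.X ⊗ W.X) ⟶ Z.X ⊗ W.X := leftUnit c (rhoCenter Z W)

variable (Z W) in
theorem unitι_leftRho (i : Irr) : unitι c i ▷ (Z.X ⊗ W.X) ≫ leftRho c Z W =
    c.coeff i • (𝟙 ((c.obj i ⊗ (c.obj i)ᵛ) ⊗ (Z.X ⊗ W.X)) ⊗≫
      c.obj i ◁ (β_ (Z.X ⊗ W.X) (c.obj i)ᵛ).inv ⊗≫ closeUp P (rho Z W) (c.obj i)) :=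
  unitι_leftUnit c (rhoCenter Z W) i

variable (Z W) in
theorem unitIncl_leftRho (hunit : Simple (𝟙_ A)) : unitIncl c ▷ (Z.X ⊗ W.X) ≫ leftRho c Z W =
    c.sqrtGlobal⁻¹ • (λ_ (Z.X ⊗ W.X)).hom :=
  unitIncl_leftUnit c (rhoCenter Z W) hunit

theorem leftRho_cent (hunit : Simple (𝟙_ A)) :
    Cent (unitBr c ⊠ minus (Z.X ⊗ W.X)) (rho Z W) (leftRho c Z W) :=
  leftUnit_cent_rho c (rhoCenter Z W) hunit

/-- The coevaluation is the unit constraint of the object `(X ⊗ Y, γ ⊗ c⁻¹)` of the center,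
evaluated on `η`. Its centrality and its value on `𝟙` are thereby inherited from the unit
constraint. -/
theorem coevMap_eq : coevMap c Z W =
    (ρ_ _).inv ≫ unitX c ◁ η_ Z.X W.X ≫ leftRho c Z W := by
  have h : ∀ i, unitι c i ≫ coevMap c Z W =
      unitι c i ≫ (ρ_ _).inv ≫ unitX c ◁ η_ Z.X W.X ≫ leftRho c Z W := by
    classical
    intro i
    have e1 : coevMap c Z W = ∑ i, c.coeff i • (unitπ c i ≫
      (𝟙 _ ⊗≫ c.obj i ◁ η_ Z.X W.X ▷ (c.obj i)ᵛ
      ⊗≫ Z.br (c.obj i) ▷ (W.X ⊗ (c.obj i)ᵛ)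
      ⊗≫ (Z.X ⊗ c.obj i) ◁ (β_ W.X (c.obj i)ᵛ).hom
      ⊗≫ Z.X ◁ P.pev (c.obj i) ▷ W.X ⊗≫ 𝟙 _)) := rfl
    have e2 : unitι c i ≫ coevMap c Z W = c.coeff i •
        (𝟙 _ ⊗≫ c.obj i ◁ η_ Z.X W.X ▷ (c.obj i)ᵛ
      ⊗≫ Z.br (c.obj i) ▷ (W.X ⊗ (c.obj i)ᵛ)
      ⊗≫ (Z.X ⊗ c.obj i) ◁ (β_ W.X (c.obj i)ᵛ).hom
      ⊗≫ Z.X ◁ P.pev (c.obj i) ▷ W.X ⊗≫ 𝟙 _) := by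
      rw [e1, Preadditive.comp_sum, Finset.sum_eq_single i]
      · rw [Linear.comp_smul, ← Category.assoc, unitι_π_self, Category.id_comp]
      · intro j _ hj
        rw [Linear.comp_smul, ← Category.assoc, unitι_π_ne c (Ne.symm hj)]
        simp
      · simp
    have e3 := unitι_leftRho c Z W i
    have e4 := braiding_evaluation (c.obj i) (c.obj i)ᵛ W.X (P.pev (c.obj i))
    have e5 : 𝟙 (c.obj i)ᵛ ⊗≫ ((c.obj i)ᵛ ◁ η_ Z.X W.X ≫ (β_ (Z.X ⊗ W.X) (c.obj i)ᵛ).inv) =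
        𝟙 (c.obj i)ᵛ ⊗≫ η_ Z.X W.X ▷ (c.obj i)ᵛ := by
      rw [BraidedCategory.braiding_inv_naturality_right, braiding_inv_tensorUnit_left]
      monoidal
    rw [e2]
    calc _ = c.coeff i • (𝟙 _ ⊗≫ c.obj i ◁ (𝟙 (c.obj i)ᵛ ⊗≫ η_ Z.X W.X ▷ (c.obj i)ᵛ) ⊗≫
          Z.br (c.obj i) ▷ (W.X ⊗ (c.obj i)ᵛ) ⊗≫ Z.X ◁ (𝟙 (c.obj i ⊗ W.X ⊗ (c.obj i)ᵛ) ⊗≫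
          c.obj i ◁ (β_ W.X (c.obj i)ᵛ).hom ⊗≫ P.pev (c.obj i) ▷ W.X ⊗≫ 𝟙 W.X) ⊗≫ 𝟙 _) := by
          congr 1; monoidal
      _ = (ρ_ _).inv ≫ (c.obj i ⊗ (c.obj i)ᵛ) ◁ η_ Z.X W.X ≫ (c.coeff i •
          (𝟙 ((c.obj i ⊗ (c.obj i)ᵛ) ⊗ (Z.X ⊗ W.X)) ⊗≫
            c.obj i ◁ (β_ (Z.X ⊗ W.X) (c.obj i)ᵛ).inv ⊗≫ closeUp P (rho Z W) (c.obj i))) := by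
          rw [← e5, e4, Linear.comp_smul, Linear.comp_smul]
          congr 1
          unfold closeUp rho tbr minus
          monoidal
      _ = (ρ_ _).inv ≫ (c.obj i ⊗ (c.obj i)ᵛ) ◁ η_ Z.X W.X ≫
          unitι c i ▷ (Z.X ⊗ W.X) ≫ leftRho c Z W := by rw [← e3]
      _ = _ := by rw [whisker_exchange_assoc]; simp
  rw [← Category.id_comp (coevMap c Z W), ← sum_unitπ_ι c, Preadditive.sum_comp]
  simp only [Category.assoc, h]
  simp only [← Category.assoc, ← Preadditive.sum_comp, sum_unitπ_ι c, Category.id_comp]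

theorem coevMap_cent_rho (hunit : Simple (𝟙_ A)) :
    Cent (unitBr c) (rho Z W) (coevMap c Z W) := by
  rw [coevMap_eq c]
  exact (Cent.rightUnitor_minus_inv _).comp (((Cent.minus _).whiskerLeft _).comp
    (leftRho_cent c hunit))

theorem unitIncl_coevMap (hunit : Simple (𝟙_ A)) :
    unitIncl c ≫ coevMap c Z W = c.sqrtGlobal⁻¹ • η_ Z.X W.X := by
  rw [coevMap_eq c, rightUnitor_inv_naturality_assoc, ← whisker_exchange_assoc, unitIncl_leftRho c Z W hunit,
    Linear.comp_smul, Linear.comp_smul]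
  congr 1
  monoidal

/-- The average in the evaluation extends over the whole diagram, since all other pieces are
central. Inside it the unit constraint meets the inclusion of `𝟙` and gives `1 / √D`, which cancels
the `√D` of the evaluation; the ordinary zigzag leaves the average of an identity. -/
theorem coevaluation_evMapAlt (hunit : Simple (𝟙_ A)) :
    (λ_ Z.X).inv ≫ η_ Z.X W.X ▷ Z.X ≫ (α_ _ _ _).hom ≫ Z.X ◁ evMapAlt c Z W ≫ rightUnit c Z =
      𝟙 Z.X := by
  have h1 := avg_plus_whiskerLeft c (γ := sig W Z) (μ := unitBr c) Z.X (ε_ Z.X W.X ≫ unitIncl c)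
  have h2 := (rightUnit_cent_sig c Z hunit).avg_comp c (γ := plus Z.X ⊠ sig W Z)
    (Z.X ◁ (ε_ Z.X W.X ≫ unitIncl c))
  have h3 : Cent Z.br (plus Z.X ⊠ sig W Z)
      ((λ_ Z.X).inv ≫ η_ Z.X W.X ▷ Z.X ≫ (α_ _ _ _).hom) := by
    refine (Cent.leftUnitor_inv _).comp (Cent.comp (μ := (plus Z.X ⊠ plus W.X) ⊠ Z.br) ?_
      (Cent.assoc _ _ _))
    rw [tbr_plus]
    exact (Cent.plus _).whiskerRight _
  have h4 := h3.comp_avg c (μ := Z.br) (Z.X ◁ (ε_ Z.X W.X ≫ unitIncl c) ≫ rightUnit c Z)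
  rw [evMapAlt_eq_sig c Z W hunit, MonoidalLinear.whiskerLeft_smul, Linear.smul_comp, ← h1, h2,
    Linear.comp_smul, Linear.comp_smul, Linear.comp_smul]
  simp only [Category.assoc] at h4
  rw [h4, MonoidalCategory.whiskerLeft_comp, Category.assoc, unitIncl_rightUnit c Z hunit,
    Linear.comp_smul, Linear.comp_smul, Linear.comp_smul, Linear.comp_smul, avg_smul, smul_smul,
    mul_inv_cancel₀ (c.sqrtGlobal_ne_zero hunit), one_smul]
  have h5 : (λ_ Z.X).inv ≫ η_ Z.X W.X ▷ Z.X ≫ (α_ Z.X W.X Z.X).hom ≫ Z.X ◁ ε_ Z.X W.X ≫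
      (ρ_ Z.X).hom = 𝟙 Z.X := by
    calc _ = 𝟙 _ ⊗≫ (η_ Z.X W.X ▷ Z.X ⊗≫ Z.X ◁ ε_ Z.X W.X) ⊗≫ 𝟙 Z.X := by monoidal
      _ = _ := by rw [evaluation_coevaluation'']; monoidal
  rw [h5, (Cent.id _).avg_eq c hunit Z.isHalfBraiding]

theorem IsCenterDual.evMapAlt_coevaluation (hd : IsCenterDual Z W) (hunit : Simple (𝟙_ A)) :
    (ρ_ W.X).inv ≫ W.X ◁ η_ Z.X W.X ≫ (α_ _ _ _).inv ≫ evMapAlt c Z W ▷ W.X ≫ leftUnit c W =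
      𝟙 W.X := by
  have h1 := avg_minus_whiskerRight c (γ := rho W Z) (μ := unitBr c) W.X (ε_ Z.X W.X ≫ unitIncl c)
  have h2 := (leftUnit_cent_rho c W hunit).avg_comp c (γ := rho W Z ⊠ minus W.X)
    ((ε_ Z.X W.X ≫ unitIncl c) ▷ W.X)
  have h3 : Cent W.br (rho W Z ⊠ minus W.X)
      ((ρ_ W.X).inv ≫ W.X ◁ η_ Z.X W.X ≫ (α_ _ _ _).inv) := by
    refine (Cent.rightUnitor_minus_inv _).comp (Cent.comp (μ := W.br ⊠ (minus Z.X ⊠ minus W.X)) ?_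
      (Cent.assoc_inv _ _ _))
    rw [tbr_minus]
    exact (Cent.minus _).whiskerLeft _
  have h4 := h3.comp_avg c (μ := W.br) ((ε_ Z.X W.X ≫ unitIncl c) ▷ W.X ≫ leftUnit c W)
  rw [hd.evMapAlt_eq_rho c hunit, MonoidalLinear.smul_whiskerRight, Linear.smul_comp, ← h1, h2,
    Linear.comp_smul, Linear.comp_smul, Linear.comp_smul]
  simp only [Category.assoc] at h4
  rw [h4, comp_whiskerRight, Category.assoc, unitIncl_leftUnit c W hunit,
    Linear.comp_smul, Linear.comp_smul, Linear.comp_smul, Linear.comp_smul, avg_smul, smul_smul,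
    mul_inv_cancel₀ (c.sqrtGlobal_ne_zero hunit), one_smul]
  have h5 : (ρ_ W.X).inv ≫ W.X ◁ η_ Z.X W.X ≫ (α_ W.X Z.X W.X).inv ≫ ε_ Z.X W.X ▷ W.X ≫
      (λ_ W.X).hom = 𝟙 W.X := by
    calc _ = 𝟙 _ ⊗≫ (W.X ◁ η_ Z.X W.X ⊗≫ ε_ Z.X W.X ▷ W.X) ⊗≫ 𝟙 W.X := by monoidal
      _ = _ := by rw [coevaluation_evaluation'']; monoidal
  rw [h5, (Cent.id _).avg_eq c hunit W.isHalfBraiding]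

/-- Both sides are central morphisms out of `I(𝟙) ⊗ X`, so it suffices to compare them on the unit,
where the coevaluation is `η / √D`. -/
theorem coevMap_evMapAlt (hunit : Simple (𝟙_ A)) :
    coevMap c Z W ▷ Z.X ≫ (α_ _ _ _).hom ≫ Z.X ◁ evMapAlt c Z W ≫ rightUnit c Z =
      leftUnit c Z := by
  have h1 : Cent (Z.br ⊠ (minus W.X ⊠ minus Z.X)) (Z.br ⊠ minus (unitX c))
      (Z.X ◁ evMapAlt c Z W) := by
    rw [tbr_minus]; exact (Cent.minus _).whiskerLeft _
  refine hom_ext_unitX_left c hunit (μ := Z.br) ?_ (leftUnit_cent_rho c Z hunit) ?_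
  · exact ((coevMap_cent_rho c hunit).whiskerRight _).comp ((Cent.assoc _ _ _).comp
      (h1.comp (rightUnit_cent_rho c Z)))
  · have h2 := coevaluation_evMapAlt (Z := Z) (W := W) c hunit
    rw [← comp_whiskerRight_assoc, unitIncl_coevMap c hunit, unitIncl_leftUnit c Z hunit,
      MonoidalLinear.smul_whiskerRight, Linear.smul_comp]
    congr 1
    rw [← cancel_epi (λ_ Z.X).inv, h2, Iso.inv_hom_id]

theorem IsCenterDual.evMapAlt_coevMap (hd : IsCenterDual Z W) (hunit : Simple (𝟙_ A))
    (hP : P.IsSpherical) :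
    W.X ◁ coevMap c Z W ≫ (α_ _ _ _).inv ≫ evMapAlt c Z W ▷ W.X ≫ leftUnit c W =
      rightUnit c W := by
  refine hom_ext_unitX_right c hunit (μ := W.br) ?_ (rightUnit_cent_sig c W hunit) ?_
  · exact ((coevMap_cent_rho c hunit).whiskerLeft _).comp ((Cent.assoc_inv _ _ _).comp
      (((evMapAlt_cent_sig c hunit hP).whiskerRight _).comp (leftUnit_cent_rho c W hunit)))
  · have h2 := hd.evMapAlt_coevaluation c hunit
    rw [← MonoidalCategory.whiskerLeft_comp_assoc, unitIncl_coevMap c hunit,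
      unitIncl_rightUnit c W hunit, MonoidalLinear.whiskerLeft_smul, Linear.smul_comp]
    congr 1
    rw [← cancel_epi (ρ_ W.X).inv, h2, Iso.inv_hom_id]

end Maps

end Duality

/-! ### Coherence axioms and rigidity of the reduced tensor product. -/

section MonoidalAxioms

local postfix:max "ᵛ" => rightDual
local infixr:70 "⊠" => tbr

open ExactPairing

set_option linter.unusedSectionVars false

variable {k : Type w} [Field k] [IsAlgClosed k] [CharZero k] {A : Type u} [Category.{v} A] [Abelian A]
  [Linear k A] [MonoidalCategory A] [MonoidalPreadditive A] [MonoidalLinear k A]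
  [BraidedCategory A] [RigidCategory A] [IsFiniteSemisimple k A]
  {P : PivotalStructure A} {Irr : Type t} [Fintype Irr] {c : SimpleChoice k P Irr}
  (hunit : Simple (𝟙_ A)) (hP : P.IsSpherical) (h : ObjectsDefined c)

section Pair

variable (Z W : DCenter A) [ExactPairing Z.X W.X]

/-- The evaluation before restriction. -/
def evR : W.X ⊗ Z.X ⟶ (redUnit h).X := evMapAlt c Z W

/-- The coevaluation before projection. -/
def coevR : (redUnit h).X ⟶ Z.X ⊗ W.X := coevMap c Z W

theorem redCoev_eq : redCoev h Z W = coevR h Z W ≫ redProj h Z W := rfl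

theorem redCoev_cent (hunit : Simple (𝟙_ A)) (hP : P.IsSpherical) :
    Cent (redUnit h).br (redTensor h Z W).br (redCoev h Z W) :=
  Cent.comp (coevMap_cent_rho c hunit) (redProj_cent_rho h Z W hunit hP)

variable {Z W}

theorem IsCenterDual.redEv_eq (hd : IsCenterDual Z W) (hunit : Simple (𝟙_ A)) (hP : P.IsSpherical) :
    redEv h Z W = redIncl h W Z ≫ evR h Z W :=
  congrArg (fun t => incl c W Z ≫ t) (hd.evMap_eq c hunit hP)

theorem IsCenterDual.redEv_cent (hd : IsCenterDual Z W) (hunit : Simple (𝟙_ A))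
    (hP : P.IsSpherical) : Cent (redTensor h W Z).br (redUnit h).br (redEv h Z W) := by
  rw [hd.redEv_eq h hunit hP]
  exact (redIncl_cent_rho h W Z hunit hP).comp (hd.evMapAlt_cent_rho c hunit hP)

theorem IsCenterDual.redProj_redEv (hd : IsCenterDual Z W) (hunit : Simple (𝟙_ A))
    (hP : P.IsSpherical) : redProj h W Z ≫ redEv h Z W = evR h Z W := by
  rw [hd.redEv_eq h hunit hP, redProj_redIncl_assoc]
  exact hd.Q_evMapAlt c hunit hP

theorem coevR_evR (hunit : Simple (𝟙_ A)) :
    coevR h Z W ▷ Z.X ≫ (α_ _ _ _).hom ≫ Z.X ◁ evR h Z W ≫ rightU h Z = leftU h Z :=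
  coevMap_evMapAlt c hunit

theorem IsCenterDual.evR_coevR (hd : IsCenterDual Z W) (hunit : Simple (𝟙_ A))
    (hP : P.IsSpherical) :
    W.X ◁ coevR h Z W ≫ (α_ _ _ _).inv ≫ evR h Z W ▷ W.X ≫ leftU h W = rightU h W :=
  hd.evMapAlt_coevMap c hunit hP

end Pair

theorem isCenterDual_redDual (Z : DCenter A) : IsCenterDual Z (redDual h Z) :=
  fun B => dualBr_eq_sharp Z B

theorem isCenterDual_redLeftDual (Z : DCenter A) : IsCenterDual (redLeftDual h Z) Z := fun B => by
  have e : sharp (redLeftDual h Z).br B = (β_ B Z.X).inv ≫ Z.br B ≫ (β_ Z.X B).hom :=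
    sharp_leftDualBr Z B
  rw [e]; simp

theorem morphismsDefined (hunit : Simple (𝟙_ A)) (hP : P.IsSpherical) : MorphismsDefined h where
  tensorHom f g := redMap_cent h hunit hP f g
  assoc Z₁ Z₂ Z₃ := redAssoc_cent h Z₁ Z₂ Z₃ hunit hP
  assoc_isIso Z₁ Z₂ Z₃ := redAssoc_isIso h Z₁ Z₂ Z₃ hunit hP
  assoc_restrict Z₁ Z₂ Z₃ := redAssoc_inclRight h Z₁ Z₂ Z₃ hunit hP
  leftUnitor Z := redLeftUnitor_cent h Z hunit hP
  leftUnitor_isIso Z := redLeftUnitor_isIso h Z hunit hP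
  rightUnitor Z := redRightUnitor_cent h Z hunit hP
  rightUnitor_isIso Z := redRightUnitor_isIso h Z hunit hP
  ev Z := (isCenterDual_redDual h Z).redEv_cent h hunit hP
  coev Z := redCoev_cent h _ _ hunit hP
  leftEv Z := (isCenterDual_redLeftDual h Z).redEv_cent h hunit hP
  leftCoev Z := redCoev_cent h _ _ hunit hP
  ev_eq Z := (isCenterDual_redDual h Z).redEv_eq h hunit hP
  leftEv_eq Z := (isCenterDual_redLeftDual h Z).redEv_eq h hunit hP
  dualBr_eq Z B := by
    rw [dualBr_eq_tw, twistOver_eq_tw (isHalfBraiding_stdDualBr Z),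
      twistUnder_eq_tw (isHalfBraiding_stdDualBr Z)]
    exact ⟨rfl, rfl⟩
  leftDualBr_eq Z B := by
    rw [leftDualBr_eq_twistUnder, twistOver_eq_tw (isHalfBraiding_stdLeftDualBr Z),
      twistUnder_eq_tw (isHalfBraiding_stdLeftDualBr Z)]
    exact ⟨rfl, rfl⟩

theorem redMap_id (hunit : Simple (𝟙_ A)) (hP : P.IsSpherical) (Z W : DCenter A) :
    redMap h (𝟙 Z) (𝟙 W) = 𝟙 (redTensor h Z W).X := by
  rw [redMap, DCenter.id_f, DCenter.id_f, id_tensorHom_id, Category.id_comp,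
    redIncl_redProj h Z W hunit hP]

theorem redMap_comp (hunit : Simple (𝟙_ A)) (hP : P.IsSpherical) {Z Z' Z'' W W' W'' : DCenter A}
    (f : Z ⟶ Z') (f' : Z' ⟶ Z'') (g : W ⟶ W') (g' : W' ⟶ W'') :
    redMap h f g ≫ redMap h f' g' = redMap h (f ≫ f') (g ≫ g') := by
  rw [← cancel_epi (redProj h Z W), ← Category.assoc, redProj_redMap h hunit hP, Category.assoc,
    redProj_redMap h hunit hP, redProj_redMap h hunit hP, DCenter.comp_f, DCenter.comp_f,
    ← tensorHom_comp_tensorHom, Category.assoc]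

theorem projLeft_cancel (hunit : Simple (𝟙_ A)) (hP : P.IsSpherical) {Z₁ Z₂ Z₃ : DCenter A} {V : A}
    {f g : (redTensor h (redTensor h Z₁ Z₂) Z₃).X ⟶ V}
    (e : projLeft h Z₁ Z₂ Z₃ ≫ f = projLeft h Z₁ Z₂ Z₃ ≫ g) : f = g := by
  have := congrArg (inclLeft h Z₁ Z₂ Z₃ ≫ ·) e
  simpa only [← Category.assoc, inclLeft_projLeft h Z₁ Z₂ Z₃ hunit hP, Category.id_comp] using this

theorem projLeft_redMap (hunit : Simple (𝟙_ A)) (hP : P.IsSpherical)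
    {Z₁ Z₂ Z₃ Z₁' Z₂' Z₃' : DCenter A} (f₁ : Z₁ ⟶ Z₁') (f₂ : Z₂ ⟶ Z₂') (f₃ : Z₃ ⟶ Z₃')
    (F : redTensor h Z₁ Z₂ ⟶ redTensor h Z₁' Z₂') (hF : F.f = redMap h f₁ f₂) :
    projLeft h Z₁ Z₂ Z₃ ≫ redMap h F f₃ =
      ((f₁.f ⊗ₘ f₂.f) ⊗ₘ f₃.f) ≫ projLeft h Z₁' Z₂' Z₃' := by
  rw [projLeft, projLeft, Category.assoc, redProj_redMap h hunit hP, hF,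
    whiskerRight_comp_tensorHom_assoc, redProj_redMap h hunit hP, tensorHom_comp_whiskerRight_assoc]

theorem projRight_redMap (hunit : Simple (𝟙_ A)) (hP : P.IsSpherical)
    {Z₁ Z₂ Z₃ Z₁' Z₂' Z₃' : DCenter A} (f₁ : Z₁ ⟶ Z₁') (f₂ : Z₂ ⟶ Z₂') (f₃ : Z₃ ⟶ Z₃')
    (F : redTensor h Z₂ Z₃ ⟶ redTensor h Z₂' Z₃') (hF : F.f = redMap h f₂ f₃) :
    projRight h Z₁ Z₂ Z₃ ≫ redMap h f₁ F =
      (f₁.f ⊗ₘ (f₂.f ⊗ₘ f₃.f)) ≫ projRight h Z₁' Z₂' Z₃' := by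
  rw [projRight, projRight, Category.assoc, redProj_redMap h hunit hP, hF,
    whiskerLeft_comp_tensorHom_assoc, redProj_redMap h hunit hP, tensorHom_comp_whiskerLeft_assoc]

theorem redAssoc_naturality (hunit : Simple (𝟙_ A)) (hP : P.IsSpherical)
    {Z₁ Z₂ Z₃ Z₁' Z₂' Z₃' : DCenter A} (f₁ : Z₁ ⟶ Z₁') (f₂ : Z₂ ⟶ Z₂') (f₃ : Z₃ ⟶ Z₃')
    (F : redTensor h Z₁ Z₂ ⟶ redTensor h Z₁' Z₂') (hF : F.f = redMap h f₁ f₂)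
    (G : redTensor h Z₂ Z₃ ⟶ redTensor h Z₂' Z₃') (hG : G.f = redMap h f₂ f₃) :
    redMap h F f₃ ≫ redAssoc h Z₁' Z₂' Z₃' = redAssoc h Z₁ Z₂ Z₃ ≫ redMap h f₁ G := by
  refine projLeft_cancel h hunit hP ?_
  rw [← Category.assoc, projLeft_redMap h hunit hP f₁ f₂ f₃ F hF, Category.assoc,
    projLeft_redAssoc h _ _ _ hunit hP, reassoc_of% projLeft_redAssoc h Z₁ Z₂ Z₃ hunit hP,
    projRight_redMap h hunit hP f₁ f₂ f₃ G hG, associator_naturality_assoc]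

theorem redLeftUnitor_naturality (hunit : Simple (𝟙_ A)) (hP : P.IsSpherical) {Z W : DCenter A}
    (f : Z ⟶ W) : redMap h (𝟙 (redUnit h)) f ≫ redLeftUnitor h W = redLeftUnitor h Z ≫ f.f := by
  rw [← cancel_epi (redProj h (redUnit h) Z), ← Category.assoc, redProj_redMap h hunit hP,
    Category.assoc, redProj_redLeftUnitor h W hunit, ← Category.assoc,
    redProj_redLeftUnitor h Z hunit, DCenter.id_f, id_tensorHom]
  refine hom_ext_redUnit_left h hunit (μ := W.br) ?_ ?_ ?_
  · exact ((Cent.minus f.f).whiskerLeft _).comp (leftU_cent_rho h W hunit)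
  · exact (leftU_cent_rho h Z hunit).comp f.central
  · rw [← whisker_exchange_assoc, unitI_leftU h W hunit, ← Category.assoc, unitI_leftU h Z hunit]
    simp

theorem redRightUnitor_naturality (hunit : Simple (𝟙_ A)) (hP : P.IsSpherical) {Z W : DCenter A}
    (f : Z ⟶ W) : redMap h f (𝟙 (redUnit h)) ≫ redRightUnitor h W = redRightUnitor h Z ≫ f.f := by
  rw [← cancel_epi (redProj h Z (redUnit h)), ← Category.assoc, redProj_redMap h hunit hP,
    Category.assoc, redProj_redRightUnitor h W hunit, ← Category.assoc,
    redProj_redRightUnitor h Z hunit, DCenter.id_f, tensorHom_id]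
  refine hom_ext_redUnit_right h hunit (μ := W.br) ?_ ?_ ?_
  · exact ((Cent.plus f.f).whiskerRight _).comp (rightU_cent_sig h W hunit)
  · exact (rightU_cent_sig h Z hunit).comp f.central
  · rw [whisker_exchange_assoc, unitI_rightU h W hunit, ← Category.assoc, unitI_rightU h Z hunit]
    simp

theorem red_triangle (hunit : Simple (𝟙_ A)) (hP : P.IsSpherical) (Z W : DCenter A)
    (L : redTensor h (redUnit h) W ⟶ W) (hL : L.f = redLeftUnitor h W)
    (R : redTensor h Z (redUnit h) ⟶ Z) (hR : R.f = redRightUnitor h Z) :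
    redAssoc h Z (redUnit h) W ≫ redMap h (𝟙 Z) L = redMap h R (𝟙 W) := by
  refine projLeft_cancel h hunit hP ?_
  rw [reassoc_of% projLeft_redAssoc h Z (redUnit h) W hunit hP, projRight, projLeft,
    Category.assoc, Category.assoc, redProj_redMap h hunit hP, redProj_redMap h hunit hP,
    DCenter.id_f, DCenter.id_f, id_tensorHom, tensorHom_id, hL, hR,
    ← MonoidalCategory.whiskerLeft_comp_assoc, ← comp_whiskerRight_assoc,
    redProj_redLeftUnitor h W hunit, redProj_redRightUnitor h Z hunit]
  exact (rightU_whiskerRight h Z W hunit (redProj_cent_rho h Z W hunit hP)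
    (redProj_cent_sig h Z W hunit hP)).symm

/-- After composition with the projection from the fourfold tensor product, each reduced associator
becomes the associator of `A` followed by a projection, so the pentagon of `A` applies. The
morphisms of the center are variables with prescribed underlying morphisms, to keep their proofs of
centrality out of the computation. -/
theorem red_pentagon (hunit : Simple (𝟙_ A)) (hP : P.IsSpherical) (W X Y Z : DCenter A)
    (F : redTensor h (redTensor h W X) Y ⟶ redTensor h W (redTensor h X Y))
    (hF : F.f = redAssoc h W X Y)
    (G : redTensor h (redTensor h X Y) Z ⟶ redTensor h X (redTensor h Y Z))
    (hG : G.f = redAssoc h X Y Z) :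
    redMap h F (𝟙 Z) ≫ redAssoc h W (redTensor h X Y) Z ≫ redMap h (𝟙 W) G =
      redAssoc h (redTensor h W X) Y Z ≫ redAssoc h W X (redTensor h Y Z) := by
  have e1 : projLeft h W X Y ▷ Z.X ≫ redProj h (redTensor h (redTensor h W X) Y) Z =
      redProj h W X ▷ Y.X ▷ Z.X ≫ projLeft h (redTensor h W X) Y Z := by
    rw [projLeft, projLeft, comp_whiskerRight_assoc]
  have e2 : projRight h W X Y ▷ Z.X ≫ redProj h (redTensor h W (redTensor h X Y)) Z =
      (W.X ◁ redProj h X Y) ▷ Z.X ≫ projLeft h W (redTensor h X Y) Z := by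
    rw [projLeft, projRight, comp_whiskerRight_assoc]
  have e3 : W.X ◁ redProj h X Y ▷ Z.X ≫ projRight h W (redTensor h X Y) Z =
      W.X ◁ projLeft h X Y Z ≫ redProj h W (redTensor h (redTensor h X Y) Z) := by
    rw [projLeft, projRight, MonoidalCategory.whiskerLeft_comp_assoc]
  have e4 : redProj h W X ▷ (Y.X ⊗ Z.X) ≫ projRight h (redTensor h W X) Y Z =
      (W.X ⊗ X.X) ◁ redProj h Y Z ≫ projLeft h W X (redTensor h Y Z) := by
    rw [projLeft, projRight, whisker_exchange_assoc]
  have e5 : W.X ◁ X.X ◁ redProj h Y Z ≫ projRight h W X (redTensor h Y Z) =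
      W.X ◁ projRight h X Y Z ≫ redProj h W (redTensor h X (redTensor h Y Z)) := by
    rw [projRight, projRight, MonoidalCategory.whiskerLeft_comp_assoc]
  have e6 : ∀ {V : A} {f g : (redTensor h (redTensor h (redTensor h W X) Y) Z).X ⟶ V},
      projLeft h W X Y ▷ Z.X ≫ redProj h (redTensor h (redTensor h W X) Y) Z ≫ f =
      projLeft h W X Y ▷ Z.X ≫ redProj h (redTensor h (redTensor h W X) Y) Z ≫ g → f = g := by
    intro V f g e
    have e' := congrArg (inclLeft h W X Y ▷ Z.X ≫ ·) e
    simp only [← comp_whiskerRight_assoc, inclLeft_projLeft h W X Y hunit hP] at e'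
    rw [id_whiskerRight, Category.id_comp, Category.id_comp] at e'
    exact (cancel_epi _).1 e'
  refine e6 ?_
  rw [← Category.assoc (redProj h (redTensor h (redTensor h W X) Y) Z), redProj_redMap h hunit hP,
    DCenter.id_f, tensorHom_id, hF, Category.assoc, ← comp_whiskerRight_assoc,
    projLeft_redAssoc h W X Y hunit hP, comp_whiskerRight_assoc, reassoc_of% e2,
    reassoc_of% projLeft_redAssoc h W (redTensor h X Y) Z hunit hP,
    associator_naturality_middle_assoc, reassoc_of% e3, redProj_redMap h hunit hP, DCenter.id_f,
    id_tensorHom, hG, ← MonoidalCategory.whiskerLeft_comp_assoc, projLeft_redAssoc h X Y Z hunit hP,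
    MonoidalCategory.whiskerLeft_comp_assoc, ← e5,
    reassoc_of% e1, reassoc_of% projLeft_redAssoc h (redTensor h W X) Y Z hunit hP,
    associator_naturality_left_assoc, reassoc_of% e4,
    projLeft_redAssoc h W X (redTensor h Y Z) hunit hP, associator_naturality_right_assoc,
    pentagon_assoc]

theorem isMonoidal (hunit : Simple (𝟙_ A)) (hP : P.IsSpherical) (hm : MorphismsDefined h) :
    IsMonoidal hm :=
  ⟨{ redStruct hm with
      tensorHom_def := fun {_ _ _ _} f g => DCenter.hom_ext (by
        refine Eq.trans ?_ (redMap_comp h hunit hP f (𝟙 _) (𝟙 _) g).symm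
        rw [Category.comp_id, Category.id_comp]; rfl)
      id_tensorHom_id := fun Z W => DCenter.hom_ext (redMap_id h hunit hP Z W)
      tensorHom_comp_tensorHom := fun f₁ f₂ g₁ g₂ => DCenter.hom_ext
        (redMap_comp h hunit hP f₁ g₁ f₂ g₂)
      whiskerLeft_id := fun Z W => DCenter.hom_ext (redMap_id h hunit hP Z W)
      id_whiskerRight := fun Z W => DCenter.hom_ext (redMap_id h hunit hP Z W)
      associator_naturality := fun f₁ f₂ f₃ => DCenter.hom_ext
        (redAssoc_naturality h hunit hP f₁ f₂ f₃ _ rfl _ rfl)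
      leftUnitor_naturality := fun f => DCenter.hom_ext (redLeftUnitor_naturality h hunit hP f)
      rightUnitor_naturality := fun f => DCenter.hom_ext (redRightUnitor_naturality h hunit hP f)
      pentagon := fun W X Y Z => DCenter.hom_ext (red_pentagon h hunit hP W X Y Z _ rfl _ rfl)
      triangle := fun Z W => DCenter.hom_ext (red_triangle h hunit hP Z W _ rfl _ rfl) }, rfl⟩

section Zigzag

variable {Z W : DCenter A} [ExactPairing Z.X W.X] (F : redUnit h ⟶ redTensor h Z W)
  (hF : F.f = redCoev h Z W) (G : redTensor h W Z ⟶ redUnit h) (hG : G.f = redEv h Z W)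

include hF hG

/-- The projections absorb all idempotents, and what is left is the zigzag `coevR_evR` on full
tensor products. -/
theorem IsCenterDual.coev_ev (hd : IsCenterDual Z W) (hunit : Simple (𝟙_ A)) (hP : P.IsSpherical) :
    redMap h F (𝟙 Z) ≫ redAssoc h Z W Z ≫ redMap h (𝟙 Z) G ≫ redRightUnitor h Z =
      redLeftUnitor h Z := by
  have e1 : projRight h Z W Z ≫ redMap h (𝟙 Z) G =
      Z.X ◁ evR h Z W ≫ redProj h Z (redUnit h) := by
    rw [projRight, Category.assoc, redProj_redMap h hunit hP, DCenter.id_f, id_tensorHom, hG,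
      ← MonoidalCategory.whiskerLeft_comp_assoc, hd.redProj_redEv h hunit hP]
  have e2 : redProj h (redUnit h) Z ≫ redMap h F (𝟙 Z) = coevR h Z W ▷ Z.X ≫ projLeft h Z W Z := by
    rw [projLeft, redProj_redMap h hunit hP, DCenter.id_f, tensorHom_id, hF, redCoev_eq,
      comp_whiskerRight_assoc]
  rw [← cancel_epi (redProj h (redUnit h) Z), reassoc_of% e2,
    reassoc_of% projLeft_redAssoc h Z W Z hunit hP, reassoc_of% e1,
    redProj_redRightUnitor h Z hunit, redProj_redLeftUnitor h Z hunit, coevR_evR h hunit]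

theorem IsCenterDual.ev_coev (hd : IsCenterDual Z W) (hunit : Simple (𝟙_ A)) (hP : P.IsSpherical)
    (i : (redTensor h W (redTensor h Z W)).X ⟶ (redTensor h (redTensor h W Z) W).X)
    (hi : redAssoc h W Z W ≫ i = 𝟙 _) :
    redMap h (𝟙 W) F ≫ i ≫ redMap h G (𝟙 W) ≫ redLeftUnitor h W = redRightUnitor h W := by
  have e1 : projLeft h W Z W ≫ redMap h G (𝟙 W) =
      evR h Z W ▷ W.X ≫ redProj h (redUnit h) W := by
    rw [projLeft, Category.assoc, redProj_redMap h hunit hP, DCenter.id_f, tensorHom_id, hG,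
      ← comp_whiskerRight_assoc, hd.redProj_redEv h hunit hP]
  have e2 : redProj h W (redUnit h) ≫ redMap h (𝟙 W) F = W.X ◁ coevR h Z W ≫ projRight h W Z W := by
    rw [projRight, redProj_redMap h hunit hP, DCenter.id_f, id_tensorHom, hF, redCoev_eq,
      MonoidalCategory.whiskerLeft_comp_assoc]
  have e3 : projRight h W Z W ≫ i = (α_ _ _ _).inv ≫ projLeft h W Z W := by
    rw [← cancel_epi (α_ W.X Z.X W.X).hom, ← Category.assoc,
      ← projLeft_redAssoc h W Z W hunit hP, Category.assoc, hi, Category.comp_id,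
      Iso.hom_inv_id_assoc]
  rw [← cancel_epi (redProj h W (redUnit h)), reassoc_of% e2, reassoc_of% e3, reassoc_of% e1,
    redProj_redRightUnitor h W hunit, redProj_redLeftUnitor h W hunit, hd.evR_coevR h hunit hP]

end Zigzag

theorem IsCenterDual.isDualPair (hunit : Simple (𝟙_ A)) (hP : P.IsSpherical)
    {hm : MorphismsDefined h} (hM : IsMonoidal hm) {Z W : DCenter A} [ExactPairing Z.X W.X]
    (hd : IsCenterDual Z W) (F : redUnit h ⟶ redTensor h Z W) (hF : F.f = redCoev h Z W)
    (G : redTensor h W Z ⟶ redUnit h) (hG : G.f = redEv h Z W) :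
    letI := redMonoidal hM
    IsDualPair (C := DCenter A) (X := Z) (Y := W) F G := by
  let := redMonoidal hM
  refine ⟨?_, ?_⟩
  · rw [← cancel_mono (λ_ W).hom, Category.assoc, Category.assoc, Category.assoc, Iso.inv_hom_id,
      Category.comp_id]
    exact DCenter.hom_ext (hd.ev_coev h F hF G hG hunit hP _
      (congrArg DCenter.Hom.f (α_ W Z W).hom_inv_id))
  · rw [← cancel_mono (ρ_ Z).hom, Category.assoc, Category.assoc, Category.assoc, Iso.inv_hom_id,
      Category.comp_id]
    exact DCenter.hom_ext (hd.coev_ev h F hF G hG hunit hP)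

theorem isRigid (hunit : Simple (𝟙_ A)) (hP : P.IsSpherical) {hm : MorphismsDefined h}
    (hM : IsMonoidal hm) : IsRigid hM where
  right Z := (isCenterDual_redDual h Z).isDualPair h hunit hP hM _ rfl _ rfl
  left Z := (isCenterDual_redLeftDual h Z).isDualPair h hunit hP hM _ rfl _ rfl

end MonoidalAxioms

/-! ### Comparison of left and right dual half-braidings by the pivotal structure. -/

section PivotalDual

local postfix:max "ᵛ" => rightDual
local postfix:max "ᵐ" => rightAdjointMate
local infixr:70 "⊠" => tbr

open ExactPairing

set_option linter.unusedSectionVars false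

section Mate

variable {A : Type u} [Category.{v} A] [MonoidalCategory A] [RightRigidCategory A]
  (P : PivotalStructure A) {X : A} (γ : HB X)

/-- The dual of `γ_B`, as a morphism `B^* ⊗ X^* ⟶ X^* ⊗ B^*`. -/
def mateBr (B : A) : Bᵛ ⊗ Xᵛ ⟶ Xᵛ ⊗ Bᵛ :=
  (dualTensorIso X B).hom ≫ (γ B)ᵐ ≫ (dualTensorIso B X).inv

theorem mateBr_evaluation (B : A) :
    mateBr γ B ▷ (B ⊗ X) ≫ (𝟙 _ ⊗≫ Xᵛ ◁ ε_ B Bᵛ ▷ X ⊗≫ ε_ X Xᵛ) =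
      (Bᵛ ⊗ Xᵛ) ◁ γ B ≫ (𝟙 _ ⊗≫ Bᵛ ◁ ε_ X Xᵛ ▷ B ⊗≫ ε_ B Bᵛ) := by
  rw [← dualTensorIso_hom_evaluation, ← dualTensorIso_hom_evaluation, ← comp_whiskerRight_assoc,
    mateBr, Category.assoc, Category.assoc, Iso.inv_hom_id, Category.comp_id,
    comp_whiskerRight_assoc, rightAdjointMate_comp_evaluation, whisker_exchange_assoc]

theorem mateBr_pev (B : A) :
    (B ⊗ X) ◁ mateBr γ B ≫ (𝟙 _ ⊗≫ B ◁ P.pev X ▷ Bᵛ ⊗≫ P.pev B) =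
      γ B ▷ (Bᵛ ⊗ Xᵛ) ≫ (𝟙 _ ⊗≫ X ◁ P.pev B ▷ Xᵛ ⊗≫ P.pev X) := by
  rw [← P.pev_tensor, ← P.pev_tensor, ← MonoidalCategory.whiskerLeft_comp_assoc,
    mateBr, Category.assoc, Category.assoc, Iso.inv_hom_id, Category.comp_id,
    MonoidalCategory.whiskerLeft_comp_assoc, ← P.pev_naturality, whisker_exchange_assoc]

/-- Paired with `B ⊗ X`, the two morphisms bring together `γ` at `B^*` and at `B`, which merge into
`γ` at `B^* ⊗ B` and disappear at the evaluation. So `mateBr` is the inverse of the rotation, that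
is, the standard dual half-braiding at `B^*`. -/
theorem sharp_mateBr (hγ : IsHalfBraiding X γ) (B : A) :
    sharp (Y := Xᵛ) γ Bᵛ ≫ mateBr γ B = 𝟙 _ := by
  have h1 := hγ.tensor Bᵛ B
  have h2 := hγ.naturality (ε_ B Bᵛ)
  rw [h1, hγ.unit] at h2
  have h3 := sharp_evaluation (Y := Xᵛ) γ Bᵛ
  rw [← cancel_mono (dualTensorIso B X).hom]
  refine hom_ext_of_evaluation (X := B ⊗ X) (Y := (B ⊗ X)ᵛ) ?_
  rw [comp_whiskerRight_assoc, comp_whiskerRight_assoc, comp_whiskerRight_assoc,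
    dualTensorIso_hom_evaluation, mateBr_evaluation, id_whiskerRight, Category.id_comp]
  calc _ = 𝟙 _ ⊗≫ (sharp (Y := Xᵛ) γ Bᵛ ▷ (B ⊗ X) ≫ (Bᵛ ⊗ Xᵛ) ◁ γ B) ⊗≫ Bᵛ ◁ ε_ X Xᵛ ▷ B ⊗≫
        ε_ B Bᵛ := by monoidal
    _ = 𝟙 _ ⊗≫ (Xᵛ ⊗ Bᵛ) ◁ γ B ⊗≫ (sharp (Y := Xᵛ) γ Bᵛ ▷ X ⊗≫ Bᵛ ◁ ε_ X Xᵛ ⊗≫ 𝟙 Bᵛ) ▷ B ⊗≫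
        ε_ B Bᵛ := by rw [← whisker_exchange]; monoidal
    _ = 𝟙 _ ⊗≫ (Xᵛ ⊗ Bᵛ) ◁ γ B ⊗≫ Xᵛ ◁ γ Bᵛ ▷ B ⊗≫ (ε_ X Xᵛ ▷ (Bᵛ ⊗ B) ≫ 𝟙_ A ◁ ε_ B Bᵛ) ⊗≫
        𝟙 (𝟙_ A) := by rw [h3]; monoidal
    _ = 𝟙 _ ⊗≫ Xᵛ ◁ (((α_ Bᵛ B X).hom ≫ Bᵛ ◁ γ B ≫ (α_ Bᵛ X B).inv ≫ γ Bᵛ ▷ B ≫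
        (α_ X Bᵛ B).hom) ≫ X ◁ ε_ B Bᵛ) ⊗≫ ε_ X Xᵛ ⊗≫ 𝟙 (𝟙_ A) := by
        rw [← whisker_exchange]; monoidal
    _ = _ := by rw [← h2]; monoidal

theorem mateBr_pev_whiskerRight (hγ : IsHalfBraiding X γ) (B : A) :
    𝟙 ((Bᵛ ⊗ X) ⊗ Xᵛ) ⊗≫ γ Bᵛ ▷ Xᵛ ⊗≫ X ◁ mateBr γ B ⊗≫ P.pev X ▷ Bᵛ ⊗≫ 𝟙 Bᵛ =
      𝟙 ((Bᵛ ⊗ X) ⊗ Xᵛ) ⊗≫ Bᵛ ◁ P.pev X ⊗≫ 𝟙 Bᵛ := by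
  have h1 := hγ.tensor B Bᵛ
  have h2 := hγ.naturality (P.pev B)
  rw [h1, hγ.unit] at h2
  have h3 := mateBr_pev P γ B
  have h4 := P.pev_pcoev B
  have key : ∀ {V : A} (f g : V ⟶ Bᵛ), B ◁ f ≫ P.pev B = B ◁ g ≫ P.pev B → f = g := by
    intro V f g e
    have aux : ∀ f : V ⟶ Bᵛ, f = 𝟙 _ ⊗≫ P.pcoev B ▷ V ⊗≫ Bᵛ ◁ (B ◁ f ≫ P.pev B) ⊗≫ 𝟙 Bᵛ := by
      intro f
      symm
      calc _ = 𝟙 _ ⊗≫ (P.pcoev B ▷ V ≫ (Bᵛ ⊗ B) ◁ f) ⊗≫ Bᵛ ◁ P.pev B ⊗≫ 𝟙 Bᵛ := by monoidal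
        _ = f ⊗≫ (P.pcoev B ▷ Bᵛ ⊗≫ Bᵛ ◁ P.pev B) ⊗≫ 𝟙 Bᵛ := by
            rw [← whisker_exchange]; monoidal
        _ = _ := by rw [h4]; monoidal
    rw [aux f, aux g, e]
  refine key _ _ ?_
  calc _ = 𝟙 _ ⊗≫ B ◁ γ Bᵛ ▷ Xᵛ ⊗≫ ((B ⊗ X) ◁ mateBr γ B ≫
        (𝟙 ((B ⊗ X) ⊗ Xᵛ ⊗ Bᵛ) ⊗≫ B ◁ P.pev X ▷ Bᵛ ⊗≫ P.pev B)) := by monoidal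
    _ = 𝟙 _ ⊗≫ (((α_ B Bᵛ X).hom ≫ B ◁ γ Bᵛ ≫ (α_ B X Bᵛ).inv ≫ γ B ▷ Bᵛ ≫
        (α_ X B Bᵛ).hom) ≫ X ◁ P.pev B) ▷ Xᵛ ⊗≫ P.pev X := by rw [h3]; monoidal
    _ = 𝟙 _ ⊗≫ (P.pev B ▷ (X ⊗ Xᵛ) ≫ 𝟙_ A ◁ P.pev X) ⊗≫ 𝟙 (𝟙_ A) := by rw [← h2]; monoidal
    _ = _ := by rw [← whisker_exchange]; monoidal

end Mate

section Rigid

variable {A : Type u} [Category.{v} A] [MonoidalCategory A] [BraidedCategory A] [RigidCategory A]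
  (P : PivotalStructure A) (Z : DCenter A)

theorem sharpInv_eq_mateBr (B D : A) [ExactPairing D Bᵛ] :
    sharpInv (Y := Z.Xᵛ) Z.br D Bᵛ = mateBr Z.br B := by
  have h1 := sharp_mateBr Z.br Z.isHalfBraiding B
  have h2 := sharpInv_sharp (Y := Z.Xᵛ) Z.isHalfBraiding D Bᵛ
  rw [← Category.comp_id (sharpInv (Y := Z.Xᵛ) Z.br D Bᵛ), ← h1, ← Category.assoc, h2,
    Category.id_comp]

theorem stdDualBr_rightDual (B : A) : stdDualBr Z Bᵛ = mateBr Z.br B :=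
  (stdDualBr_eq Z Bᵛ).trans
    (@sharpInv_eq_mateBr A _ _ _ _ Z B _ (LeftRigidCategory.leftDual Bᵛ).exact)

/-- The mate description is available only at objects of the form `B^*`; the isomorphism `B ≅
B^{**}` and naturality transport it to every `B`. -/
theorem stdDualBr_pev (B : A) :
    𝟙 ((B ⊗ Z.X) ⊗ Z.Xᵛ) ⊗≫ Z.br B ▷ Z.Xᵛ ⊗≫ Z.X ◁ stdDualBr Z B ⊗≫ P.pev Z.X ▷ B ⊗≫ 𝟙 B =
      𝟙 ((B ⊗ Z.X) ⊗ Z.Xᵛ) ⊗≫ B ◁ P.pev Z.X ⊗≫ 𝟙 B := by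
  have h1 := mateBr_pev_whiskerRight P Z.br Z.isHalfBraiding Bᵛ
  rw [← stdDualBr_rightDual] at h1
  have h2 := Z.isHalfBraiding.naturality (P.iso B).hom
  have h3 := (isHalfBraiding_stdDualBr Z).naturality (P.iso B).hom
  rw [← cancel_mono (P.iso B).hom]
  calc _ = 𝟙 _ ⊗≫ Z.br B ▷ Z.Xᵛ ⊗≫ Z.X ◁ stdDualBr Z B ⊗≫ (P.pev Z.X ▷ B ≫
        𝟙_ A ◁ (P.iso B).hom) ⊗≫ 𝟙 _ := by monoidal
    _ = 𝟙 _ ⊗≫ Z.br B ▷ Z.Xᵛ ⊗≫ Z.X ◁ (stdDualBr Z B ≫ Z.Xᵛ ◁ (P.iso B).hom) ⊗≫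
        P.pev Z.X ▷ Bᵛᵛ ⊗≫ 𝟙 _ := by rw [← whisker_exchange]; monoidal
    _ = 𝟙 _ ⊗≫ (Z.br B ≫ Z.X ◁ (P.iso B).hom) ▷ Z.Xᵛ ⊗≫ Z.X ◁ stdDualBr Z Bᵛᵛ ⊗≫
        P.pev Z.X ▷ Bᵛᵛ ⊗≫ 𝟙 _ := by rw [← h3]; monoidal
    _ = 𝟙 _ ⊗≫ (P.iso B).hom ▷ Z.X ▷ Z.Xᵛ ⊗≫ (𝟙 ((Bᵛᵛ ⊗ Z.X) ⊗ Z.Xᵛ) ⊗≫ Z.br Bᵛᵛ ▷ Z.Xᵛ ⊗≫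
        Z.X ◁ stdDualBr Z Bᵛᵛ ⊗≫ P.pev Z.X ▷ Bᵛᵛ ⊗≫ 𝟙 Bᵛᵛ) := by rw [← h2]; monoidal
    _ = 𝟙 _ ⊗≫ ((P.iso B).hom ▷ (Z.X ⊗ Z.Xᵛ) ≫ Bᵛᵛ ◁ P.pev Z.X) ⊗≫ 𝟙 Bᵛᵛ := by
        rw [h1]; monoidal
    _ = _ := by rw [← whisker_exchange]; monoidal

/-- The rigid structure in which left duals are right duals, by means of a pivotal structure. -/
@[reducible]
def pivotalRigid : RigidCategory A where
  rightDual := inferInstance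
  leftDual X := { leftDual := Xᵛ, exact := P.pairing X }

theorem stdDualBr_eq_cosharp (B : A) : stdDualBr Z B =
    letI := P.pairing Z.X
    cosharp (fun B => rotInv Z.br B Bᵛ) B := by
  let := P.pairing Z.X
  have h := Z.isHalfBraiding
  have h1 := stdDualBr_pev P Z B
  have h2 : rotInv Z.br B Bᵛ ≫ Z.br B = 𝟙 _ := rotInv_hom h.naturality h.tensor h.unit B Bᵛ
  have h3 := P.pev_pcoev Z.X
  have h4 : rotInv Z.br B Bᵛ ▷ Z.Xᵛ ⊗≫ B ◁ P.pev Z.X ⊗≫ 𝟙 B =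
      𝟙 _ ⊗≫ Z.X ◁ stdDualBr Z B ⊗≫ P.pev Z.X ▷ B ⊗≫ 𝟙 B := by
    calc _ = rotInv Z.br B Bᵛ ▷ Z.Xᵛ ⊗≫ (𝟙 ((B ⊗ Z.X) ⊗ Z.Xᵛ) ⊗≫ B ◁ P.pev Z.X ⊗≫ 𝟙 B) := by
          monoidal
      _ = (rotInv Z.br B Bᵛ ≫ Z.br B) ▷ Z.Xᵛ ⊗≫ Z.X ◁ stdDualBr Z B ⊗≫ P.pev Z.X ▷ B ⊗≫ 𝟙 B := by
          rw [← h1]; monoidal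
      _ = _ := by rw [h2]; monoidal
  have h5 : cosharp (fun B => rotInv Z.br B Bᵛ) B = 𝟙 (B ⊗ Z.Xᵛ) ⊗≫ P.pcoev Z.X ▷ (B ⊗ Z.Xᵛ) ⊗≫
      Z.Xᵛ ◁ rotInv Z.br B Bᵛ ▷ Z.Xᵛ ⊗≫ (Z.Xᵛ ⊗ B) ◁ P.pev Z.X ⊗≫ 𝟙 (Z.Xᵛ ⊗ B) := rfl
  change _ = cosharp (fun B => rotInv Z.br B Bᵛ) B
  rw [h5]
  symm
  calc _ = 𝟙 (B ⊗ Z.Xᵛ) ⊗≫ P.pcoev Z.X ▷ (B ⊗ Z.Xᵛ) ⊗≫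
        Z.Xᵛ ◁ (rotInv Z.br B Bᵛ ▷ Z.Xᵛ ⊗≫ B ◁ P.pev Z.X ⊗≫ 𝟙 B) := by monoidal
    _ = 𝟙 (B ⊗ Z.Xᵛ) ⊗≫ (P.pcoev Z.X ▷ (B ⊗ Z.Xᵛ) ≫ (Z.Xᵛ ⊗ Z.X) ◁ stdDualBr Z B) ⊗≫
        Z.Xᵛ ◁ P.pev Z.X ▷ B ⊗≫ 𝟙 (Z.Xᵛ ⊗ B) := by rw [h4]; monoidal
    _ = stdDualBr Z B ⊗≫ (P.pcoev Z.X ▷ Z.Xᵛ ⊗≫ Z.Xᵛ ◁ P.pev Z.X) ▷ B ⊗≫ 𝟙 (Z.Xᵛ ⊗ B) := by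
        rw [← whisker_exchange]; monoidal
    _ = _ := by rw [h3]; monoidal

/-- If the right dual is regarded as a left dual by means of the pivotal structure, the two standard
dual half-braidings agree, hence so do their conjugates by crossings. The formula for the rotation
of a left dual half-braiding then also applies to `dualBr`. -/
theorem dualBr_eq_leftDualBr (B : A) :
    dualBr Z B = @leftDualBr A _ _ _ (pivotalRigid P) Z B := by
  have e : @stdLeftDualBr A _ _ (pivotalRigid P) Z = stdDualBr Z := by
    rw [@stdLeftDualBr_eq A _ _ _ (pivotalRigid P)]
    funext B
    exact (stdDualBr_eq_cosharp P Z B).symm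
  have h1 := @leftDualBr_eq_twistUnder A _ _ _ (pivotalRigid P) Z B
  rw [h1, @twistUnder_eq_tw A _ _ _ _ _ (@isHalfBraiding_stdLeftDualBr A _ _ _ (pivotalRigid P) Z)
    (pivotalRigid P) B, dualBr_eq_tw]
  unfold tw
  congr! 3
  exact (congrFun e B).symm

theorem sharp_dualBr (B : A) : @sharp A _ _ Z.Xᵛ Z.X (P.pairing Z.X) (dualBr Z) B =
    (β_ B Z.X).inv ≫ Z.br B ≫ (β_ Z.X B).hom := by
  rw [show dualBr Z = @leftDualBr A _ _ _ (pivotalRigid P) Z from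
    funext (dualBr_eq_leftDualBr P Z)]
  exact @sharp_leftDualBr A _ _ _ (pivotalRigid P) Z B

theorem sharp_dualBr_iso (B : A) :
    (P.iso Z.X).hom ▷ B ≫ sharp (Y := Z.Xᵛᵛ) (dualBr Z) B =
      (β_ B Z.X).inv ≫ Z.br B ≫ (β_ Z.X B).hom ≫ B ◁ (P.iso Z.X).hom := by
  have h1 := sharp_dualBr P Z B
  have h2 : @sharp A _ _ Z.Xᵛ Z.X (P.pairing Z.X) (dualBr Z) B =
      𝟙 (Z.X ⊗ B) ⊗≫ (Z.X ⊗ B) ◁ P.pcoev Z.X ⊗≫ Z.X ◁ dualBr Z B ▷ Z.X ⊗≫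
        P.pev Z.X ▷ (B ⊗ Z.X) ⊗≫ 𝟙 (B ⊗ Z.X) := rfl
  rw [h2] at h1
  have h3 : P.pcoev Z.X ≫ Z.Xᵛ ◁ (P.iso Z.X).hom = η_ Z.Xᵛ Z.Xᵛᵛ := by
    rw [PivotalStructure.pcoev, Category.assoc, ← MonoidalCategory.whiskerLeft_comp,
      Iso.inv_hom_id, MonoidalCategory.whiskerLeft_id, Category.comp_id]
  have h4 := reassoc_of% h1
  rw [← h4]
  unfold sharp
  symm
  calc _ = 𝟙 (Z.X ⊗ B) ⊗≫ (Z.X ⊗ B) ◁ P.pcoev Z.X ⊗≫ Z.X ◁ dualBr Z B ▷ Z.X ⊗≫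
        (P.pev Z.X ▷ (B ⊗ Z.X) ≫ 𝟙_ A ◁ B ◁ (P.iso Z.X).hom) ⊗≫ 𝟙 _ := by monoidal
    _ = 𝟙 (Z.X ⊗ B) ⊗≫ (Z.X ⊗ B) ◁ P.pcoev Z.X ⊗≫ Z.X ◁ (dualBr Z B ▷ Z.X ≫
        (Z.Xᵛ ⊗ B) ◁ (P.iso Z.X).hom) ⊗≫ P.pev Z.X ▷ (B ⊗ Z.Xᵛᵛ) ⊗≫ 𝟙 _ := by
        rw [← whisker_exchange]; monoidal
    _ = 𝟙 (Z.X ⊗ B) ⊗≫ (Z.X ⊗ B) ◁ (P.pcoev Z.X ≫ Z.Xᵛ ◁ (P.iso Z.X).hom) ⊗≫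
        Z.X ◁ dualBr Z B ▷ Z.Xᵛᵛ ⊗≫ P.pev Z.X ▷ (B ⊗ Z.Xᵛᵛ) ⊗≫ 𝟙 _ := by
        rw [← whisker_exchange]; monoidal
    _ = 𝟙 (Z.X ⊗ B) ⊗≫ ((Z.X ⊗ B) ◁ η_ Z.Xᵛ Z.Xᵛᵛ ⊗≫ Z.X ◁ dualBr Z B ▷ Z.Xᵛᵛ) ⊗≫
        (P.iso Z.X).hom ▷ (Z.Xᵛ ⊗ B ⊗ Z.Xᵛᵛ) ⊗≫ ε_ Z.Xᵛ Z.Xᵛᵛ ▷ (B ⊗ Z.Xᵛᵛ) ⊗≫ 𝟙 _ := by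
        rw [h3, PivotalStructure.pev]; monoidal
    _ = 𝟙 (Z.X ⊗ B) ⊗≫ (Z.X ◁ (𝟙 B ⊗≫ B ◁ η_ Z.Xᵛ Z.Xᵛᵛ ⊗≫ dualBr Z B ▷ Z.Xᵛᵛ) ≫
        (P.iso Z.X).hom ▷ ((Z.Xᵛ ⊗ B) ⊗ Z.Xᵛᵛ)) ⊗≫ ε_ Z.Xᵛ Z.Xᵛᵛ ▷ (B ⊗ Z.Xᵛᵛ) ⊗≫ 𝟙 _ := by
        monoidal
    _ = _ := by rw [whisker_exchange]; monoidal

end Rigid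

end PivotalDual

/-! ### Dual morphisms and duals of products for the reduced tensor product. -/

section ReducedDuals

local postfix:max "ᵛ" => rightDual
local postfix:max "ᵐ" => rightAdjointMate
local infixr:70 "⊠" => tbr

open ExactPairing

set_option linter.unusedSectionVars false

section Agree

variable {A : Type u} [Category.{v} A] [MonoidalCategory A] {X X' Y Y' V : A}

/-- The half-braidings `μ` and `μ'` agree after composition with `e`. -/
def Agree (μ μ' : HB X) (e : X ⟶ Y) : Prop := ∀ B, μ B ≫ e ▷ B = μ' B ≫ e ▷ B

variable {μ μ' : HB X} {γ γ' : HB X'} {e : X ⟶ Y}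

theorem Agree.precomp (h : Agree μ μ' e) {f : X' ⟶ X} (hf : Cent γ μ f) (hf' : Cent γ' μ' f) :
    Agree γ γ' (f ≫ e) := fun B => by
  rw [comp_whiskerRight, ← Category.assoc, ← hf B, Category.assoc, h B, ← Category.assoc, hf' B,
    Category.assoc]

theorem Agree.postcomp (h : Agree μ μ' e) (g : Y ⟶ Y') : Agree μ μ' (e ≫ g) := fun B => by
  rw [comp_whiskerRight, ← Category.assoc, h B, Category.assoc]

theorem Agree.whiskerLeft (h : Agree μ μ' e) (ν : HB V) : Agree (ν ⊠ μ) (ν ⊠ μ') (V ◁ e) :=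
  fun B => by
    have h1 := h B
    unfold tbr
    calc _ = 𝟙 _ ⊗≫ ν B ▷ X ⊗≫ V ◁ (μ B ≫ e ▷ B) ⊗≫ 𝟙 _ := by monoidal
      _ = _ := by rw [h1]; monoidal

theorem Agree.whiskerRight (h : Agree μ μ' e) (ν : HB V) : Agree (μ ⊠ ν) (μ' ⊠ ν) (e ▷ V) :=
  fun B => by
    have h1 := h B
    have key : ∀ μ : HB X, (μ ⊠ ν) B ≫ e ▷ V ▷ B =
        𝟙 _ ⊗≫ (μ B ≫ e ▷ B) ▷ V ⊗≫ Y ◁ ν B ⊗≫ 𝟙 _ := fun μ => by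
      unfold tbr
      calc _ = 𝟙 _ ⊗≫ μ B ▷ V ⊗≫ (X ◁ ν B ≫ e ▷ (V ⊗ B)) ⊗≫ 𝟙 _ := by monoidal
        _ = _ := by rw [whisker_exchange]; monoidal
    rw [key, key, h1]

theorem Agree.trans {μ'' : HB X} (h : Agree μ μ' e) (h' : Agree μ' μ'' e) : Agree μ μ'' e :=
  fun B => (h B).trans (h' B)

end Agree

variable {k : Type w} [Field k] [IsAlgClosed k] [CharZero k] {A : Type u} [Category.{v} A] [Abelian A]
  [Linear k A] [MonoidalCategory A] [MonoidalPreadditive A] [MonoidalLinear k A]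
  [BraidedCategory A] [RigidCategory A] [IsFiniteSemisimple k A]
  {P : PivotalStructure A} {Irr : Type t} [Fintype Irr] {c : SimpleChoice k P Irr}
  (hunit : Simple (𝟙_ A)) (hP : P.IsSpherical) (h : ObjectsDefined c)

theorem Agree.avg_comp (c : SimpleChoice k P Irr) {V X Y : A} {γ : HB V} {μ μ' : HB X} {e : X ⟶ Y}
    (he : Agree μ μ' e) (g : V ⟶ X) : avg c γ μ g ≫ e = avg c γ μ' g ≫ e := by
  have key : ∀ C, wrap P γ μ g C ≫ e = wrap P γ μ' g C ≫ e := fun C => by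
    have aux : ∀ μ : HB X, wrap P γ μ g C ≫ e = 𝟙 V ⊗≫ η_ C Cᵛ ▷ V ⊗≫ C ◁ γ Cᵛ ⊗≫ C ◁ g ▷ Cᵛ ⊗≫
        (μ C ≫ e ▷ C) ▷ Cᵛ ⊗≫ Y ◁ P.pev C ⊗≫ 𝟙 Y := fun μ => by
      unfold wrap
      calc _ = 𝟙 V ⊗≫ η_ C Cᵛ ▷ V ⊗≫ C ◁ γ Cᵛ ⊗≫ C ◁ g ▷ Cᵛ ⊗≫
            μ C ▷ Cᵛ ⊗≫ (X ◁ P.pev C ≫ e ▷ 𝟙_ A) ⊗≫ 𝟙 Y := by monoidal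
        _ = _ := by rw [whisker_exchange]; monoidal
    rw [aux, aux, he C]
  simp only [avg, Linear.smul_comp, Preadditive.sum_comp, key]

/-- The double dual half-braiding is obtained by rotating `dualBr` and adding crossings; by
`sharp_dualBr_iso` the rotation is the original half-braiding between the opposite crossings,
transported along the pivotal isomorphism. -/
theorem iso_cent (Z : DCenter A) :
    DCenter.IsCentral Z (redDual h (redDual h Z)) (P.iso Z.X).hom := fun B => by
  have h1 := sharp_dualBr_iso P Z B
  have h2 : (redDual h (redDual h Z)).br B =
      (β_ B Z.Xᵛᵛ).hom ≫ sharp (Y := Z.Xᵛᵛ) (dualBr Z) B ≫ (β_ Z.Xᵛᵛ B).inv :=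
    dualBr_eq_sharp (redDual h Z) B
  refine (congrArg (B ◁ (P.iso Z.X).hom ≫ ·) h2).trans ?_
  change B ◁ (P.iso Z.X).hom ≫ (β_ B Z.Xᵛᵛ).hom ≫ sharp (Y := Z.Xᵛᵛ) (dualBr Z) B ≫
    (β_ Z.Xᵛᵛ B).inv = Z.br B ≫ (P.iso Z.X).hom ▷ B
  have h3 := BraidedCategory.braiding_naturality_left (P.iso Z.X).hom B
  rw [BraidedCategory.braiding_naturality_right_assoc, reassoc_of% h1,
    Iso.hom_inv_id_assoc, ← reassoc_of% h3, Iso.hom_inv_id, Category.comp_id]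

theorem evR_eq (Z W : DCenter A) [ExactPairing Z.X W.X] (hunit : Simple (𝟙_ A)) :
    evR h Z W = c.sqrtGlobal • avg c (sig W Z) (redUnit h).br (ε_ Z.X W.X ≫ unitI h) :=
  evMapAlt_eq_sig c Z W hunit

/-- The unrestricted evaluation is nondegenerate: the zigzag, started from `𝟙 ⟶ I(𝟙)`, recovers `f`
up to the factor `1 / √D`. -/
theorem IsCenterDual.hom_ext_evR {Z W : DCenter A} [ExactPairing Z.X W.X] (hd : IsCenterDual Z W)
    (hunit : Simple (𝟙_ A)) (hP : P.IsSpherical) {V : A} {f g : V ⟶ W.X}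
    (e : f ▷ Z.X ≫ evR h Z W = g ▷ Z.X ≫ evR h Z W) : f = g := by
  have key : ∀ f : V ⟶ W.X, (ρ_ V).inv ≫ V ◁ unitI h ≫ V ◁ coevR h Z W ≫ (α_ _ _ _).inv ≫
      (f ▷ Z.X ≫ evR h Z W) ▷ W.X ≫ leftU h W = c.sqrtGlobal⁻¹ • f := fun f => by
    have e1 := hd.evR_coevR h hunit hP
    rw [comp_whiskerRight_assoc, ← associator_inv_naturality_left_assoc, whisker_exchange_assoc,
      e1, whisker_exchange_assoc, unitI_rightU h W hunit]
    simp
  have h1 := key f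
  rw [e, key g] at h1
  have h2 := congrArg (c.sqrtGlobal • ·) h1
  simpa [smul_smul, c.sqrtGlobal_ne_zero hunit] using h2.symm

theorem evR_mate {X Y Y' R : A} [ExactPairing X Y] {γ : HB X} (f : Y' ⟶ Y) {r : HB R}
    (j : 𝟙_ A ⟶ R) : f ▷ X ≫ avg c (plus Y ⊠ γ) r (ε_ X Y ≫ j) =
      avg c (plus Y' ⊠ γ) r ((f ▷ X ≫ ε_ X Y) ≫ j) := by
  rw [((Cent.plus f).whiskerRight γ).comp_avg c, Category.assoc]

/-- The evaluation of `Z` with its dual. -/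
def evD (Z : DCenter A) : Z.Xᵛ ⊗ Z.X ⟶ (redUnit h).X := evR h Z (redDual h Z)

theorem evD_eq (Z : DCenter A) (hunit : Simple (𝟙_ A)) : evD h Z =
    c.sqrtGlobal • avg c (plus Z.Xᵛ ⊠ Z.br) (redUnit h).br (ε_ Z.X Z.Xᵛ ≫ unitI h) :=
  evR_eq h Z (redDual h Z) hunit

theorem hom_ext_evD (hunit : Simple (𝟙_ A)) (hP : P.IsSpherical) {Z : DCenter A} {V : A}
    {f g : V ⟶ Z.Xᵛ} (e : f ▷ Z.X ≫ evD h Z = g ▷ Z.X ≫ evD h Z) : f = g :=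
  (isCenterDual_redDual h Z).hom_ext_evR h hunit hP e

/-- Both `f` and its dual pass into the average that defines the evaluation: the dual because its
strand carries `plus`, and `f` because it is central. Inside, the relation is the defining one for
the dual morphism in `A`. -/
theorem rightAdjointMate_evD (hunit : Simple (𝟙_ A)) {Z W : DCenter A} (f : Z ⟶ W) :
    (f.f)ᵐ ▷ Z.X ≫ evD h Z = W.Xᵛ ◁ f.f ≫ evD h W := by
  have h1 : Cent (plus W.Xᵛ ⊠ Z.br) (plus W.Xᵛ ⊠ W.br) (W.Xᵛ ◁ f.f) :=
    Cent.whiskerLeft _ f.central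
  rw [evD_eq h Z hunit, evD_eq h W hunit, Linear.comp_smul, Linear.comp_smul, evR_mate,
    h1.comp_avg c, rightAdjointMate_comp_evaluation, Category.assoc]

/-- The projection to the reduced tensor product of `W^∨` and `Z`. -/
def projDual (W Z : DCenter A) : W.Xᵛ ⊗ Z.X ⟶ (redTensor h (redDual h W) Z).X :=
  redProj h (redDual h W) Z

theorem projDual_redEv (hunit : Simple (𝟙_ A)) (hP : P.IsSpherical) (Z : DCenter A) :
    projDual h Z Z ≫ redEv h Z (redDual h Z) = evD h Z :=
  (isCenterDual_redDual h Z).redProj_redEv h hunit hP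

theorem projDual_redMap (hunit : Simple (𝟙_ A)) (hP : P.IsSpherical) {Z W Z' W' : DCenter A}
    (g : redDual h W ⟶ redDual h W') (t : W.Xᵛ ⟶ W'.Xᵛ) (ht : g.f = t) (f : Z ⟶ Z') :
    projDual h W Z ≫ redMap h g f = (t ⊗ₘ f.f) ≫ projDual h W' Z' := by
  subst ht
  exact redProj_redMap h hunit hP g f

/-- The dual of a morphism for the reduced tensor product is its dual in `A`. -/
theorem eq_rightAdjointMate (hunit : Simple (𝟙_ A)) (hP : P.IsSpherical) {Z W : DCenter A}
    (f : Z ⟶ W) (g : redDual h W ⟶ redDual h Z)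
    (e : redMap h g (𝟙 Z) ≫ redEv h Z (redDual h Z) =
      redMap h (𝟙 (redDual h W)) f ≫ redEv h W (redDual h W)) : g.f = (f.f)ᵐ := by
  obtain ⟨t, ht⟩ : ∃ t : W.Xᵛ ⟶ Z.Xᵛ, g.f = t := ⟨_, rfl⟩
  refine ht.trans (hom_ext_evD h hunit hP (Eq.trans ?_ (rightAdjointMate_evD h hunit f).symm))
  have e1 : projDual h W Z ≫ redMap h g (𝟙 Z) ≫ redEv h Z (redDual h Z) =
      projDual h W Z ≫ redMap h (𝟙 (redDual h W)) f ≫ redEv h W (redDual h W) :=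
    congrArg (projDual h W Z ≫ ·) e
  rw [← Category.assoc, ← Category.assoc, projDual_redMap h hunit hP g t ht,
    projDual_redMap h hunit hP (𝟙 (redDual h W)) (𝟙 _) rfl, Category.assoc, Category.assoc,
    projDual_redEv h hunit hP, projDual_redEv h hunit hP, DCenter.id_f,
    tensorHom_id, id_tensorHom] at e1
  exact e1

section Tensor

variable (Z W : DCenter A)

/-- The pairing of `Z` with the first factor of `Z ⊗̄ W`. -/
def pairLeft : Z.Xᵛ ⊗ (redTensor h Z W).X ⟶ W.X :=
  Z.Xᵛ ◁ redIncl h Z W ≫ (α_ _ _ _).inv ≫ ε_ Z.X Z.Xᵛ ▷ W.X ≫ (λ_ W.X).hom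

theorem pairLeft_cent (hunit : Simple (𝟙_ A)) (hP : P.IsSpherical) :
    Cent (plus Z.Xᵛ ⊠ (redTensor h Z W).br) W.br (pairLeft h Z W) := by
  have h1 : Cent ((plus Z.Xᵛ ⊠ plus Z.X) ⊠ W.br) (plus (𝟙_ A) ⊠ W.br) (ε_ Z.X Z.Xᵛ ▷ W.X) := by
    rw [tbr_plus]; exact (Cent.plus _).whiskerRight _
  exact ((redIncl_cent_sig h Z W hunit hP).whiskerLeft _).comp ((Cent.assoc_inv _ _ _).comp
    (h1.comp (Cent.leftUnitor _)))

/-- The composite is `√D` times an average of a morphism equal to `1 / √D` times the plain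
contraction; on `Z ⊗̄ W` this contraction is already central, so averaging leaves it unchanged. -/
theorem whiskerLeft_redIncl_evD (hunit : Simple (𝟙_ A)) (hP : P.IsSpherical) :
    Z.Xᵛ ◁ redIncl h Z W ≫ (α_ _ _ _).inv ≫ evD h Z ▷ W.X ≫ leftU h W = pairLeft h Z W := by
  have h2 := (leftU_cent_rho h W hunit).avg_comp c (γ := (plus Z.Xᵛ ⊠ Z.br) ⊠ minus W.X)
    ((ε_ Z.X Z.Xᵛ ≫ unitI h) ▷ W.X)
  have h3 : Cent (plus Z.Xᵛ ⊠ (redTensor h Z W).br) ((plus Z.Xᵛ ⊠ Z.br) ⊠ minus W.X)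
      (Z.Xᵛ ◁ redIncl h Z W ≫ (α_ _ _ _).inv) :=
    ((redIncl_cent_rho h Z W hunit hP).whiskerLeft _).comp (Cent.assoc_inv _ _ _)
  have h4 := h3.comp_avg c (μ := W.br) ((ε_ Z.X Z.Xᵛ ≫ unitI h) ▷ W.X ≫ leftU h W)
  have h5 : (Z.Xᵛ ◁ redIncl h Z W ≫ (α_ _ _ _).inv) ≫
      (ε_ Z.X Z.Xᵛ ≫ unitI h) ▷ W.X ≫ leftU h W = c.sqrtGlobal⁻¹ • pairLeft h Z W := by
    rw [comp_whiskerRight, Category.assoc, Category.assoc, unitI_leftU h W hunit, Linear.comp_smul,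
      Linear.comp_smul, Linear.comp_smul]
    rfl
  unfold rho at h2
  rw [← h2, avg_minus_whiskerRight, h5, avg_smul,
    (pairLeft_cent h Z W hunit hP).avg_eq c hunit W.isHalfBraiding, Category.assoc] at h4
  rw [evD_eq h Z hunit, MonoidalLinear.smul_whiskerRight, Linear.smul_comp,
    Linear.comp_smul, Linear.comp_smul, h4, smul_smul, mul_inv_cancel₀ (c.sqrtGlobal_ne_zero hunit),
    one_smul]

theorem dualTensorIso_evD (hunit : Simple (𝟙_ A)) (hP : P.IsSpherical) :
    ((dualTensorIso Z.X W.X).hom ≫ (redIncl h Z W)ᵐ) ▷ (redTensor h Z W).X ≫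
      evD h (redTensor h Z W) =
    (α_ _ _ _).hom ≫ W.Xᵛ ◁ pairLeft h Z W ≫ evD h W := by
  have h1 : Cent (plus (W.Xᵛ ⊗ Z.Xᵛ) ⊠ (redTensor h Z W).br) (plus W.Xᵛ ⊠ W.br)
      ((α_ _ _ _).hom ≫ W.Xᵛ ◁ pairLeft h Z W) := by
    rw [← tbr_plus]
    exact (Cent.assoc _ _ _).comp ((pairLeft_cent h Z W hunit hP).whiskerLeft _)
  have h3 : ((dualTensorIso Z.X W.X).hom ≫ (redIncl h Z W)ᵐ) ▷ (redTensor h Z W).X ≫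
      ε_ (redTensor h Z W).X ((redTensor h Z W).X)ᵛ =
      ((α_ _ _ _).hom ≫ W.Xᵛ ◁ pairLeft h Z W) ≫ ε_ W.X W.Xᵛ := by
    rw [comp_whiskerRight, Category.assoc, rightAdjointMate_comp_evaluation,
      ← whisker_exchange_assoc, dualTensorIso_hom_evaluation]
    unfold pairLeft
    monoidal
  rw [evD_eq h W hunit, evD_eq h (redTensor h Z W) hunit, ← Category.assoc (α_ _ _ _).hom,
    Linear.comp_smul, Linear.comp_smul, evR_mate, h1.comp_avg c, h3, Category.assoc]

include h in
theorem agree_rho : Agree (plus (W.Xᵛ ⊗ Z.Xᵛ) ⊠ (Z.br ⊠ minus W.X))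
    ((plus W.Xᵛ ⊠ dualBr Z) ⊠ minus (Z.X ⊗ W.X))
    ((dualTensorIso Z.X W.X).hom ▷ (Z.X ⊗ W.X) ≫ ε_ (Z.X ⊗ W.X) (Z.X ⊗ W.X)ᵛ) := by
  have h1 : Agree (plus Z.Xᵛ ⊠ Z.br) (dualBr Z ⊠ minus Z.X) (ε_ Z.X Z.Xᵛ) :=
    fun B => ((isCenterDual_redDual h Z).evaluation B).symm
  have h2 := ((h1.whiskerRight (minus W.X)).precomp (Cent.assoc_inv _ _ _)
    (Cent.assoc_inv _ _ _)).whiskerLeft (plus W.Xᵛ)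
  have h3 := h2.precomp (Cent.assoc _ _ _) (Cent.assoc _ _ _)
  have h4 := h3.postcomp (W.Xᵛ ◁ (λ_ W.X).hom ≫ ε_ W.X W.Xᵛ)
  rw [← tbr_plus, ← tbr_minus, dualTensorIso_hom_evaluation]
  have e : ((α_ W.Xᵛ Z.Xᵛ (Z.X ⊗ W.X)).hom ≫ W.Xᵛ ◁ ((α_ Z.Xᵛ Z.X W.X).inv ≫
      ε_ Z.X Z.Xᵛ ▷ W.X)) ≫ W.Xᵛ ◁ (λ_ W.X).hom ≫ ε_ W.X W.Xᵛ =
      𝟙 _ ⊗≫ W.Xᵛ ◁ ε_ Z.X Z.Xᵛ ▷ W.X ⊗≫ ε_ W.X W.Xᵛ := by monoidal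
  rw [← e]
  exact h4

include h in
theorem agree_sig : Agree ((dualBr W ⊠ minus Z.Xᵛ) ⊠ minus (Z.X ⊗ W.X))
    (plus (W.Xᵛ ⊗ Z.Xᵛ) ⊠ (plus Z.X ⊠ W.br))
    ((dualTensorIso Z.X W.X).hom ▷ (Z.X ⊗ W.X) ≫ ε_ (Z.X ⊗ W.X) (Z.X ⊗ W.X)ᵛ) := by
  have h1 : Agree (dualBr W ⊠ minus W.X) (plus W.Xᵛ ⊠ W.br) (ε_ W.X W.Xᵛ) :=
    fun B => (isCenterDual_redDual h W).evaluation B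
  have h2 : Cent (minus Z.Xᵛ ⊠ (minus Z.X ⊠ minus W.X)) (minus W.X)
      ((α_ _ _ _).inv ≫ ε_ Z.X Z.Xᵛ ▷ W.X ≫ (λ_ W.X).hom) := by
    rw [tbr_minus, tbr_minus]; exact Cent.minus _
  have h3 : Cent ((plus Z.Xᵛ ⊠ plus Z.X) ⊠ W.br) (plus (𝟙_ A) ⊠ W.br) (ε_ Z.X Z.Xᵛ ▷ W.X) := by
    rw [tbr_plus]; exact (Cent.plus _).whiskerRight _
  have h4 : Cent (plus Z.Xᵛ ⊠ (plus Z.X ⊠ W.br)) W.br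
      ((α_ _ _ _).inv ≫ ε_ Z.X Z.Xᵛ ▷ W.X ≫ (λ_ W.X).hom) :=
    (Cent.assoc_inv _ _ _).comp (h3.comp (Cent.leftUnitor _))
  have h5 := (h1.precomp (h2.whiskerLeft _) (h4.whiskerLeft _)).precomp
    (Cent.assoc _ _ _) (Cent.assoc _ _ _)
  rw [← tbr_plus, ← tbr_minus, dualTensorIso_hom_evaluation]
  have e : (α_ W.Xᵛ Z.Xᵛ (Z.X ⊗ W.X)).hom ≫ W.Xᵛ ◁ ((α_ Z.Xᵛ Z.X W.X).inv ≫
      ε_ Z.X Z.Xᵛ ▷ W.X ≫ (λ_ W.X).hom) ≫ ε_ W.X W.Xᵛ =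
      𝟙 _ ⊗≫ W.Xᵛ ◁ ε_ Z.X Z.Xᵛ ▷ W.X ⊗≫ ε_ W.X W.Xᵛ := by monoidal
  rw [← e]
  exact h5

/-- The inclusion of the underlying object of `W^∨ ⊗̄ Z^∨`. -/
def inclDuals : (redTensor h (redDual h W) (redDual h Z)).X ⟶ W.Xᵛ ⊗ Z.Xᵛ :=
  redIncl h (redDual h W) (redDual h Z)

/-- The projection to the underlying object of `W^∨ ⊗̄ Z^∨`. -/
def projDuals : W.Xᵛ ⊗ Z.Xᵛ ⟶ (redTensor h (redDual h W) (redDual h Z)).X :=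
  redProj h (redDual h W) (redDual h Z)

theorem inclDuals_projDuals (hunit : Simple (𝟙_ A)) (hP : P.IsSpherical) :
    inclDuals h Z W ≫ projDuals h Z W = 𝟙 _ := redIncl_redProj h _ _ hunit hP

/-- The dual of `Q` acts as the identity on `W^∨ ⊗̄ Z^∨`. Paired with `Z ⊗ W` this says that the
loop around `Z ⊗ W` can be removed above the nested evaluation, since there `rho` and `sig` agree.
-/
theorem inclDuals_dualTensorIso (hunit : Simple (𝟙_ A)) (hP : P.IsSpherical) :
    inclDuals h Z W ≫ (dualTensorIso Z.X W.X).hom ≫ (Q c Z W)ᵐ =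
      inclDuals h Z W ≫ (dualTensorIso Z.X W.X).hom := by
  have hr : Cent (redTensor h (redDual h W) (redDual h Z)).br (dualBr W ⊠ minus Z.Xᵛ)
    (inclDuals h Z W) := redIncl_cent_rho h (redDual h W) (redDual h Z) hunit hP
  have hs : Cent (redTensor h (redDual h W) (redDual h Z)).br (plus W.Xᵛ ⊠ dualBr Z)
    (inclDuals h Z W) := redIncl_cent_sig h (redDual h W) (redDual h Z) hunit hP
  have h1 := (agree_rho h Z W).precomp ((Cent.plus (inclDuals h Z W)).whiskerRight _)
    (hs.whiskerRight _)
  have h2 := (agree_sig h Z W).precomp (hr.whiskerRight _)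
    ((Cent.plus (inclDuals h Z W)).whiskerRight _)
  -- `agree_rho` and `agree_sig` are joined through the reduced half-braiding of `W^∨ ⊗̄ Z^∨`, which
  -- is the restriction of both relevant half-braidings. The average from `sig` to `rho` may then be
  -- replaced by one from `sig` to `sig`, which fixes the identity.
  have h3 := (h1.trans h2).avg_comp c (γ := plus _ ⊠ (plus Z.X ⊠ W.br)) (𝟙 _)
  have h4 := (Cent.id (plus (redTensor h (redDual h W) (redDual h Z)).X ⊠
    (plus Z.X ⊠ W.br))).avg_eq c hunit
    ((isHalfBraiding_plus _).tbr ((isHalfBraiding_plus _).tbr W.isHalfBraiding))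
  rw [h4, Category.id_comp, ← MonoidalCategory.whiskerLeft_id, avg_plus_whiskerLeft] at h3
  have h5 : avg c (plus Z.X ⊠ W.br) (Z.br ⊠ minus W.X) (𝟙 _) = Q c Z W := (Q_eq_avg c Z W).symm
  rw [h5] at h3
  refine hom_ext_of_evaluation (X := Z.X ⊗ W.X) (Y := (Z.X ⊗ W.X)ᵛ) ?_
  rw [comp_whiskerRight, comp_whiskerRight, comp_whiskerRight, Category.assoc, Category.assoc,
    Category.assoc, rightAdjointMate_comp_evaluation, ← h3, whisker_exchange_assoc,
    whisker_exchange_assoc]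

end Tensor

end ReducedDuals

/-! ### Monoidality of the pivotal isomorphism. -/

section ReducedPivotal

local postfix:max "ᵛ" => rightDual
local postfix:max "ᵐ" => rightAdjointMate
local infixr:70 "⊠" => tbr

open ExactPairing

set_option linter.unusedSectionVars false

theorem dualTensorIso_hom_evaluation' {C : Type u} [Category.{v} C] [MonoidalCategory C]
    [RightRigidCategory C] (X Y : C) :
    (dualTensorIso X Y).hom ▷ (X ⊗ Y) ≫ ε_ (X ⊗ Y) (X ⊗ Y)ᵛ =
      (α_ _ _ _).hom ≫ Yᵛ ◁ ((α_ _ _ _).inv ≫ ε_ X Xᵛ ▷ Y ≫ (λ_ Y).hom) ≫ ε_ Y Yᵛ := by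
  rw [dualTensorIso_hom_evaluation]
  monoidal

variable {k : Type w} [Field k] [IsAlgClosed k] [CharZero k] {A : Type u} [Category.{v} A] [Abelian A]
  [Linear k A] [MonoidalCategory A] [MonoidalPreadditive A] [MonoidalLinear k A]
  [BraidedCategory A] [RigidCategory A] [IsFiniteSemisimple k A]
  {P : PivotalStructure A} {Irr : Type t} [Fintype Irr] {c : SimpleChoice k P Irr}
  (hunit : Simple (𝟙_ A)) (hP : P.IsSpherical) (h : ObjectsDefined c) (Z W : DCenter A)

theorem projDual_pairLeft (hunit : Simple (𝟙_ A)) (hP : P.IsSpherical)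
    (E : redTensor h (redDual h Z) Z ⟶ redUnit h) (hE : E.f = redEv h Z (redDual h Z))
    (i : (redTensor h (redDual h Z) (redTensor h Z W)).X ⟶
      (redTensor h (redTensor h (redDual h Z) Z) W).X)
    (hi : redAssoc h (redDual h Z) Z W ≫ i = 𝟙 _) :
    projDual h Z (redTensor h Z W) ≫ i ≫ redMap h E (𝟙 W) ≫ redLeftUnitor h W =
      pairLeft h Z W := by
  have h1 : (projDual h Z (redTensor h Z W)) =
      Z.Xᵛ ◁ redIncl h Z W ≫ projRight h (redDual h Z) Z W := by
    change _ = (redDual h Z).X ◁ redIncl h Z W ≫ (redDual h Z).X ◁ redProj h Z W ≫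
      redProj h (redDual h Z) (redTensor h Z W)
    rw [← MonoidalCategory.whiskerLeft_comp_assoc, redIncl_redProj h Z W hunit hP,
      MonoidalCategory.whiskerLeft_id, Category.id_comp]
    rfl
  have h2 : projRight h (redDual h Z) Z W ≫ i =
      (α_ _ _ _).inv ≫ projLeft h (redDual h Z) Z W := by
    rw [← cancel_epi (α_ (redDual h Z).X Z.X W.X).hom, ← Category.assoc,
      ← projLeft_redAssoc h (redDual h Z) Z W hunit hP, Category.assoc, hi, Category.comp_id,
      Iso.hom_inv_id_assoc]
  have h3 : projLeft h (redDual h Z) Z W ≫ redMap h E (𝟙 W) =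
      evR h Z (redDual h Z) ▷ W.X ≫ redProj h (redUnit h) W := by
    rw [projLeft, Category.assoc, redProj_redMap h hunit hP, DCenter.id_f, tensorHom_id, hE,
      ← comp_whiskerRight_assoc, (isCenterDual_redDual h Z).redProj_redEv h hunit hP]
  have h4 : projRight h (redDual h Z) Z W ≫ i ≫ redMap h E (𝟙 W) ≫ redLeftUnitor h W =
      (α_ _ _ _).inv ≫ evR h Z (redDual h Z) ▷ W.X ≫ leftU h W := by
    rw [reassoc_of% h2, reassoc_of% h3, redProj_redLeftUnitor h W hunit]
  refine Eq.trans ?_ (whiskerLeft_redIncl_evD h Z W hunit hP)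
  rw [h1]
  exact (Category.assoc _ _ _).trans (congrArg (Z.Xᵛ ◁ redIncl h Z W ≫ ·) h4)

/-- The tensor compatibility of duals for the reduced tensor product, in terms of that of `A`. -/
theorem projDuals_comp (hunit : Simple (𝟙_ A)) (hP : P.IsSpherical)
    (T : redTensor h (redDual h W) (redDual h Z) ⟶ redDual h (redTensor h Z W))
    (G : redTensor h (redDual h Z) (redTensor h Z W) ⟶ W)
    (hG : projDual h Z (redTensor h Z W) ≫ G.f = pairLeft h Z W)
    (e : redMap h T (𝟙 (redTensor h Z W)) ≫ redEv h _ (redDual h (redTensor h Z W)) =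
      redAssoc h (redDual h W) (redDual h Z) (redTensor h Z W) ≫
        redMap h (𝟙 (redDual h W)) G ≫ redEv h W (redDual h W))
    (t : (redTensor h (redDual h W) (redDual h Z)).X ⟶ ((redTensor h Z W).X)ᵛ) (ht : T.f = t) :
    projDuals h Z W ≫ t = (dualTensorIso Z.X W.X).hom ≫ (redIncl h Z W)ᵐ := by
  refine hom_ext_evD h hunit hP (Eq.trans ?_ (dualTensorIso_evD h Z W hunit hP).symm)
  have h1 : redProj h (redTensor h (redDual h W) (redDual h Z)) (redTensor h Z W) ≫
      redMap h T (𝟙 (redTensor h Z W)) ≫ redEv h _ (redDual h (redTensor h Z W)) =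
      t ▷ (redTensor h Z W).X ≫ evD h (redTensor h Z W) := by
    subst ht
    rw [← Category.assoc, redProj_redMap h hunit hP, DCenter.id_f, tensorHom_id, Category.assoc,
      (isCenterDual_redDual h (redTensor h Z W)).redProj_redEv h hunit hP]
    rfl
  have h2 : redProj h (redDual h W) (redTensor h (redDual h Z) (redTensor h Z W)) ≫
      redMap h (𝟙 (redDual h W)) G ≫ redEv h W (redDual h W) =
      (redDual h W).X ◁ G.f ≫ evR h W (redDual h W) := by
    rw [← Category.assoc, redProj_redMap h hunit hP, DCenter.id_f, id_tensorHom, Category.assoc,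
      (isCenterDual_redDual h W).redProj_redEv h hunit hP]
  have h3 : projLeft h (redDual h W) (redDual h Z) (redTensor h Z W) ≫
      redAssoc h (redDual h W) (redDual h Z) (redTensor h Z W) ≫
        redMap h (𝟙 (redDual h W)) G ≫ redEv h W (redDual h W) =
      (α_ _ _ _).hom ≫ (redDual h W).X ◁ (redProj h (redDual h Z) (redTensor h Z W) ≫ G.f) ≫
        evR h W (redDual h W) := by
    rw [reassoc_of% projLeft_redAssoc h (redDual h W) (redDual h Z) (redTensor h Z W) hunit hP,
      projRight, Category.assoc, h2, MonoidalCategory.whiskerLeft_comp_assoc]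
  have h4 : redProj h (redDual h Z) (redTensor h Z W) ≫ G.f = pairLeft h Z W := hG
  rw [h4, ← e] at h3
  have h5 : projLeft h (redDual h W) (redDual h Z) (redTensor h Z W) ≫
      redMap h T (𝟙 (redTensor h Z W)) ≫ redEv h _ (redDual h (redTensor h Z W)) =
      (projDuals h Z W ≫ t) ▷ (redTensor h Z W).X ≫ evD h (redTensor h Z W) := by
    rw [projLeft, Category.assoc, h1, comp_whiskerRight, Category.assoc]
    rfl
  exact h5.symm.trans h3

theorem comp_redProj_mate (hunit : Simple (𝟙_ A)) (hP : P.IsSpherical)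
    {t : (redTensor h (redDual h W) (redDual h Z)).X ⟶ ((redTensor h Z W).X)ᵛ}
    (ht : projDuals h Z W ≫ t = (dualTensorIso Z.X W.X).hom ≫ (redIncl h Z W)ᵐ) :
    t ≫ (redProj h Z W)ᵐ = inclDuals h Z W ≫ (dualTensorIso Z.X W.X).hom := by
  rw [← inclDuals_dualTensorIso h Z W hunit hP, ← redProj_redIncl h Z W,
    comp_rightAdjointMate, ← reassoc_of% ht, ← Category.assoc (inclDuals h Z W),
    inclDuals_projDuals h Z W hunit hP, Category.id_comp]

/-- After composition with the projection from `Z ⊗ W`, both comparison morphisms become those of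
`A`, and naturality of the pivotal isomorphism at this projection reduces the claim to monoidality
in `A`. -/
theorem red_iso_monoidal (hunit : Simple (𝟙_ A)) (hP : P.IsSpherical)
    {t : (redTensor h (redDual h W) (redDual h Z)).X ⟶ ((redTensor h Z W).X)ᵛ}
    (ht : projDuals h Z W ≫ t = (dualTensorIso Z.X W.X).hom ≫ (redIncl h Z W)ᵐ)
    {s : (redTensor h (redDual h (redDual h Z)) (redDual h (redDual h W))).X ⟶
      ((redTensor h (redDual h W) (redDual h Z)).X)ᵛ}
    (hs : projDuals h (redDual h W) (redDual h Z) ≫ s =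
      (dualTensorIso (redDual h W).X (redDual h Z).X).hom ≫
        (redIncl h (redDual h W) (redDual h Z))ᵐ)
    (F : Z ⟶ redDual h (redDual h Z)) (hF : F.f = (P.iso Z.X).hom)
    (G : W ⟶ redDual h (redDual h W)) (hG : G.f = (P.iso W.X).hom) :
    (P.iso (redTensor h Z W).X).hom ≫ tᵐ = redMap h F G ≫ s := by
  have h1 := comp_redProj_mate h Z W hunit hP ht
  have h2 := redProj_redMap h hunit hP F G
  have h3 := congrArg rightAdjointMate h1
  rw [comp_rightAdjointMate, comp_rightAdjointMate] at h3
  have h4 := P.naturality (redProj h Z W)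
  have h5 := P.monoidal Z.X W.X
  rw [← cancel_epi (redProj h Z W), reassoc_of% h4, h3, reassoc_of% h2, reassoc_of% h5]
  refine Eq.trans ?_ (congrArg ((F.f ⊗ₘ G.f) ≫ ·) hs).symm
  rw [hF, hG]
  rfl

end ReducedPivotal

/-! ### The pivotal structure of the center. -/

section ReducedPivotalStructure

local postfix:max "ᵛ" => rightDual
local postfix:max "ᵐ" => rightAdjointMate

open ExactPairing

set_option linter.unusedSectionVars false

variable {k : Type w} [Field k] [IsAlgClosed k] [CharZero k] {A : Type u} [Category.{v} A] [Abelian A]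
  [Linear k A] [MonoidalCategory A] [MonoidalPreadditive A] [MonoidalLinear k A]
  [BraidedCategory A] [RigidCategory A] [IsFiniteSemisimple k A]
  {P : PivotalStructure A} {Irr : Type t} [Fintype Irr] {c : SimpleChoice k P Irr}
  {h : ObjectsDefined c} {hm : MorphismsDefined h} {hM : IsMonoidal hm} (hr : IsRigid hM)
  (hunit : Simple (𝟙_ A)) (hP : P.IsSpherical)

include hunit hP

theorem IsRigid.rightAdjointMate_f {Z W : DCenter A} (f : Z ⟶ W) :
    letI := redMonoidal hM
    letI := redRigid hr
    DCenter.Hom.f (show redDual h W ⟶ redDual h Z from fᵐ) = (f.f)ᵐ := by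
  let := redMonoidal hM
  let := redRigid hr
  exact eq_rightAdjointMate h hunit hP f _
    (congrArg DCenter.Hom.f (rightAdjointMate_comp_evaluation f))

theorem IsRigid.projDuals_dualTensorIso (Z W : DCenter A) :
    letI := redMonoidal hM
    letI := redRigid hr
    projDuals h Z W ≫ DCenter.Hom.f (show redTensor h (redDual h W) (redDual h Z) ⟶
      redDual h (redTensor h Z W) from (dualTensorIso Z W).hom) =
      (dualTensorIso Z.X W.X).hom ≫ (redIncl h Z W)ᵐ := by
  let := redMonoidal hM
  let := redRigid hr
  refine projDuals_comp h Z W hunit hP (dualTensorIso Z W).hom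
    ((α_ _ _ _).inv ≫ ε_ Z Zᵛ ▷ W ≫ (λ_ W).hom) ?_
    (congrArg DCenter.Hom.f (dualTensorIso_hom_evaluation' Z W)) _ rfl
  exact projDual_pairLeft h Z W hunit hP _ rfl _
    (congrArg DCenter.Hom.f (α_ (redDual h Z) Z W).hom_inv_id)

theorem IsRigid.exists_pivotalStructure :
    letI := redMonoidal hM
    letI := redRigid hr
    ∃ PZ : PivotalStructure (DCenter A),
      ∀ Z : DCenter A, (PZ.iso Z).hom.f = (P.iso Z.X).hom := by
  let := redMonoidal hM
  let := redRigid hr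
  refine ⟨{ iso := fun Z => DCenter.isoMk (W := redDual h (redDual h Z)) (P.iso Z.X).hom
              (iso_cent h Z) (P.iso Z.X).isIso_hom
            naturality := fun {Z W} f => DCenter.hom_ext ?_
            monoidal := fun Z W => DCenter.hom_ext ?_ }, fun Z => rfl⟩
  · have h1 := hr.rightAdjointMate_f hunit hP f
    have h2 := hr.rightAdjointMate_f hunit hP (Z := redDual h W) (W := redDual h Z) fᵐ
    have h3 : DCenter.Hom.f (show redDual h (redDual h Z) ⟶ redDual h (redDual h W) from fᵐᵐ) =
      ((f.f)ᵐ)ᵐ := h2.trans (congrArg (fun t : W.Xᵛ ⟶ Z.Xᵛ => tᵐ) h1)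
    exact (P.naturality f.f).trans (congrArg ((P.iso Z.X).hom ≫ ·) h3.symm)
  · have h1 := hr.projDuals_dualTensorIso hunit hP Z W
    have h2 := hr.projDuals_dualTensorIso hunit hP (redDual h W) (redDual h Z)
    have h3 := hr.rightAdjointMate_f hunit hP (Z := redTensor h (redDual h W) (redDual h Z))
      (W := redDual h (redTensor h Z W)) (dualTensorIso Z W).hom
    have h4 := red_iso_monoidal (P := P) h Z W hunit hP h1 h2
      (DCenter.homMk (P.iso Z.X).hom (iso_cent h Z)) rfl
      (DCenter.homMk (P.iso W.X).hom (iso_cent h W)) rfl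
    exact (congrArg ((P.iso (redTensor h Z W).X).hom ≫ ·) h3).trans h4

end ReducedPivotalStructure

/-! ### Categories in which every morphism has a pseudo-inverse. -/

section Regular

variable {C : Type u} [Category.{v} C] [Preadditive C]

/-- If `f ≫ g ≫ f = f`, then `1 - f ≫ g` is an idempotent whose image is the kernel of `f`. -/
theorem hasKernels_of_regular [IsIdempotentComplete C]
    (hreg : ∀ {X Y : C} (f : X ⟶ Y), ∃ g : Y ⟶ X, f ≫ g ≫ f = f) : HasKernels C :=
  ⟨fun {X Y} f => by
    obtain ⟨g, hg⟩ := hreg f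
    obtain ⟨K, i, p, hip, hpi⟩ := IsIdempotentComplete.idempotents_split X (𝟙 X - f ≫ g)
      (by simp [reassoc_of% hg])
    have hi : i ≫ f = 0 := by
      rw [← Category.id_comp i, ← hip, Category.assoc, Category.assoc, reassoc_of% hpi]
      simp [hg]
    exact ⟨⟨_, KernelFork.IsLimit.ofι i hi (fun s _ => s ≫ p)
      (fun s hs => by rw [Category.assoc, hpi]; simp [reassoc_of% hs])
      (fun s hs m hm => by rw [← hm, Category.assoc, hip, Category.comp_id])⟩⟩⟩

/-- If every morphism is von Neumann regular and idempotents split, then the category is abelian as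
soon as it has finite products. -/
theorem exists_abelian_of_regular [HasFiniteProducts C] [IsIdempotentComplete C]
    (hreg : ∀ {X Y : C} (f : X ⟶ Y), ∃ g : Y ⟶ X, f ≫ g ≫ f = f) :
    ∃ a : Abelian C, a.toPreadditive = ‹Preadditive C› := by
  have hk : HasKernels C := hasKernels_of_regular hreg
  have hc : HasCokernels C := ⟨fun {X Y} f => by
    obtain ⟨g, hg⟩ := hreg f
    obtain ⟨K, i, p, hip, hpi⟩ := IsIdempotentComplete.idempotents_split Y (𝟙 Y - g ≫ f)
      (by simp [hg])
    have hp : f ≫ p = 0 := by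
      rw [← Category.comp_id p, ← hip, reassoc_of% hpi]
      simp [reassoc_of% hg]
    exact ⟨⟨_, CokernelCofork.IsColimit.ofπ p hp (fun s _ => i ≫ s)
      (fun s hs => by rw [reassoc_of% hpi]; simp [hs])
      (fun s hs m hm => by rw [← hm, reassoc_of% hip])⟩⟩⟩
  have hm : IsNormalMonoCategory C := ⟨fun {X Y} f _ => by
    obtain ⟨g, hg⟩ := hreg f
    have hfg : f ≫ g = 𝟙 X := by rw [← cancel_mono f, Category.assoc, hg, Category.id_comp]
    exact ⟨{ Z := Y
             g := 𝟙 Y - g ≫ f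
             w := by simp [hg]
             isLimit := KernelFork.IsLimit.ofι f _ (fun s _ => s ≫ g)
               (fun s hs => by
                 rw [Preadditive.comp_sub, Category.comp_id, sub_eq_zero] at hs
                 rw [Category.assoc, ← hs])
               (fun s hs m hm => by rw [← hm, Category.assoc, hfg, Category.comp_id]) }⟩⟩
  have he : IsNormalEpiCategory C := ⟨fun {X Y} f _ => by
    obtain ⟨g, hg⟩ := hreg f
    have hgf : g ≫ f = 𝟙 Y := by rw [← cancel_epi f, hg, Category.comp_id]
    exact ⟨{ W := X
             g := 𝟙 X - f ≫ g
             w := by simp [hgf]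
             isColimit := CokernelCofork.IsColimit.ofπ f _ (fun s _ => g ≫ s)
               (fun s hs => by
                 rw [Preadditive.sub_comp, Category.id_comp, sub_eq_zero, Category.assoc] at hs
                 exact hs.symm)
               (fun s hs m hm => by rw [← hm, reassoc_of% hgf]) }⟩⟩
  exact ⟨{ ‹Preadditive C› with
             normalMonoOfMono := hm.normalMonoOfMono
             normalEpiOfEpi := he.normalEpiOfEpi }, rfl⟩

/-- A decomposition of `X` into a finite direct sum of simple objects. -/
structure SimpleSum (X : C) where
  J : Type
  [fintype : Fintype J]
  S : J → C
  simple : ∀ i, Simple (S i)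
  ι : ∀ i, S i ⟶ X
  π : ∀ i, X ⟶ S i
  ι_π_self : ∀ i, ι i ≫ π i = 𝟙 (S i)
  ι_π_ne : ∀ i j, i ≠ j → ι i ≫ π j = 0
  total : ∑ i, π i ≫ ι i = 𝟙 X

attribute [instance] SimpleSum.fintype

theorem SimpleSum.exists_bicone {X : C} (D : SimpleSum X) :
    ∃ (n : ℕ) (S : Fin n → C), (∀ i, Simple (S i)) ∧
      ∃ b : Bicone S, Nonempty b.IsBilimit ∧ Nonempty (b.pt ≅ X) := by
  classical
  let e := Fintype.equivFin D.J
  let b : Bicone fun i => D.S (e.symm i) :=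
    { pt := X
      π := fun i => D.π (e.symm i)
      ι := fun i => D.ι (e.symm i)
      ι_π := fun i j => by
        by_cases hij : i = j
        · subst hij; simpa using D.ι_π_self _
        · simpa [hij] using D.ι_π_ne _ _ (fun h => hij (e.symm.injective h)) }
  refine ⟨_, _, fun i => D.simple _, b, ⟨isBilimitOfTotal b ?_⟩, ⟨Iso.refl X⟩⟩
  rw [← D.total]
  exact Equiv.sum_comp e.symm fun i => D.π i ≫ D.ι i

/-- The decomposition of a direct sum. -/
def SimpleSum.add {X Y Z : C} (D : SimpleSum X) (E : SimpleSum Y) (i : X ⟶ Z) (p : Z ⟶ X)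
    (j : Y ⟶ Z) (q : Z ⟶ Y) (hip : i ≫ p = 𝟙 X) (hjq : j ≫ q = 𝟙 Y) (hiq : i ≫ q = 0)
    (hjp : j ≫ p = 0) (h : p ≫ i + q ≫ j = 𝟙 Z) : SimpleSum Z where
  J := D.J ⊕ E.J
  S := Sum.elim D.S E.S
  simple := Sum.rec D.simple E.simple
  ι := Sum.rec (fun a => D.ι a ≫ i) (fun a => E.ι a ≫ j)
  π := Sum.rec (fun a => p ≫ D.π a) (fun a => q ≫ E.π a)
  ι_π_self := by
    rintro (a | a)
    · exact (by simpa [reassoc_of% hip] using D.ι_π_self a : (D.ι a ≫ i) ≫ p ≫ D.π a = 𝟙 _)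
    · exact (by simpa [reassoc_of% hjq] using E.ι_π_self a : (E.ι a ≫ j) ≫ q ≫ E.π a = 𝟙 _)
  ι_π_ne := by
    rintro (a | a) (b | b) hab
    · exact (by simpa [reassoc_of% hip] using D.ι_π_ne a b (fun h => hab (h ▸ rfl)) :
        (D.ι a ≫ i) ≫ p ≫ D.π b = 0)
    · exact (by simp [reassoc_of% hiq] : (D.ι a ≫ i) ≫ q ≫ E.π b = 0)
    · exact (by simp [reassoc_of% hjp] : (E.ι a ≫ j) ≫ p ≫ D.π b = 0)
    · exact (by simpa [reassoc_of% hjq] using E.ι_π_ne a b (fun h => hab (h ▸ rfl)) :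
        (E.ι a ≫ j) ≫ q ≫ E.π b = 0)
  total := by
    have h1 : ∑ a, (p ≫ D.π a) ≫ D.ι a ≫ i = p ≫ i := by
      have := congrArg (fun t => p ≫ t ≫ i) D.total
      simpa [Preadditive.comp_sum, Preadditive.sum_comp] using this
    have h2 : ∑ a, (q ≫ E.π a) ≫ E.ι a ≫ j = q ≫ j := by
      have := congrArg (fun t => q ≫ t ≫ j) E.total
      simpa [Preadditive.comp_sum, Preadditive.sum_comp] using this
    rw [← h, ← h1, ← h2]
    exact Fintype.sum_sum_type _

/-- A nonzero morphism from some `G i` is nonzero on one of its simple summands, which is then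
isomorphic to the target; there are finitely many such summands in total. -/
theorem exists_finite_simple [HasKernels C] {I : Type t} [Fintype I] {G : I → C}
    (D : ∀ i, SimpleSum (G i)) (hG : ∀ Z : C, Simple Z → ∃ (i : I) (u : G i ⟶ Z), u ≠ 0) :
    ∃ (n : ℕ) (S : Fin n → C), ∀ X : C, Simple X → ∃ i, Nonempty (X ≅ S i) := by
  let e := Fintype.equivFin (Σ i, (D i).J)
  refine ⟨_, fun a => (D (e.symm a).1).S (e.symm a).2, fun Z hZ => ?_⟩
  obtain ⟨i, u, hu⟩ := hG Z hZ
  obtain ⟨a, ha⟩ : ∃ a, (D i).ι a ≫ u ≠ 0 := by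
    by_contra! h0
    refine hu ?_
    rw [← Category.id_comp u, ← (D i).total, Preadditive.sum_comp]
    simp [h0]
  have := (D i).simple a
  have := isIso_of_hom_simple ha
  refine ⟨e ⟨i, a⟩, ⟨(asIso ((D i).ι a ≫ u)).symm ≪≫ eqToIso ?_⟩⟩
  exact congrArg (fun x : Σ i, (D i).J => (D x.1).S x.2) (e.symm_apply_apply ⟨i, a⟩).symm

variable {k : Type w} [Field k] [Linear k C]

/-- Endomorphisms of a retract form a corner of those of `X`; the corner of a proper retract does
not contain the identity. -/
theorem finrank_end_lt {X Y : C} [Module.Finite k (X ⟶ X)] {m : Y ⟶ X} {r : X ⟶ Y}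
    (hmr : m ≫ r = 𝟙 Y) (hrm : r ≫ m ≠ 𝟙 X) :
    Module.finrank k (Y ⟶ Y) < Module.finrank k (X ⟶ X) := by
  let φ : (Y ⟶ Y) →ₗ[k] (X ⟶ X) :=
    { toFun := fun a => r ≫ a ≫ m
      map_add' := by simp
      map_smul' := by simp }
  have hφ : Function.Injective φ := fun a b hab => by
    have : m ≫ (r ≫ a ≫ m) ≫ r = m ≫ (r ≫ b ≫ m) ≫ r := congrArg (fun t => m ≫ t ≫ r) hab
    simpa [hmr, reassoc_of% hmr] using this
  rw [← LinearMap.finrank_range_of_inj hφ]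
  refine Submodule.finrank_lt fun htop => hrm ?_
  obtain ⟨a, ha⟩ := LinearMap.range_eq_top.1 htop (𝟙 X)
  have ha : r ≫ a ≫ m = 𝟙 X := ha
  have h1 : a ≫ m = m := by
    have := congrArg (m ≫ ·) ha
    simpa [reassoc_of% hmr] using this
  rw [← h1, ha]

theorem nonempty_simpleSum [IsIdempotentComplete C] [∀ X Y : C, Module.Finite k (X ⟶ Y)]
    (hreg : ∀ {X Y : C} (f : X ⟶ Y), ∃ g : Y ⟶ X, f ≫ g ≫ f = f) (X : C) :
    Nonempty (SimpleSum X) := by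
  induction hn : Module.finrank k (X ⟶ X) using Nat.strong_induction_on generalizing X with
  | _ n ih =>
  subst hn
  by_cases h0 : 𝟙 X = 0
  · exact ⟨{ J := Empty
             S := Empty.elim
             simple := fun i => i.elim
             ι := fun i => i.elim
             π := fun i => i.elim
             ι_π_self := fun i => i.elim
             ι_π_ne := fun i => i.elim
             total := by simp [h0] }⟩
  by_cases hs : Simple X
  · exact ⟨{ J := Unit
             S := fun _ => X
             simple := fun _ => hs
             ι := fun _ => 𝟙 X
             π := fun _ => 𝟙 X
             ι_π_self := fun _ => Category.comp_id _
             ι_π_ne := fun i j hij => (hij rfl).elim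
             total := by simp }⟩
  obtain ⟨Y, m, hm, hm0, hmi⟩ : ∃ (Y : C) (m : Y ⟶ X), Mono m ∧ m ≠ 0 ∧ ¬ IsIso m := by
    by_contra! hc
    refine hs ⟨fun {Y} m _ => ⟨fun hi h => h0 ?_, fun h => hc Y m inferInstance h⟩⟩
    have := IsIso.inv_hom_id m
    rw [← this]
    exact (congrArg (inv m ≫ ·) h).trans comp_zero
  obtain ⟨r, hr⟩ := hreg m
  have hmr : m ≫ r = 𝟙 Y := by rw [← cancel_mono m, Category.assoc, hr, Category.id_comp]
  -- A proper nonzero subobject is a retract by regularity, and splitting the complementary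
  -- idempotent writes `X` as a direct sum of two objects with smaller endomorphism algebras.
  obtain ⟨Y', m', r', hmr', hrm'⟩ := IsIdempotentComplete.idempotents_split X (𝟙 X - r ≫ m)
    (by simp [hr])
  have h1 : m' ≫ r = 0 := by
    rw [← cancel_mono m, zero_comp, ← Category.id_comp m', ← hmr']
    simp only [Category.assoc, reassoc_of% hrm']
    simp [reassoc_of% hmr]
  have h2 : m ≫ r' = 0 := by
    rw [← Category.comp_id r', ← hmr', reassoc_of% hrm']
    simp [reassoc_of% hmr]
  obtain ⟨D⟩ := ih _ (finrank_end_lt (k := k) hmr fun h => hmi ⟨r, hmr, h⟩) Y rfl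
  obtain ⟨E⟩ := ih _ (finrank_end_lt (k := k) hmr' fun h => hm0 (by
    rw [hrm', sub_eq_self] at h
    rw [← hr, h, comp_zero])) Y' rfl
  exact ⟨D.add E m r m' r' hmr hmr' h2 h1 (by rw [hrm']; abel)⟩

end Regular

/-! ### Regularity, retracts and direct sums for the center. -/

section Multifusion

local postfix:max "ᵛ" => rightDual
local infixr:70 "⊠" => tbr

set_option linter.unusedSectionVars false

section Regular

variable {A : Type u} [Category.{v} A] [Abelian A] (k : Type w) [Field k] [Linear k A]
  [IsFiniteSemisimple k A]

include k in
-- Each simple summand of `Y` lifts to `V`: the pullback of `e` to it is an epimorphism onto a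
-- simple object, nonzero and therefore split. The lifts are added up.
theorem exists_section {V Y : A} (e : V ⟶ Y) [Epi e] : ∃ s : Y ⟶ V, s ≫ e = 𝟙 Y := by
  obtain ⟨n, T, hT, p, q, hpq⟩ := exists_simple_decomposition k Y
  have key : ∀ i, ∃ g : T i ⟶ V, g ≫ e = q i := fun i => by
    have := hT i
    have hne : pullback.snd e (q i) ≠ 0 := fun h0 =>
      id_nonzero (T i) (by rw [← cancel_epi (pullback.snd e (q i)), h0, zero_comp, zero_comp])
    obtain ⟨g, hg⟩ := exists_comp_eq_id k hne
    exact ⟨g ≫ pullback.fst e (q i), by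
      rw [Category.assoc, pullback.condition, reassoc_of% hg]⟩
  choose g hg using key
  exact ⟨∑ i, p i ≫ g i, by simp [Preadditive.sum_comp, hg, hpq]⟩

include k in
theorem exists_retraction {V Y : A} (m : V ⟶ Y) [Mono m] : ∃ r : Y ⟶ V, m ≫ r = 𝟙 V := by
  obtain ⟨n, T, hT, p, q, hpq⟩ := exists_simple_decomposition k V
  have key : ∀ i, ∃ g : Y ⟶ T i, m ≫ g = p i := fun i => by
    have := hT i
    have hne : pushout.inr m (p i) ≠ 0 := fun h0 =>
      id_nonzero (T i) (by rw [← cancel_mono (pushout.inr m (p i)), h0, comp_zero, comp_zero])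
    obtain ⟨g, hg⟩ := exists_id_eq_comp k hne
    exact ⟨pushout.inl m (p i) ≫ g, by
      rw [pushout.condition_assoc, hg, Category.comp_id]⟩
  choose g hg using key
  exact ⟨∑ i, g i ≫ q i, by simp [Preadditive.comp_sum, reassoc_of% hg, hpq]⟩

include k in
theorem exists_regular {V Y : A} (f : V ⟶ Y) : ∃ g : Y ⟶ V, f ≫ g ≫ f = f := by
  obtain ⟨s, hs⟩ := exists_section k (factorThruImage f)
  obtain ⟨r, hr⟩ := exists_retraction k (image.ι f)
  refine ⟨r ≫ s, ?_⟩
  calc f ≫ (r ≫ s) ≫ f = (factorThruImage f ≫ image.ι f) ≫ (r ≫ s) ≫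
        (factorThruImage f ≫ image.ι f) := by rw [image.fac]
    _ = factorThruImage f ≫ (image.ι f ≫ r) ≫ (s ≫ factorThruImage f) ≫ image.ι f := by
        simp only [Category.assoc]
    _ = f := by rw [hr, hs, Category.id_comp, Category.id_comp, image.fac]

end Regular

section Center

variable {A : Type u} [Category.{v} A] [MonoidalCategory A]

theorem IsHalfBraiding.exists_splitting {X V : A} {γ : HB X} (hγ : IsHalfBraiding X γ) {e : X ⟶ X}
    (he : Cent γ γ e) {i : V ⟶ X} {p : X ⟶ V} (hip : i ≫ p = 𝟙 V) (hpi : p ≫ i = e) :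
    ∃ r : HB V, IsHalfBraiding V r ∧ Cent r γ i ∧ Cent γ r p := by
  have hi : i ≫ e = i := by rw [← hpi, reassoc_of% hip]
  have hp : e ≫ p = p := by rw [← hpi, Category.assoc, hip, Category.comp_id]
  have h1 : Cent (fun B => B ◁ i ≫ γ B ≫ p ▷ B) γ i := fun B => by
    rw [Category.assoc, Category.assoc, ← comp_whiskerRight, hpi, ← he B,
      ← MonoidalCategory.whiskerLeft_comp_assoc, hi]
  have h2 : Cent γ (fun B => B ◁ i ≫ γ B ≫ p ▷ B) p := fun B => by
    rw [← MonoidalCategory.whiskerLeft_comp_assoc, hpi, reassoc_of% he B, ← comp_whiskerRight, hp]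
  exact ⟨_, hγ.of_retract hip h1 h2, h1, h2⟩

variable [Preadditive A] [MonoidalPreadditive A]

instance [IsIdempotentComplete A] : IsIdempotentComplete (DCenter A) where
  idempotents_split Z e he := by
    obtain ⟨V, i, p, hip, hpi⟩ :=
      IsIdempotentComplete.idempotents_split Z.X e.f (congrArg DCenter.Hom.f he)
    obtain ⟨r, hr, hi, hp⟩ := Z.isHalfBraiding.exists_splitting e.central hip hpi
    exact ⟨⟨V, r, hr⟩, DCenter.homMk i hi, DCenter.homMk p hp, DCenter.hom_ext hip,
      DCenter.hom_ext hpi⟩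

section Sum

variable {X Y V : A} (γ : HB X) (μ : HB Y) (i : X ⟶ V) (p : V ⟶ X) (j : Y ⟶ V) (q : V ⟶ Y)

/-- The half-braiding of a direct sum. -/
def sumBr : HB V := fun B => B ◁ p ≫ γ B ≫ i ▷ B + B ◁ q ≫ μ B ≫ j ▷ B

variable {γ μ i p j q} (hγ : IsHalfBraiding X γ) (hμ : IsHalfBraiding Y μ) (hip : i ≫ p = 𝟙 X)
  (hjq : j ≫ q = 𝟙 Y) (hiq : i ≫ q = 0) (hjp : j ≫ p = 0) (h : p ≫ i + q ≫ j = 𝟙 V)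

include hγ hμ hip hjq hiq hjp h

theorem isHalfBraiding_sumBr : IsHalfBraiding V (sumBr γ μ i p j q) where
  isIso B := by
    have := hγ.isIso B
    have := hμ.isIso B
    have w : ∀ {P Q R : A} (a : P ⟶ Q) (b : Q ⟶ R), B ◁ a ≫ B ◁ b = B ◁ (a ≫ b) :=
      fun a b => (MonoidalCategory.whiskerLeft_comp _ _ _).symm
    have w' : ∀ {P Q R : A} (a : P ⟶ Q) (b : Q ⟶ R), a ▷ B ≫ b ▷ B = (a ≫ b) ▷ B :=
      fun a b => (comp_whiskerRight _ _ _).symm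
    refine ⟨p ▷ B ≫ inv (γ B) ≫ B ◁ i + q ▷ B ≫ inv (μ B) ≫ B ◁ j, ?_, ?_⟩
    · rw [← MonoidalCategory.whiskerLeft_id, ← h, MonoidalPreadditive.whiskerLeft_add, ← w, ← w]
      simp only [sumBr, Preadditive.add_comp, Preadditive.comp_add, Category.assoc,
        reassoc_of% w', hip, hjq, hiq, hjp]
      simp
    · rw [← id_whiskerRight, ← h, MonoidalPreadditive.add_whiskerRight, ← w', ← w']
      simp only [sumBr, Preadditive.add_comp, Preadditive.comp_add, Category.assoc,
        reassoc_of% w, hip, hjq, hiq, hjp]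
      simp
  naturality {B B'} f := by
    have h1 := hγ.naturality f
    have h2 := hμ.naturality f
    simp only [sumBr, Preadditive.add_comp, Preadditive.comp_add, Category.assoc]
    rw [← whisker_exchange_assoc, ← whisker_exchange_assoc, reassoc_of% h1, reassoc_of% h2,
      whisker_exchange, whisker_exchange]
  tensor B B' := by
    have key : ∀ {X Y : A} (γ : HB X) (μ : HB Y) (i : X ⟶ V) (p : V ⟶ X) (j : Y ⟶ V) (q : V ⟶ Y),
        (α_ B B' V).hom ≫ B ◁ (B' ◁ p ≫ γ B' ≫ i ▷ B') ≫ (α_ B V B').inv ≫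
          (B ◁ q ≫ μ B ≫ j ▷ B) ▷ B' ≫ (α_ V B B').hom =
        (B ⊗ B') ◁ p ≫ (α_ _ _ _).hom ≫ B ◁ γ B' ≫ B ◁ (i ≫ q) ▷ B' ≫ (α_ _ _ _).inv ≫
          μ B ▷ B' ≫ (α_ _ _ _).hom ≫ j ▷ (B ⊗ B') := by
      intros; monoidal
    simp only [sumBr, Preadditive.add_comp, Preadditive.comp_add, key,
      MonoidalPreadditive.whiskerLeft_add, MonoidalPreadditive.add_whiskerRight, hip, hjq, hiq, hjp]
    simp [hγ.tensor, hμ.tensor]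

theorem sumBr_cent : Cent γ (sumBr γ μ i p j q) i ∧ Cent μ (sumBr γ μ i p j q) j ∧
    Cent (sumBr γ μ i p j q) γ p ∧ Cent (sumBr γ μ i p j q) μ q := by
  have w : ∀ {P Q R : A} (B : A) (a : P ⟶ Q) (b : Q ⟶ R), B ◁ a ≫ B ◁ b = B ◁ (a ≫ b) :=
    fun B a b => (MonoidalCategory.whiskerLeft_comp _ _ _).symm
  have w' : ∀ {P Q R : A} (B : A) (a : P ⟶ Q) (b : Q ⟶ R), a ▷ B ≫ b ▷ B = (a ≫ b) ▷ B :=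
    fun B a b => (comp_whiskerRight _ _ _).symm
  refine ⟨fun B => ?_, fun B => ?_, fun B => ?_, fun B => ?_⟩ <;>
    simp [sumBr, reassoc_of% w, w', hip, hjq, hiq, hjp]

end Sum

end Center

section FiniteProducts

variable {A : Type u} [Category.{v} A] [Abelian A] [MonoidalCategory A] [MonoidalPreadditive A]

instance : HasBinaryBiproducts (DCenter A) where
  has_binary_biproduct Z W := by
    have h := isHalfBraiding_sumBr Z.isHalfBraiding W.isHalfBraiding
      (biprod.inl_fst (X := Z.X) (Y := W.X)) biprod.inr_snd biprod.inl_snd biprod.inr_fst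
      biprod.total
    have hc := sumBr_cent Z.isHalfBraiding W.isHalfBraiding
      (biprod.inl_fst (X := Z.X) (Y := W.X)) biprod.inr_snd biprod.inl_snd biprod.inr_fst
      biprod.total
    exact hasBinaryBiproduct_of_total
      { pt := ⟨_, _, h⟩
        fst := DCenter.homMk _ hc.2.2.1
        snd := DCenter.homMk _ hc.2.2.2
        inl := DCenter.homMk _ hc.1
        inr := DCenter.homMk _ hc.2.1
        inl_fst := DCenter.hom_ext biprod.inl_fst
        inl_snd := DCenter.hom_ext biprod.inl_snd
        inr_fst := DCenter.hom_ext biprod.inr_fst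
        inr_snd := DCenter.hom_ext biprod.inr_snd } (DCenter.hom_ext biprod.total)

/-- Splitting the zero endomorphism of any object provides the zero object. -/
theorem hasFiniteProducts_of_nonempty (Z : DCenter A) : HasFiniteProducts (DCenter A) := by
  obtain ⟨V, i, p, hip, hpi⟩ := IsIdempotentComplete.idempotents_split Z (0 : Z ⟶ Z) (by simp)
  have hV : IsZero V := by
    rw [IsZero.iff_id_eq_zero, ← Category.comp_id (𝟙 V), ← hip, Category.assoc, reassoc_of% hpi]
    simp
  have : HasTerminal (DCenter A) := hV.isTerminal.hasTerminal
  exact hasFiniteProducts_of_has_binary_and_terminal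

end FiniteProducts

end Multifusion

/-! ### Semisimplicity of the center and the multifusion property. -/

section ReducedMultifusion

local infixr:70 "⊠" => tbr

set_option linter.unusedSectionVars false

variable {k : Type w} [Field k] [IsAlgClosed k] [CharZero k] {A : Type u} [Category.{v} A] [Abelian A]
  [Linear k A] [MonoidalCategory A] [MonoidalPreadditive A] [MonoidalLinear k A]
  [BraidedCategory A] [RigidCategory A] [IsFiniteSemisimple k A]
  {P : PivotalStructure A} {Irr : Type t} [Fintype Irr] {c : SimpleChoice k P Irr}
  (hunit : Simple (𝟙_ A)) (hP : P.IsSpherical) (h : ObjectsDefined c)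

instance (Z W : DCenter A) : Module.Finite k (Z ⟶ W) :=
  Module.Finite.of_injective
    ({ toFun := fun f => f.f
       map_add' := fun _ _ => rfl
       map_smul' := fun _ _ => rfl } : (Z ⟶ W) →ₗ[k] (Z.X ⟶ W.X))
    fun _ _ e => DCenter.hom_ext e

include c hunit hP in
-- A pseudo-inverse `g` of `f` in `A` is averaged. As `f` is central, it passes into the average on
-- both sides, and the average of `f ≫ g ≫ f = f` is `f` again.
theorem exists_center_regular {Z W : DCenter A} (f : Z ⟶ W) :
    ∃ g : W ⟶ Z, f ≫ g ≫ f = f := by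
  obtain ⟨g, hg⟩ := exists_regular k f.f
  refine ⟨DCenter.homMk (avg c W.br Z.br g)
    (avg_cent c hunit hP W.isHalfBraiding Z.isHalfBraiding g), DCenter.hom_ext ?_⟩
  have h1 : f.f ≫ avg c W.br Z.br g ≫ f.f = f.f := by
    have hf : Cent Z.br W.br f.f := f.central
    rw [hf.avg_comp c, hf.comp_avg c, hg, hf.avg_eq c hunit W.isHalfBraiding]
  exact h1

/-- The free object of the center on `V`. -/
def freeCenter (V : A) : DCenter A :=
  ⟨(redUnit h).X ⊗ V, (redUnit h).br ⊠ minus V,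
    (redUnit h).isHalfBraiding.tbr (isHalfBraiding_minus V)⟩

/-- A nonzero morphism `X_i ⟶ Z` of `A` extends to the free object `I(𝟙) ⊗ X_i` by the left unit
constraint, and its restriction along `𝟙 ⟶ I(𝟙)` is `1 / √D` times the original, hence nonzero. -/
theorem exists_freeCenter_ne_zero (hunit : Simple (𝟙_ A)) (Z : DCenter A) (hZ : Simple Z) :
    ∃ (i : Irr) (u : freeCenter h (c.obj i) ⟶ Z), u ≠ 0 := by
  obtain ⟨i, f, hf⟩ : ∃ (i : Irr) (f : c.obj i ⟶ Z.X), f ≠ 0 := by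
    by_contra! h0
    refine id_nonzero Z (DCenter.hom_ext (hom_ext_from_simple k fun S hS p => ?_))
    obtain ⟨i, ⟨e⟩⟩ := c.exists_iso S hS
    rw [← e.hom_inv_id_assoc p, h0 i (e.inv ≫ p), comp_zero, zero_comp, zero_comp]
  have hu : Cent ((redUnit h).br ⊠ minus (c.obj i)) Z.br ((redUnit h).X ◁ f ≫ leftU h Z) :=
    ((Cent.minus f).whiskerLeft _).comp (leftU_cent_rho h Z hunit)
  refine ⟨i, DCenter.homMk (Z := freeCenter h (c.obj i)) _ hu, fun h0 => hf ?_⟩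
  have h1 : (redUnit h).X ◁ f ≫ leftU h Z = 0 := congrArg DCenter.Hom.f h0
  have h2 := congrArg (fun t => (λ_ (c.obj i)).inv ≫ unitI h ▷ c.obj i ≫ t) h1
  rw [← whisker_exchange_assoc, unitI_leftU h Z hunit] at h2
  simpa [c.sqrtGlobal_ne_zero hunit] using h2

include hunit hP h in
theorem isFiniteSemisimple_center : IsFiniteSemisimple k (DCenter A) := by
  have hreg : ∀ {Z W : DCenter A} (f : Z ⟶ W), ∃ g : W ⟶ Z, f ≫ g ≫ f = f :=
    fun f => exists_center_regular (c := c) hunit hP f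
  have hf : ∀ Z W : DCenter A, Module.Finite k (Z ⟶ W) := fun Z W => inferInstance
  have := hasFiniteProducts_of_nonempty (redUnit h)
  have := hasKernels_of_regular hreg
  exact
    { abelian := exists_abelian_of_regular hreg
      finite_hom := hf
      semisimple := fun Z => (nonempty_simpleSum (k := k) hreg Z).some.exists_bicone
      finite_simple := exists_finite_simple
        (fun i => (nonempty_simpleSum (k := k) hreg (freeCenter h (c.obj i))).some)
        (exists_freeCenter_ne_zero h hunit) }

include hunit hP in
theorem isMultifusion {hm : MorphismsDefined h} {hM : IsMonoidal hm} (hr : IsRigid hM) :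
    letI := redMonoidal hM
    letI := redRigid hr
    IsMultifusion k (DCenter A) := by
  let := redMonoidal hM
  let := redRigid hr
  have : MonoidalPreadditive (DCenter A) := by
    refine ⟨fun {X Y Z} => DCenter.hom_ext ?_, fun {X Y Z} => DCenter.hom_ext ?_,
      fun {X Y Z} f g => DCenter.hom_ext ?_, fun {X Y Z} f g => DCenter.hom_ext ?_⟩
    · exact (by simp [redMap] : redMap h (𝟙 X) (0 : Y ⟶ Z) = 0)
    · exact (by simp [redMap] : redMap h (0 : Y ⟶ Z) (𝟙 X) = 0)
    · exact (by simp [redMap] : redMap h (𝟙 X) (f + g) = redMap h (𝟙 X) f + redMap h (𝟙 X) g)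
    · exact (by simp [redMap] : redMap h (f + g) (𝟙 X) = redMap h f (𝟙 X) + redMap h g (𝟙 X))
  refine ⟨isFiniteSemisimple_center hunit hP h, this, ?_⟩
  refine ⟨fun X {Y Z} r f => DCenter.hom_ext ?_, fun r {Y Z} f X => DCenter.hom_ext ?_⟩
  · exact (by simp [redMap] : redMap h (𝟙 X) (r • f) = r • redMap h (𝟙 X) f)
  · exact (by simp [redMap] : redMap h (r • f) (𝟙 X) = r • redMap h f (𝟙 X))

end ReducedMultifusion

end RedCenter

end

theorem propositionp {k : Type w} [Field k] [IsAlgClosed k] [CharZero k]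
    {A : Type u} [Category.{v} A] [Abelian A] [Linear k A]
    [MonoidalCategory A] [MonoidalPreadditive A] [MonoidalLinear k A]
    [BraidedCategory A] [RigidCategory A] [IsFiniteSemisimple k A] (hunit : Simple (𝟙_ A))
    (P : PivotalStructure A) (hP : P.IsSpherical)
    {Irr : Type t} [Fintype Irr] (c : SimpleChoice k P Irr) :
    ∃ (h : ObjectsDefined c) (hm : MorphismsDefined h) (hM : IsMonoidal hm) (hr : IsRigid hM),
      letI : MonoidalCategory (DCenter A) := redMonoidal hM
      letI : RigidCategory (DCenter A) := redRigid hr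
      IsMultifusion k (DCenter A) ∧
        ∃ PZ : PivotalStructure (DCenter A),
          ∀ Z : DCenter A, (PZ.iso Z).hom.f = (P.iso Z.X).hom :=
  ⟨objectsDefined c hunit hP, morphismsDefined _ hunit hP, isMonoidal _ hunit hP _,
    isRigid _ hunit hP _, isMultifusion hunit hP _ _,
    IsRigid.exists_pivotalStructure _ hunit hP⟩
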